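/- **Setting.** All manifolds, bundles and forms are smooth ($C^\infty$); differential forms are complex valued, i.e. sections of exterior powers of $T^*\otimes\mathbb C$, and are extended complex-linearly to complexified tangent spaces. $\alpha\wedge\beta(v,w)=\alpha(v)\beta(w)-\alpha(w)\beta(v)$ for 1-forms. Let $M$ be a real 3-manifold with a *flag structure*: two complex line subbundles $T^1,T^2\subset TM\otimes\mathbb C$ with $T^1\cap T^2=0$ such that $T^1\oplus T^2$ is a contact distribution, i.e. locally $T^1\oplus T^2=\ker\theta$ for a complex 1-form $\theta$ with $d\theta\wedge\theta\neq0$ everywhere. Let $E\to M$ be the $\mathbb C^*$-bundle whose points over $x$ are the complex covectors $\theta$ at $x$ with $\ker\theta=T^1_x\oplus T^2_x$, and let $\omega$ be its tautological 1-form. Let $Y\to E$ be the coframe bundle whose points over $\theta\in E_x$ are the 4-tuples $(\omega,\omega^1,\omega^2,\varphi)$ of complex covectors on $T_\theta E$, where $\omega$ is the tautological one, $\omega^1,\omega^2$ are pull-backs of covectors $\theta^1,\theta^2$ at $x$ with $\theta^1(T^2)=0\ne\theta^1(T^1)$, $\theta^2(T^1)=0\neq\theta^2(T^2)$, and $$d\omega=\omega^1\wedge\omega^2+\omega\wedge\varphi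 .\qquad(1)$$ The same letters $\omega,\omega^1,\omega^2,\varphi$ denote the resulting tautological 1-forms on the 13-dimensional manifold $Y$. Let $B\subset\mathrm{SL}(3,\mathbb C)$ be the Borel group of upper triangular matrices and $\mathfrak b$ its Lie algebra. The group $B$ acts on $Y$ on the right, over $M$: for $h=\begin{pmatrix}a&c&e\\0&\frac1{ab}&d\\0&0&b\end{pmatrix}$, $R_h$ replaces the coframe $(\omega,\omega^1,\omega^2,\varphi)$ at $\theta$ by $$\Big(\tfrac ab\,\omega,\;\; a^2b\,\omega^1-2a^2d\,\omega,\;\; \tfrac1{ab^2}\omega^2+\tfrac cb\,\omega,\;\; \varphi+abc\,\omega^1+\tfrac{2d}b\omega^2+\big(\tfrac{4e}b-2acd\big)\omega\Big)$$ at the point $\frac ab\theta$ of $E$ (forms being transported from $\theta$ to $\frac ab\theta$ by the dilation $\theta\mapsto\frac ab\theta$ of $E$). For 1-forms $\omega_1^1,\varphi^1,\varphi^2,\psi$ on $Y$ put $$\Omega_1^1=d\omega_1^1-\tfrac32\omega^2\wedge\varphi^1-\tfrac32\omega^1\wedge\varphi^2,\qquad \Psi=d\psi-2\varphi^1\wedge\varphi^2-\varphi\wedge\psi,$$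 $$\Phi^1=d\varphi^1-\varphi^1\wedge\omega_1^1-\tfrac12\omega^1\wedge\psi-\tfrac12\varphi\wedge\varphi^1,\qquad \Phi^2=d\varphi^2+\varphi^2\wedge\omega_1^1-\tfrac12\omega^2\wedge\psi-\tfrac12\varphi\wedge\varphi^2 .$$ Call $(\omega_1^1,\varphi^1,\varphi^2,\psi)$ *canonically normalized* if these forms are smooth, $$d\omega^1=\tfrac12\omega^1\wedge\varphi+\omega^1\wedge\omega_1^1+\omega\wedge\varphi^1,\qquad d\omega^2=\tfrac12\omega^2\wedge\varphi-\omega^2\wedge\omega_1^1+\omega\wedge\varphi^2,\qquad(2)$$ $$d\varphi=\omega^1\wedge\varphi^2-\omega^2\wedge\varphi^1+\omega\wedge\psi,\qquad(3)$$ $\Omega_1^1=\omega\wedge\lambda$ for some 1-form $\lambda$, $\Omega_1^1$ contains no terms $\omega^1\wedge\omega$, $\omega^2\wedge\omega$, and $\Phi^1$ contains no term $\omega^1\wedge\omega$. Here a 2-form on $Y$ is expanded in the complex coframe of $Y$ consisting of $\omega,\omega^1,\omega^2$ and of $\varphi,\omega_1^1,\varphi^1,\varphi^2,\psi$ and their complex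 conjugates; equivalently, its $\omega\wedge\omega^1$, $\omega\wedge\omega^2$, $\omega^1\wedge\omega^2$ terms are those of its restriction to the common kernel of $\varphi,\omega_1^1,\varphi^1,\varphi^2,\psi$. **Theorem 5.2.** There is exactly one canonically normalized $(\omega_1^1,\varphi^1,\varphi^2,\psi)$ on $Y$. With these forms, $$\pi=\begin{pmatrix}-\frac12\varphi-\frac13\omega_1^1&-\varphi^2&-\frac14\psi\\ \omega^1&\frac23\omega_1^1&\frac12\varphi^1\\ 2\omega&2\omega^2&\frac12\varphi-\frac13\omega_1^1\end{pmatrix}$$ is a (generalized) Cartan connection on $Y\to M$, that is, a smooth $\mathfrak{sl}(3,\mathbb C)$-valued 1-form such that 0. $\pi_y:T_yY\to\mathfrak{sl}(3,\mathbb C)$ is injective for every $y\in Y$; 1. $\pi(X^*)=X$ for all $X\in\mathfrak b$, where $X^*(y)=\frac{d}{dt}\big|_{t=0}\,y\,e^{tX}$; 2. $(R_h)^*\pi=\mathrm{Ad}_{h^{-1}}\pi=h^{-1}\pi h$ for all $h\in B$. Its curvature is $$d\pi+\pi\wedge\pi=\begin{pmatrix}0&-\Phi^2&-\frac14\Psi\\0&0&\frac12\Phi^1\\0&0&0\end{pmatrix},$$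 and there are smooth functions $Q^1,Q^2,U_1,U_2:Y\to\mathbb C$ with $$\Phi^1=Q^1\,\omega\wedge\omega^2,\qquad \Phi^2=Q^2\,\omega\wedge\omega^1,\qquad \Psi=(U_1\omega^1+U_2\omega^2)\wedge\omega .$$ -/

import Mathlib

open scoped Manifold ContDiff Topology TensorProduct
open Set

noncomputable section

namespace FlagGeometry

/-! ### Complex-valued differential forms on real manifolds -/

section Forms

/-- Complex-valued 1-forms (sections of `T*N ⊗ ℂ`) on a manifold modelled on `V`. -/
abbrev OneForm (V : Type*) [NormedAddCommGroup V] [NormedSpace ℝ V] (N : Type*)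
    [TopologicalSpace N] [ChartedSpace V N] : Type _ :=
  ∀ p : N, TangentSpace 𝓘(ℝ, V) p →L[ℝ] ℂ

/-- Complex-valued 2-forms, as functions of two tangent vectors. -/
abbrev TwoForm (V : Type*) [NormedAddCommGroup V] [NormedSpace ℝ V] (N : Type*)
    [TopologicalSpace N] [ChartedSpace V N] : Type _ :=
  ∀ p : N, TangentSpace 𝓘(ℝ, V) p → TangentSpace 𝓘(ℝ, V) p → ℂ

variable {V : Type*} [NormedAddCommGroup V] [NormedSpace ℝ V] {N : Type*}
    [TopologicalSpace N] [ChartedSpace V N]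

/-- The coordinate expression of a 1-form in the chart at `p₀`: its pull-back by the inverse
chart. -/
def inChart (α : OneForm V N) (p₀ : N) (u : V) : V →L[ℝ] ℂ :=
  (α ((chartAt V p₀).symm u)).comp (mfderiv 𝓘(ℝ, V) 𝓘(ℝ, V) (chartAt V p₀).symm u)

/-- A 1-form is smooth on `U` if its coordinate expressions are. -/
def OneForm.SmoothOn (α : OneForm V N) (U : Set N) : Prop :=
  ∀ p₀ : N, ContDiffOn ℝ ∞ (inChart α p₀)
    ((chartAt V p₀).target ∩ (chartAt V p₀).symm ⁻¹' U)

/-- A vector field is smooth on `U` if its coordinate expressions are. -/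
def SmoothVectorFieldOn (X : ∀ p : N, TangentSpace 𝓘(ℝ, V) p) (U : Set N) : Prop :=
  ∀ p₀ : N, ContDiffOn ℝ ∞ (fun u : V => (mfderiv 𝓘(ℝ, V) 𝓘(ℝ, V) (chartAt V p₀)
      ((chartAt V p₀).symm u) (X ((chartAt V p₀).symm u)) : V))
    ((chartAt V p₀).target ∩ (chartAt V p₀).symm ⁻¹' U)

/-- The exterior derivative `dα(v, w) = D_v α(w) - D_w α(v)`, computed at `p` in the chart at `p`
(through which Mathlib identifies `T_p N` with `V`). -/
def d (α : OneForm V N) : TwoForm V N := fun p v w =>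
  (fderiv ℝ (inChart α p) (chartAt V p p) : V →L[ℝ] V →L[ℝ] ℂ) v w
    - (fderiv ℝ (inChart α p) (chartAt V p p) : V →L[ℝ] V →L[ℝ] ℂ) w v

/-- The wedge product of two covectors. -/
def wedge {T : Type*} [AddCommGroup T] [Module ℝ T] [TopologicalSpace T] (α β : T →L[ℝ] ℂ)
    (v w : T) : ℂ := α v * β w - α w * β v

/-- The wedge product of two 1-forms. -/
def OneForm.wedge (α β : OneForm V N) : TwoForm V N := fun p => FlagGeometry.wedge (α p) (β p)

end Forms

scoped infixl:70 " ∧ᶠ " => OneForm.wedge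

/-! ### Smooth bundles from local trivializations -/

/-- Data of a smooth locally trivial bundle `P → M` over a manifold `M` modelled on `W`, with fibres
modelled on an open subset `G` of `V`: a smoothly compatible family of trivializations, one near
each point of `M`. -/
structure BundleAtlas (W : Type*) [NormedAddCommGroup W] [NormedSpace ℝ W] (M : Type*)
    [TopologicalSpace M] [ChartedSpace W M] (P V : Type*) [NormedAddCommGroup V]
    [NormedSpace ℝ V] where
  proj : P → M
  U : M → Set M
  isOpen_U : ∀ x, IsOpen (U x)
  mem_U : ∀ x, x ∈ U x
  G : Set V
  isOpen_G : IsOpen G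
  coord : M → P → V
  point : M → M → V → P
  coord_mem : ∀ x₀ p, proj p ∈ U x₀ → coord x₀ p ∈ G
  proj_point : ∀ x₀ x v, x ∈ U x₀ → v ∈ G → proj (point x₀ x v) = x
  coord_point : ∀ x₀ x v, x ∈ U x₀ → v ∈ G → coord x₀ (point x₀ x v) = v
  point_coord : ∀ x₀ p, proj p ∈ U x₀ → point x₀ (proj p) (coord x₀ p) = p
  smooth : ∀ x₀ x₁, ContDiffOn ℝ ∞
    (fun q : W × V => coord x₁ (point x₀ ((chartAt W x₀).symm q.1) q.2))
    {q | q.1 ∈ (chartAt W x₀).target ∧ (chartAt W x₀).symm q.1 ∈ U x₀ ∩ U x₁ ∧ q.2 ∈ G}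

namespace BundleAtlas

variable {W : Type*} [NormedAddCommGroup W] [NormedSpace ℝ W] {M : Type*}
    [TopologicalSpace M] [ChartedSpace W M] {P V : Type*} [NormedAddCommGroup V]
    [NormedSpace ℝ V] (A : BundleAtlas W M P V)

/-- The chart `p ↦ (chart of the base point, fibre coordinate)` near the fibre over `x₀`. -/
def chart (x₀ : M) : PartialEquiv P (W × V) where
  toFun p := (chartAt W x₀ (A.proj p), A.coord x₀ p)
  invFun q := A.point x₀ ((chartAt W x₀).symm q.1) q.2
  source := {p | A.proj p ∈ (chartAt W x₀).source ∧ A.proj p ∈ A.U x₀}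
  target := {q | q.1 ∈ (chartAt W x₀).target ∧ (chartAt W x₀).symm q.1 ∈ A.U x₀ ∧ q.2 ∈ A.G}
  map_source' p hp := ⟨(chartAt W x₀).map_source hp.1, by
    simpa [(chartAt W x₀).left_inv hp.1] using hp.2, A.coord_mem _ _ hp.2⟩
  map_target' q hq := by
    simp only [mem_ofPred_eq, A.proj_point _ _ _ hq.2.1 hq.2.2]
    exact ⟨(chartAt W x₀).map_target hq.1, hq.2.1⟩
  left_inv' p hp := by
    simp only [(chartAt W x₀).left_inv hp.1]
    exact A.point_coord _ _ hp.2
  right_inv' q hq := by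
    simp only [A.proj_point _ _ _ hq.2.1 hq.2.2, (chartAt W x₀).right_inv hq.1,
      A.coord_point _ _ _ hq.2.1 hq.2.2]

lemma isOpen_target_inter {S : Set M} (hS : IsOpen S) (x₀ : M) :
    IsOpen {q : W × V | q.1 ∈ (chartAt W x₀).target ∧ (chartAt W x₀).symm q.1 ∈ S ∧ q.2 ∈ A.G} := by
  have h1 : IsOpen ((chartAt W x₀).target ∩ (chartAt W x₀).symm ⁻¹' S) :=
    (chartAt W x₀).isOpen_inter_preimage_symm hS
  have := h1.prod A.isOpen_G
  convert this using 1
  ext q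
  simp [Set.mem_prod, and_assoc]

lemma trans_source (x₀ x₁ : M) : ((A.chart x₀).symm.trans (A.chart x₁)).source =
    {q : W × V | q.1 ∈ (chartAt W x₀).target ∧
      (chartAt W x₀).symm q.1 ∈ (A.U x₀ ∩ A.U x₁) ∩ (chartAt W x₁).source ∧ q.2 ∈ A.G} := by
  ext q
  simp only [PartialEquiv.trans_source, PartialEquiv.symm_source, mem_inter_iff, mem_preimage,
    mem_ofPred_eq, chart, PartialEquiv.coe_symm_mk]
  constructor
  · rintro ⟨⟨h1, h2, h3⟩, h4, h5⟩
    rw [A.proj_point _ _ _ h2 h3] at h4 h5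
    exact ⟨h1, ⟨⟨h2, h5⟩, h4⟩, h3⟩
  · rintro ⟨h1, ⟨⟨h2, h5⟩, h4⟩, h3⟩
    rw [A.proj_point _ _ _ h2 h3]
    exact ⟨⟨h1, h2, h3⟩, h4, h5⟩

lemma contDiffOn_trans [IsManifold 𝓘(ℝ, W) ∞ M] (x₀ x₁ : M) :
    ContDiffOn ℝ ∞ ((A.chart x₀).symm.trans (A.chart x₁))
      ((A.chart x₀).symm.trans (A.chart x₁)).source := by
  rw [A.trans_source]
  have h1 : ContDiffOn ℝ ∞ (fun u : W => chartAt W x₁ ((chartAt W x₀).symm u))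
      ((chartAt W x₀).target ∩ (chartAt W x₀).symm ⁻¹' (chartAt W x₁).source) := by
    have := contDiffOn_ext_coord_change (I := 𝓘(ℝ, W)) (n := ∞) (M := M) x₁ x₀
    rw [PartialEquiv.trans_source] at this
    simpa [Function.comp_def] using this
  have h2 : ContDiffOn ℝ ∞ (fun q : W × V => chartAt W x₁ ((chartAt W x₀).symm q.1))
      {q : W × V | q.1 ∈ (chartAt W x₀).target ∧
      (chartAt W x₀).symm q.1 ∈ (A.U x₀ ∩ A.U x₁) ∩ (chartAt W x₁).source ∧ q.2 ∈ A.G} :=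
    h1.comp contDiff_fst.contDiffOn (fun q hq => ⟨hq.1, hq.2.1.2⟩)
  refine (h2.prodMk ((A.smooth x₀ x₁).mono fun q hq => ⟨hq.1, hq.2.1.1, hq.2.2⟩)).congr ?_
  rintro q ⟨h1, h2, h3⟩
  simp only [PartialEquiv.coe_trans, Function.comp_apply, chart, PartialEquiv.coe_symm_mk,
    A.proj_point _ _ _ h2.1.1 h3]

/-- The compatible charts of the total space. -/
def core [IsManifold 𝓘(ℝ, W) ∞ M] : ChartedSpaceCore (W × V) P where
  atlas := range A.chart
  chartAt p := A.chart (A.proj p)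
  mem_chart_source p := ⟨mem_chart_source W _, A.mem_U _⟩
  chart_mem_atlas p := ⟨_, rfl⟩
  open_source := by
    rintro _ _ ⟨x₀, rfl⟩ ⟨x₁, rfl⟩
    rw [A.trans_source]
    exact A.isOpen_target_inter (((A.isOpen_U _).inter (A.isOpen_U _)).inter
      (chartAt W x₁).open_source) x₀
  continuousOn_toFun := by
    rintro _ _ ⟨x₀, rfl⟩ ⟨x₁, rfl⟩
    exact (A.contDiffOn_trans x₀ x₁).continuousOn

theorem isManifold [IsManifold 𝓘(ℝ, W) ∞ M] :
    letI := A.core.toTopologicalSpace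
    letI := A.core.toChartedSpace
    IsManifold 𝓘(ℝ, W × V) ∞ P := by
  let _ := A.core.toTopologicalSpace
  let _ := A.core.toChartedSpace
  refine isManifold_of_contDiffOn _ _ _ ?_
  intro e e' he he'
  obtain ⟨x₀, rfl⟩ : ∃ x₀, e = A.core.openPartialHomeomorph (A.chart x₀) ⟨x₀, rfl⟩ := by
    obtain ⟨s, ⟨t, rfl⟩, hs⟩ := he
    simp only [mem_iUnion, mem_singleton_iff] at hs
    obtain ⟨⟨x₀, rfl⟩, rfl⟩ := hs
    exact ⟨x₀, rfl⟩
  obtain ⟨x₁, rfl⟩ : ∃ x₀, e' = A.core.openPartialHomeomorph (A.chart x₀) ⟨x₀, rfl⟩ := by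
    obtain ⟨s, ⟨t, rfl⟩, hs⟩ := he'
    simp only [mem_iUnion, mem_singleton_iff] at hs
    obtain ⟨⟨x₀, rfl⟩, rfl⟩ := hs
    exact ⟨x₀, rfl⟩
  have h := A.contDiffOn_trans x₀ x₁
  simp only [modelWithCornersSelf_coe, modelWithCornersSelf_coe_symm, range_id, inter_univ,
    preimage_id_eq, id_eq, Function.comp_id, Function.id_comp]
  exact h

section Smooth

variable [IsManifold 𝓘(ℝ, W) ∞ M]

theorem eventually_chart (p : P) :
    letI := A.core.toTopologicalSpace
    letI := A.core.toChartedSpace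
    ∀ᶠ p' in 𝓝 p, p' ∈ (chartAt (W × V) p).source :=
  letI := A.core.toTopologicalSpace
  letI := A.core.toChartedSpace
  (chartAt (W × V) p).open_source.mem_nhds (mem_chart_source (W × V) p)

theorem contMDiff_proj :
    letI := A.core.toTopologicalSpace
    letI := A.core.toChartedSpace
    ContMDiff 𝓘(ℝ, W × V) 𝓘(ℝ, W) ∞ A.proj := by
  let _ := A.core.toTopologicalSpace
  let _ := A.core.toChartedSpace
  have := A.isManifold
  intro p
  have h1 : ContMDiffAt 𝓘(ℝ, W × V) 𝓘(ℝ, W × V) ∞ (chartAt (W × V) p) p :=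
    contMDiffAt_of_mem_maximalAtlas (IsManifold.chart_mem_maximalAtlas p) (mem_chart_source _ p)
  have h2 : ContMDiffAt 𝓘(ℝ, W × V) 𝓘(ℝ, W) ∞ (Prod.fst : W × V → W) (chartAt (W × V) p p) :=
    contDiff_fst.contMDiff _
  have h3 : ContMDiffAt 𝓘(ℝ, W) 𝓘(ℝ, W) ∞ (chartAt W (A.proj p)).symm
      (chartAt W (A.proj p) (A.proj p)) :=
    contMDiffAt_symm_of_mem_maximalAtlas (IsManifold.chart_mem_maximalAtlas _)
      (mem_chart_target W _)
  have h4 : ContMDiffAt 𝓘(ℝ, W × V) 𝓘(ℝ, W) ∞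
      ((chartAt W (A.proj p)).symm ∘ (Prod.fst ∘ chartAt (W × V) p)) p :=
    ContMDiffAt.comp p h3 (ContMDiffAt.comp p h2 h1)
  refine h4.congr_of_eventuallyEq ?_
  filter_upwards [A.eventually_chart p] with p' hp'
  exact ((chartAt W (A.proj p)).left_inv hp'.1).symm

theorem contMDiffAt_coord (x₀ : M) (p : P) (hp : A.proj p ∈ A.U x₀) :
    letI := A.core.toTopologicalSpace
    letI := A.core.toChartedSpace
    ContMDiffAt 𝓘(ℝ, W × V) 𝓘(ℝ, V) ∞ (A.coord x₀) p := by
  let _ := A.core.toTopologicalSpace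
  let _ := A.core.toChartedSpace
  have := A.isManifold
  have h1 : ContMDiffAt 𝓘(ℝ, W × V) 𝓘(ℝ, W × V) ∞ (chartAt (W × V) p) p :=
    contMDiffAt_of_mem_maximalAtlas (IsManifold.chart_mem_maximalAtlas p) (mem_chart_source _ p)
  have h2 : ContMDiffAt 𝓘(ℝ, W × V) 𝓘(ℝ, V) ∞
      (fun q : W × V => A.coord x₀ (A.point (A.proj p) ((chartAt W (A.proj p)).symm q.1) q.2))
      (chartAt (W × V) p p) := by
    refine ContDiffAt.contMDiffAt ((A.smooth (A.proj p) x₀).contDiffAt ?_)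
    refine (A.isOpen_target_inter ((A.isOpen_U _).inter (A.isOpen_U _)) _).mem_nhds ?_
    refine ⟨mem_chart_target W _, ?_, A.coord_mem _ _ (A.mem_U _)⟩
    change (chartAt W (A.proj p)).symm (chartAt W (A.proj p) (A.proj p)) ∈ _
    rw [(chartAt W (A.proj p)).left_inv (mem_chart_source W _)]
    exact ⟨A.mem_U _, hp⟩
  refine (ContMDiffAt.comp p h2 h1).congr_of_eventuallyEq ?_
  filter_upwards [A.eventually_chart p] with p' hp'
  exact congrArg (A.coord x₀) ((A.chart (A.proj p)).left_inv hp').symm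

/-- Tangent vectors are pairs (preferred chart), and the projection is the first component. -/
theorem mfderiv_proj (p : P) :
    letI := A.core.toTopologicalSpace
    letI := A.core.toChartedSpace
    (mfderiv 𝓘(ℝ, W × V) 𝓘(ℝ, W) A.proj p : W × V →L[ℝ] W) = ContinuousLinearMap.fst ℝ W V := by
  let _ := A.core.toTopologicalSpace
  let _ := A.core.toChartedSpace
  have h0 := (A.contMDiff_proj p).mdifferentiableAt (by simp)
  refine h0.mfderiv.trans ?_
  have : (writtenInExtChartAt 𝓘(ℝ, W × V) 𝓘(ℝ, W) p A.proj) =ᶠ[𝓝 (extChartAt 𝓘(ℝ, W × V) p p)]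
      (Prod.fst : W × V → W) := by
    have ho : (chartAt (W × V) p).target ∈ 𝓝 (extChartAt 𝓘(ℝ, W × V) p p) :=
      (chartAt (W × V) p).open_target.mem_nhds (by
        simp)
    filter_upwards [ho] with q hq
    have hq' : q ∈ (A.chart (A.proj p)).target := hq
    change chartAt W (A.proj p) (A.proj (A.point (A.proj p)
      ((chartAt W (A.proj p)).symm q.1) q.2)) = q.1
    rw [A.proj_point _ _ _ hq'.2.1 hq'.2.2, (chartAt W (A.proj p)).right_inv hq'.1]
  rw [modelWithCornersSelf_coe, range_id, fderivWithin_univ, this.fderiv_eq]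
  exact fderiv_fst

end Smooth

end BundleAtlas

/-! ### Naturality of the coordinate expressions -/

section Naturality

set_option linter.unusedSectionVars false

variable {V : Type*} [NormedAddCommGroup V] [NormedSpace ℝ V] {N : Type*}
    [TopologicalSpace N] [ChartedSpace V N] [IsManifold 𝓘(ℝ, V) ∞ N]

lemma chart_comp_symm_deriv (p₀ : N) {u : V} (hu : u ∈ (chartAt V p₀).target) (v : V) :
    (mfderiv 𝓘(ℝ, V) 𝓘(ℝ, V) (chartAt V p₀) ((chartAt V p₀).symm u)
      (mfderiv 𝓘(ℝ, V) 𝓘(ℝ, V) (chartAt V p₀).symm u v) : V) = v := by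
  have : IsManifold 𝓘(ℝ, V) 1 N := IsManifold.of_le (n := ∞) (by simp)
  have h := (mdifferentiable_chart (I := 𝓘(ℝ, V)) p₀).comp_symm_deriv hu
  exact congrArg (fun f => f v) h

lemma symm_comp_chart_deriv (p₀ : N) {u : V} (hu : u ∈ (chartAt V p₀).target) (v : V) :
    (mfderiv 𝓘(ℝ, V) 𝓘(ℝ, V) (chartAt V p₀).symm u
      (mfderiv 𝓘(ℝ, V) 𝓘(ℝ, V) (chartAt V p₀) ((chartAt V p₀).symm u) v) : V) = v := by
  have : IsManifold 𝓘(ℝ, V) 1 N := IsManifold.of_le (n := ∞) (by simp)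
  have h := (mdifferentiable_chart (I := 𝓘(ℝ, V)) p₀).symm_comp_deriv
    ((chartAt V p₀).map_target hu)
  rw [(chartAt V p₀).right_inv hu] at h
  exact congrArg (fun f => f v) h

/-- Change of charts. -/
def transition (p₀ p₁ : N) (u : V) : V := chartAt V p₁ ((chartAt V p₀).symm u)

lemma isOpen_transition_source (p₀ p₁ : N) :
    IsOpen ((chartAt V p₀).target ∩ (chartAt V p₀).symm ⁻¹' (chartAt V p₁).source) :=
  (chartAt V p₀).isOpen_inter_preimage_symm (chartAt V p₁).open_source

lemma contDiffOn_transition (p₀ p₁ : N) :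
    ContDiffOn ℝ ∞ (transition (V := V) p₀ p₁)
      ((chartAt V p₀).target ∩ (chartAt V p₀).symm ⁻¹' (chartAt V p₁).source) := by
  have := contDiffOn_ext_coord_change (I := 𝓘(ℝ, V)) (n := ∞) (M := N) p₁ p₀
  rw [PartialEquiv.trans_source] at this
  have h : ContDiffOn ℝ ∞ (fun u : V => chartAt V p₁ ((chartAt V p₀).symm u))
      ((chartAt V p₀).target ∩ (chartAt V p₀).symm ⁻¹' (chartAt V p₁).source) := by
    simpa [Function.comp_def] using this
  exact h

lemma mfderiv_chart_symm_eq (p₀ : N) {u : V} (hu : u ∈ (chartAt V p₀).target) :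
    (mfderiv 𝓘(ℝ, V) 𝓘(ℝ, V) (chartAt V p₀).symm u : V →L[ℝ] V) =
      fderiv ℝ (transition p₀ ((chartAt V p₀).symm u)) u := by
  have : IsManifold 𝓘(ℝ, V) 1 N := IsManifold.of_le (n := ∞) (by simp)
  have h0 := mdifferentiableAt_atlas_symm (I := 𝓘(ℝ, V)) (chart_mem_atlas V p₀) hu
  refine h0.mfderiv.trans ?_
  rw [modelWithCornersSelf_coe, range_id, fderivWithin_univ]
  rfl

lemma inChart_transition (α : OneForm V N) (p₀ p₁ : N) {u : V}
    (hu : u ∈ (chartAt V p₀).target) (hu' : (chartAt V p₀).symm u ∈ (chartAt V p₁).source) :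
    inChart α p₀ u = (inChart α p₁ (transition p₀ p₁ u)).comp (fderiv ℝ (transition p₀ p₁) u) := by
  have : IsManifold 𝓘(ℝ, V) 1 N := IsManifold.of_le (n := ∞) (by simp)
  have hτ : transition p₀ p₁ u ∈ (chartAt V p₁).target := (chartAt V p₁).map_source hu'
  have hpt : (chartAt V p₁).symm (transition p₀ p₁ u) = (chartAt V p₀).symm u :=
    (chartAt V p₁).left_inv hu'
  have hs1 := mdifferentiableAt_atlas_symm (I := 𝓘(ℝ, V)) (chart_mem_atlas V p₁) hτ
  have hτd : DifferentiableAt ℝ (transition p₀ p₁) u :=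
    ((contDiffOn_transition p₀ p₁).contDiffAt
      ((isOpen_transition_source p₀ p₁).mem_nhds ⟨hu, hu'⟩)).differentiableAt (by simp)
  have heq : (chartAt V p₀).symm =ᶠ[𝓝 u] (chartAt V p₁).symm ∘ transition p₀ p₁ := by
    filter_upwards [(isOpen_transition_source p₀ p₁).mem_nhds ⟨hu, hu'⟩] with u' hu'
    exact ((chartAt V p₁).left_inv hu'.2).symm
  have hd : ∀ v : V, (mfderiv 𝓘(ℝ, V) 𝓘(ℝ, V) (chartAt V p₀).symm u v : V) =
      (mfderiv 𝓘(ℝ, V) 𝓘(ℝ, V) (chartAt V p₁).symm (transition p₀ p₁ u)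
        (fderiv ℝ (transition p₀ p₁) u v) : V) := by
    have hτm : MDifferentiableAt 𝓘(ℝ, V) 𝓘(ℝ, V) (transition p₀ p₁) u := hτd.mdifferentiableAt
    have h1 := mfderiv_comp u hs1 hτm
    have h2 := mfderiv_eq_fderiv (𝕜 := ℝ) (f := transition (V := V) p₀ p₁) (x := u)
    have h3 := heq.mfderiv_eq (I := 𝓘(ℝ, V)) (I' := 𝓘(ℝ, V))
    intro v
    have h1' := congrArg (fun f : V →L[ℝ] V => f v) h1
    have h2' := congrArg (fun f : V →L[ℝ] V => f v) h2
    have h3' := congrArg (fun f : V →L[ℝ] V => f v) h3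
    exact h3'.trans (h1'.trans (congrArg
      (mfderiv 𝓘(ℝ, V) 𝓘(ℝ, V) (chartAt V p₁).symm (transition p₀ p₁ u) : V →L[ℝ] V) h2'))
  have hα : ∀ p p' : N, p = p' → (α p : V →L[ℝ] ℂ) = (α p' : V →L[ℝ] ℂ) := by
    rintro p _ rfl; rfl
  unfold inChart
  ext v
  have e1 := hd v
  have e2 := hα _ _ hpt
  simp only [ContinuousLinearMap.comp_apply] at e1 ⊢
  exact (congrArg (α ((chartAt V p₀).symm u) : V →L[ℝ] ℂ) e1).trans
    (congrArg (fun f : V →L[ℝ] ℂ => f _) e2.symm)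

lemma OneForm.SmoothOn.contDiffAt {α : OneForm V N} {U : Set N} (hα : α.SmoothOn U)
    (hU : IsOpen U) (p₀ : N) {u : V} (hu : u ∈ (chartAt V p₀).target)
    (hu' : (chartAt V p₀).symm u ∈ U) : ContDiffAt ℝ ∞ (inChart α p₀) u :=
  (hα p₀).contDiffAt (((chartAt V p₀).isOpen_inter_preimage_symm hU).mem_nhds ⟨hu, hu'⟩)

/-- The exterior derivative may be computed in any chart. -/
lemma d_eq_inChart {α : OneForm V N} {U : Set N} (hα : α.SmoothOn U) (hU : IsOpen U)
    (p₀ : N) {u : V} (hu : u ∈ (chartAt V p₀).target) (hu' : (chartAt V p₀).symm u ∈ U) (v w : V) :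
    d α ((chartAt V p₀).symm u) (mfderiv 𝓘(ℝ, V) 𝓘(ℝ, V) (chartAt V p₀).symm u v)
      (mfderiv 𝓘(ℝ, V) 𝓘(ℝ, V) (chartAt V p₀).symm u w) =
    (fderiv ℝ (inChart α p₀) u : V →L[ℝ] V →L[ℝ] ℂ) v w -
      (fderiv ℝ (inChart α p₀) u : V →L[ℝ] V →L[ℝ] ℂ) w v := by
  set p := (chartAt V p₀).symm u with hp
  have hps := mem_chart_source V p
  set τ := transition (V := V) p₀ p with hτdef
  have hopen := (isOpen_transition_source (V := V) p₀ p).mem_nhds ⟨hu, hps⟩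
  have hτ : ContDiffAt ℝ ∞ τ u := (contDiffOn_transition p₀ p).contDiffAt hopen
  have hτu : τ u = chartAt V p p := rfl
  have hL : ContDiffAt ℝ ∞ (inChart α p) (τ u) := by
    rw [hτu]
    refine hα.contDiffAt hU p (mem_chart_target V p) ?_
    rw [(chartAt V p).left_inv hps]; exact hu'
  have heq : inChart α p₀ =ᶠ[𝓝 u] fun u' => (inChart α p (τ u')).comp (fderiv ℝ τ u') := by
    filter_upwards [hopen] with u' hu'
    exact inChart_transition α p₀ p hu'.1 hu'.2
  have hLd : DifferentiableAt ℝ (inChart α p) (τ u) := hL.differentiableAt (by simp)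
  have hτd : DifferentiableAt ℝ τ u := hτ.differentiableAt (by simp)
  have hτ2 : DifferentiableAt ℝ (fderiv ℝ τ) u :=
    (hτ.fderiv_right (m := 1) (by norm_cast)).differentiableAt (by simp)
  have hsymm : ∀ v w, fderiv ℝ (fderiv ℝ τ) u v w = fderiv ℝ (fderiv ℝ τ) u w v := by
    intro v w
    exact (hτ.isSymmSndFDerivAt (by
      simpa using (WithTop.coe_le_coe.2 (le_top : (2 : ℕ∞) ≤ ⊤)))).eq v w
  have hfd : ∀ v w : V, (fderiv ℝ (inChart α p₀) u : V →L[ℝ] V →L[ℝ] ℂ) v w =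
      (fderiv ℝ (inChart α p) (τ u) : V →L[ℝ] V →L[ℝ] ℂ) (fderiv ℝ τ u v) (fderiv ℝ τ u w)
        + (inChart α p (τ u)) (fderiv ℝ (fderiv ℝ τ) u v w) := by
    intro v w
    have hc : HasFDerivAt (fun u' => inChart α p (τ u'))
        ((fderiv ℝ (inChart α p) (τ u)).comp (fderiv ℝ τ u)) u :=
      hLd.hasFDerivAt.comp u hτd.hasFDerivAt
    have := hc.clm_comp hτ2.hasFDerivAt
    rw [heq.fderiv_eq, this.fderiv]
    simp [add_comm]
  have hl : d α p (mfderiv 𝓘(ℝ, V) 𝓘(ℝ, V) (chartAt V p₀).symm u v)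
      (mfderiv 𝓘(ℝ, V) 𝓘(ℝ, V) (chartAt V p₀).symm u w) =
      (fderiv ℝ (inChart α p) (τ u) : V →L[ℝ] V →L[ℝ] ℂ) (fderiv ℝ τ u v) (fderiv ℝ τ u w) -
      (fderiv ℝ (inChart α p) (τ u) : V →L[ℝ] V →L[ℝ] ℂ) (fderiv ℝ τ u w) (fderiv ℝ τ u v) := by
    rw [mfderiv_chart_symm_eq p₀ hu]
    rfl
  rw [hl, hfd, hfd, hsymm w v]
  ring

end Naturality

/-! ### Flag structures -/

/-- The complex-linear extension of a real-linear form `T → ℂ` to `ℂ ⊗ T`. -/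
def cext {T : Type*} [AddCommGroup T] [Module ℝ T] [TopologicalSpace T] (α : T →L[ℝ] ℂ) :
    ℂ ⊗[ℝ] T →ₗ[ℂ] ℂ :=
  (α : T →ₗ[ℝ] ℂ).liftBaseChange ℂ

/-- The model of real 3-manifolds. -/
abbrev E3 : Type := EuclideanSpace ℝ (Fin 3)

section Flag

variable {M : Type*} [TopologicalSpace M] [ChartedSpace E3 M]

/-- The complexified tangent space. -/
abbrev CTangent (x : M) : Type := ℂ ⊗[ℝ] TangentSpace (𝓡 3) x

/-- A field of complex lines in `TM ⊗ ℂ` is a smooth sub-bundle of rank one if it is locally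
spanned by a nowhere vanishing smooth section `X + iY`. -/
def IsSmoothLineField (T : ∀ x : M, Submodule ℂ (CTangent x)) : Prop :=
  ∀ x₀ : M, ∃ U : Set M, IsOpen U ∧ x₀ ∈ U ∧ ∃ X Y : ∀ x : M, TangentSpace (𝓡 3) x,
    SmoothVectorFieldOn X U ∧ SmoothVectorFieldOn Y U ∧ ∀ x ∈ U,
      ((1 : ℂ) ⊗ₜ[ℝ] X x + Complex.I ⊗ₜ[ℝ] Y x : CTangent x) ≠ 0 ∧
      T x = Submodule.span ℂ {((1 : ℂ) ⊗ₜ[ℝ] X x + Complex.I ⊗ₜ[ℝ] Y x : CTangent x)}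

variable (M) in
/-- A flag structure on a real 3-manifold: two complex line sub-bundles `T₁`, `T₂` of `TM ⊗ ℂ` with
`T₁ ∩ T₂ = 0` such that `T₁ ⊕ T₂` is a contact distribution, i.e. it is locally the kernel of a
smooth complex 1-form `θ` such that `dθ ∧ θ` vanishes nowhere. -/
structure FlagStructure where
  T₁ : ∀ x : M, Submodule ℂ (CTangent x)
  T₂ : ∀ x : M, Submodule ℂ (CTangent x)
  smooth₁ : IsSmoothLineField T₁
  smooth₂ : IsSmoothLineField T₂
  disjoint : ∀ x, T₁ x ⊓ T₂ x = ⊥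
  contact : ∀ x₀ : M, ∃ U : Set M, IsOpen U ∧ x₀ ∈ U ∧ ∃ θ : OneForm E3 M, θ.SmoothOn U ∧
    ∀ x ∈ U, LinearMap.ker (cext (θ x)) = T₁ x ⊔ T₂ x ∧
      ∃ u v w : TangentSpace (𝓡 3) x,
        d θ x u v * θ x w + d θ x v w * θ x u + d θ x w u * θ x v ≠ 0

/-- A complex covector `η` vanishes on the subspace `S'` and nowhere on `S ∖ {0}`. -/
def IsDualTo {x : M} (S S' : Submodule ℂ (CTangent x)) (η : TangentSpace (𝓡 3) x →L[ℝ] ℂ) : Prop :=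
  (∀ z ∈ S', cext η z = 0) ∧ ∀ z ∈ S, z ≠ 0 → cext η z ≠ 0

/-- A local section `θ` of the bundle of contact forms, completed by `θ₁`, `θ₂` to an adapted
coframe on the open set `U`, normalized by `dθ = θ₁ ∧ θ₂`. -/
structure AdaptedCoframe (F : FlagStructure M) where
  U : Set M
  isOpen_U : IsOpen U
  θ : OneForm E3 M
  θ₁ : OneForm E3 M
  θ₂ : OneForm E3 M
  smooth : θ.SmoothOn U
  smooth₁ : θ₁.SmoothOn U
  smooth₂ : θ₂.SmoothOn U
  ker_θ : ∀ x ∈ U, LinearMap.ker (cext (θ x)) = F.T₁ x ⊔ F.T₂ x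
  dual₁ : ∀ x ∈ U, IsDualTo (F.T₁ x) (F.T₂ x) (θ₁ x)
  dual₂ : ∀ x ∈ U, IsDualTo (F.T₂ x) (F.T₁ x) (θ₂ x)
  d_θ : ∀ x ∈ U, d θ x = wedge (θ₁ x) (θ₂ x)

end Flag

/-! ### Linear algebra in dimension three -/

section LinearAlgebra

/-- The standard basis vectors. -/
abbrev e3 (j : Fin 3) : E3 := EuclideanSpace.single j 1

lemma e3_expand (v : E3) : v = v 0 • e3 0 + v 1 • e3 1 + v 2 • e3 2 := by
  ext j
  fin_cases j <;> simp

lemma cov_expand (α : E3 →L[ℝ] ℂ) (v : E3) :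
    α v = v 0 * α (e3 0) + v 1 * α (e3 1) + v 2 * α (e3 2) := by
  conv_lhs => rw [e3_expand v]
  simp only [map_add, map_smul, Complex.real_smul]

lemma cov_ext {α β : E3 →L[ℝ] ℂ} (h : ∀ j, α (e3 j) = β (e3 j)) : α = β := by
  ext v
  rw [cov_expand α, cov_expand β, h, h, h]

/-- Coordinates on the complexification of `ℝ³`. -/
def cvec : ℂ ⊗[ℝ] E3 ≃ₗ[ℂ] (Fin 3 → ℂ) :=
  ((EuclideanSpace.basisFun (Fin 3) ℝ).toBasis.baseChange ℂ).equivFun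

lemma cvec_tmul (c : ℂ) (X : E3) (j : Fin 3) : cvec (c ⊗ₜ[ℝ] X) j = c * X j := by
  simp [cvec, Module.Basis.baseChange_repr_tmul, mul_comm]

lemma cext_eq (α : E3 →L[ℝ] ℂ) (z : ℂ ⊗[ℝ] E3) :
    cext α z = cvec z 0 * α (e3 0) + cvec z 1 * α (e3 1) + cvec z 2 * α (e3 2) := by
  induction z with
  | zero => simp
  | add x y hx hy => simp only [map_add, hx, hy, Pi.add_apply]; ring
  | tmul c X =>
    have : cext α (c ⊗ₜ[ℝ] X) = c * α X := rfl
    rw [this, cov_expand α X]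
    simp only [cvec_tmul]
    ring

/-- The determinant of three covectors. -/
def cdet (a b c : E3 →L[ℝ] ℂ) : ℂ :=
  a (e3 0) * (b (e3 1) * c (e3 2) - b (e3 2) * c (e3 1))
    - a (e3 1) * (b (e3 0) * c (e3 2) - b (e3 2) * c (e3 0))
    + a (e3 2) * (b (e3 0) * c (e3 1) - b (e3 1) * c (e3 0))

lemma cdet_eq_det (a b c : E3 →L[ℝ] ℂ) : cdet a b c =
    Matrix.det !![a (e3 0), a (e3 1), a (e3 2); b (e3 0), b (e3 1), b (e3 2);
      c (e3 0), c (e3 1), c (e3 2)] := by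
  rw [Matrix.det_fin_three]; simp [cdet]; ring

lemma cdet_ne_zero {a b c : E3 →L[ℝ] ℂ} (h : ∀ z : ℂ ⊗[ℝ] E3, cext a z = 0 → cext b z = 0 →
    cext c z = 0 → z = 0) : cdet a b c ≠ 0 := by
  intro h0
  rw [cdet_eq_det] at h0
  obtain ⟨v, hv, hv'⟩ := Matrix.exists_mulVec_eq_zero_iff.2 h0
  apply hv
  have := h (cvec.symm v) ?_ ?_ ?_
  · simpa using this
  · have := congrFun hv' 0
    rw [cext_eq]; simp [Matrix.mulVec, dotProduct, Fin.sum_univ_three] at this ⊢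
    linear_combination this
  · have := congrFun hv' 1
    rw [cext_eq]; simp [Matrix.mulVec, dotProduct, Fin.sum_univ_three] at this ⊢
    linear_combination this
  · have := congrFun hv' 2
    rw [cext_eq]; simp [Matrix.mulVec, dotProduct, Fin.sum_univ_three] at this ⊢
    linear_combination this

/-- Expansion of a covector in a coframe (Cramer's rule). -/
lemma cramer {a b c : E3 →L[ℝ] ℂ} (h : cdet a b c ≠ 0) (α : E3 →L[ℝ] ℂ) :
    α = (cdet α b c / cdet a b c) • a + (cdet a α c / cdet a b c) • b
      + (cdet a b α / cdet a b c) • c := by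
  apply cov_ext
  intro j
  simp only [add_apply, smul_apply, smul_eq_mul]
  rw [div_mul_eq_mul_div, div_mul_eq_mul_div, div_mul_eq_mul_div, ← add_div, ← add_div,
    eq_div_iff h]
  unfold cdet
  fin_cases j <;> simp <;> ring

lemma cdet_lin {a b c : E3 →L[ℝ] ℂ} (x y z : ℂ) :
    cdet (x • a + y • b + z • c) b c = x * cdet a b c ∧
    cdet a (x • a + y • b + z • c) c = y * cdet a b c ∧
    cdet a b (x • a + y • b + z • c) = z * cdet a b c := by
  simp only [cdet, add_apply, smul_apply, smul_eq_mul]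
  refine ⟨by ring, by ring, by ring⟩

/-- The alternating form `(v, w) ↦ A v w - A w v`. -/
def alt (A : E3 →L[ℝ] E3 →L[ℝ] ℂ) (v w : E3) : ℂ := A v w - A w v

lemma alt_expand (A : E3 →L[ℝ] E3 →L[ℝ] ℂ) (v w : E3) :
    alt A v w = (v 0 * w 1 - v 1 * w 0) * alt A (e3 0) (e3 1)
      + (v 0 * w 2 - v 2 * w 0) * alt A (e3 0) (e3 2)
      + (v 1 * w 2 - v 2 * w 1) * alt A (e3 1) (e3 2) := by
  have h : ∀ v w, A v w = v 0 * A (e3 0) w + v 1 * A (e3 1) w + v 2 * A (e3 2) w := by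
    intro v w
    exact cov_expand (A.flip w) v
  simp only [alt]
  rw [h v w, h w v]
  simp only [cov_expand (A (e3 _)) v, cov_expand (A (e3 _)) w]
  ring

/-- Contraction of `alt A` with a vector in the second slot. -/
def altR (A : E3 →L[ℝ] E3 →L[ℝ] ℂ) (X : E3) : E3 →L[ℝ] ℂ := A.flip X - A X

@[simp] lemma altR_apply (A : E3 →L[ℝ] E3 →L[ℝ] ℂ) (X v : E3) : altR A X v = alt A v X := rfl

/-- Contraction of `alt A` with a complex vector `X + iY` in the second slot. -/
def altC (A : E3 →L[ℝ] E3 →L[ℝ] ℂ) (X Y : E3) : E3 →L[ℝ] ℂ := altR A X + Complex.I • altR A Y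

lemma altC_apply (A : E3 →L[ℝ] E3 →L[ℝ] ℂ) (X Y v : E3) :
    altC A X Y v = alt A v X + Complex.I * alt A v Y := rfl

/-- `alt A` on two complex vectors `X₁ + iY₁`, `X₂ + iY₂`. -/
def altCC (A : E3 →L[ℝ] E3 →L[ℝ] ℂ) (X₁ Y₁ X₂ Y₂ : E3) : ℂ :=
  altC A X₂ Y₂ X₁ + Complex.I * altC A X₂ Y₂ Y₁

lemma cext_altC (A : E3 →L[ℝ] E3 →L[ℝ] ℂ) (X₁ Y₁ X₂ Y₂ : E3) :
    cext (altC A X₂ Y₂) ((1 : ℂ) ⊗ₜ[ℝ] X₁ + Complex.I ⊗ₜ[ℝ] Y₁) = altCC A X₁ Y₁ X₂ Y₂ := by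
  have h : ∀ (c : ℂ) X, cext (altC A X₂ Y₂) (c ⊗ₜ[ℝ] X) = c * altC A X₂ Y₂ X := fun _ _ => rfl
  rw [map_add, h, h, one_mul, altCC]

lemma altCC_self (A : E3 →L[ℝ] E3 →L[ℝ] ℂ) (X Y : E3) : altCC A X Y X Y = 0 := by
  simp only [altCC, altC_apply, alt]
  ring

lemma altCC_swap (A : E3 →L[ℝ] E3 →L[ℝ] ℂ) (X Y X' Y' : E3) :
    altCC A X Y X' Y' = - altCC A X' Y' X Y := by
  simp only [altCC, altC_apply, alt]
  ring

/-- Alternating forms in dimension three are decomposable. -/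
lemma alt_decomp (A : E3 →L[ℝ] E3 →L[ℝ] ℂ) (X₁ Y₁ X₂ Y₂ v w : E3) :
    alt A v w * altCC A X₁ Y₁ X₂ Y₂ =
      - (altC A X₂ Y₂ v * altC A X₁ Y₁ w - altC A X₂ Y₂ w * altC A X₁ Y₁ v) := by
  simp only [altCC, altC_apply]
  rw [alt_expand A v w, alt_expand A X₁ X₂, alt_expand A X₁ Y₂, alt_expand A Y₁ X₂,
    alt_expand A Y₁ Y₂, alt_expand A v X₂, alt_expand A v Y₂, alt_expand A v X₁,
    alt_expand A v Y₁, alt_expand A w X₂, alt_expand A w Y₂, alt_expand A w X₁, alt_expand A w Y₁]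
  ring

/-- Contact forms are nondegenerate on their kernel. -/
lemma altCC_ne_zero (A : E3 →L[ℝ] E3 →L[ℝ] ℂ) (t : E3 →L[ℝ] ℂ) (X₁ Y₁ X₂ Y₂ : E3)
    (h1 : cext t ((1 : ℂ) ⊗ₜ[ℝ] X₁ + Complex.I ⊗ₜ[ℝ] Y₁) = 0)
    (h2 : cext t ((1 : ℂ) ⊗ₜ[ℝ] X₂ + Complex.I ⊗ₜ[ℝ] Y₂) = 0)
    (h1' : ((1 : ℂ) ⊗ₜ[ℝ] X₁ + Complex.I ⊗ₜ[ℝ] Y₁ : ℂ ⊗[ℝ] E3) ≠ 0)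
    (h12 : ((1 : ℂ) ⊗ₜ[ℝ] X₂ + Complex.I ⊗ₜ[ℝ] Y₂ : ℂ ⊗[ℝ] E3) ∉
      Submodule.span ℂ {((1 : ℂ) ⊗ₜ[ℝ] X₁ + Complex.I ⊗ₜ[ℝ] Y₁ : ℂ ⊗[ℝ] E3)})
    (u v w : E3) (hc : alt A u v * t w + alt A v w * t u + alt A w u * t v ≠ 0) :
    altCC A X₁ Y₁ X₂ Y₂ ≠ 0 := by
  intro h0
  set Z₁ := ((1 : ℂ) ⊗ₜ[ℝ] X₁ + Complex.I ⊗ₜ[ℝ] Y₁ : ℂ ⊗[ℝ] E3) with hZ₁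
  set Z₂ := ((1 : ℂ) ⊗ₜ[ℝ] X₂ + Complex.I ⊗ₜ[ℝ] Y₂ : ℂ ⊗[ℝ] E3) with hZ₂
  have hz : ∀ j, cvec Z₁ j = X₁ j + Complex.I * Y₁ j := by
    intro j; rw [hZ₁, map_add, Pi.add_apply, cvec_tmul, cvec_tmul, one_mul]
  have hy : ∀ j, cvec Z₂ j = X₂ j + Complex.I * Y₂ j := by
    intro j; rw [hZ₂, map_add, Pi.add_apply, cvec_tmul, cvec_tmul, one_mul]
  rw [cext_eq] at h1 h2
  have hCC : altCC A X₁ Y₁ X₂ Y₂ =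
      (cvec Z₁ 0 * cvec Z₂ 1 - cvec Z₁ 1 * cvec Z₂ 0) * alt A (e3 0) (e3 1)
      + (cvec Z₁ 0 * cvec Z₂ 2 - cvec Z₁ 2 * cvec Z₂ 0) * alt A (e3 0) (e3 2)
      + (cvec Z₁ 1 * cvec Z₂ 2 - cvec Z₁ 2 * cvec Z₂ 1) * alt A (e3 1) (e3 2) := by
    simp only [altCC, altC_apply, hz, hy]
    rw [alt_expand A X₁ X₂, alt_expand A X₁ Y₂, alt_expand A Y₁ X₂, alt_expand A Y₁ Y₂]
    ring
  rw [hCC] at h0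
  have hc' : alt A (e3 0) (e3 1) * t (e3 2) - alt A (e3 0) (e3 2) * t (e3 1)
      + alt A (e3 1) (e3 2) * t (e3 0) ≠ 0 := by
    intro h
    apply hc
    rw [alt_expand A u v, alt_expand A v w, alt_expand A w u, cov_expand t u, cov_expand t v,
      cov_expand t w]
    linear_combination ((u 0 : ℂ) * (v 1 * w 2 - v 2 * w 1) - u 1 * (v 0 * w 2 - v 2 * w 0)
      + u 2 * (v 0 * w 1 - v 1 * w 0)) * h
  generalize alt A (e3 0) (e3 1) = b01 at *
  generalize alt A (e3 0) (e3 2) = b02 at *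
  generalize alt A (e3 1) (e3 2) = b12 at *
  generalize t (e3 0) = t0 at *
  generalize t (e3 1) = t1 at *
  generalize t (e3 2) = t2 at *
  -- the cross product of `Z₁` and `Z₂` is proportional to `t`
  have c01 : cvec Z₁ 0 * cvec Z₂ 1 - cvec Z₁ 1 * cvec Z₂ 0 = 0 := by
    refine (mul_eq_zero.1 ?_).resolve_right hc'
    linear_combination t2 * h0 + (b02 * cvec Z₂ 0 + b12 * cvec Z₂ 1) * h1
      - (b02 * cvec Z₁ 0 + b12 * cvec Z₁ 1) * h2
  have c02 : cvec Z₁ 0 * cvec Z₂ 2 - cvec Z₁ 2 * cvec Z₂ 0 = 0 := by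
    refine (mul_eq_zero.1 ?_).resolve_right hc'
    linear_combination (-t1) * h0 + (-b01 * cvec Z₂ 0 + b12 * cvec Z₂ 2) * h1
      - (-b01 * cvec Z₁ 0 + b12 * cvec Z₁ 2) * h2
  have c12 : cvec Z₁ 1 * cvec Z₂ 2 - cvec Z₁ 2 * cvec Z₂ 1 = 0 := by
    refine (mul_eq_zero.1 ?_).resolve_right hc'
    linear_combination t0 * h0 - (b01 * cvec Z₂ 1 + b02 * cvec Z₂ 2) * h1
      + (b01 * cvec Z₁ 1 + b02 * cvec Z₁ 2) * h2
  apply h12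
  rw [Submodule.mem_span_singleton]
  have hne : cvec Z₁ ≠ 0 := by simpa using h1'
  obtain ⟨k, hk⟩ : ∃ k, cvec Z₁ k ≠ 0 := by
    by_contra! hcon
    exact hne (funext hcon)
  refine ⟨cvec Z₂ k / cvec Z₁ k, cvec.injective ?_⟩
  rw [map_smul]
  ext j
  simp only [Pi.smul_apply, smul_eq_mul]
  rw [div_mul_eq_mul_div, div_eq_iff hk]
  fin_cases k <;> fin_cases j <;> simp only [Fin.zero_eta, Fin.mk_one, Fin.reduceFinMk] <;>
    first
    | ring1
    | linear_combination c01
    | linear_combination -c01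
    | linear_combination c02
    | linear_combination -c02
    | linear_combination c12
    | linear_combination -c12

end LinearAlgebra

/-! ### Existence of adapted coframes -/

section Existence

lemma ContDiffOn.altC {G : Type*} [NormedAddCommGroup G] [NormedSpace ℝ G]
    {A : G → E3 →L[ℝ] E3 →L[ℝ] ℂ} {X Y : G → E3} {s : Set G} (hA : ContDiffOn ℝ ∞ A s)
    (hX : ContDiffOn ℝ ∞ X s) (hY : ContDiffOn ℝ ∞ Y s) :
    ContDiffOn ℝ ∞ (fun u => altC (A u) (X u) (Y u)) s := by
  have hR : ∀ {X : G → E3}, ContDiffOn ℝ ∞ X s → ContDiffOn ℝ ∞ (fun u => altR (A u) (X u)) s :=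
    fun hX => contDiffOn_clm_apply.2 fun v =>
      ((hA.clm_apply contDiffOn_const).clm_apply hX).sub
        ((hA.clm_apply hX).clm_apply contDiffOn_const)
  exact (hR hX).add ((hR hY).const_smul _)

variable {M : Type*} [TopologicalSpace M] [ChartedSpace E3 M]

lemma cext_eq_zero_of_mem {x : M} {T₁ T₂ : Submodule ℂ (CTangent x)}
    {α : TangentSpace (𝓡 3) x →L[ℝ] ℂ} (h : LinearMap.ker (cext α) = T₁ ⊔ T₂) {z : CTangent x}
    (hz : z ∈ T₁ ∨ z ∈ T₂) : cext α z = 0 := by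
  have : z ∈ LinearMap.ker (cext α) := by
    rw [h]
    rcases hz with hz | hz
    · exact Submodule.mem_sup_left hz
    · exact Submodule.mem_sup_right hz
  exact this

lemma isDualTo_of_span {x : M} {S S' : Submodule ℂ (CTangent x)} {η : TangentSpace (𝓡 3) x →L[ℝ] ℂ}
    {Z Z' : CTangent x} (hS : S = Submodule.span ℂ {Z}) (hS' : S' = Submodule.span ℂ {Z'})
    (h : cext η Z ≠ 0) (h' : cext η Z' = 0) : IsDualTo S S' η := by
  constructor
  · intro z hz
    rw [hS', Submodule.mem_span_singleton] at hz
    obtain ⟨c, rfl⟩ := hz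
    rw [map_smul, h', smul_zero]
  · intro z hz hz0
    rw [hS, Submodule.mem_span_singleton] at hz
    obtain ⟨c, rfl⟩ := hz
    rw [map_smul, smul_eq_mul]
    refine mul_ne_zero ?_ h
    rintro rfl
    exact hz0 (zero_smul _ _)

lemma cext_smul {T : Type*} [AddCommGroup T] [Module ℝ T] [TopologicalSpace T]
    (c : ℂ) (α : T →L[ℝ] ℂ) (z : ℂ ⊗[ℝ] T) : cext (c • α) z = c * cext α z := by
  induction z with
  | zero => simp
  | add x y hx hy => rw [map_add, hx, hy, map_add]; ring
  | tmul a X =>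
    change a * (c * α X) = c * (a * α X)
    ring

lemma cext_add {T : Type*} [AddCommGroup T] [Module ℝ T] [TopologicalSpace T]
    (α β : T →L[ℝ] ℂ) (z : ℂ ⊗[ℝ] T) : cext (α + β) z = cext α z + cext β z := by
  induction z with
  | zero => simp
  | add x y hx hy => rw [map_add, hx, hy, map_add, map_add]; ring
  | tmul a X =>
    change a * (α X + β X) = a * α X + a * β X
    ring

variable [IsManifold (𝓡 3) ∞ M]

theorem exists_adaptedCoframe (F : FlagStructure M) (x₀ : M) :
    ∃ C : AdaptedCoframe F, x₀ ∈ C.U := by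
  obtain ⟨U₁, hU₁, hx₁, X₁, Y₁, hX₁, hY₁, hT₁⟩ := F.smooth₁ x₀
  obtain ⟨U₂, hU₂, hx₂, X₂, Y₂, hX₂, hY₂, hT₂⟩ := F.smooth₂ x₀
  obtain ⟨U₃, hU₃, hx₃, θ, hθ, hc⟩ := F.contact x₀
  set U := U₁ ∩ U₂ ∩ U₃ with hUdef
  have hU : IsOpen U := (hU₁.inter hU₂).inter hU₃
  set A : M → E3 →L[ℝ] E3 →L[ℝ] ℂ := fun x => fderiv ℝ (inChart θ x) (chartAt E3 x x) with hA
  have hdA : ∀ x (v w : E3), d θ x v w = alt (A x) v w := fun _ _ _ => rfl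
  set g : M → ℂ := fun x => altCC (A x) (X₁ x) (Y₁ x) (X₂ x) (Y₂ x) with hg
  set θ₁ : OneForm E3 M := fun x => (g x)⁻¹ • altC (A x) (X₂ x) (Y₂ x) with hθ₁
  set θ₂ : OneForm E3 M := fun x => (-1 : ℂ) • altC (A x) (X₁ x) (Y₁ x) with hθ₂
  have hgne : ∀ x ∈ U, g x ≠ 0 := by
    rintro x ⟨⟨h1, h2⟩, h3⟩
    obtain ⟨hk, u, v, w, hne⟩ := hc x h3
    obtain ⟨hz1, hs1⟩ := hT₁ x h1
    obtain ⟨hz2, hs2⟩ := hT₂ x h2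
    have m1 : ((1 : ℂ) ⊗ₜ[ℝ] X₁ x + Complex.I ⊗ₜ[ℝ] Y₁ x : CTangent x) ∈ F.T₁ x := by
      rw [hs1]; exact Submodule.mem_span_singleton_self _
    have m2 : ((1 : ℂ) ⊗ₜ[ℝ] X₂ x + Complex.I ⊗ₜ[ℝ] Y₂ x : CTangent x) ∈ F.T₂ x := by
      rw [hs2]; exact Submodule.mem_span_singleton_self _
    refine altCC_ne_zero (A x) (θ x) _ _ _ _ (cext_eq_zero_of_mem hk (Or.inl m1))
      (cext_eq_zero_of_mem hk (Or.inr m2)) hz1 ?_ u v w hne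
    intro hmem
    apply hz2
    have : ((1 : ℂ) ⊗ₜ[ℝ] X₂ x + Complex.I ⊗ₜ[ℝ] Y₂ x : CTangent x) ∈ F.T₁ x ⊓ F.T₂ x :=
      ⟨by rw [hs1]; exact hmem, m2⟩
    rw [F.disjoint x] at this
    exact (Submodule.mem_bot ℂ).1 this
  -- coordinate expressions
  have key : ∀ p₀ : M, ∀ u ∈ (chartAt E3 p₀).target ∩ (chartAt E3 p₀).symm ⁻¹' U, ∀ v w : E3,
      alt (A ((chartAt E3 p₀).symm u)) (mfderiv (𝓡 3) (𝓡 3) (chartAt E3 p₀).symm u v)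
        (mfderiv (𝓡 3) (𝓡 3) (chartAt E3 p₀).symm u w) =
      alt (fderiv ℝ (inChart θ p₀) u) v w := by
    intro p₀ u hu v w
    exact d_eq_inChart hθ hU₃ p₀ hu.1 hu.2.2 v w
  have cC : ∀ (X Y : ∀ x : M, TangentSpace (𝓡 3) x) (p₀ : M),
      ∀ u ∈ (chartAt E3 p₀).target ∩ (chartAt E3 p₀).symm ⁻¹' U, ∀ v : E3,
      altC (A ((chartAt E3 p₀).symm u)) (X ((chartAt E3 p₀).symm u)) (Y ((chartAt E3 p₀).symm u))
        (mfderiv (𝓡 3) (𝓡 3) (chartAt E3 p₀).symm u v) =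
      altC (fderiv ℝ (inChart θ p₀) u)
        (mfderiv (𝓡 3) (𝓡 3) (chartAt E3 p₀) ((chartAt E3 p₀).symm u) (X ((chartAt E3 p₀).symm u)))
        (mfderiv (𝓡 3) (𝓡 3) (chartAt E3 p₀) ((chartAt E3 p₀).symm u) (Y ((chartAt E3 p₀).symm u)))
        v := by
    intro X Y p₀ u hu v
    have e : ∀ X : ∀ x : M, TangentSpace (𝓡 3) x, (mfderiv (𝓡 3) (𝓡 3) (chartAt E3 p₀).symm u
      (mfderiv (𝓡 3) (𝓡 3) (chartAt E3 p₀) ((chartAt E3 p₀).symm u)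
        (X ((chartAt E3 p₀).symm u))) : E3) = X ((chartAt E3 p₀).symm u) :=
      fun X => symm_comp_chart_deriv p₀ hu.1 _
    have k : ∀ X : ∀ x : M, TangentSpace (𝓡 3) x,
        alt (A ((chartAt E3 p₀).symm u)) (mfderiv (𝓡 3) (𝓡 3) (chartAt E3 p₀).symm u v)
          (X ((chartAt E3 p₀).symm u)) = alt (fderiv ℝ (inChart θ p₀) u) v
          (mfderiv (𝓡 3) (𝓡 3) (chartAt E3 p₀) ((chartAt E3 p₀).symm u)
            (X ((chartAt E3 p₀).symm u))) := fun X =>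
      (congrArg (alt (A ((chartAt E3 p₀).symm u))
        (mfderiv (𝓡 3) (𝓡 3) (chartAt E3 p₀).symm u v)) (e X)).symm.trans (key p₀ u hu v _)
    exact congrArg₂ (fun a b : ℂ => a + Complex.I * b) (k X) (k Y)
  have hmono : ∀ {V : Set M}, U ⊆ V → ∀ p₀ : M,
      (chartAt E3 p₀).target ∩ (chartAt E3 p₀).symm ⁻¹' U ⊆
      (chartAt E3 p₀).target ∩ (chartAt E3 p₀).symm ⁻¹' V :=
    fun h p₀ u hu => ⟨hu.1, h hu.2⟩
  have sub1 : U ⊆ U₁ := fun x hx => hx.1.1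
  have sub2 : U ⊆ U₂ := fun x hx => hx.1.2
  have sub3 : U ⊆ U₃ := fun x hx => hx.2
  have hA' : ∀ p₀ : M, ContDiffOn ℝ ∞ (fderiv ℝ (inChart θ p₀))
      ((chartAt E3 p₀).target ∩ (chartAt E3 p₀).symm ⁻¹' U) := fun p₀ =>
    ((hθ p₀).mono (hmono sub3 p₀)).fderiv_of_isOpen
      ((chartAt E3 p₀).isOpen_inter_preimage_symm hU) (by simp)
  have s1 := fun p₀ => ContDiffOn.altC (hA' p₀) ((hX₁ p₀).mono (hmono sub1 p₀))
    ((hY₁ p₀).mono (hmono sub1 p₀))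
  have s2 := fun p₀ => ContDiffOn.altC (hA' p₀) ((hX₂ p₀).mono (hmono sub2 p₀))
    ((hY₂ p₀).mono (hmono sub2 p₀))
  have sg : ∀ p₀ : M, ContDiffOn ℝ ∞ (fun u => g ((chartAt E3 p₀).symm u))
      ((chartAt E3 p₀).target ∩ (chartAt E3 p₀).symm ⁻¹' U) := by
    intro p₀
    have := ((s2 p₀).clm_apply ((hX₁ p₀).mono (hmono sub1 p₀))).add
      (contDiffOn_const (c := Complex.I) |>.mul
        ((s2 p₀).clm_apply ((hY₁ p₀).mono (hmono sub1 p₀))))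
    refine this.congr ?_
    intro u hu
    have e : ∀ X : ∀ x : M, TangentSpace (𝓡 3) x, (mfderiv (𝓡 3) (𝓡 3) (chartAt E3 p₀).symm u
      (mfderiv (𝓡 3) (𝓡 3) (chartAt E3 p₀) ((chartAt E3 p₀).symm u)
        (X ((chartAt E3 p₀).symm u))) : E3) = X ((chartAt E3 p₀).symm u) :=
      fun X => symm_comp_chart_deriv p₀ hu.1 _
    have h1 := cC X₂ Y₂ p₀ u hu
      (mfderiv (𝓡 3) (𝓡 3) (chartAt E3 p₀) ((chartAt E3 p₀).symm u) (X₁ ((chartAt E3 p₀).symm u)))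
    have h2 := cC X₂ Y₂ p₀ u hu
      (mfderiv (𝓡 3) (𝓡 3) (chartAt E3 p₀) ((chartAt E3 p₀).symm u) (Y₁ ((chartAt E3 p₀).symm u)))
    rw [e] at h1 h2
    exact congrArg₂ (fun a b : ℂ => a + Complex.I * b) h1 h2
  refine ⟨⟨U, hU, θ, θ₁, θ₂, fun p₀ => (hθ p₀).mono (hmono sub3 p₀), ?_, ?_,
    fun x hx => (hc x hx.2).1, ?_, ?_, ?_⟩, ⟨⟨hx₁, hx₂⟩, hx₃⟩⟩
  · intro p₀
    refine (((sg p₀).inv fun u hu => hgne _ hu.2).smul (s2 p₀)).congr ?_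
    intro u hu
    ext v
    exact congrArg (fun a : ℂ => (g ((chartAt E3 p₀).symm u))⁻¹ * a) (cC X₂ Y₂ p₀ u hu v)
  · intro p₀
    refine ((s1 p₀).const_smul (-1 : ℂ)).congr ?_
    intro u hu
    ext v
    exact congrArg (fun a : ℂ => (-1) * a) (cC X₁ Y₁ p₀ u hu v)
  · intro x hx
    refine isDualTo_of_span (hT₁ x hx.1.1).2 (hT₂ x hx.1.2).2 ?_ ?_
    · refine (cext_smul _ _ _).trans_ne (mul_ne_zero (inv_ne_zero (hgne x hx)) ?_)
      exact (cext_altC (A x) _ _ _ _).trans_ne (hgne x hx)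
    · refine (cext_smul _ _ _).trans (mul_eq_zero_of_right _ ?_)
      exact (cext_altC (A x) _ _ _ _).trans (altCC_self _ _ _)
  · intro x hx
    refine isDualTo_of_span (hT₂ x hx.1.2).2 (hT₁ x hx.1.1).2 ?_ ?_
    · refine (cext_smul _ _ _).trans_ne (mul_ne_zero (by norm_num) ?_)
      refine (cext_altC (A x) _ _ _ _).trans_ne ?_
      exact (altCC_swap _ _ _ _ _).trans_ne (neg_ne_zero.2 (hgne x hx))
    · refine (cext_smul _ _ _).trans (mul_eq_zero_of_right _ ?_)
      exact (cext_altC (A x) _ _ _ _).trans (altCC_self _ _ _)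
  · intro x hx
    funext v w
    have h := alt_decomp (A x) (X₁ x) (Y₁ x) (X₂ x) (Y₂ x) v w
    have hg0 : altCC (A x) (X₁ x) (Y₁ x) (X₂ x) (Y₂ x) ≠ 0 := hgne x hx
    change alt (A x) v w = ((altCC (A x) (X₁ x) (Y₁ x) (X₂ x) (Y₂ x))⁻¹ * altC (A x) (X₂ x) (Y₂ x) v)
      * (-1 * altC (A x) (X₁ x) (Y₁ x) w) -
      ((altCC (A x) (X₁ x) (Y₁ x) (X₂ x) (Y₂ x))⁻¹ * altC (A x) (X₂ x) (Y₂ x) w)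
      * (-1 * altC (A x) (X₁ x) (Y₁ x) v)
    rw [eq_div_of_mul_eq hg0 h]
    field_simp
    ring

end Existence

/-! ### Coefficients in an adapted coframe -/

section Coefficients

/-- The determinant of an endomorphism of `ℝ³`, as a complex number. -/
def detD (D : E3 →L[ℝ] E3) : ℂ :=
  (D (e3 0) 0 * (D (e3 1) 1 * D (e3 2) 2 - D (e3 2) 1 * D (e3 1) 2)
    - D (e3 0) 1 * (D (e3 1) 0 * D (e3 2) 2 - D (e3 2) 0 * D (e3 1) 2)
    + D (e3 0) 2 * (D (e3 1) 0 * D (e3 2) 1 - D (e3 2) 0 * D (e3 1) 1) : ℝ)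

lemma cdet_comp (a b c : E3 →L[ℝ] ℂ) (D : E3 →L[ℝ] E3) :
    cdet (a.comp D) (b.comp D) (c.comp D) = cdet a b c * detD D := by
  have h : ∀ (α : E3 →L[ℝ] ℂ) v, (α.comp D) v =
      D v 0 * α (e3 0) + D v 1 * α (e3 1) + D v 2 * α (e3 2) := fun α v => cov_expand α (D v)
  simp only [cdet, detD, h]
  push_cast
  ring

lemma ContDiffOn.cdet {G : Type*} [NormedAddCommGroup G] [NormedSpace ℝ G]
    {a b c : G → E3 →L[ℝ] ℂ} {s : Set G} (ha : ContDiffOn ℝ ∞ a s) (hb : ContDiffOn ℝ ∞ b s)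
    (hc : ContDiffOn ℝ ∞ c s) : ContDiffOn ℝ ∞ (fun u => cdet (a u) (b u) (c u)) s := by
  have h : ∀ {α : G → E3 →L[ℝ] ℂ}, ContDiffOn ℝ ∞ α s → ∀ j,
      ContDiffOn ℝ ∞ (fun u => α u (e3 j)) s := fun hα j => hα.clm_apply contDiffOn_const
  unfold FlagGeometry.cdet
  exact (((h ha 0).mul (((h hb 1).mul (h hc 2)).sub ((h hb 2).mul (h hc 1)))).sub
    ((h ha 1).mul (((h hb 0).mul (h hc 2)).sub ((h hb 2).mul (h hc 0))))).add
    ((h ha 2).mul (((h hb 0).mul (h hc 1)).sub ((h hb 1).mul (h hc 0))))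

lemma cdet_lin0 (k l : ℂ) (α β b c : E3 →L[ℝ] ℂ) :
    cdet (k • α + l • β) b c = k * cdet α b c + l * cdet β b c := by
  simp only [cdet, add_apply, smul_apply, smul_eq_mul]; ring

lemma cdet_lin1 (k l : ℂ) (α β a c : E3 →L[ℝ] ℂ) :
    cdet a (k • α + l • β) c = k * cdet a α c + l * cdet a β c := by
  simp only [cdet, add_apply, smul_apply, smul_eq_mul]; ring

lemma cdet_lin2 (k l : ℂ) (α β a b : E3 →L[ℝ] ℂ) :
    cdet a b (k • α + l • β) = k * cdet a b α + l * cdet a b β := by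
  simp only [cdet, add_apply, smul_apply, smul_eq_mul]; ring

variable {M : Type*} [TopologicalSpace M] [ChartedSpace E3 M] [IsManifold (𝓡 3) ∞ M]

lemma contDiffOn_cdet_div {a b c a' b' c' : OneForm E3 M} {U : Set M} (ha : a.SmoothOn U)
    (hb : b.SmoothOn U) (hc : c.SmoothOn U) (ha' : a'.SmoothOn U) (hb' : b'.SmoothOn U)
    (hc' : c'.SmoothOn U) (hne : ∀ x ∈ U, cdet (a x) (b x) (c x) ≠ 0) (p₀ : M) :
    ContDiffOn ℝ ∞ (fun u => cdet (a' ((chartAt E3 p₀).symm u)) (b' ((chartAt E3 p₀).symm u))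
      (c' ((chartAt E3 p₀).symm u)) / cdet (a ((chartAt E3 p₀).symm u))
      (b ((chartAt E3 p₀).symm u)) (c ((chartAt E3 p₀).symm u)))
      ((chartAt E3 p₀).target ∩ (chartAt E3 p₀).symm ⁻¹' U) := by
  have hcomp : ∀ (a b c : OneForm E3 M) (u : E3),
      cdet (inChart a p₀ u) (inChart b p₀ u) (inChart c p₀ u) =
      cdet (a ((chartAt E3 p₀).symm u)) (b ((chartAt E3 p₀).symm u))
        (c ((chartAt E3 p₀).symm u)) * detD (mfderiv (𝓡 3) (𝓡 3) (chartAt E3 p₀).symm u) :=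
    fun a b c u => cdet_comp _ _ _ _
  have hD : ∀ u ∈ (chartAt E3 p₀).target ∩ (chartAt E3 p₀).symm ⁻¹' U,
      cdet (inChart a p₀ u) (inChart b p₀ u) (inChart c p₀ u) ≠ 0 := by
    intro u hu h0
    apply hne _ hu.2
    have h : ∀ α : OneForm E3 M, (α ((chartAt E3 p₀).symm u) : E3 →L[ℝ] ℂ) =
        (inChart α p₀ u).comp (mfderiv (𝓡 3) (𝓡 3) (chartAt E3 p₀) ((chartAt E3 p₀).symm u)) := by
      intro α
      ext v
      exact (congrArg (α ((chartAt E3 p₀).symm u)) (symm_comp_chart_deriv p₀ hu.1 v)).symm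
    refine (congrArg₂ (fun x (y : (E3 →L[ℝ] ℂ) × (E3 →L[ℝ] ℂ)) => cdet x y.1 y.2) (h a)
      (Prod.ext (h b) (h c) : ((b ((chartAt E3 p₀).symm u), c ((chartAt E3 p₀).symm u)) :
        (E3 →L[ℝ] ℂ) × (E3 →L[ℝ] ℂ)) = (_, _))).trans ?_
    refine (cdet_comp _ _ _ _).trans ?_
    rw [h0, zero_mul]
  refine ((ContDiffOn.cdet (ha' p₀) (hb' p₀) (hc' p₀)).mul
    ((ContDiffOn.cdet (ha p₀) (hb p₀) (hc p₀)).inv hD)).congr ?_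
  intro u hu
  have := hD u hu
  rw [hcomp] at this
  refine Eq.symm ((congrArg₂ (fun x y : ℂ => x * y⁻¹) (hcomp a' b' c' u) (hcomp a b c u)).trans ?_)
  exact (div_eq_mul_inv _ _).symm.trans (mul_div_mul_right _ _ (right_ne_zero_of_mul this))

end Coefficients

section ContactForms

variable {M : Type*} [TopologicalSpace M] [ChartedSpace E3 M]

namespace FlagStructure

lemma exists_mem₁ (F : FlagStructure M) (x : M) : ∃ z ∈ F.T₁ x, z ≠ 0 := by
  obtain ⟨U, -, hx, X, Y, -, -, h⟩ := F.smooth₁ x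
  exact ⟨_, by rw [(h x hx).2]; exact Submodule.mem_span_singleton_self _, (h x hx).1⟩

lemma exists_mem₂ (F : FlagStructure M) (x : M) : ∃ z ∈ F.T₂ x, z ≠ 0 := by
  obtain ⟨U, -, hx, X, Y, -, -, h⟩ := F.smooth₂ x
  exact ⟨_, by rw [(h x hx).2]; exact Submodule.mem_span_singleton_self _, (h x hx).1⟩

end FlagStructure

namespace AdaptedCoframe

variable {F : FlagStructure M} (C : AdaptedCoframe F)

lemma det_ne_zero {x : M} (hx : x ∈ C.U) : cdet (C.θ x) (C.θ₁ x) (C.θ₂ x) ≠ 0 := by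
  have H : ∀ z : CTangent x, cext (C.θ x) z = 0 → cext (C.θ₁ x) z = 0 → cext (C.θ₂ x) z = 0 →
      z = 0 := by
    intro z hz h1 h2
    have hz' : z ∈ F.T₁ x ⊔ F.T₂ x := by rw [← C.ker_θ x hx]; exact hz
    obtain ⟨z₁, hz₁, z₂, hz₂, rfl⟩ := Submodule.mem_sup.1 hz'
    rw [map_add, (C.dual₁ x hx).1 z₂ hz₂, add_zero] at h1
    rw [map_add, (C.dual₂ x hx).1 z₁ hz₁, zero_add] at h2
    have e1 : z₁ = 0 := by
      by_contra hne
      exact (C.dual₁ x hx).2 z₁ hz₁ hne h1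
    have e2 : z₂ = 0 := by
      by_contra hne
      exact (C.dual₂ x hx).2 z₂ hz₂ hne h2
    rw [e1, e2, add_zero]
  exact cdet_ne_zero H

/-- The coefficient of `θ`. -/
def coef₀ (x : M) (α : TangentSpace (𝓡 3) x →L[ℝ] ℂ) : ℂ :=
  cdet α (C.θ₁ x) (C.θ₂ x) / cdet (C.θ x) (C.θ₁ x) (C.θ₂ x)

/-- The coefficient of `θ₁`. -/
def coef₁ (x : M) (α : TangentSpace (𝓡 3) x →L[ℝ] ℂ) : ℂ :=
  cdet (C.θ x) α (C.θ₂ x) / cdet (C.θ x) (C.θ₁ x) (C.θ₂ x)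

/-- The coefficient of `θ₂`. -/
def coef₂ (x : M) (α : TangentSpace (𝓡 3) x →L[ℝ] ℂ) : ℂ :=
  cdet (C.θ x) (C.θ₁ x) α / cdet (C.θ x) (C.θ₁ x) (C.θ₂ x)

lemma expand {x : M} (hx : x ∈ C.U) (α : TangentSpace (𝓡 3) x →L[ℝ] ℂ) :
    α = C.coef₀ x α • C.θ x + C.coef₁ x α • C.θ₁ x + C.coef₂ x α • C.θ₂ x :=
  cramer (C.det_ne_zero hx) α

/-- The linear combination of the coframe with given coefficients. -/
def comb (x : M) (a b c : ℂ) : TangentSpace (𝓡 3) x →L[ℝ] ℂ :=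
  a • C.θ x + b • C.θ₁ x + c • C.θ₂ x

lemma coef₀_comb {x : M} (hx : x ∈ C.U) (a b c : ℂ) : C.coef₀ x (C.comb x a b c) = a :=
  (div_eq_iff (C.det_ne_zero hx)).2 (cdet_lin a b c).1

lemma coef₁_comb {x : M} (hx : x ∈ C.U) (a b c : ℂ) : C.coef₁ x (C.comb x a b c) = b :=
  (div_eq_iff (C.det_ne_zero hx)).2 (cdet_lin a b c).2.1

lemma coef₂_comb {x : M} (hx : x ∈ C.U) (a b c : ℂ) : C.coef₂ x (C.comb x a b c) = c :=
  (div_eq_iff (C.det_ne_zero hx)).2 (cdet_lin a b c).2.2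

lemma coef₀_lin (x : M) (k l : ℂ) (α β : TangentSpace (𝓡 3) x →L[ℝ] ℂ) :
    C.coef₀ x (k • α + l • β) = k * C.coef₀ x α + l * C.coef₀ x β := by
  have h := cdet_lin0 k l α β (C.θ₁ x) (C.θ₂ x)
  exact (congrArg (· / _) h).trans (by simp only [coef₀]; ring)

lemma coef₁_lin (x : M) (k l : ℂ) (α β : TangentSpace (𝓡 3) x →L[ℝ] ℂ) :
    C.coef₁ x (k • α + l • β) = k * C.coef₁ x α + l * C.coef₁ x β := by
  have h := cdet_lin1 k l α β (C.θ x) (C.θ₂ x)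
  exact (congrArg (· / _) h).trans (by simp only [coef₁]; ring)

lemma coef₂_lin (x : M) (k l : ℂ) (α β : TangentSpace (𝓡 3) x →L[ℝ] ℂ) :
    C.coef₂ x (k • α + l • β) = k * C.coef₂ x α + l * C.coef₂ x β := by
  have h := cdet_lin2 k l α β (C.θ x) (C.θ₁ x)
  exact (congrArg (· / _) h).trans (by simp only [coef₂]; ring)

lemma cext_comb (x : M) (a b c : ℂ) (z : CTangent x) :
    cext (C.comb x a b c) z = a * cext (C.θ x) z + b * cext (C.θ₁ x) z + c * cext (C.θ₂ x) z := by
  unfold comb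
  rw [cext_add, cext_add, cext_smul, cext_smul, cext_smul]

/-- A covector with kernel `T₁ ⊕ T₂` is a multiple of `θ`. -/
lemma eq_smul_of_ker {x : M} (hx : x ∈ C.U) {α : TangentSpace (𝓡 3) x →L[ℝ] ℂ}
    (h : LinearMap.ker (cext α) = F.T₁ x ⊔ F.T₂ x) : α = C.coef₀ x α • C.θ x := by
  have e := C.expand hx α
  obtain ⟨z₁, hz₁, hne₁⟩ := F.exists_mem₁ x
  obtain ⟨z₂, hz₂, hne₂⟩ := F.exists_mem₂ x
  have k := C.cext_comb x (C.coef₀ x α) (C.coef₁ x α) (C.coef₂ x α)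
  have e' : α = C.comb x (C.coef₀ x α) (C.coef₁ x α) (C.coef₂ x α) := e
  rw [← e'] at k
  have k1 := k z₁
  rw [cext_eq_zero_of_mem h (Or.inl hz₁), cext_eq_zero_of_mem (C.ker_θ x hx) (Or.inl hz₁),
    (C.dual₂ x hx).1 z₁ hz₁] at k1
  have k2 := k z₂
  rw [cext_eq_zero_of_mem h (Or.inr hz₂), cext_eq_zero_of_mem (C.ker_θ x hx) (Or.inr hz₂),
    (C.dual₁ x hx).1 z₂ hz₂] at k2
  have c1 : C.coef₁ x α = 0 := by
    have : C.coef₁ x α * cext (C.θ₁ x) z₁ = 0 := by linear_combination -k1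
    exact (mul_eq_zero.1 this).resolve_right ((C.dual₁ x hx).2 z₁ hz₁ hne₁)
  have c2 : C.coef₂ x α = 0 := by
    have : C.coef₂ x α * cext (C.θ₂ x) z₂ = 0 := by linear_combination -k2
    exact (mul_eq_zero.1 this).resolve_right ((C.dual₂ x hx).2 z₂ hz₂ hne₂)
  ext v
  have ev : α v = C.coef₀ x α * C.θ x v + C.coef₁ x α * C.θ₁ x v + C.coef₂ x α * C.θ₂ x v :=
    congrArg (fun f : TangentSpace (𝓡 3) x →L[ℝ] ℂ => f v) e
  rw [c1, c2, zero_mul, zero_mul, add_zero, add_zero] at ev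
  exact ev

/-- A covector dual to `T₁` modulo `T₂` is `a θ₁ + b θ` with `a ≠ 0`. -/
lemma eq_of_dual₁ {x : M} (hx : x ∈ C.U) {α : TangentSpace (𝓡 3) x →L[ℝ] ℂ}
    (h : IsDualTo (F.T₁ x) (F.T₂ x) α) :
    α = C.comb x (C.coef₀ x α) (C.coef₁ x α) 0 ∧ C.coef₁ x α ≠ 0 := by
  have e' : α = C.comb x (C.coef₀ x α) (C.coef₁ x α) (C.coef₂ x α) := C.expand hx α
  obtain ⟨z₁, hz₁, hne₁⟩ := F.exists_mem₁ x
  obtain ⟨z₂, hz₂, hne₂⟩ := F.exists_mem₂ x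
  have k := C.cext_comb x (C.coef₀ x α) (C.coef₁ x α) (C.coef₂ x α)
  rw [← e'] at k
  have k2 := k z₂
  rw [h.1 z₂ hz₂, cext_eq_zero_of_mem (C.ker_θ x hx) (Or.inr hz₂), (C.dual₁ x hx).1 z₂ hz₂] at k2
  have c2 : C.coef₂ x α = 0 := by
    have : C.coef₂ x α * cext (C.θ₂ x) z₂ = 0 := by linear_combination -k2
    exact (mul_eq_zero.1 this).resolve_right ((C.dual₂ x hx).2 z₂ hz₂ hne₂)
  refine ⟨by rw [c2] at e'; exact e', fun h0 => h.2 z₁ hz₁ hne₁ ?_⟩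
  rw [k z₁, cext_eq_zero_of_mem (C.ker_θ x hx) (Or.inl hz₁), h0, c2]
  ring

/-- A covector dual to `T₂` modulo `T₁` is `a θ₂ + b θ` with `a ≠ 0`. -/
lemma eq_of_dual₂ {x : M} (hx : x ∈ C.U) {α : TangentSpace (𝓡 3) x →L[ℝ] ℂ}
    (h : IsDualTo (F.T₂ x) (F.T₁ x) α) :
    α = C.comb x (C.coef₀ x α) 0 (C.coef₂ x α) ∧ C.coef₂ x α ≠ 0 := by
  have e' : α = C.comb x (C.coef₀ x α) (C.coef₁ x α) (C.coef₂ x α) := C.expand hx α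
  obtain ⟨z₁, hz₁, hne₁⟩ := F.exists_mem₁ x
  obtain ⟨z₂, hz₂, hne₂⟩ := F.exists_mem₂ x
  have k := C.cext_comb x (C.coef₀ x α) (C.coef₁ x α) (C.coef₂ x α)
  rw [← e'] at k
  have k1 := k z₁
  rw [h.1 z₁ hz₁, cext_eq_zero_of_mem (C.ker_θ x hx) (Or.inl hz₁), (C.dual₂ x hx).1 z₁ hz₁] at k1
  have c1 : C.coef₁ x α = 0 := by
    have : C.coef₁ x α * cext (C.θ₁ x) z₁ = 0 := by linear_combination -k1
    exact (mul_eq_zero.1 this).resolve_right ((C.dual₁ x hx).2 z₁ hz₁ hne₁)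
  refine ⟨by rw [c1] at e'; exact e', fun h0 => h.2 z₂ hz₂ hne₂ ?_⟩
  rw [k z₂, cext_eq_zero_of_mem (C.ker_θ x hx) (Or.inr hz₂), h0, c1]
  ring

lemma dual₁_comb {x : M} (hx : x ∈ C.U) (a : ℂ) {b : ℂ} (hb : b ≠ 0) :
    IsDualTo (F.T₁ x) (F.T₂ x) (C.comb x a b 0) := by
  refine ⟨fun z hz => ?_, fun z hz hne => ?_⟩
  · rw [cext_comb, cext_eq_zero_of_mem (C.ker_θ x hx) (Or.inr hz), (C.dual₁ x hx).1 z hz]; ring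
  · rw [cext_comb, cext_eq_zero_of_mem (C.ker_θ x hx) (Or.inl hz)]
    simpa using ⟨hb, (C.dual₁ x hx).2 z hz hne⟩

lemma dual₂_comb {x : M} (hx : x ∈ C.U) (a : ℂ) {c : ℂ} (hc : c ≠ 0) :
    IsDualTo (F.T₂ x) (F.T₁ x) (C.comb x a 0 c) := by
  refine ⟨fun z hz => ?_, fun z hz hne => ?_⟩
  · rw [cext_comb, cext_eq_zero_of_mem (C.ker_θ x hx) (Or.inl hz), (C.dual₂ x hx).1 z hz]; ring
  · rw [cext_comb, cext_eq_zero_of_mem (C.ker_θ x hx) (Or.inr hz)]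
    simpa using ⟨hc, (C.dual₂ x hx).2 z hz hne⟩

lemma ker_smul {x : M} {α : TangentSpace (𝓡 3) x →L[ℝ] ℂ} {μ : ℂ} (hμ : μ ≠ 0) :
    LinearMap.ker (cext (μ • α)) = LinearMap.ker (cext α) := by
  ext z
  rw [LinearMap.mem_ker, LinearMap.mem_ker, cext_smul]
  simp [hμ]

lemma coef₀_ne_zero {x : M} (hx : x ∈ C.U) {α : TangentSpace (𝓡 3) x →L[ℝ] ℂ}
    (h : LinearMap.ker (cext α) = F.T₁ x ⊔ F.T₂ x) : C.coef₀ x α ≠ 0 := by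
  intro h0
  have e := C.eq_smul_of_ker hx h
  have hk : ∀ z, cext (C.θ x) z = 0 := by
    intro z
    have : z ∈ LinearMap.ker (cext (C.θ x)) := by
      rw [C.ker_θ x hx, ← h, e, LinearMap.mem_ker, cext_smul, h0, zero_mul]
    exact this
  apply C.det_ne_zero hx
  have : ∀ j, C.θ x (e3 j) = 0 := by
    intro j
    have := hk ((1 : ℂ) ⊗ₜ[ℝ] e3 j)
    have h2 : cext (C.θ x) ((1 : ℂ) ⊗ₜ[ℝ] e3 j) = 1 * C.θ x (e3 j) := rfl
    rw [h2, one_mul] at this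
    exact this
  have h1 : cdet (C.θ x) (C.θ₁ x) (C.θ₂ x) = C.θ x (e3 0) * _ - C.θ x (e3 1) * _
    + C.θ x (e3 2) * _ := rfl
  rw [h1, this 0, this 1, this 2]
  ring

end AdaptedCoframe

end ContactForms

/-! ### The bundle `E` of contact forms -/

section ContactBundle

variable {M : Type*} [TopologicalSpace M] [ChartedSpace E3 M]

/-- The `ℂ*`-bundle `E` of contact forms: covectors with kernel `T₁ ⊕ T₂`. -/
@[ext]
structure ContactForm (F : FlagStructure M) where
  pt : M
  θ : TangentSpace (𝓡 3) pt →L[ℝ] ℂ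
  ker_θ : LinearMap.ker (cext θ) = F.T₁ pt ⊔ F.T₂ pt

/-- The action of `ℂ*` on `E`. -/
def ContactForm.scale {F : FlagStructure M} (μ : ℂ) (hμ : μ ≠ 0) (e : ContactForm F) :
    ContactForm F :=
  ⟨e.pt, μ • e.θ, (AdaptedCoframe.ker_smul hμ).trans e.ker_θ⟩

lemma AdaptedCoframe.coef₀_smul {F : FlagStructure M} (C : AdaptedCoframe F) (x : M) (μ : ℂ)
    (α : TangentSpace (𝓡 3) x →L[ℝ] ℂ) : C.coef₀ x (μ • α) = μ * C.coef₀ x α := by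
  have := C.coef₀_lin x μ 0 α α
  rw [zero_mul, add_zero] at this
  refine Eq.trans (congrArg (C.coef₀ x) ?_) this
  ext v
  exact ((congrArg (fun a : ℂ => μ * α v + a) (zero_mul (α v))).trans (add_zero _)).symm

lemma AdaptedCoframe.coef₀_θ {F : FlagStructure M} (C : AdaptedCoframe F) {x : M} (hx : x ∈ C.U) :
    C.coef₀ x (C.θ x) = 1 := div_self (C.det_ne_zero hx)

variable [IsManifold (𝓡 3) ∞ M] (F : FlagStructure M)

/-- A chosen adapted coframe near each point (used only for local trivializations). -/
def cof (x₀ : M) : AdaptedCoframe F := (exists_adaptedCoframe F x₀).choose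

lemma mem_cof (x₀ : M) : x₀ ∈ (cof F x₀).U := (exists_adaptedCoframe F x₀).choose_spec

open Classical in
/-- The contact form `λ θ` at `x`, for the chosen local section `θ` near `x₀`. -/
def contactPoint (x₀ x : M) (l : ℂ) : ContactForm F :=
  if h : x ∈ (cof F x₀).U ∧ l ≠ 0 then
    ⟨x, l • (cof F x₀).θ x, (AdaptedCoframe.ker_smul h.2).trans ((cof F x₀).ker_θ x h.1)⟩
  else ⟨x₀, (cof F x₀).θ x₀, (cof F x₀).ker_θ x₀ (mem_cof F x₀)⟩

lemma contactPoint_eq {x₀ x : M} {l : ℂ} (hx : x ∈ (cof F x₀).U) (hl : l ≠ 0) :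
    contactPoint F x₀ x l =
      ⟨x, l • (cof F x₀).θ x, (AdaptedCoframe.ker_smul hl).trans ((cof F x₀).ker_θ x hx)⟩ :=
  dif_pos ⟨hx, hl⟩

/-- The quotient of the chosen contact forms near `x₀` and near `x₁`. -/
def ratio (x₀ x₁ x : M) : ℂ := (cof F x₁).coef₀ x ((cof F x₀).θ x)

lemma contDiffOn_coef₀ {α : OneForm E3 M} {U : Set M} (x₁ : M) (hα : α.SmoothOn U) (p₀ : M) :
    ContDiffOn ℝ ∞ (fun u => (cof F x₁).coef₀ ((chartAt E3 p₀).symm u)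
      (α ((chartAt E3 p₀).symm u)))
      ((chartAt E3 p₀).target ∩ (chartAt E3 p₀).symm ⁻¹' (U ∩ (cof F x₁).U)) := by
  have hm : ∀ {β : OneForm E3 M} {W : Set M}, β.SmoothOn W → U ∩ (cof F x₁).U ⊆ W →
      β.SmoothOn (U ∩ (cof F x₁).U) := fun h hW p => (h p).mono fun u hu => ⟨hu.1, hW hu.2⟩
  exact contDiffOn_cdet_div (hm (cof F x₁).smooth inter_subset_right)
    (hm (cof F x₁).smooth₁ inter_subset_right) (hm (cof F x₁).smooth₂ inter_subset_right)
    (hm hα inter_subset_left) (hm (cof F x₁).smooth₁ inter_subset_right)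
    (hm (cof F x₁).smooth₂ inter_subset_right) (fun x hx => (cof F x₁).det_ne_zero hx.2) p₀

lemma contDiffOn_coef₁ {α : OneForm E3 M} {U : Set M} (x₁ : M) (hα : α.SmoothOn U) (p₀ : M) :
    ContDiffOn ℝ ∞ (fun u => (cof F x₁).coef₁ ((chartAt E3 p₀).symm u)
      (α ((chartAt E3 p₀).symm u)))
      ((chartAt E3 p₀).target ∩ (chartAt E3 p₀).symm ⁻¹' (U ∩ (cof F x₁).U)) := by
  have hm : ∀ {β : OneForm E3 M} {W : Set M}, β.SmoothOn W → U ∩ (cof F x₁).U ⊆ W →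
      β.SmoothOn (U ∩ (cof F x₁).U) := fun h hW p => (h p).mono fun u hu => ⟨hu.1, hW hu.2⟩
  exact contDiffOn_cdet_div (hm (cof F x₁).smooth inter_subset_right)
    (hm (cof F x₁).smooth₁ inter_subset_right) (hm (cof F x₁).smooth₂ inter_subset_right)
    (hm (cof F x₁).smooth inter_subset_right) (hm hα inter_subset_left)
    (hm (cof F x₁).smooth₂ inter_subset_right) (fun x hx => (cof F x₁).det_ne_zero hx.2) p₀

lemma contDiffOn_coef₂ {α : OneForm E3 M} {U : Set M} (x₁ : M) (hα : α.SmoothOn U) (p₀ : M) :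
    ContDiffOn ℝ ∞ (fun u => (cof F x₁).coef₂ ((chartAt E3 p₀).symm u)
      (α ((chartAt E3 p₀).symm u)))
      ((chartAt E3 p₀).target ∩ (chartAt E3 p₀).symm ⁻¹' (U ∩ (cof F x₁).U)) := by
  have hm : ∀ {β : OneForm E3 M} {W : Set M}, β.SmoothOn W → U ∩ (cof F x₁).U ⊆ W →
      β.SmoothOn (U ∩ (cof F x₁).U) := fun h hW p => (h p).mono fun u hu => ⟨hu.1, hW hu.2⟩
  exact contDiffOn_cdet_div (hm (cof F x₁).smooth inter_subset_right)
    (hm (cof F x₁).smooth₁ inter_subset_right) (hm (cof F x₁).smooth₂ inter_subset_right)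
    (hm (cof F x₁).smooth inter_subset_right) (hm (cof F x₁).smooth₁ inter_subset_right)
    (hm hα inter_subset_left) (fun x hx => (cof F x₁).det_ne_zero hx.2) p₀

lemma contDiffOn_ratio (x₀ x₁ p₀ : M) :
    ContDiffOn ℝ ∞ (fun u => ratio F x₀ x₁ ((chartAt E3 p₀).symm u))
      ((chartAt E3 p₀).target ∩ (chartAt E3 p₀).symm ⁻¹' ((cof F x₀).U ∩ (cof F x₁).U)) :=
  contDiffOn_coef₀ F x₁ (cof F x₀).smooth p₀

lemma ratio_ne_zero {x₀ x₁ x : M} (h₀ : x ∈ (cof F x₀).U) (h₁ : x ∈ (cof F x₁).U) :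
    ratio F x₀ x₁ x ≠ 0 := (cof F x₁).coef₀_ne_zero h₁ ((cof F x₀).ker_θ x h₀)

/-- The local trivializations `(x, λ) ↦ λ θ` of `E`. -/
def contactAtlas : BundleAtlas E3 M (ContactForm F) ℂ where
  proj := ContactForm.pt
  U x := (cof F x).U
  isOpen_U x := (cof F x).isOpen_U
  mem_U := mem_cof F
  G := {0}ᶜ
  isOpen_G := isOpen_compl_singleton
  coord x₀ e := (cof F x₀).coef₀ e.pt e.θ
  point := contactPoint F
  coord_mem x₀ e he := (cof F x₀).coef₀_ne_zero he e.ker_θ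
  proj_point x₀ x l hx hl := by rw [contactPoint_eq F hx hl]
  coord_point x₀ x l hx hl := by
    rw [contactPoint_eq F hx hl]
    exact ((cof F x₀).coef₀_smul x l _).trans (by rw [(cof F x₀).coef₀_θ hx, mul_one])
  point_coord x₀ e he := by
    rw [contactPoint_eq F he ((cof F x₀).coef₀_ne_zero he e.ker_θ)]
    obtain ⟨x, θ, hθ⟩ := e
    congr 1
    exact ((cof F x₀).eq_smul_of_ker he hθ).symm
  smooth x₀ x₁ := by
    have h1 : ContDiffOn ℝ ∞ (fun q : E3 × ℂ => q.2 * ratio F x₀ x₁ ((chartAt E3 x₀).symm q.1))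
        {q | q.1 ∈ (chartAt E3 x₀).target ∧ (chartAt E3 x₀).symm q.1 ∈
          (cof F x₀).U ∩ (cof F x₁).U ∧ q.2 ∈ ({0}ᶜ : Set ℂ)} :=
      contDiff_snd.contDiffOn.mul ((contDiffOn_ratio F x₀ x₁ x₀).comp contDiff_fst.contDiffOn
        fun q hq => ⟨hq.1, hq.2.1⟩)
    refine h1.congr ?_
    rintro q ⟨_, h2, h3⟩
    rw [contactPoint_eq F h2.1 h3]
    exact (cof F x₁).coef₀_smul _ _ _

instance : TopologicalSpace (ContactForm F) := (contactAtlas F).core.toTopologicalSpace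

instance : ChartedSpace (E3 × ℂ) (ContactForm F) := (contactAtlas F).core.toChartedSpace

instance : IsManifold 𝓘(ℝ, E3 × ℂ) ∞ (ContactForm F) := (contactAtlas F).isManifold

/-- The differential of the projection `E → M`. -/
def dpt (e : ContactForm F) : TangentSpace 𝓘(ℝ, E3 × ℂ) e →L[ℝ] TangentSpace (𝓡 3) e.pt :=
  mfderiv 𝓘(ℝ, E3 × ℂ) (𝓡 3) ContactForm.pt e

/-- The tautological 1-form on `E`. -/
def tautE : OneForm (E3 × ℂ) (ContactForm F) := fun e => e.θ.comp (dpt F e)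

variable {F}

lemma dpt_apply (e : ContactForm F) (v : E3 × ℂ) : (dpt F e v : E3) = v.1 :=
  congrArg (fun f : E3 × ℂ →L[ℝ] E3 => f v) ((contactAtlas F).mfderiv_proj e)

/-- The fibre coordinate `λ` of `E` with respect to the chosen section near `x₀`. -/
def lam (x₀ : M) (e : ContactForm F) : ℂ := (cof F x₀).coef₀ e.pt e.θ

lemma lam_ne_zero {x₀ : M} {e : ContactForm F} (he : e.pt ∈ (cof F x₀).U) : lam x₀ e ≠ 0 :=
  (cof F x₀).coef₀_ne_zero he e.ker_θ

lemma θ_eq {x₀ : M} {e : ContactForm F} (he : e.pt ∈ (cof F x₀).U) :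
    e.θ = lam x₀ e • (cof F x₀).θ e.pt := (cof F x₀).eq_smul_of_ker he e.ker_θ

/-- The differential of `λ`. -/
def dlam (x₀ : M) (e : ContactForm F) : E3 × ℂ →L[ℝ] ℂ :=
  mfderiv 𝓘(ℝ, E3 × ℂ) 𝓘(ℝ, ℂ) (lam x₀) e

lemma contMDiffAt_lam {x₀ : M} {e : ContactForm F} (he : e.pt ∈ (cof F x₀).U) :
    ContMDiffAt 𝓘(ℝ, E3 × ℂ) 𝓘(ℝ, ℂ) ∞ (lam x₀) e := (contactAtlas F).contMDiffAt_coord x₀ e he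

/-- The coordinate expression of `λ`. -/
def lamC (x₀ : M) (e : ContactForm F) (q : E3 × ℂ) : ℂ := lam x₀ ((chartAt (E3 × ℂ) e).symm q)

lemma hasFDerivAt_lamC {x₀ : M} {e : ContactForm F} (he : e.pt ∈ (cof F x₀).U) :
    HasFDerivAt (lamC x₀ e) (dlam x₀ e) (chartAt (E3 × ℂ) e e) := by
  have h := ((contMDiffAt_lam he).mdifferentiableAt (by simp)).hasMFDerivAt.2
  simp only [writtenInExtChartAt, extChartAt, mfld_simps] at h
  exact hasFDerivWithinAt_univ.1 h

lemma chart_symm_apply (e : ContactForm F) (q : E3 × ℂ) :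
    (chartAt (E3 × ℂ) e).symm q = contactPoint F e.pt ((chartAt E3 e.pt).symm q.1) q.2 := rfl

lemma mem_chart_target_iff (e : ContactForm F) (q : E3 × ℂ) : q ∈ (chartAt (E3 × ℂ) e).target ↔
    q.1 ∈ (chartAt E3 e.pt).target ∧ (chartAt E3 e.pt).symm q.1 ∈ (cof F e.pt).U ∧ q.2 ≠ 0 :=
  Iff.rfl

lemma chart_symm_pt (e : ContactForm F) {q : E3 × ℂ} (hq : q ∈ (chartAt (E3 × ℂ) e).target) :
    ((chartAt (E3 × ℂ) e).symm q).pt = (chartAt E3 e.pt).symm q.1 := by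
  rw [mem_chart_target_iff] at hq
  rw [chart_symm_apply, contactPoint_eq F hq.2.1 hq.2.2]

lemma chart_apply_fst (e : ContactForm F) : (chartAt (E3 × ℂ) e e).1 = chartAt E3 e.pt e.pt := rfl

lemma dlam_self (e : ContactForm F) : dlam e.pt e = ContinuousLinearMap.snd ℝ E3 ℂ := by
  have h := hasFDerivAt_lamC (x₀ := e.pt) (e := e) (mem_cof F e.pt)
  refine h.unique ?_
  refine hasFDerivAt_snd.congr_of_eventuallyEq ?_
  filter_upwards [(chartAt (E3 × ℂ) e).open_target.mem_nhds (mem_chart_target _ e)] with q hq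
  rw [mem_chart_target_iff] at hq
  exact (contactAtlas F).coord_point e.pt _ q.2 hq.2.1 hq.2.2

/-- Change of trivialization of `E`. -/
lemma lam_change {x₀ x₁ : M} {e : ContactForm F} (h₀ : e.pt ∈ (cof F x₀).U)
    : lam x₁ e = lam x₀ e * ratio F x₀ x₁ e.pt := by
  unfold lam ratio
  conv_lhs => rw [(cof F x₀).eq_smul_of_ker h₀ e.ker_θ]
  exact (cof F x₁).coef₀_smul _ _ _

/-- The differential of `ratio`. -/
def dratio (x₀ x₁ x : M) : TangentSpace (𝓡 3) x →L[ℝ] ℂ :=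
  mfderiv (𝓡 3) 𝓘(ℝ, ℂ) (ratio F x₀ x₁) x

lemma contMDiffAt_ratio {x₀ x₁ x : M} (h₀ : x ∈ (cof F x₀).U) (h₁ : x ∈ (cof F x₁).U) :
    ContMDiffAt (𝓡 3) 𝓘(ℝ, ℂ) ∞ (ratio F x₀ x₁) x := by
  have h1 : ContMDiffAt (𝓡 3) (𝓡 3) ∞ (chartAt E3 x) x :=
    contMDiffAt_of_mem_maximalAtlas (IsManifold.chart_mem_maximalAtlas x) (mem_chart_source _ x)
  have hx : (chartAt E3 x).symm (chartAt E3 x x) = x :=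
    (chartAt E3 x).left_inv (mem_chart_source _ x)
  have h2 : ContMDiffAt (𝓡 3) 𝓘(ℝ, ℂ) ∞
      (fun u => ratio F x₀ x₁ ((chartAt E3 x).symm u)) (chartAt E3 x x) := by
    refine ContDiffAt.contMDiffAt ((contDiffOn_ratio F x₀ x₁ x).contDiffAt ?_)
    refine ((chartAt E3 x).isOpen_inter_preimage_symm ((cof F x₀).isOpen_U.inter
      (cof F x₁).isOpen_U)).mem_nhds ⟨mem_chart_target _ x, ?_⟩
    rw [mem_preimage, hx]
    exact ⟨h₀, h₁⟩
  refine (ContMDiffAt.comp x h2 h1).congr_of_eventuallyEq ?_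
  filter_upwards [(chartAt E3 x).open_source.mem_nhds (mem_chart_source _ x)] with y hy
  exact congrArg (ratio F x₀ x₁) ((chartAt E3 x).left_inv hy).symm

lemma hasFDerivAt_ratio {x₀ x₁ x : M} (h₀ : x ∈ (cof F x₀).U) (h₁ : x ∈ (cof F x₁).U) :
    HasFDerivAt (fun u => ratio F x₀ x₁ ((chartAt E3 x).symm u))
      (dratio (F := F) x₀ x₁ x : E3 →L[ℝ] ℂ) (chartAt E3 x x) := by
  have h := ((contMDiffAt_ratio h₀ h₁).mdifferentiableAt (by simp)).hasMFDerivAt.2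
  simp only [writtenInExtChartAt, extChartAt, mfld_simps] at h
  exact hasFDerivWithinAt_univ.1 h

lemma dlam_change {x₀ x₁ : M} {e : ContactForm F} (h₀ : e.pt ∈ (cof F x₀).U)
    (h₁ : e.pt ∈ (cof F x₁).U) (v : E3 × ℂ) : dlam x₁ e v =
      ratio F x₀ x₁ e.pt * dlam x₀ e v + lam x₀ e * dratio (F := F) x₀ x₁ e.pt v.1 := by
  have h1 := hasFDerivAt_lamC h₁
  have h0 := hasFDerivAt_lamC h₀
  have hr := (hasFDerivAt_ratio h₀ h₁).comp (chartAt (E3 × ℂ) e e)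
    (hasFDerivAt_fst (𝕜 := ℝ) (E := E3) (F := ℂ))
  have hm := h0.mul hr
  have : lamC x₁ e =ᶠ[𝓝 (chartAt (E3 × ℂ) e e)] fun q => lamC x₀ e q *
      ((fun u => ratio F x₀ x₁ ((chartAt E3 e.pt).symm u)) ∘ Prod.fst) q := by
    have hU : ∀ᶠ e' in 𝓝 e, ContactForm.pt e' ∈ (cof F x₀).U :=
      ((contactAtlas F).contMDiff_proj e).continuousAt.eventually
        ((cof F x₀).isOpen_U.mem_nhds h₀)
    have hsymm : Filter.Tendsto (chartAt (E3 × ℂ) e).symm (𝓝 (chartAt (E3 × ℂ) e e)) (𝓝 e) := by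
      have := ((chartAt (E3 × ℂ) e).continuousAt_symm (mem_chart_target _ e))
      rwa [ContinuousAt, (chartAt (E3 × ℂ) e).left_inv (mem_chart_source _ e)] at this
    filter_upwards [(chartAt (E3 × ℂ) e).open_target.mem_nhds (mem_chart_target _ e),
      hsymm.eventually hU] with q hq hq'
    unfold lamC
    rw [lam_change hq']
    simp only [Function.comp_apply]
    rw [chart_symm_pt e hq]
  have hu := h1.unique (hm.congr_of_eventuallyEq this)
  have hv := congrArg (fun f : E3 × ℂ →L[ℝ] ℂ => f v) hu
  have e1 : lamC x₀ e (chartAt (E3 × ℂ) e e) = lam x₀ e := by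
    unfold lamC
    rw [(chartAt (E3 × ℂ) e).left_inv (mem_chart_source _ e)]
  have e2 : ratio F x₀ x₁ ((chartAt E3 e.pt).symm (chartAt (E3 × ℂ) e e).1) =
      ratio F x₀ x₁ e.pt := by
    rw [chart_apply_fst, (chartAt E3 e.pt).left_inv (mem_chart_source _ e.pt)]
  simp only [Function.comp_apply, e1, e2] at hv
  refine hv.trans ?_
  change lam x₀ e * dratio (F := F) x₀ x₁ e.pt v.1 + ratio F x₀ x₁ e.pt * dlam x₀ e v = _
  ring

/-- The coordinate expression of the tautological form. -/
lemma inChart_tautE {x₀ : M} (e : ContactForm F) {q : E3 × ℂ}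
    (hq : q ∈ (chartAt (E3 × ℂ) e).target) (hq' : (chartAt E3 e.pt).symm q.1 ∈ (cof F x₀).U) :
    inChart (tautE F) e q =
      lamC x₀ e q • (inChart (cof F x₀).θ e.pt q.1).comp (ContinuousLinearMap.fst ℝ E3 ℂ) := by
  have hM : IsManifold 𝓘(ℝ, E3 × ℂ) 1 (ContactForm F) := IsManifold.of_le (n := ∞) (by simp)
  have hM' : IsManifold (𝓡 3) 1 M := IsManifold.of_le (n := ∞) (by simp)
  set e' := (chartAt (E3 × ℂ) e).symm q with he'
  have hpt : e'.pt = (chartAt E3 e.pt).symm q.1 := chart_symm_pt e hq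
  have hs := mdifferentiableAt_atlas_symm (I := 𝓘(ℝ, E3 × ℂ)) (chart_mem_atlas _ e) hq
  have hs1 := mdifferentiableAt_atlas_symm (I := 𝓡 3) (chart_mem_atlas _ e.pt) hq.1
  have hp : MDifferentiableAt 𝓘(ℝ, E3 × ℂ) (𝓡 3) ContactForm.pt e' :=
    ((contactAtlas F).contMDiff_proj e').mdifferentiableAt (by simp)
  have hf : MDifferentiableAt 𝓘(ℝ, E3 × ℂ) (𝓡 3) (Prod.fst : E3 × ℂ → E3) q :=
    differentiableAt_fst.mdifferentiableAt
  have h1 := mfderiv_comp q hp hs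
  have h2 := mfderiv_comp q hs1 hf
  have h3 : ContactForm.pt ∘ (chartAt (E3 × ℂ) e).symm =ᶠ[𝓝 q]
      (chartAt E3 e.pt).symm ∘ Prod.fst := by
    filter_upwards [(chartAt (E3 × ℂ) e).open_target.mem_nhds hq] with q hq
    exact chart_symm_pt e hq
  have h4 := h3.mfderiv_eq (I := 𝓘(ℝ, E3 × ℂ)) (I' := 𝓡 3)
  have h5 := mfderiv_eq_fderiv (𝕜 := ℝ) (f := (Prod.fst : E3 × ℂ → E3)) (x := q)
  have h6 : fderiv ℝ (Prod.fst : E3 × ℂ → E3) q = ContinuousLinearMap.fst ℝ E3 ℂ := fderiv_fst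
  have key : ∀ v : E3 × ℂ, (dpt F e' (mfderiv 𝓘(ℝ, E3 × ℂ) 𝓘(ℝ, E3 × ℂ)
      (chartAt (E3 × ℂ) e).symm q v) : E3) =
      mfderiv (𝓡 3) (𝓡 3) (chartAt E3 e.pt).symm q.1 v.1 := by
    intro v
    have h1' := congrArg (fun f : E3 × ℂ →L[ℝ] E3 => f v) h1
    have h2' := congrArg (fun f : E3 × ℂ →L[ℝ] E3 => f v) h2
    have h4' := congrArg (fun f : E3 × ℂ →L[ℝ] E3 => f v) h4
    have h5' := congrArg (fun f : E3 × ℂ →L[ℝ] E3 => f v) (h5.trans h6)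
    exact h1'.symm.trans (h4'.trans (h2'.trans
      (congrArg (mfderiv (𝓡 3) (𝓡 3) (chartAt E3 e.pt).symm q.1 : E3 →L[ℝ] E3) h5')))
  have hα : ∀ p p' : M, p = p' →
      ((cof F x₀).θ p : E3 →L[ℝ] ℂ) = ((cof F x₀).θ p' : E3 →L[ℝ] ℂ) := by
    rintro p _ rfl; rfl
  have hθ := θ_eq (x₀ := x₀) (e := e') (by rw [hpt]; exact hq')
  refine ContinuousLinearMap.ext fun v => ?_
  have t1 : inChart (tautE F) e q v = e'.θ (dpt F e' (mfderiv 𝓘(ℝ, E3 × ℂ) 𝓘(ℝ, E3 × ℂ)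
      (chartAt (E3 × ℂ) e).symm q v)) := rfl
  rw [t1]
  have t2 : ∀ w : E3, e'.θ w = lam x₀ e' * (cof F x₀).θ e'.pt w := fun w =>
    congrArg (fun f : E3 →L[ℝ] ℂ => f w) hθ
  refine (t2 _).trans ?_
  refine congrArg (fun z : ℂ => lam x₀ e' * z) ?_
  refine (congrArg (fun f : E3 →L[ℝ] ℂ => f _) (hα _ _ hpt)).trans ?_
  exact congrArg ((cof F x₀).θ ((chartAt E3 e.pt).symm q.1) : E3 →L[ℝ] ℂ) (key v)

/-- `dω = dλ ∧ θ + λ dθ` on `E`. -/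
lemma d_tautE {x₀ : M} {e : ContactForm F} (he : e.pt ∈ (cof F x₀).U) (v w : E3 × ℂ) :
    d (tautE F) e v w = dlam x₀ e v * (cof F x₀).θ e.pt w.1 - dlam x₀ e w * (cof F x₀).θ e.pt v.1
      + lam x₀ e * wedge ((cof F x₀).θ₁ e.pt) ((cof F x₀).θ₂ e.pt) v.1 w.1 := by
  set C := cof F x₀
  have hx : (chartAt E3 e.pt).symm (chartAt E3 e.pt e.pt) = e.pt :=
    (chartAt E3 e.pt).left_inv (mem_chart_source _ e.pt)
  have h0 := hasFDerivAt_lamC he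
  have hL : DifferentiableAt ℝ (inChart C.θ e.pt) (chartAt E3 e.pt e.pt) :=
    (C.smooth.contDiffAt C.isOpen_U e.pt (mem_chart_target _ e.pt)
      (by rw [hx]; exact he)).differentiableAt (by simp)
  have hL' := hL.hasFDerivAt.comp (chartAt (E3 × ℂ) e e)
    (hasFDerivAt_fst (𝕜 := ℝ) (E := E3) (F := ℂ))
  have hc : HasFDerivAt (fun q : E3 × ℂ => (inChart C.θ e.pt q.1).comp
      (ContinuousLinearMap.fst ℝ E3 ℂ)) _ (chartAt (E3 × ℂ) e e) :=
    hL'.clm_comp (hasFDerivAt_const (ContinuousLinearMap.fst ℝ E3 ℂ) _)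
  have hs : HasFDerivAt (fun q => lamC x₀ e q • (inChart C.θ e.pt q.1).comp
      (ContinuousLinearMap.fst ℝ E3 ℂ)) _ (chartAt (E3 × ℂ) e e) := h0.smul hc
  have heq : inChart (tautE F) e =ᶠ[𝓝 (chartAt (E3 × ℂ) e e)] fun q =>
      lamC x₀ e q • (inChart C.θ e.pt q.1).comp (ContinuousLinearMap.fst ℝ E3 ℂ) := by
    have hU : ∀ᶠ e' in 𝓝 e, ContactForm.pt e' ∈ C.U :=
      ((contactAtlas F).contMDiff_proj e).continuousAt.eventually (C.isOpen_U.mem_nhds he)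
    have hsymm : Filter.Tendsto (chartAt (E3 × ℂ) e).symm (𝓝 (chartAt (E3 × ℂ) e e)) (𝓝 e) := by
      have := ((chartAt (E3 × ℂ) e).continuousAt_symm (mem_chart_target _ e))
      rwa [ContinuousAt, (chartAt (E3 × ℂ) e).left_inv (mem_chart_source _ e)] at this
    filter_upwards [(chartAt (E3 × ℂ) e).open_target.mem_nhds (mem_chart_target _ e),
      hsymm.eventually hU] with q hq hq'
    rw [chart_symm_pt e hq] at hq'
    exact inChart_tautE e hq hq'
  have e1 : lamC x₀ e (chartAt (E3 × ℂ) e e) = lam x₀ e := by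
    unfold lamC
    rw [(chartAt (E3 × ℂ) e).left_inv (mem_chart_source _ e)]
  have hfd : ∀ v w : E3 × ℂ, (fderiv ℝ (inChart (tautE F) e) (chartAt (E3 × ℂ) e e) :
      E3 × ℂ →L[ℝ] E3 × ℂ →L[ℝ] ℂ) v w = lam x₀ e *
      (fderiv ℝ (inChart C.θ e.pt) (chartAt E3 e.pt e.pt) : E3 →L[ℝ] E3 →L[ℝ] ℂ) v.1 w.1 +
      dlam x₀ e v * inChart C.θ e.pt (chartAt E3 e.pt e.pt) w.1 := by
    intro v w
    rw [heq.fderiv_eq, hs.fderiv]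
    simp [e1, chart_apply_fst]
  have hθ : ∀ w : E3, inChart C.θ e.pt (chartAt E3 e.pt e.pt) w = C.θ e.pt w := by
    intro w
    have hmf : (mfderiv (𝓡 3) (𝓡 3) (chartAt E3 e.pt).symm (chartAt E3 e.pt e.pt) w : E3) = w := by
      have := mfderiv_chart_symm_eq (N := M) e.pt (mem_chart_target E3 e.pt)
      have h' := congrArg (fun f : E3 →L[ℝ] E3 => f w) this
      refine h'.trans ?_
      rw [hx]
      have hid : transition (V := E3) e.pt e.pt =ᶠ[𝓝 (chartAt E3 e.pt e.pt)] id := by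
        filter_upwards [(chartAt E3 e.pt).open_target.mem_nhds (mem_chart_target _ e.pt)] with u hu
        exact (chartAt E3 e.pt).right_inv hu
      rw [hid.fderiv_eq]
      simp
    have hα : ∀ p p' : M, p = p' → (C.θ p : E3 →L[ℝ] ℂ) = (C.θ p' : E3 →L[ℝ] ℂ) := by
      rintro p _ rfl; rfl
    exact (congrArg (fun f : E3 →L[ℝ] ℂ => f _) (hα _ _ hx)).trans
      (congrArg (C.θ e.pt : E3 →L[ℝ] ℂ) hmf)
  have hd : (fderiv ℝ (inChart C.θ e.pt) (chartAt E3 e.pt e.pt) : E3 →L[ℝ] E3 →L[ℝ] ℂ) v.1 w.1 -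
      (fderiv ℝ (inChart C.θ e.pt) (chartAt E3 e.pt e.pt) : E3 →L[ℝ] E3 →L[ℝ] ℂ) w.1 v.1 =
      wedge (C.θ₁ e.pt) (C.θ₂ e.pt) v.1 w.1 :=
    congrFun (congrFun (C.d_θ e.pt he) v.1) w.1
  have : d (tautE F) e v w = (fderiv ℝ (inChart (tautE F) e) (chartAt (E3 × ℂ) e e) :
      E3 × ℂ →L[ℝ] E3 × ℂ →L[ℝ] ℂ) v w - (fderiv ℝ (inChart (tautE F) e) (chartAt (E3 × ℂ) e e) :
      E3 × ℂ →L[ℝ] E3 × ℂ →L[ℝ] ℂ) w v := rfl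
  rw [this, hfd, hfd, hθ, hθ, ← hd]
  ring

end ContactBundle

/-! ### The bundle `Y` of adapted coframes -/

section FrameBundle

variable {M : Type*} [TopologicalSpace M] [ChartedSpace E3 M] [IsManifold (𝓡 3) ∞ M]

/-- The coframe bundle `Y`. A point over `e = (x, θ)` in `E` is a coframe `(ω, ω¹, ω², φ)` of `T_e E`
satisfying `dω = ω¹ ∧ ω² + ω ∧ φ`, where `ω` is the tautological form, and `ω¹`, `ω²` are pull-backs
of forms `η₁`, `η₂` on `T_x M` such that `η₁` vanishes on `T₂` but not on `T₁`, and `η₂` vanishes on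
`T₁` but not on `T₂`. -/
@[ext]
structure Frame (F : FlagStructure M) where
  base : ContactForm F
  η₁ : TangentSpace (𝓡 3) base.pt →L[ℝ] ℂ
  η₂ : TangentSpace (𝓡 3) base.pt →L[ℝ] ℂ
  φ : TangentSpace 𝓘(ℝ, E3 × ℂ) base →L[ℝ] ℂ
  dual₁ : IsDualTo (F.T₁ base.pt) (F.T₂ base.pt) η₁
  dual₂ : IsDualTo (F.T₂ base.pt) (F.T₁ base.pt) η₂
  structure_eq : ∀ v w, d (tautE F) base v w =
    wedge (η₁.comp (dpt F base)) (η₂.comp (dpt F base)) v w + wedge (tautE F base) φ v w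

variable {F : FlagStructure M}

/-- The structure equation in terms of a local section of `E`. -/
lemma structure_eq_iff {x₀ : M} {e : ContactForm F} (he : e.pt ∈ (cof F x₀).U)
    (η₁ η₂ : E3 →L[ℝ] ℂ) (φ : E3 × ℂ →L[ℝ] ℂ) :
    (∀ v w, d (tautE F) e v w =
      wedge (ContinuousLinearMap.comp (M₂ := TangentSpace (𝓡 3) e.pt) η₁ (dpt F e))
        (ContinuousLinearMap.comp (M₂ := TangentSpace (𝓡 3) e.pt) η₂ (dpt F e)) v w
      + wedge (tautE F e) φ v w) ↔
    ∀ v w : E3 × ℂ,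
      dlam x₀ e v * (cof F x₀).θ e.pt w.1 - dlam x₀ e w * (cof F x₀).θ e.pt v.1
        + lam x₀ e * wedge ((cof F x₀).θ₁ e.pt) ((cof F x₀).θ₂ e.pt) v.1 w.1 =
      (η₁ v.1 * η₂ w.1 - η₁ w.1 * η₂ v.1) +
        (lam x₀ e * (cof F x₀).θ e.pt v.1 * φ w - lam x₀ e * (cof F x₀).θ e.pt w.1 * φ v) := by
  have hω : ∀ v : E3 × ℂ, tautE F e v = lam x₀ e * (cof F x₀).θ e.pt v.1 := fun v =>
    (congrArg (e.θ : E3 →L[ℝ] ℂ) (dpt_apply e v)).trans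
      (congrArg (fun f : E3 →L[ℝ] ℂ => f v.1) (θ_eq he))
  have h : ∀ v w : E3 × ℂ, wedge (ContinuousLinearMap.comp (M₂ := TangentSpace (𝓡 3) e.pt) η₁
        (dpt F e)) (ContinuousLinearMap.comp (M₂ := TangentSpace (𝓡 3) e.pt) η₂ (dpt F e)) v w
      + wedge (tautE F e) φ v w = (η₁ v.1 * η₂ w.1 - η₁ w.1 * η₂ v.1) +
        (lam x₀ e * (cof F x₀).θ e.pt v.1 * φ w - lam x₀ e * (cof F x₀).θ e.pt w.1 * φ v) := by
    intro v w
    have h1 : ∀ v : E3 × ℂ, η₁ (dpt F e v : E3) = η₁ v.1 := fun v => congrArg η₁ (dpt_apply e v)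
    have h2 : ∀ v : E3 × ℂ, η₂ (dpt F e v : E3) = η₂ v.1 := fun v => congrArg η₂ (dpt_apply e v)
    rw [← h1 v, ← h1 w, ← h2 v, ← h2 w, ← hω v, ← hω w]
    rfl
  constructor
  · intro H v w
    rw [← d_tautE he v w, ← h v w]
    exact H v w
  · intro H v w
    exact (d_tautE he v w).trans ((H v w).trans (h v w).symm)

/-- The form `φ = -λ⁻¹ dλ + β`, with `β` a covector on `M`. -/
def phiOf (x₀ : M) (e : ContactForm F) (β : E3 →L[ℝ] ℂ) : E3 × ℂ →L[ℝ] ℂ :=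
  - ((lam x₀ e)⁻¹ • dlam x₀ e) + β.comp (ContinuousLinearMap.fst ℝ E3 ℂ)

/-- The covector `β` on `M` with `φ = -λ⁻¹ dλ + β`. -/
def betaOf (x₀ : M) (e : ContactForm F) (φ : E3 × ℂ →L[ℝ] ℂ) : E3 →L[ℝ] ℂ :=
  (φ + (lam x₀ e)⁻¹ • dlam x₀ e).comp (ContinuousLinearMap.inl ℝ E3 ℂ)

lemma phiOf_apply (x₀ : M) (e : ContactForm F) (β : E3 →L[ℝ] ℂ) (v : E3 × ℂ) :
    phiOf x₀ e β v = -((lam x₀ e)⁻¹ * dlam x₀ e v) + β v.1 := rfl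

lemma betaOf_apply (x₀ : M) (e : ContactForm F) (φ : E3 × ℂ →L[ℝ] ℂ) (v : E3) :
    betaOf x₀ e φ v = φ (v, 0) + (lam x₀ e)⁻¹ * dlam x₀ e (v, 0) := rfl

lemma betaOf_phiOf (x₀ : M) (e : ContactForm F) (β : E3 →L[ℝ] ℂ) :
    betaOf x₀ e (phiOf x₀ e β) = β := by
  refine ContinuousLinearMap.ext fun v => ?_
  rw [betaOf_apply, phiOf_apply]
  ring

/-- The points of `Y` over `e`, in terms of their coordinates. -/
def mkFrame (x₀ : M) (e : ContactForm F) (he : e.pt ∈ (cof F x₀).U) (a₁ a₂ v₁ v₂ s : ℂ)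
    (ha : a₁ * a₂ = lam x₀ e) : Frame F where
  base := e
  η₁ := (cof F x₀).comb e.pt (v₁ * lam x₀ e) a₁ 0
  η₂ := (cof F x₀).comb e.pt (v₂ * lam x₀ e) 0 a₂
  φ := phiOf x₀ e ((cof F x₀).comb e.pt s (a₁ * v₂) (-(a₂ * v₁)))
  dual₁ := (cof F x₀).dual₁_comb he _ (left_ne_zero_of_mul (ha.trans_ne (lam_ne_zero he)))
  dual₂ := (cof F x₀).dual₂_comb he _ (right_ne_zero_of_mul (ha.trans_ne (lam_ne_zero he)))
  structure_eq := by
    refine (structure_eq_iff he _ _ _).2 fun v w => ?_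
    have hl := lam_ne_zero he
    have hc : ∀ (a b c : ℂ) (u : E3), (cof F x₀).comb e.pt a b c u = a * (cof F x₀).θ e.pt u +
      b * (cof F x₀).θ₁ e.pt u + c * (cof F x₀).θ₂ e.pt u := fun _ _ _ _ => rfl
    have hφ : ∀ u : E3 × ℂ, phiOf x₀ e ((cof F x₀).comb e.pt s (a₁ * v₂) (-(a₂ * v₁))) u =
        -((lam x₀ e)⁻¹ * dlam x₀ e u) + (s * (cof F x₀).θ e.pt u.1 +
          a₁ * v₂ * (cof F x₀).θ₁ e.pt u.1 + -(a₂ * v₁) * (cof F x₀).θ₂ e.pt u.1) := fun _ => rfl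
    rw [hφ, hφ]
    refine Eq.trans ?_ (congrArg₂ (fun z z' : ℂ => z + z') (congrArg₂ (fun z z' : ℂ => z - z')
      (congrArg₂ (fun z z' : ℂ => z * z') (hc _ _ _ v.1) (hc _ _ _ w.1))
      (congrArg₂ (fun z z' : ℂ => z * z') (hc _ _ _ w.1) (hc _ _ _ v.1))).symm rfl)
    have hll : lam x₀ e * (lam x₀ e)⁻¹ = 1 := mul_inv_cancel₀ hl
    simp only [wedge]
    linear_combination (((cof F x₀).θ e.pt v.1 * dlam x₀ e w -
      (cof F x₀).θ e.pt w.1 * dlam x₀ e v)) * hll -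
      ((cof F x₀).θ₁ e.pt v.1 * (cof F x₀).θ₂ e.pt w.1 -
        (cof F x₀).θ₁ e.pt w.1 * (cof F x₀).θ₂ e.pt v.1) * ha

/-- The coordinates `(a₁, a₂, v₁, v₂, s)` of a point of `Y`. -/
def frameCoord (x₀ : M) (y : Frame F) : Fin 5 → ℂ :=
  ![(cof F x₀).coef₁ y.base.pt y.η₁, (cof F x₀).coef₂ y.base.pt y.η₂,
    (cof F x₀).coef₀ y.base.pt y.η₁ / lam x₀ y.base,
    (cof F x₀).coef₀ y.base.pt y.η₂ / lam x₀ y.base,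
    (cof F x₀).coef₀ y.base.pt (betaOf x₀ y.base y.φ)]

lemma wedge_coef_eq_zero {a b c : E3 →L[ℝ] ℂ} (h : cdet a b c ≠ 0) {k₁ k₂ k₃ : ℂ}
    (H : ∀ v w : E3, k₁ * (a v * b w - a w * b v) + k₂ * (a v * c w - a w * c v)
      + k₃ * (b v * c w - b w * c v) = 0) : k₁ = 0 ∧ k₂ = 0 ∧ k₃ = 0 := by
  have h01 := H (e3 0) (e3 1)
  have h12 := H (e3 1) (e3 2)
  have h20 := H (e3 2) (e3 0)
  refine ⟨(mul_eq_zero.1 ?_).resolve_right h, (mul_eq_zero.1 ?_).resolve_right h,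
    (mul_eq_zero.1 ?_).resolve_right h⟩ <;> unfold cdet
  · linear_combination c (e3 2) * h01 + c (e3 0) * h12 + c (e3 1) * h20
  · linear_combination -(b (e3 2) * h01 + b (e3 0) * h12 + b (e3 1) * h20)
  · linear_combination a (e3 2) * h01 + a (e3 0) * h12 + a (e3 1) * h20

lemma Frame.relations {x₀ : M} (y : Frame F) (he : y.base.pt ∈ (cof F x₀).U) :
    (cof F x₀).coef₁ y.base.pt y.η₁ * (cof F x₀).coef₂ y.base.pt y.η₂ = lam x₀ y.base ∧
    ∃ s : ℂ, y.φ = phiOf x₀ y.base ((cof F x₀).comb y.base.pt s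
        ((cof F x₀).coef₁ y.base.pt y.η₁ * ((cof F x₀).coef₀ y.base.pt y.η₂ / lam x₀ y.base))
        (-((cof F x₀).coef₂ y.base.pt y.η₂ *
          ((cof F x₀).coef₀ y.base.pt y.η₁ / lam x₀ y.base)))) := by
  set C := cof F x₀ with hC
  set l := lam x₀ y.base with hldef
  have hl : l ≠ 0 := lam_ne_zero he
  have H := (structure_eq_iff he y.η₁ y.η₂ y.φ).1 y.structure_eq
  have hη₁ := congrArg (fun f : E3 →L[ℝ] ℂ => f) (C.eq_of_dual₁ he y.dual₁).1
  have hη₂ := congrArg (fun f : E3 →L[ℝ] ℂ => f) (C.eq_of_dual₂ he y.dual₂).1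
  set β : E3 →L[ℝ] ℂ := betaOf x₀ y.base y.φ with hβ
  have hβC := C.expand he β
  set c₁ := C.coef₀ y.base.pt y.η₁
  set a₁ := C.coef₁ y.base.pt y.η₁
  set c₂ := C.coef₀ y.base.pt y.η₂
  set a₂ := C.coef₂ y.base.pt y.η₂
  set b₀ := C.coef₀ y.base.pt β
  set b₁ := C.coef₁ y.base.pt β
  set b₂ := C.coef₂ y.base.pt β
  have hdet : cdet (C.θ y.base.pt) (C.θ₁ y.base.pt) (C.θ₂ y.base.pt) ≠ 0 := C.det_ne_zero he
  set t : E3 →L[ℝ] ℂ := C.θ y.base.pt with ht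
  set t₁ : E3 →L[ℝ] ℂ := C.θ₁ y.base.pt with ht₁
  set t₂ : E3 →L[ℝ] ℂ := C.θ₂ y.base.pt with ht₂
  have e₁ : ∀ u : E3, y.η₁ u = c₁ * t u + a₁ * t₁ u := by
    intro u
    refine (congrArg (fun f : E3 →L[ℝ] ℂ => f u) hη₁).trans ?_
    change c₁ * t u + a₁ * t₁ u + 0 * t₂ u = _
    ring
  have e₂ : ∀ u : E3, y.η₂ u = c₂ * t u + a₂ * t₂ u := by
    intro u
    refine (congrArg (fun f : E3 →L[ℝ] ℂ => f u) hη₂).trans ?_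
    change c₂ * t u + 0 * t₁ u + a₂ * t₂ u = _
    ring
  have eβ : ∀ u : E3, β u = b₀ * t u + b₁ * t₁ u + b₂ * t₂ u := fun u =>
    congrArg (fun f : E3 →L[ℝ] ℂ => f u) hβC
  have eβ' : ∀ u : E3, β u = y.φ (u, (0 : ℂ)) + l⁻¹ * dlam x₀ y.base (u, 0) := fun u => rfl
  have H' : ∀ v w : E3 × ℂ, dlam x₀ y.base v * t w.1 - dlam x₀ y.base w * t v.1
      + l * (t₁ v.1 * t₂ w.1 - t₁ w.1 * t₂ v.1) =
      (y.η₁ v.1 * y.η₂ w.1 - y.η₁ w.1 * y.η₂ v.1) + (l * t v.1 * y.φ w - l * t w.1 * y.φ v) := H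
  obtain ⟨u₀, hu₀⟩ : ∃ u, t u ≠ 0 := by
    by_contra! hcon
    apply hdet
    simp [cdet, hcon]
  have hvert : ∀ ν : ℂ, y.φ ((0 : E3), ν) = -(l⁻¹ * dlam x₀ y.base (0, ν)) := by
    intro ν
    have h1 := H' (u₀, 0) (0, ν)
    simp only [e₁, e₂, map_zero] at h1
    have h2 : t u₀ * (l * y.φ ((0 : E3), ν) + dlam x₀ y.base (0, ν)) = 0 := by
      linear_combination -h1
    have h3 := (mul_eq_zero.1 h2).resolve_left hu₀
    field_simp
    linear_combination h3
  have hsplit : ∀ (f : E3 × ℂ →L[ℝ] ℂ) (v : E3 × ℂ), f v = f (v.1, 0) + f (0, v.2) := by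
    intro f v
    rw [← map_add]
    simp
  have hφ : ∀ v : E3 × ℂ, y.φ v = -(l⁻¹ * dlam x₀ y.base v) + β v.1 := by
    intro v
    refine (hsplit y.φ v).trans ?_
    rw [hsplit (dlam x₀ y.base) v]
    refine (congrArg (fun z : ℂ => y.φ (v.1, (0 : ℂ)) + z) (hvert v.2)).trans ?_
    rw [eβ']
    ring
  have H3 := wedge_coef_eq_zero (k₁ := l * b₁ - a₁ * c₂) (k₂ := l * b₂ + c₁ * a₂)
    (k₃ := a₁ * a₂ - l) hdet (by
    intro v w
    have h1 := H' (v, 0) (w, 0)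
    rw [hφ, hφ] at h1
    simp only [e₁, e₂, eβ] at h1
    have hll : l * l⁻¹ = 1 := mul_inv_cancel₀ hl
    linear_combination -h1 + (t v * dlam x₀ y.base (w, 0) - t w * dlam x₀ y.base (v, 0)) * hll)
  obtain ⟨k1, k2, k3⟩ := H3
  refine ⟨sub_eq_zero.1 k3, b₀, ?_⟩
  refine ContinuousLinearMap.ext fun v => ?_
  refine (hφ v).trans ?_
  change -(l⁻¹ * dlam x₀ y.base v) + β v.1 = -(l⁻¹ * dlam x₀ y.base v) +
    (b₀ * t v.1 + a₁ * (c₂ / l) * t₁ v.1 + -(a₂ * (c₁ / l)) * t₂ v.1)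
  rw [eβ]
  have q1 : b₁ = a₁ * (c₂ / l) := by field_simp; linear_combination k1
  have q2 : b₂ = -(a₂ * (c₁ / l)) := by field_simp; linear_combination k2
  rw [q1, q2]

lemma frameCoord_mkFrame {x₀ : M} {e : ContactForm F} (he : e.pt ∈ (cof F x₀).U)
    (a₁ a₂ v₁ v₂ s : ℂ) (ha : a₁ * a₂ = lam x₀ e) :
    frameCoord x₀ (mkFrame x₀ e he a₁ a₂ v₁ v₂ s ha) = ![a₁, a₂, v₁, v₂, s] := by
  have hl := lam_ne_zero he
  have h0 : frameCoord x₀ (mkFrame x₀ e he a₁ a₂ v₁ v₂ s ha) 0 = a₁ :=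
    (cof F x₀).coef₁_comb he _ _ _
  have h1 : frameCoord x₀ (mkFrame x₀ e he a₁ a₂ v₁ v₂ s ha) 1 = a₂ :=
    (cof F x₀).coef₂_comb he _ _ _
  have h2 : frameCoord x₀ (mkFrame x₀ e he a₁ a₂ v₁ v₂ s ha) 2 = v₁ :=
    (congrArg (· / lam x₀ e) ((cof F x₀).coef₀_comb he _ _ _)).trans
      (mul_div_cancel_right₀ _ hl)
  have h3 : frameCoord x₀ (mkFrame x₀ e he a₁ a₂ v₁ v₂ s ha) 3 = v₂ :=
    (congrArg (· / lam x₀ e) ((cof F x₀).coef₀_comb he _ _ _)).trans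
      (mul_div_cancel_right₀ _ hl)
  have h4 : frameCoord x₀ (mkFrame x₀ e he a₁ a₂ v₁ v₂ s ha) 4 = s :=
    (congrArg ((cof F x₀).coef₀ e.pt) (betaOf_phiOf x₀ e _)).trans ((cof F x₀).coef₀_comb he _ _ _)
  funext i
  fin_cases i
  exacts [h0, h1, h2, h3, h4]

lemma mkFrame_frameCoord {x₀ : M} (y : Frame F) (he : y.base.pt ∈ (cof F x₀).U)
    (h : frameCoord x₀ y 0 * frameCoord x₀ y 1 = lam x₀ y.base) :
    mkFrame x₀ y.base he (frameCoord x₀ y 0) (frameCoord x₀ y 1) (frameCoord x₀ y 2)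
      (frameCoord x₀ y 3) (frameCoord x₀ y 4) h = y := by
  have hl := lam_ne_zero he
  obtain ⟨-, s, hs⟩ := y.relations he
  have h1 := (cof F x₀).eq_of_dual₁ he y.dual₁
  have h2 := (cof F x₀).eq_of_dual₂ he y.dual₂
  have hs' : frameCoord x₀ y 4 = s := by
    have h3 : betaOf x₀ y.base y.φ = _ := (congrArg (betaOf x₀ y.base) hs).trans (betaOf_phiOf _ _ _)
    exact (congrArg ((cof F x₀).coef₀ y.base.pt) h3).trans ((cof F x₀).coef₀_comb he _ _ _)
  have hη₁ : (mkFrame x₀ y.base he (frameCoord x₀ y 0) (frameCoord x₀ y 1) (frameCoord x₀ y 2)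
      (frameCoord x₀ y 3) (frameCoord x₀ y 4) h).η₁ = y.η₁ := by
    refine Eq.trans ?_ h1.1.symm
    change (cof F x₀).comb y.base.pt ((cof F x₀).coef₀ y.base.pt y.η₁ / lam x₀ y.base *
      lam x₀ y.base) _ _ = _
    rw [div_mul_cancel₀ _ hl]
    rfl
  have hη₂ : (mkFrame x₀ y.base he (frameCoord x₀ y 0) (frameCoord x₀ y 1) (frameCoord x₀ y 2)
      (frameCoord x₀ y 3) (frameCoord x₀ y 4) h).η₂ = y.η₂ := by
    refine Eq.trans ?_ h2.1.symm
    change (cof F x₀).comb y.base.pt ((cof F x₀).coef₀ y.base.pt y.η₂ / lam x₀ y.base *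
      lam x₀ y.base) _ _ = _
    rw [div_mul_cancel₀ _ hl]
    rfl
  have hφ : (mkFrame x₀ y.base he (frameCoord x₀ y 0) (frameCoord x₀ y 1) (frameCoord x₀ y 2)
      (frameCoord x₀ y 3) (frameCoord x₀ y 4) h).φ = y.φ := by
    refine Eq.trans ?_ hs.symm
    change phiOf x₀ y.base ((cof F x₀).comb y.base.pt (frameCoord x₀ y 4) _ _) = _
    rw [hs']
    rfl
  refine Frame.ext rfl ?_ ?_ ?_
  exacts [hη₁, hη₂, hφ]

end FrameBundle

section FrameManifold

variable {M : Type*} [TopologicalSpace M] [ChartedSpace E3 M] [IsManifold (𝓡 3) ∞ M]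
  (F : FlagStructure M)

lemma smoothOn_dratio (x₀ x₁ : M) :
    OneForm.SmoothOn (fun x => dratio (F := F) x₀ x₁ x) ((cof F x₀).U ∩ (cof F x₁).U) := by
  intro p₀
  have hopen := (chartAt E3 p₀).isOpen_inter_preimage_symm
    ((cof F x₀).isOpen_U.inter (cof F x₁).isOpen_U)
  have h : ContDiffOn ℝ ∞ (fderiv ℝ fun u => ratio F x₀ x₁ ((chartAt E3 p₀).symm u))
      ((chartAt E3 p₀).target ∩ (chartAt E3 p₀).symm ⁻¹' ((cof F x₀).U ∩ (cof F x₁).U)) :=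
    (contDiffOn_ratio F x₀ x₁ p₀).fderiv_of_isOpen hopen (by simp)
  refine h.congr fun u hu => ?_
  have hM' : IsManifold (𝓡 3) 1 M := IsManifold.of_le (n := ∞) (by simp)
  have hs := mdifferentiableAt_atlas_symm (I := 𝓡 3) (chart_mem_atlas E3 p₀) hu.1
  have hr : MDifferentiableAt (𝓡 3) 𝓘(ℝ, ℂ) (ratio F x₀ x₁) ((chartAt E3 p₀).symm u) :=
    (contMDiffAt_ratio hu.2.1 hu.2.2).mdifferentiableAt (by simp)
  have h1 := mfderiv_comp u hr hs
  have h2 := mfderiv_eq_fderiv (𝕜 := ℝ)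
    (f := fun u : E3 => ratio F x₀ x₁ ((chartAt E3 p₀).symm u)) (x := u)
  exact h1.symm.trans h2

variable {F}

lemma betaOf_phiOf' {x₀ x₁ : M} {e : ContactForm F} (h₀ : e.pt ∈ (cof F x₀).U)
    (h₁ : e.pt ∈ (cof F x₁).U) (β : TangentSpace (𝓡 3) e.pt →L[ℝ] ℂ) :
    betaOf x₁ e (phiOf x₀ e β) =
      (1 : ℂ) • β + (ratio F x₀ x₁ e.pt)⁻¹ • dratio (F := F) x₀ x₁ e.pt := by
  have hl := lam_ne_zero h₀
  have hr := ratio_ne_zero F h₀ h₁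
  refine ContinuousLinearMap.ext fun v => ?_
  have h := dlam_change h₀ h₁ (v, 0)
  change -((lam x₀ e)⁻¹ * dlam x₀ e (v, 0)) + β v + (lam x₁ e)⁻¹ * dlam x₁ e (v, 0) =
    1 * β v + (ratio F x₀ x₁ e.pt)⁻¹ * dratio (F := F) x₀ x₁ e.pt v
  rw [h, lam_change (x₁ := x₁) h₀]
  change -((lam x₀ e)⁻¹ * dlam x₀ e (v, 0)) + β v + (lam x₀ e * ratio F x₀ x₁ e.pt)⁻¹ *
    (ratio F x₀ x₁ e.pt * dlam x₀ e (v, 0) + lam x₀ e * dratio (F := F) x₀ x₁ e.pt v) =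
    1 * β v + (ratio F x₀ x₁ e.pt)⁻¹ * dratio (F := F) x₀ x₁ e.pt v
  generalize dratio (F := F) x₀ x₁ e.pt v = z
  field_simp
  ring

lemma coef₀_comb' (x₀ x₁ x : M) (a b c : ℂ) :
    (cof F x₁).coef₀ x ((cof F x₀).comb x a b c) = a * (cof F x₁).coef₀ x ((cof F x₀).θ x)
      + b * (cof F x₁).coef₀ x ((cof F x₀).θ₁ x) + c * (cof F x₁).coef₀ x ((cof F x₀).θ₂ x) := by
  have h := (cof F x₁).coef₀_lin x 1 c
    (a • (cof F x₀).θ x + b • (cof F x₀).θ₁ x) ((cof F x₀).θ₂ x)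
  rw [one_smul, (cof F x₁).coef₀_lin, one_mul] at h
  exact h

lemma coef₁_comb' (x₀ x₁ x : M) (a b c : ℂ) :
    (cof F x₁).coef₁ x ((cof F x₀).comb x a b c) = a * (cof F x₁).coef₁ x ((cof F x₀).θ x)
      + b * (cof F x₁).coef₁ x ((cof F x₀).θ₁ x) + c * (cof F x₁).coef₁ x ((cof F x₀).θ₂ x) := by
  have h := (cof F x₁).coef₁_lin x 1 c
    (a • (cof F x₀).θ x + b • (cof F x₀).θ₁ x) ((cof F x₀).θ₂ x)
  rw [one_smul, (cof F x₁).coef₁_lin, one_mul] at h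
  exact h

lemma coef₂_comb' (x₀ x₁ x : M) (a b c : ℂ) :
    (cof F x₁).coef₂ x ((cof F x₀).comb x a b c) = a * (cof F x₁).coef₂ x ((cof F x₀).θ x)
      + b * (cof F x₁).coef₂ x ((cof F x₀).θ₁ x) + c * (cof F x₁).coef₂ x ((cof F x₀).θ₂ x) := by
  have h := (cof F x₁).coef₂_lin x 1 c
    (a • (cof F x₀).θ x + b • (cof F x₀).θ₁ x) ((cof F x₀).θ₂ x)
  rw [one_smul, (cof F x₁).coef₂_lin, one_mul] at h
  exact h

variable (F) in
/-- The change of coordinates of `Y`. -/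
def frameTransition (x₀ x₁ x : M) (h : Fin 5 → ℂ) : Fin 5 → ℂ :=
  ![h 2 * (h 0 * h 1) * (cof F x₁).coef₁ x ((cof F x₀).θ x)
      + h 0 * (cof F x₁).coef₁ x ((cof F x₀).θ₁ x),
    h 3 * (h 0 * h 1) * (cof F x₁).coef₂ x ((cof F x₀).θ x)
      + h 1 * (cof F x₁).coef₂ x ((cof F x₀).θ₂ x),
    (h 2 * (h 0 * h 1) * (cof F x₁).coef₀ x ((cof F x₀).θ x)
      + h 0 * (cof F x₁).coef₀ x ((cof F x₀).θ₁ x)) * (h 0 * h 1 * ratio F x₀ x₁ x)⁻¹,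
    (h 3 * (h 0 * h 1) * (cof F x₁).coef₀ x ((cof F x₀).θ x)
      + h 1 * (cof F x₁).coef₀ x ((cof F x₀).θ₂ x)) * (h 0 * h 1 * ratio F x₀ x₁ x)⁻¹,
    h 4 * (cof F x₁).coef₀ x ((cof F x₀).θ x)
      + h 0 * h 3 * (cof F x₁).coef₀ x ((cof F x₀).θ₁ x)
      + -(h 1 * h 2) * (cof F x₁).coef₀ x ((cof F x₀).θ₂ x)
      + (ratio F x₀ x₁ x)⁻¹ * (cof F x₁).coef₀ x (dratio (F := F) x₀ x₁ x)]

lemma frameCoord_mkFrame' {x₀ x₁ : M} {e : ContactForm F} (h₀ : e.pt ∈ (cof F x₀).U)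
    (h₁ : e.pt ∈ (cof F x₁).U) (h : Fin 5 → ℂ) (ha : h 0 * h 1 = lam x₀ e) :
    frameCoord x₁ (mkFrame x₀ e h₀ (h 0) (h 1) (h 2) (h 3) (h 4) ha) =
      frameTransition F x₀ x₁ e.pt h := by
  set y := mkFrame x₀ e h₀ (h 0) (h 1) (h 2) (h 3) (h 4) ha with hy
  have hl' : lam x₁ e = h 0 * h 1 * ratio F x₀ x₁ e.pt := by rw [lam_change h₀, ha]
  have e0 : frameCoord x₁ y 0 = frameTransition F x₀ x₁ e.pt h 0 := by
    refine (coef₁_comb' x₀ x₁ e.pt _ _ _).trans ?_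
    rw [zero_mul, add_zero, ← ha]
    rfl
  have e1 : frameCoord x₁ y 1 = frameTransition F x₀ x₁ e.pt h 1 := by
    refine (coef₂_comb' x₀ x₁ e.pt _ _ _).trans ?_
    rw [zero_mul, add_zero, ← ha]
    rfl
  have e2 : frameCoord x₁ y 2 = frameTransition F x₀ x₁ e.pt h 2 := by
    refine (congrArg (· / lam x₁ e) (coef₀_comb' x₀ x₁ e.pt _ _ _)).trans ?_
    simp only [hl', zero_mul, add_zero, ← ha, div_eq_mul_inv]
    rfl
  have e3 : frameCoord x₁ y 3 = frameTransition F x₀ x₁ e.pt h 3 := by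
    refine (congrArg (· / lam x₁ e) (coef₀_comb' x₀ x₁ e.pt _ _ _)).trans ?_
    simp only [hl', zero_mul, add_zero, ← ha, div_eq_mul_inv]
    rfl
  have e4 : frameCoord x₁ y 4 = frameTransition F x₀ x₁ e.pt h 4 := by
    have h2 := (cof F x₁).coef₀_lin e.pt 1 (ratio F x₀ x₁ e.pt)⁻¹
      ((cof F x₀).comb e.pt (h 4) (h 0 * h 3) (-(h 1 * h 2))) (dratio (F := F) x₀ x₁ e.pt)
    rw [one_mul, coef₀_comb'] at h2
    exact (congrArg ((cof F x₁).coef₀ e.pt) (betaOf_phiOf' h₀ h₁ _)).trans h2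
  funext i
  fin_cases i
  exacts [e0, e1, e2, e3, e4]

variable (F)

lemma contDiffOn_frameTransition (x₀ x₁ : M) : ContDiffOn ℝ ∞
    (fun q : E3 × (Fin 5 → ℂ) => frameTransition F x₀ x₁ ((chartAt E3 x₀).symm q.1) q.2)
    {q | q.1 ∈ (chartAt E3 x₀).target ∧ (chartAt E3 x₀).symm q.1 ∈ (cof F x₀).U ∩ (cof F x₁).U ∧
      q.2 ∈ {h : Fin 5 → ℂ | h 0 ≠ 0 ∧ h 1 ≠ 0}} := by
  set S := {q : E3 × (Fin 5 → ℂ) | q.1 ∈ (chartAt E3 x₀).target ∧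
    (chartAt E3 x₀).symm q.1 ∈ (cof F x₀).U ∩ (cof F x₁).U ∧
      q.2 ∈ {h : Fin 5 → ℂ | h 0 ≠ 0 ∧ h 1 ≠ 0}} with hS
  have hh : ∀ i, ContDiffOn ℝ ∞ (fun q : E3 × (Fin 5 → ℂ) => q.2 i) S := fun i =>
    ((contDiff_apply ℝ ℂ i).comp contDiff_snd).contDiffOn
  have hfst : ∀ {f : E3 → ℂ} {U : Set M}, ContDiffOn ℝ ∞ f ((chartAt E3 x₀).target ∩
      (chartAt E3 x₀).symm ⁻¹' U) → (cof F x₀).U ∩ (cof F x₁).U ⊆ U →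
      ContDiffOn ℝ ∞ (fun q : E3 × (Fin 5 → ℂ) => f q.1) S := fun hf hU =>
    hf.comp contDiff_fst.contDiffOn fun q hq => ⟨hq.1, hU hq.2.1⟩
  have hr := hfst (contDiffOn_ratio F x₀ x₁ x₀) subset_rfl
  have hr0 : ∀ q ∈ S, ratio F x₀ x₁ ((chartAt E3 x₀).symm q.1) ≠ 0 := fun q hq =>
    ratio_ne_zero F hq.2.1.1 hq.2.1.2
  have c0 := hfst (contDiffOn_coef₀ F x₁ (cof F x₀).smooth x₀) subset_rfl
  have c01 := hfst (contDiffOn_coef₀ F x₁ (cof F x₀).smooth₁ x₀) subset_rfl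
  have c02 := hfst (contDiffOn_coef₀ F x₁ (cof F x₀).smooth₂ x₀) subset_rfl
  have c1 := hfst (contDiffOn_coef₁ F x₁ (cof F x₀).smooth x₀) subset_rfl
  have c11 := hfst (contDiffOn_coef₁ F x₁ (cof F x₀).smooth₁ x₀) subset_rfl
  have c2 := hfst (contDiffOn_coef₂ F x₁ (cof F x₀).smooth x₀) subset_rfl
  have c22 := hfst (contDiffOn_coef₂ F x₁ (cof F x₀).smooth₂ x₀) subset_rfl
  have cd := hfst (contDiffOn_coef₀ F x₁ (smoothOn_dratio F x₀ x₁) x₀)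
    fun x hx => ⟨hx, hx.2⟩
  have hl := (hh 0).mul (hh 1)
  have hlr := (hl.mul hr).inv fun q hq => mul_ne_zero (mul_ne_zero hq.2.2.1 hq.2.2.2) (hr0 q hq)
  refine contDiffOn_pi.2 fun i => ?_
  fin_cases i
  · exact (((hh 2).mul hl).mul c1).add ((hh 0).mul c11)
  · exact (((hh 3).mul hl).mul c2).add ((hh 1).mul c22)
  · exact ((((hh 2).mul hl).mul c0).add ((hh 0).mul c01)).mul hlr
  · exact ((((hh 3).mul hl).mul c0).add ((hh 1).mul c02)).mul hlr
  · exact ((((hh 4).mul c0).add (((hh 0).mul (hh 3)).mul c01)).add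
      (((hh 1).mul (hh 2)).neg.mul c02)).add ((hr.inv hr0).mul cd)

lemma lam_contactPoint {x₀ x : M} {l : ℂ} (hx : x ∈ (cof F x₀).U) (hl : l ≠ 0) :
    lam x₀ (contactPoint F x₀ x l) = l := (contactAtlas F).coord_point x₀ x l hx hl

lemma contactPoint_pt {x₀ x : M} {l : ℂ} (hx : x ∈ (cof F x₀).U) (hl : l ≠ 0) :
    (contactPoint F x₀ x l).pt = x := (contactAtlas F).proj_point x₀ x l hx hl

open Classical in
/-- The point of `Y` over `x` with given coordinates (for the chosen coframe near `x₀`). -/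
def framePoint (x₀ x : M) (h : Fin 5 → ℂ) : Frame F :=
  if H : (contactPoint F x₀ x (h 0 * h 1)).pt ∈ (cof F x₀).U ∧
      h 0 * h 1 = lam x₀ (contactPoint F x₀ x (h 0 * h 1)) then
    mkFrame x₀ (contactPoint F x₀ x (h 0 * h 1)) H.1 (h 0) (h 1) (h 2) (h 3) (h 4) H.2
  else mkFrame x₀ ⟨x₀, (cof F x₀).θ x₀, (cof F x₀).ker_θ x₀ (mem_cof F x₀)⟩ (mem_cof F x₀) 1 1 0 0 0
    ((one_mul 1).trans ((cof F x₀).coef₀_θ (mem_cof F x₀)).symm)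

variable {F} in
lemma mkFrame_congr {x₀ : M} {e e' : ContactForm F} (h : e = e') (he : e.pt ∈ (cof F x₀).U)
    (he' : e'.pt ∈ (cof F x₀).U) (a₁ a₂ v₁ v₂ s : ℂ) (ha : a₁ * a₂ = lam x₀ e)
    (ha' : a₁ * a₂ = lam x₀ e') :
    mkFrame x₀ e he a₁ a₂ v₁ v₂ s ha = mkFrame x₀ e' he' a₁ a₂ v₁ v₂ s ha' := by
  subst h
  rfl

lemma framePoint_eq {x₀ x : M} {h : Fin 5 → ℂ} (hx : x ∈ (cof F x₀).U) (h0 : h 0 ≠ 0)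
    (h1 : h 1 ≠ 0) : framePoint F x₀ x h =
      mkFrame x₀ (contactPoint F x₀ x (h 0 * h 1))
        (by rw [contactPoint_pt F hx (mul_ne_zero h0 h1)]; exact hx) (h 0) (h 1) (h 2) (h 3) (h 4)
        (lam_contactPoint F hx (mul_ne_zero h0 h1)).symm :=
  dif_pos ⟨by rw [contactPoint_pt F hx (mul_ne_zero h0 h1)]; exact hx,
    (lam_contactPoint F hx (mul_ne_zero h0 h1)).symm⟩

/-- The local trivializations of `Y → M`. -/
def frameAtlas : BundleAtlas E3 M (Frame F) (Fin 5 → ℂ) where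
  proj y := y.base.pt
  U x := (cof F x).U
  isOpen_U x := (cof F x).isOpen_U
  mem_U := mem_cof F
  G := {h | h 0 ≠ 0 ∧ h 1 ≠ 0}
  isOpen_G := (isOpen_ne_fun (continuous_apply 0) continuous_const).inter
    (isOpen_ne_fun (continuous_apply 1) continuous_const)
  coord x₀ y := frameCoord x₀ y
  point := framePoint F
  coord_mem x₀ y hy := ⟨((cof F x₀).eq_of_dual₁ hy y.dual₁).2, ((cof F x₀).eq_of_dual₂ hy y.dual₂).2⟩
  proj_point x₀ x h hx hh := by
    rw [framePoint_eq F hx hh.1 hh.2]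
    exact contactPoint_pt F hx (mul_ne_zero hh.1 hh.2)
  coord_point x₀ x h hx hh := by
    rw [framePoint_eq F hx hh.1 hh.2, frameCoord_mkFrame]
    funext i
    fin_cases i <;> rfl
  point_coord x₀ y hy := by
    have h1 : frameCoord x₀ y 0 * frameCoord x₀ y 1 = lam x₀ y.base := (y.relations hy).1
    rw [framePoint_eq F hy ((cof F x₀).eq_of_dual₁ hy y.dual₁).2
      ((cof F x₀).eq_of_dual₂ hy y.dual₂).2]
    refine (mkFrame_congr ?_ _ hy _ _ _ _ _ _ h1).trans (mkFrame_frameCoord y hy h1)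
    rw [h1]
    exact (contactAtlas F).point_coord x₀ y.base hy
  smooth x₀ x₁ := by
    refine (contDiffOn_frameTransition F x₀ x₁).congr ?_
    rintro q ⟨_, h2, h3⟩
    have hpt := contactPoint_pt F h2.1 (mul_ne_zero h3.1 h3.2)
    rw [framePoint_eq F h2.1 h3.1 h3.2]
    refine (frameCoord_mkFrame' (x₁ := x₁) _ ?_ q.2 _).trans ?_
    · rw [hpt]
      exact h2.2
    · rw [hpt]

instance : TopologicalSpace (Frame F) := (frameAtlas F).core.toTopologicalSpace

instance : ChartedSpace (E3 × (Fin 5 → ℂ)) (Frame F) := (frameAtlas F).core.toChartedSpace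

instance : IsManifold 𝓘(ℝ, E3 × (Fin 5 → ℂ)) ∞ (Frame F) := (frameAtlas F).isManifold

end FrameManifold

/-! ### The Borel subgroup -/

section Borel

/-- `3 × 3` complex matrices. -/
abbrev Mat3 : Type := Matrix (Fin 3) (Fin 3) ℂ

lemma blockTriangular_iff (A : Mat3) :
    A.BlockTriangular id ↔ A 1 0 = 0 ∧ A 2 0 = 0 ∧ A 2 1 = 0 := by
  constructor
  · intro h
    exact ⟨h (by decide), h (by decide), h (by decide)⟩
  · rintro ⟨h1, h2, h3⟩ i j hij
    fin_cases i <;> fin_cases j <;> first | assumption | exact absurd hij (by decide)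

/-- The Borel subgroup of upper triangular matrices in `SL(3, ℂ)`. -/
def Borel : Subgroup (Matrix.SpecialLinearGroup (Fin 3) ℂ) where
  carrier := {h | (h : Mat3).BlockTriangular id}
  one_mem' := Matrix.blockTriangular_one
  mul_mem' {g h} hg hh := by
    rw [mem_ofPred_eq, Matrix.SpecialLinearGroup.coe_mul]
    exact Matrix.BlockTriangular.mul hg hh
  inv_mem' {g} hg := by
    rw [mem_ofPred_eq, blockTriangular_iff] at hg ⊢
    obtain ⟨h1, h2, h3⟩ := hg
    rw [Matrix.SpecialLinearGroup.coe_inv, Matrix.adjugate_fin_three]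
    simp [h1, h2, h3]

/-- The matrix of an element of the Borel subgroup. -/
abbrev borelMat (h : Borel) : Mat3 := (h : Matrix.SpecialLinearGroup (Fin 3) ℂ)

lemma borelMat_diag (h : Borel) : borelMat h 0 0 * borelMat h 1 1 * borelMat h 2 2 = 1 := by
  have h1 := Matrix.det_of_isUpperTriangular h.2
  rw [Fin.prod_univ_three, (h : Matrix.SpecialLinearGroup (Fin 3) ℂ).2] at h1
  exact h1.symm

lemma borelMat_ne_zero₀ (h : Borel) : borelMat h 0 0 ≠ 0 :=
  left_ne_zero_of_mul (left_ne_zero_of_mul ((borelMat_diag h).trans_ne one_ne_zero))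

lemma borelMat_ne_zero₂ (h : Borel) : borelMat h 2 2 ≠ 0 :=
  right_ne_zero_of_mul ((borelMat_diag h).trans_ne one_ne_zero)

/-- The Lie algebra of the Borel subgroup: traceless upper triangular matrices. -/
def borelAlgebra : Submodule ℂ Mat3 where
  carrier := {X | X.BlockTriangular id ∧ X.trace = 0}
  zero_mem' := ⟨Matrix.blockTriangular_zero, Matrix.trace_zero _ _⟩
  add_mem' hX hY := ⟨hX.1.add hY.1, by rw [Matrix.trace_add, hX.2, hY.2, add_zero]⟩
  smul_mem' c X hX := by
    rw [mem_ofPred_eq, blockTriangular_iff] at *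
    obtain ⟨⟨h1, h2, h3⟩, h4⟩ := hX
    exact ⟨by simp [h1, h2, h3], by rw [Matrix.trace_smul, h4, smul_zero]⟩

lemma pow_diag {X : Mat3} (hX : X.BlockTriangular id) (n : ℕ) (i : Fin 3) :
    (X ^ n) i i = X i i ^ n := by
  induction n with
  | zero => simp
  | succ n ih =>
    have hn : (X ^ n).BlockTriangular id := hX.pow n
    rw [blockTriangular_iff] at hX hn
    obtain ⟨a1, a2, a3⟩ := hX
    obtain ⟨b1, b2, b3⟩ := hn
    rw [pow_succ, pow_succ, ← ih, Matrix.mul_apply, Fin.sum_univ_three]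
    fin_cases i <;> simp [a1, a2, a3, b1, b2, b3]

lemma exp_diag {X : Mat3} (hX : X.BlockTriangular id) (i : Fin 3) :
    (NormedSpace.exp X) i i = Complex.exp (X i i) := by
  have h1 : HasSum (fun n : ℕ => ((n.factorial : ℂ)⁻¹ • X ^ n)) (NormedSpace.exp X) := by
    let _ : NormedRing Mat3 := Matrix.linftyOpNormedRing
    let _ : NormedAlgebra ℂ Mat3 := Matrix.linftyOpNormedAlgebra
    exact NormedSpace.exp_series_hasSum_exp' (𝕂 := ℂ) X
  have h2 : HasSum (fun n : ℕ => ((n.factorial : ℂ)⁻¹ • X ^ n) i i) (NormedSpace.exp X i i) :=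
    h1.map (AddMonoidHom.mk' (fun A : Mat3 => A i i) fun _ _ => rfl) (continuous_apply_apply i i)
  have h3 : HasSum (fun n : ℕ => ((n.factorial : ℂ)⁻¹ • X i i ^ n)) (NormedSpace.exp (X i i)) :=
    NormedSpace.exp_series_hasSum_exp' (𝕂 := ℂ) (X i i)
  rw [← Complex.exp_eq_exp_ℂ] at h3
  refine h2.unique ?_
  simpa [pow_diag hX] using h3

/-- The exponential map from the Lie algebra to the Borel subgroup. -/
def borelExp (X : borelAlgebra) : Borel :=
  ⟨⟨NormedSpace.exp (X : Mat3), by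
    have ht := X.2.2
    rw [Matrix.trace_fin_three] at ht
    rw [Matrix.det_of_isUpperTriangular X.2.1.exp, Fin.prod_univ_three, exp_diag X.2.1,
      exp_diag X.2.1, exp_diag X.2.1, ← Complex.exp_add, ← Complex.exp_add, ht, Complex.exp_zero]⟩,
    X.2.1.exp⟩

end Borel

/-! ### The action of the Borel subgroup on `Y` -/

section Action

variable {M : Type*} [TopologicalSpace M] [ChartedSpace E3 M] [IsManifold (𝓡 3) ∞ M]
  {F : FlagStructure M}

lemma lam_scale (x₀ : M) {μ : ℂ} (hμ : μ ≠ 0) (e : ContactForm F) :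
    lam x₀ (e.scale μ hμ) = μ * lam x₀ e := (cof F x₀).coef₀_smul _ _ _

lemma chart_scale {μ : ℂ} (hμ : μ ≠ 0) (e e' : ContactForm F) :
    chartAt (E3 × ℂ) e (e'.scale μ hμ) =
      ((chartAt (E3 × ℂ) e e').1, μ * (chartAt (E3 × ℂ) e e').2) :=
  Prod.ext rfl (lam_scale e.pt hμ e')

/-- The dilation of `E` in the preferred charts. -/
def dilation (μ : ℂ) : E3 × ℂ →L[ℝ] E3 × ℂ :=
  (ContinuousLinearMap.fst ℝ E3 ℂ).prod (μ • ContinuousLinearMap.snd ℝ E3 ℂ)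

lemma mdifferentiableAt_scale {μ : ℂ} (hμ : μ ≠ 0) (e : ContactForm F) :
    MDifferentiableAt 𝓘(ℝ, E3 × ℂ) 𝓘(ℝ, E3 × ℂ) (ContactForm.scale (F := F) μ hμ) e := by
  have hM : IsManifold 𝓘(ℝ, E3 × ℂ) 1 (ContactForm F) := IsManifold.of_le (n := ∞) (by simp)
  have h1 := mdifferentiableAt_atlas (I := 𝓘(ℝ, E3 × ℂ)) (chart_mem_atlas (E3 × ℂ) e)
    (mem_chart_source _ e)
  have hs : e.scale μ hμ ∈ (chartAt (E3 × ℂ) e).source := mem_chart_source (E3 × ℂ) (e.scale μ hμ)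
  have heq : chartAt (E3 × ℂ) e (e.scale μ hμ) = dilation μ (chartAt (E3 × ℂ) e e) :=
    chart_scale hμ e e
  have h2 := mdifferentiableAt_atlas_symm (I := 𝓘(ℝ, E3 × ℂ)) (chart_mem_atlas (E3 × ℂ) e)
    ((chartAt (E3 × ℂ) e).map_source hs)
  rw [heq] at h2
  have h3 : MDifferentiableAt 𝓘(ℝ, E3 × ℂ) 𝓘(ℝ, E3 × ℂ) (dilation μ) (chartAt (E3 × ℂ) e e) :=
    (dilation μ).differentiableAt.mdifferentiableAt
  refine ((h2.comp _ h3).comp e h1).congr_of_eventuallyEq ?_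
  filter_upwards [(chartAt (E3 × ℂ) e).open_source.mem_nhds (mem_chart_source _ e)] with e' he'
  have hs' : e'.scale μ hμ ∈ (chartAt (E3 × ℂ) e).source := he'
  refine ((chartAt (E3 × ℂ) e).left_inv hs').symm.trans ?_
  exact congrArg (chartAt (E3 × ℂ) e).symm (chart_scale hμ e e')

lemma mfderiv_scale {μ : ℂ} (hμ : μ ≠ 0) (e : ContactForm F) :
    (mfderiv 𝓘(ℝ, E3 × ℂ) 𝓘(ℝ, E3 × ℂ) (ContactForm.scale (F := F) μ hμ) e :
      E3 × ℂ →L[ℝ] E3 × ℂ) = dilation μ := by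
  refine (mdifferentiableAt_scale hμ e).mfderiv.trans ?_
  have : (writtenInExtChartAt 𝓘(ℝ, E3 × ℂ) 𝓘(ℝ, E3 × ℂ) e (ContactForm.scale (F := F) μ hμ))
      =ᶠ[𝓝 (chartAt (E3 × ℂ) e e)] dilation μ := by
    filter_upwards [(chartAt (E3 × ℂ) e).open_target.mem_nhds (mem_chart_target _ e)] with q hq
    have h := chart_scale hμ e ((chartAt (E3 × ℂ) e).symm q)
    rw [(chartAt (E3 × ℂ) e).right_inv hq] at h
    exact h
  rw [modelWithCornersSelf_coe, range_id, fderivWithin_univ]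
  exact (this.fderiv_eq).trans (dilation μ).fderiv

lemma dilation_inverse {μ : ℂ} (hμ : μ ≠ 0) : (dilation μ).inverse = dilation μ⁻¹ := by
  refine ContinuousLinearMap.inverse_eq ?_ ?_ <;> refine ContinuousLinearMap.ext fun v => ?_
  · exact Prod.ext rfl (mul_inv_cancel_left₀ hμ v.2)
  · exact Prod.ext rfl (inv_mul_cancel_left₀ hμ v.2)

/-- The inverse of the differential of the dilation `E → E`. -/
def scaleInv {μ : ℂ} (hμ : μ ≠ 0) (e : ContactForm F) :
    TangentSpace 𝓘(ℝ, E3 × ℂ) (e.scale μ hμ) →L[ℝ] TangentSpace 𝓘(ℝ, E3 × ℂ) e :=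
  (mfderiv 𝓘(ℝ, E3 × ℂ) 𝓘(ℝ, E3 × ℂ) (ContactForm.scale (F := F) μ hμ) e).inverse

lemma scaleInv_apply {μ : ℂ} (hμ : μ ≠ 0) (e : ContactForm F) (v : E3 × ℂ) :
    (scaleInv hμ e v : E3 × ℂ) = (v.1, μ⁻¹ * v.2) := by
  have h := (congrArg ContinuousLinearMap.inverse (mfderiv_scale hμ e)).trans (dilation_inverse hμ)
  exact congrArg (fun f : E3 × ℂ →L[ℝ] E3 × ℂ => f v) h

lemma tautE_apply (e : ContactForm F) (v : E3 × ℂ) : tautE F e v = e.θ v.1 :=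
  congrArg (e.θ : E3 →L[ℝ] ℂ) (dpt_apply e v)

/-- The exterior derivative of the tautological form is homogeneous. -/
lemma d_tautE_scale {μ : ℂ} (hμ : μ ≠ 0) (e : ContactForm F) (v w : E3 × ℂ) :
    d (tautE F) (e.scale μ hμ) v w = μ * d (tautE F) e (v.1, μ⁻¹ * v.2) (w.1, μ⁻¹ * w.2) := by
  have h1 := d_tautE (x₀ := e.pt) (e := e.scale μ hμ) (mem_cof F e.pt) v w
  have h2 := d_tautE (mem_cof F e.pt) (v.1, μ⁻¹ * v.2) (w.1, μ⁻¹ * w.2)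
  have h3 : dlam e.pt (e.scale μ hμ) = ContinuousLinearMap.snd ℝ E3 ℂ := dlam_self (e.scale μ hμ)
  rw [h3, lam_scale] at h1
  rw [dlam_self] at h2
  refine h1.trans (Eq.trans ?_ (congrArg (fun z : ℂ => μ * z) h2).symm)
  change v.2 * (cof F e.pt).θ e.pt w.1 - w.2 * (cof F e.pt).θ e.pt v.1 + μ * lam e.pt e *
    wedge ((cof F e.pt).θ₁ e.pt) ((cof F e.pt).θ₂ e.pt) v.1 w.1 =
    μ * (μ⁻¹ * v.2 * (cof F e.pt).θ e.pt w.1 - μ⁻¹ * w.2 * (cof F e.pt).θ e.pt v.1 + lam e.pt e *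
    wedge ((cof F e.pt).θ₁ e.pt) ((cof F e.pt).θ₂ e.pt) v.1 w.1)
  field_simp

lemma structure_eq_scale {μ : ℂ} (hμ : μ ≠ 0) (e : ContactForm F)
    (η₁ η₂ : TangentSpace (𝓡 3) e.pt →L[ℝ] ℂ) (ψ : TangentSpace 𝓘(ℝ, E3 × ℂ) e →L[ℝ] ℂ)
    (H : ∀ v w, μ * d (tautE F) e v w =
      wedge (η₁.comp (dpt F e)) (η₂.comp (dpt F e)) v w + μ * wedge (tautE F e) ψ v w)
    (v w : E3 × ℂ) : d (tautE F) (e.scale μ hμ) v w =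
      wedge (ContinuousLinearMap.comp (M₂ := TangentSpace (𝓡 3) (e.scale μ hμ).pt) η₁
        (dpt F (e.scale μ hμ))) (ContinuousLinearMap.comp
          (M₂ := TangentSpace (𝓡 3) (e.scale μ hμ).pt) η₂ (dpt F (e.scale μ hμ))) v w
      + wedge (tautE F (e.scale μ hμ)) (ψ.comp (scaleInv hμ e)) v w := by
  refine (d_tautE_scale hμ e v w).trans ((H _ _).trans ?_)
  have h1 : ∀ (η : E3 →L[ℝ] ℂ) (v : E3 × ℂ), η (dpt F e (v.1, μ⁻¹ * v.2) : E3) =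
      η (dpt F (e.scale μ hμ) v : E3) := fun η v =>
    congrArg η ((dpt_apply e _).trans (dpt_apply (e.scale μ hμ) v).symm)
  have h2 : ∀ v : E3 × ℂ, tautE F (e.scale μ hμ) v = μ * tautE F e (v.1, μ⁻¹ * v.2) := fun v =>
    (tautE_apply (e.scale μ hμ) v).trans
      (congrArg (fun z : ℂ => μ * z) (tautE_apply e (v.1, μ⁻¹ * v.2)).symm)
  have h3 : ∀ v : E3 × ℂ, ψ (scaleInv hμ e v) = ψ (v.1, μ⁻¹ * v.2) := fun v =>
    congrArg (ψ : E3 × ℂ →L[ℝ] ℂ) (scaleInv_apply hμ e v)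
  have q1 : wedge (η₁.comp (dpt F e)) (η₂.comp (dpt F e)) (v.1, μ⁻¹ * v.2) (w.1, μ⁻¹ * w.2) =
      wedge (ContinuousLinearMap.comp (M₂ := TangentSpace (𝓡 3) (e.scale μ hμ).pt) η₁
        (dpt F (e.scale μ hμ))) (ContinuousLinearMap.comp
          (M₂ := TangentSpace (𝓡 3) (e.scale μ hμ).pt) η₂ (dpt F (e.scale μ hμ))) v w :=
    congrArg₂ (fun z z' : ℂ => z - z')
      (congrArg₂ (fun z z' : ℂ => z * z') (h1 η₁ v) (h1 η₂ w))
      (congrArg₂ (fun z z' : ℂ => z * z') (h1 η₁ w) (h1 η₂ v))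
  have q2 : wedge (tautE F (e.scale μ hμ)) (ψ.comp (scaleInv hμ e)) v w =
      μ * tautE F e (v.1, μ⁻¹ * v.2) * ψ (w.1, μ⁻¹ * w.2) -
        μ * tautE F e (w.1, μ⁻¹ * w.2) * ψ (v.1, μ⁻¹ * v.2) :=
    congrArg₂ (fun z z' : ℂ => z - z')
      (congrArg₂ (fun z z' : ℂ => z * z') (h2 v) (h3 w))
      (congrArg₂ (fun z z' : ℂ => z * z') (h2 w) (h3 v))
  have q3 : wedge (tautE F e) ψ (v.1, μ⁻¹ * v.2) (w.1, μ⁻¹ * w.2) =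
      tautE F e (v.1, μ⁻¹ * v.2) * ψ (w.1, μ⁻¹ * w.2) -
        tautE F e (w.1, μ⁻¹ * w.2) * ψ (v.1, μ⁻¹ * v.2) := rfl
  rw [← q1, q2, q3]
  ring

/-- The new `η₁ = a²b η₁ - 2a²d θ` in the action of the Borel subgroup, for `h` with rows
`(a, c, e)`, `(0, 1/(ab), d)`, `(0, 0, b)`. -/
def Frame.newη₁ (y : Frame F) (h : Borel) : TangentSpace (𝓡 3) y.base.pt →L[ℝ] ℂ :=
  (borelMat h 0 0 ^ 2 * borelMat h 2 2) • y.η₁ - (2 * borelMat h 0 0 ^ 2 * borelMat h 1 2) • y.base.θ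

/-- The new `η₂ = η₂/(ab²) + (c/b) θ`. -/
def Frame.newη₂ (y : Frame F) (h : Borel) : TangentSpace (𝓡 3) y.base.pt →L[ℝ] ℂ :=
  (1 / (borelMat h 0 0 * borelMat h 2 2 ^ 2)) • y.η₂ + (borelMat h 0 1 / borelMat h 2 2) • y.base.θ

/-- The new `φ = φ + abc ω¹ + (2d/b) ω² + (4e/b - 2acd) ω`. -/
def Frame.newφ (y : Frame F) (h : Borel) : TangentSpace 𝓘(ℝ, E3 × ℂ) y.base →L[ℝ] ℂ :=
  y.φ + (borelMat h 0 0 * borelMat h 2 2 * borelMat h 0 1) • y.η₁.comp (dpt F y.base)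
    + (2 * borelMat h 1 2 / borelMat h 2 2) • y.η₂.comp (dpt F y.base)
    + (4 * borelMat h 0 2 / borelMat h 2 2
        - 2 * borelMat h 0 0 * borelMat h 0 1 * borelMat h 1 2) • tautE F y.base

lemma Frame.cext_newη₁ (y : Frame F) (h : Borel) (z : CTangent y.base.pt) :
    cext (y.newη₁ h) z = borelMat h 0 0 ^ 2 * borelMat h 2 2 * cext y.η₁ z
      - 2 * borelMat h 0 0 ^ 2 * borelMat h 1 2 * cext y.base.θ z := by
  rw [Frame.newη₁, eq_sub_iff_add_eq, ← cext_smul, ← cext_smul, ← cext_add, sub_add_cancel]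

lemma Frame.cext_newη₂ (y : Frame F) (h : Borel) (z : CTangent y.base.pt) :
    cext (y.newη₂ h) z = 1 / (borelMat h 0 0 * borelMat h 2 2 ^ 2) * cext y.η₂ z
      + borelMat h 0 1 / borelMat h 2 2 * cext y.base.θ z := by
  rw [Frame.newη₂, cext_add, cext_smul, cext_smul]

lemma Frame.dual_newη₁ (y : Frame F) (h : Borel) :
    IsDualTo (F.T₁ y.base.pt) (F.T₂ y.base.pt) (y.newη₁ h) := by
  refine ⟨fun z hz => ?_, fun z hz hne => ?_⟩
  · rw [y.cext_newη₁, y.dual₁.1 z hz, cext_eq_zero_of_mem y.base.ker_θ (Or.inr hz), mul_zero,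
      mul_zero, sub_zero]
  · rw [y.cext_newη₁, cext_eq_zero_of_mem y.base.ker_θ (Or.inl hz), mul_zero, sub_zero]
    exact mul_ne_zero (mul_ne_zero (pow_ne_zero 2 (borelMat_ne_zero₀ h)) (borelMat_ne_zero₂ h))
      (y.dual₁.2 z hz hne)

lemma Frame.dual_newη₂ (y : Frame F) (h : Borel) :
    IsDualTo (F.T₂ y.base.pt) (F.T₁ y.base.pt) (y.newη₂ h) := by
  refine ⟨fun z hz => ?_, fun z hz hne => ?_⟩
  · rw [y.cext_newη₂, y.dual₂.1 z hz, cext_eq_zero_of_mem y.base.ker_θ (Or.inl hz), mul_zero,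
      mul_zero, add_zero]
  · rw [y.cext_newη₂, cext_eq_zero_of_mem y.base.ker_θ (Or.inr hz), mul_zero, add_zero]
    exact mul_ne_zero (one_div_ne_zero (mul_ne_zero (borelMat_ne_zero₀ h)
      (pow_ne_zero 2 (borelMat_ne_zero₂ h)))) (y.dual₂.2 z hz hne)

lemma Frame.structure_eq_new (y : Frame F) (h : Borel) (v w : E3 × ℂ) :
    borelMat h 0 0 / borelMat h 2 2 * d (tautE F) y.base v w =
      wedge ((y.newη₁ h).comp (dpt F y.base)) ((y.newη₂ h).comp (dpt F y.base)) v w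
        + borelMat h 0 0 / borelMat h 2 2 * wedge (tautE F y.base) (y.newφ h) v w := by
  have ha := borelMat_ne_zero₀ h
  have hb := borelMat_ne_zero₂ h
  have H : d (tautE F) y.base v w = (y.η₁ (dpt F y.base v) * y.η₂ (dpt F y.base w)
      - y.η₁ (dpt F y.base w) * y.η₂ (dpt F y.base v))
      + (y.base.θ (dpt F y.base v) * y.φ w - y.base.θ (dpt F y.base w) * y.φ v) :=
    y.structure_eq v w
  have h1 : ∀ u, y.newη₁ h u = borelMat h 0 0 ^ 2 * borelMat h 2 2 * y.η₁ u
      - 2 * borelMat h 0 0 ^ 2 * borelMat h 1 2 * y.base.θ u := fun _ => rfl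
  have h2 : ∀ u, y.newη₂ h u = 1 / (borelMat h 0 0 * borelMat h 2 2 ^ 2) * y.η₂ u
      + borelMat h 0 1 / borelMat h 2 2 * y.base.θ u := fun _ => rfl
  have h3 : ∀ v : E3 × ℂ, y.newφ h v = y.φ v
      + borelMat h 0 0 * borelMat h 2 2 * borelMat h 0 1 * y.η₁ (dpt F y.base v)
      + 2 * borelMat h 1 2 / borelMat h 2 2 * y.η₂ (dpt F y.base v)
      + (4 * borelMat h 0 2 / borelMat h 2 2
        - 2 * borelMat h 0 0 * borelMat h 0 1 * borelMat h 1 2) * y.base.θ (dpt F y.base v) :=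
    fun _ => rfl
  change _ = (y.newη₁ h (dpt F y.base v) * y.newη₂ h (dpt F y.base w)
      - y.newη₁ h (dpt F y.base w) * y.newη₂ h (dpt F y.base v)) + borelMat h 0 0 / borelMat h 2 2 *
      (y.base.θ (dpt F y.base v) * y.newφ h w - y.base.θ (dpt F y.base w) * y.newφ h v)
  rw [H, h1, h1, h2, h2, h3, h3]
  field_simp
  ring

/-- The right action of the Borel subgroup on `Y`: the coframe `(ω, ω¹, ω², φ)` is replaced by
`((a/b) ω, a²b ω¹ - 2a²d ω, ω²/(ab²) + (c/b) ω, φ + abc ω¹ + (2d/b) ω² + (4e/b - 2acd) ω)`, moved to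
the point `(a/b) e` of `E` by the dilation. -/
def act (h : Borel) (y : Frame F) : Frame F where
  base := y.base.scale (borelMat h 0 0 / borelMat h 2 2)
    (div_ne_zero (borelMat_ne_zero₀ h) (borelMat_ne_zero₂ h))
  η₁ := y.newη₁ h
  η₂ := y.newη₂ h
  φ := (y.newφ h).comp (scaleInv (div_ne_zero (borelMat_ne_zero₀ h) (borelMat_ne_zero₂ h)) y.base)
  dual₁ := y.dual_newη₁ h
  dual₂ := y.dual_newη₂ h
  structure_eq := structure_eq_scale _ _ _ _ _ (y.structure_eq_new h)

end Action

/-! ### Tautological forms, connection forms and curvature on `Y` -/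

section Cartan

variable {M : Type*} [TopologicalSpace M] [ChartedSpace E3 M] [IsManifold (𝓡 3) ∞ M]
  (F : FlagStructure M)

/-- The model space of `Y`. -/
abbrev EY : Type := E3 × (Fin 5 → ℂ)

/-- Complex 1-forms on `Y`. -/
abbrev YForm : Type _ := OneForm EY (Frame F)

/-- The differential of the projection `Y → E`. -/
def dbase (y : Frame F) : TangentSpace 𝓘(ℝ, EY) y →L[ℝ] TangentSpace 𝓘(ℝ, E3 × ℂ) y.base :=
  mfderiv 𝓘(ℝ, EY) 𝓘(ℝ, E3 × ℂ) (Frame.base (F := F)) y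

variable {F} in
/-- The projection `Y → E` is smooth. -/
lemma contMDiff_base : ContMDiff 𝓘(ℝ, EY) 𝓘(ℝ, E3 × ℂ) ∞ (Frame.base (F := F)) := by
  intro y
  have h1 : ContMDiffAt 𝓘(ℝ, EY) 𝓘(ℝ, EY) ∞ (chartAt EY y) y :=
    contMDiffAt_of_mem_maximalAtlas (IsManifold.chart_mem_maximalAtlas y) (mem_chart_source _ y)
  let f : EY → E3 × ℂ := fun q => (q.1, q.2 0 * q.2 1)
  have hf : ContDiff ℝ ∞ f := contDiff_fst.prodMk
    (((contDiff_apply ℝ ℂ 0).comp contDiff_snd).mul ((contDiff_apply ℝ ℂ 1).comp contDiff_snd))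
  have hc : ∀ y' : Frame F, y' ∈ (chartAt EY y).source →
      f (chartAt EY y y') = chartAt (E3 × ℂ) y.base y'.base := fun y' hy' =>
    Prod.ext rfl (y'.relations hy'.2).1
  have h2 : ContMDiffAt 𝓘(ℝ, EY) 𝓘(ℝ, E3 × ℂ) ∞ f (chartAt EY y y) := hf.contMDiff _
  have h3 : ContMDiffAt 𝓘(ℝ, E3 × ℂ) 𝓘(ℝ, E3 × ℂ) ∞ (chartAt (E3 × ℂ) y.base).symm
      (f (chartAt EY y y)) := by
    rw [hc y (mem_chart_source _ y)]
    exact contMDiffAt_symm_of_mem_maximalAtlas (IsManifold.chart_mem_maximalAtlas _)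
      (mem_chart_target _ _)
  refine ((h3.comp _ h2).comp y h1).congr_of_eventuallyEq ?_
  filter_upwards [(chartAt EY y).open_source.mem_nhds (mem_chart_source EY y)] with y' hy'
  have hs : y'.base ∈ (chartAt (E3 × ℂ) y.base).source := hy'
  refine ((chartAt (E3 × ℂ) y.base).left_inv hs).symm.trans ?_
  exact congrArg (chartAt (E3 × ℂ) y.base).symm (hc y' hy').symm

/-- The tautological form `ω` on `Y`. -/
def ω₀ : YForm F := fun y => (tautE F y.base).comp (dbase F y)

/-- The tautological form `ω¹` on `Y`. -/
def ω₁ : YForm F := fun y => (y.η₁.comp (dpt F y.base)).comp (dbase F y)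

/-- The tautological form `ω²` on `Y`. -/
def ω₂ : YForm F := fun y => (y.η₂.comp (dpt F y.base)).comp (dbase F y)

/-- The tautological form `φ` on `Y`. -/
def φ : YForm F := fun y => y.φ.comp (dbase F y)

/-- Four 1-forms `ω₁¹`, `φ¹`, `φ²`, `ψ` on `Y`. -/
@[ext]
structure ConnectionForms where
  ω₁₁ : YForm F
  φ₁ : YForm F
  φ₂ : YForm F
  ψ : YForm F

namespace ConnectionForms

variable {F} (Γ : ConnectionForms F)

/-- `Ω₁¹ = dω₁¹ - (3/2) ω² ∧ φ¹ - (3/2) ω¹ ∧ φ²`. -/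
def Ω₁₁ : TwoForm EY (Frame F) :=
  d Γ.ω₁₁ - (3 / 2 : ℂ) • (ω₂ F ∧ᶠ Γ.φ₁) - (3 / 2 : ℂ) • (ω₁ F ∧ᶠ Γ.φ₂)

/-- `Φ¹ = dφ¹ - φ¹ ∧ ω₁¹ - (1/2) ω¹ ∧ ψ - (1/2) φ ∧ φ¹`. -/
def Φ₁ : TwoForm EY (Frame F) :=
  d Γ.φ₁ - Γ.φ₁ ∧ᶠ Γ.ω₁₁ - (1 / 2 : ℂ) • (ω₁ F ∧ᶠ Γ.ψ) - (1 / 2 : ℂ) • (φ F ∧ᶠ Γ.φ₁)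

/-- `Φ² = dφ² + φ² ∧ ω₁¹ - (1/2) ω² ∧ ψ - (1/2) φ ∧ φ²`. -/
def Φ₂ : TwoForm EY (Frame F) :=
  d Γ.φ₂ + Γ.φ₂ ∧ᶠ Γ.ω₁₁ - (1 / 2 : ℂ) • (ω₂ F ∧ᶠ Γ.ψ) - (1 / 2 : ℂ) • (φ F ∧ᶠ Γ.φ₂)

/-- `Ψ = dψ - 2 φ¹ ∧ φ² - φ ∧ ψ`. -/
def Ψ : TwoForm EY (Frame F) :=
  d Γ.ψ - (2 : ℂ) • (Γ.φ₁ ∧ᶠ Γ.φ₂) - φ F ∧ᶠ Γ.ψ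

/-- The tangent vectors annihilated by `φ`, `ω₁¹`, `φ¹`, `φ²`, `ψ`. -/
def horizontal (y : Frame F) : Submodule ℝ (TangentSpace 𝓘(ℝ, EY) y) :=
  LinearMap.ker (φ F y).toLinearMap ⊓ LinearMap.ker (Γ.ω₁₁ y).toLinearMap ⊓
    LinearMap.ker (Γ.φ₁ y).toLinearMap ⊓ LinearMap.ker (Γ.φ₂ y).toLinearMap ⊓
    LinearMap.ker (Γ.ψ y).toLinearMap

/-- `p`, `q`, `r` are the coefficients of `ω ∧ ω¹`, `ω ∧ ω²`, `ω¹ ∧ ω²` in the 2-form `Θ`. As `ω`,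
`ω¹`, `ω²` together with `φ`, `ω₁¹`, `φ¹`, `φ²`, `ψ` and their conjugates span the complex covectors
on `Y`, these coefficients are read off on the vectors annihilated by the latter forms. -/
def HorizontalTerms (Θ : TwoForm EY (Frame F)) (p q r : Frame F → ℂ) : Prop :=
  ∀ y, ∀ v ∈ Γ.horizontal y, ∀ w ∈ Γ.horizontal y, Θ y v w =
    p y * (ω₀ F ∧ᶠ ω₁ F) y v w + q y * (ω₀ F ∧ᶠ ω₂ F) y v w + r y * (ω₁ F ∧ᶠ ω₂ F) y v w

/-- The canonical normalization of the forms `ω₁¹`, `φ¹`, `φ²`, `ψ`: the structure equations for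
`dω¹`, `dω²`, `dφ` hold, `Ω₁¹` is a multiple `ω ∧ λ` of `ω` without terms `ω ∧ ω¹`, `ω ∧ ω²`, and `Φ¹`
has no term `ω ∧ ω¹`. -/
structure IsCanonical : Prop where
  smooth_ω₁₁ : Γ.ω₁₁.SmoothOn univ
  smooth_φ₁ : Γ.φ₁.SmoothOn univ
  smooth_φ₂ : Γ.φ₂.SmoothOn univ
  smooth_ψ : Γ.ψ.SmoothOn univ
  d_ω₁ : d (ω₁ F) = (1 / 2 : ℂ) • (ω₁ F ∧ᶠ φ F) + ω₁ F ∧ᶠ Γ.ω₁₁ + ω₀ F ∧ᶠ Γ.φ₁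
  d_ω₂ : d (ω₂ F) = (1 / 2 : ℂ) • (ω₂ F ∧ᶠ φ F) - ω₂ F ∧ᶠ Γ.ω₁₁ + ω₀ F ∧ᶠ Γ.φ₂
  d_φ : d (φ F) = ω₁ F ∧ᶠ Γ.φ₂ - ω₂ F ∧ᶠ Γ.φ₁ + ω₀ F ∧ᶠ Γ.ψ
  Ω₁₁_eq : ∃ lam : YForm F, Γ.Ω₁₁ = ω₀ F ∧ᶠ lam
  Ω₁₁_terms : ∃ r, Γ.HorizontalTerms Γ.Ω₁₁ 0 0 r
  Φ₁_terms : ∃ q r, Γ.HorizontalTerms Γ.Φ₁ 0 q r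

/-- The matrix of 1-forms `π`. -/
def cartanForm : Matrix (Fin 3) (Fin 3) (YForm F) :=
  !![-((1 / 2 : ℂ) • φ F) - (1 / 3 : ℂ) • Γ.ω₁₁, -Γ.φ₂, -((1 / 4 : ℂ) • Γ.ψ);
    ω₁ F, (2 / 3 : ℂ) • Γ.ω₁₁, (1 / 2 : ℂ) • Γ.φ₁;
    (2 : ℂ) • ω₀ F, (2 : ℂ) • ω₂ F, (1 / 2 : ℂ) • φ F - (1 / 3 : ℂ) • Γ.ω₁₁]

end ConnectionForms

variable {F}

/-- The value of a matrix of 1-forms on a tangent vector. -/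
def evalMat (π : Matrix (Fin 3) (Fin 3) (YForm F)) (y : Frame F) (v : TangentSpace 𝓘(ℝ, EY) y) :
    Mat3 := Matrix.of fun i j => π i j y v

/-- The curvature `dπ + π ∧ π`. -/
def curvature (π : Matrix (Fin 3) (Fin 3) (YForm F)) :
    Matrix (Fin 3) (Fin 3) (TwoForm EY (Frame F)) :=
  Matrix.of fun i j => d (π i j) + ∑ k, π i k ∧ᶠ π k j

/-- The curve `t ↦ y e^{tX}` in `Y`, for `X` in the Lie algebra of the Borel subgroup. -/
def orbit (X : borelAlgebra) (y : Frame F) (t : ℝ) : Frame F := act (borelExp ((t : ℂ) • X)) y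

lemma Frame.ext_of_eq {y y' : Frame F} (hp : y.base.pt = y'.base.pt)
    (hθ : (y.base.θ : E3 →L[ℝ] ℂ) = y'.base.θ) (h1 : (y.η₁ : E3 →L[ℝ] ℂ) = y'.η₁)
    (h2 : (y.η₂ : E3 →L[ℝ] ℂ) = y'.η₂) (h3 : (y.φ : E3 × ℂ →L[ℝ] ℂ) = y'.φ) : y = y' := by
  obtain ⟨⟨p, θ, hk⟩, η₁, η₂, φ, a, b, c⟩ := y
  obtain ⟨⟨p', θ', hk'⟩, η₁', η₂', φ', a', b', c'⟩ := y'
  dsimp at hp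
  subst hp
  change θ = θ' at hθ
  subst hθ
  change η₁ = η₁' at h1
  change η₂ = η₂' at h2
  change φ = φ' at h3
  subst h1 h2 h3
  rfl

lemma act_one (y : Frame F) : act 1 y = y := by
  have hm : borelMat 1 = 1 := rfl
  have h1 : ∀ v, y.newη₁ 1 v = borelMat 1 0 0 ^ 2 * borelMat 1 2 2 * y.η₁ v
      - 2 * borelMat 1 0 0 ^ 2 * borelMat 1 1 2 * y.base.θ v := fun _ => rfl
  have h2 : ∀ v, y.newη₂ 1 v = 1 / (borelMat 1 0 0 * borelMat 1 2 2 ^ 2) * y.η₂ v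
      + borelMat 1 0 1 / borelMat 1 2 2 * y.base.θ v := fun _ => rfl
  have h3 : ∀ v : E3 × ℂ, y.newφ 1 v = y.φ v
      + borelMat 1 0 0 * borelMat 1 2 2 * borelMat 1 0 1 * y.η₁ (dpt F y.base v)
      + 2 * borelMat 1 1 2 / borelMat 1 2 2 * y.η₂ (dpt F y.base v)
      + (4 * borelMat 1 0 2 / borelMat 1 2 2
        - 2 * borelMat 1 0 0 * borelMat 1 0 1 * borelMat 1 1 2) * y.base.θ (dpt F y.base v) :=
    fun _ => rfl
  have h4 : ∀ (hμ : borelMat 1 0 0 / borelMat 1 2 2 ≠ 0) (v : E3 × ℂ),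
      (scaleInv hμ y.base v : E3 × ℂ) = v := fun hμ v =>
    (scaleInv_apply hμ y.base v).trans (Prod.ext rfl (by simp [hm]))
  refine Frame.ext_of_eq rfl ?_ ?_ ?_ ?_ <;> refine ContinuousLinearMap.ext fun v => ?_
  · change borelMat 1 0 0 / borelMat 1 2 2 * y.base.θ v = y.base.θ v
    simp [hm]
  · refine (h1 v).trans ?_
    simp [hm]
    rfl
  · refine (h2 v).trans ?_
    simp [hm]
    rfl
  · refine (congrArg (y.newφ 1 : E3 × ℂ →L[ℝ] ℂ) (h4 _ v)).trans ((h3 v).trans ?_)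
    simp [hm]
    rfl

/-- The curve `t ↦ y e^{tX}` starts at `y`. -/
lemma orbit_zero (X : borelAlgebra) (y : Frame F) : orbit X y 0 = y := by
  have : borelExp (((0 : ℝ) : ℂ) • X) = 1 := by
    apply Subtype.ext
    apply Subtype.ext
    change NormedSpace.exp ((((0 : ℝ) : ℂ) • X : borelAlgebra) : Mat3) = 1
    simp
  rw [orbit, this, act_one]

/-- Generalized Cartan connections on `Y → M`: smooth 1-forms `π` with values in `sl(3, ℂ)` such that
`π` is injective on each tangent space, `π(X^*) = X` for the fundamental vertical fields
`X^*(y) = d/dt y e^{tX}` at `t = 0`, and `(R_h)^* π = h⁻¹ π h` for `h` in the Borel subgroup. -/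
structure IsCartanConnection (π : Matrix (Fin 3) (Fin 3) (YForm F)) : Prop where
  smooth : ∀ i j, (π i j).SmoothOn univ
  mem_sl : ∀ y v, evalMat π y v ∈ LieAlgebra.SpecialLinear.sl (Fin 3) ℂ
  injective : ∀ y, Function.Injective (evalMat π y)
  fundamental : ∀ (X : borelAlgebra) (y : Frame F), evalMat π (orbit X y 0)
    (mfderiv 𝓘(ℝ, ℝ) 𝓘(ℝ, EY) (orbit X y) 0 (1 : ℝ)) = X
  equivariant : ∀ (h : Borel) (y : Frame F) (v : TangentSpace 𝓘(ℝ, EY) y),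
    evalMat π (act h y) (mfderiv 𝓘(ℝ, EY) 𝓘(ℝ, EY) (act h) y v) =
      borelMat h⁻¹ * evalMat π y v * borelMat h

end Cartan

end FlagGeometry

end

open FlagGeometry

noncomputable section

namespace FlagGeometry

/-! ### Calculus of complex-valued forms on normed spaces -/

section FlatForms

variable {V V' : Type*} [NormedAddCommGroup V] [NormedSpace ℝ V] [NormedAddCommGroup V']
  [NormedSpace ℝ V']

/-! The statement is local on `M` except for the gluing of the four forms, and gluing follows from
uniqueness. Near a point a contact form `t` is completed to a coframe with `dt = t₁ ∧ t₂`. This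
gives fibre coordinates `k 0, …, k 4` on `Y` in which `ω = k₀k₁ t`, `ω¹ = k₂k₀k₁ t + k₀ t₁`, `ω² =
k₃k₀k₁ t + k₁ t₂`, and `φ` is minus the logarithmic differential of `k₀k₁` plus a form on the base.
The coframe itself is the local section with coordinates `(1, 1, 0, 0, 0)`, and `φ` vanishes along
it.

Existence on the base (`exists_baseConnection`): along this section the equations for `dω¹`, `dω²`,
`dφ` determine the connection forms up to four functions. The vanishing of the three components of
`Ω₁¹` fixes three of these functions, and the missing `ω ∧ ω¹` term of `Φ¹` fixes the last one. The
identities `d² = 0` then remove all curvature components except the four that remain in the theorem.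

Existence on `Y` (`curv_gaugeForm`, `flat_solves`): if `h` in the Borel group moves the section to
the point with coordinates `k`, a Cartan connection must equal `h⁻¹ A h + h⁻¹ dh`, where `A` is the
connection matrix on the base. Only the multiple `a⁻¹ h` of `h` with upper left entry `1` is a
rational function of `k`, so `hmat` is this multiple and the closed scalar form `traceForm` restores
the trace. Gauge transformations conjugate the curvature, which stays strictly upper triangular, and
its entries are exactly the defects of the structure equations (`curv_cartanMat`). The entries
containing tautological forms come out right, and the other entries define the required forms.

Uniqueness (`canonical_unique`): by Cartan's lemma two systems satisfying (2) and (3) differ by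
terms with coefficients `D, E, F, G`. The condition `Ω₁¹ = ω ∧ λ` gives `D = 0`, the missing terms
of `Ω₁¹` give `E = F = 0`, and the missing term of `Φ¹` gives `G = 0`. Hence a canonical system has
a prescribed expression in every chart (`IsFlat`), and the local solutions agree on overlaps.

The Cartan axioms are then read off in coordinates. The group acts by right multiplication on
`hmat`, up to the scalar that keeps the corner entry equal to `1` (`hmat_fibreAct`). This yields
equivariance and the values on fundamental fields. Injectivity holds because the first two columns
detect the base directions, and `hmat` detects the fibre coordinates. -/

/-- The exterior derivative of a 1-form on a normed space. -/
def extD (α : V → V →L[ℝ] ℂ) (u v w : V) : ℂ := fderiv ℝ α u v w - fderiv ℝ α u w v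

/-- The wedge product of a 2-form and a 1-form. -/
def wedge₃ {T : Type*} (Θ : T → T → ℂ) (γ : T → ℂ) (a b c : T) : ℂ :=
  -- For antisymmetric `Θ` the cyclic sum is already alternating, so no further permutations or
  -- factors are needed.
  Θ a b * γ c + Θ b c * γ a + Θ c a * γ b

lemma extD_congr {α β : V → V →L[ℝ] ℂ} {u : V} (h : α =ᶠ[𝓝 u] β) : extD α u = extD β u := by
  funext v w
  simp only [extD, h.fderiv_eq]

lemma extD_congr_on {α β : V → V →L[ℝ] ℂ} {S : Set V} (hS : IsOpen S) (h : EqOn α β S) {u : V}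
    (hu : u ∈ S) : extD α u = extD β u :=
  extD_congr (h.eventuallyEq_of_mem (hS.mem_nhds hu))

lemma extD_add {α β : V → V →L[ℝ] ℂ} {u : V} (hα : DifferentiableAt ℝ α u)
    (hβ : DifferentiableAt ℝ β u) (v w : V) :
    extD (fun q => α q + β q) u v w = extD α u v w + extD β u v w := by
  have : fderiv ℝ (fun q => α q + β q) u = _ := fderiv_add hα hβ
  simp only [extD, this, add_apply]
  ring

lemma extD_sub {α β : V → V →L[ℝ] ℂ} {u : V} (hα : DifferentiableAt ℝ α u)
    (hβ : DifferentiableAt ℝ β u) (v w : V) :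
    extD (fun q => α q - β q) u v w = extD α u v w - extD β u v w := by
  have : fderiv ℝ (fun q => α q - β q) u = _ := fderiv_sub hα hβ
  simp only [extD, this, sub_apply]
  ring

lemma extD_smul {f : V → ℂ} {α : V → V →L[ℝ] ℂ} {u : V} (hf : DifferentiableAt ℝ f u)
    (hα : DifferentiableAt ℝ α u) (v w : V) :
    extD (fun q => f q • α q) u v w =
      fderiv ℝ f u v * α u w - fderiv ℝ f u w * α u v + f u * extD α u v w := by
  have : fderiv ℝ (fun q => f q • α q) u = _ := (hf.hasFDerivAt.smul hα.hasFDerivAt).fderiv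
  simp only [extD, this, add_apply, smul_apply, ContinuousLinearMap.smulRight_apply, smul_eq_mul]
  ring

lemma extD_const_smul (c : ℂ) {α : V → V →L[ℝ] ℂ} {u : V} (hα : DifferentiableAt ℝ α u) (v w : V) :
    extD (fun q => c • α q) u v w = c * extD α u v w := by
  rw [extD_smul (differentiableAt_const c) hα]
  simp

lemma extD_neg {α : V → V →L[ℝ] ℂ} {u : V} (v w : V) :
    extD (fun q => -α q) u v w = -extD α u v w := by
  have : fderiv ℝ (fun q => -α q) u = _ := fderiv_neg
  simp only [extD, this, neg_apply]
  ring

/-- Linear pull-back commutes with the exterior derivative. -/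
lemma extD_comp {α : V' → V' →L[ℝ] ℂ} (L : V →L[ℝ] V') {u : V} (hα : DifferentiableAt ℝ α (L u))
    (v w : V) : extD (fun q => (α (L q)).comp L) u v w = extD α (L u) (L v) (L w) := by
  have h1 : HasFDerivAt (fun q => α (L q)) ((fderiv ℝ α (L u)).comp L) u :=
    hα.hasFDerivAt.comp u L.hasFDerivAt
  have h2 := (h1.clm_comp (hasFDerivAt_const L u)).fderiv
  simp [extD, h2]

lemma fderiv_form_apply {α : V → V →L[ℝ] ℂ} {u : V} (hα : DifferentiableAt ℝ α u) (v w : V) :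
    fderiv ℝ (fun q => α q w) u v = fderiv ℝ α u v w := by
  have := (hα.hasFDerivAt.clm_apply (hasFDerivAt_const w u)).fderiv
  simp [this]

lemma differentiableAt_form_apply {α : V → V →L[ℝ] ℂ} {u : V} (hα : DifferentiableAt ℝ α u)
    (w : V) : DifferentiableAt ℝ (fun q => α q w) u :=
  (hα.hasFDerivAt.clm_apply (hasFDerivAt_const w u)).differentiableAt

/-! ### Exterior derivatives of 2-forms and the identity `d² = 0` -/

/-- The exterior derivative of the 2-form `Θ`. -/
def extD₂ (Θ : V → V → V → ℂ) (u a b c : V) : ℂ :=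
  fderiv ℝ (fun q => Θ q a b) u c + fderiv ℝ (fun q => Θ q b c) u a + fderiv ℝ (fun q => Θ q c a) u b

/-- This is `d² = 0`: the six second derivatives of `α` cancel in pairs because the two directions
of differentiation commute. -/
lemma extD₂_extD {α : V → V →L[ℝ] ℂ} {u : V} (hα : ContDiffAt ℝ ∞ α u) (a b c : V) :
    extD₂ (extD α) u a b c = 0 := by
  have h2 : DifferentiableAt ℝ (fderiv ℝ α) u :=
    (hα.fderiv_right (m := 1) (by norm_cast)).differentiableAt (by simp)
  have hs : ∀ v w, fderiv ℝ (fderiv ℝ α) u v w = fderiv ℝ (fderiv ℝ α) u w v := fun v w =>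
    (hα.isSymmSndFDerivAt (by
      simpa using (WithTop.coe_le_coe.2 (le_top : (2 : ℕ∞) ≤ ⊤)))).eq v w
  have h : ∀ a b c, fderiv ℝ (fun q => extD α q a b) u c =
      fderiv ℝ (fderiv ℝ α) u c a b - fderiv ℝ (fderiv ℝ α) u c b a := by
    intro a b c
    have e : ∀ a b, HasFDerivAt (fun q => fderiv ℝ α q a b) _ u := fun a b =>
      (h2.hasFDerivAt.clm_apply (hasFDerivAt_const a u)).clm_apply (hasFDerivAt_const b u)
    have := ((e a b).sub (e b a)).fderiv
    change fderiv ℝ (fun q => fderiv ℝ α q a b - fderiv ℝ α q b a) u c = _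
    have h' : fderiv ℝ (fun q => fderiv ℝ α q a b - fderiv ℝ α q b a) u = _ := this
    rw [h']
    simp
  simp only [extD₂, h]
  rw [hs c a, hs c b, hs a b]
  ring

lemma differentiableAt_wedge {α β : V → V →L[ℝ] ℂ} {u : V} (hα : DifferentiableAt ℝ α u)
    (hβ : DifferentiableAt ℝ β u) (a b : V) : DifferentiableAt ℝ (fun q => wedge (α q) (β q) a b) u :=
  ((differentiableAt_form_apply hα a).mul (differentiableAt_form_apply hβ b)).sub
    ((differentiableAt_form_apply hα b).mul (differentiableAt_form_apply hβ a))

lemma fderiv_wedge {α β : V → V →L[ℝ] ℂ} {u : V} (hα : DifferentiableAt ℝ α u)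
    (hβ : DifferentiableAt ℝ β u) (a b c : V) : fderiv ℝ (fun q => wedge (α q) (β q) a b) u c =
      fderiv ℝ α u c a * β u b + α u a * fderiv ℝ β u c b
        - fderiv ℝ α u c b * β u a - α u b * fderiv ℝ β u c a := by
  have h := (((differentiableAt_form_apply hα a).hasFDerivAt.mul
    (differentiableAt_form_apply hβ b).hasFDerivAt).sub
    ((differentiableAt_form_apply hα b).hasFDerivAt.mul
    (differentiableAt_form_apply hβ a).hasFDerivAt)).fderiv
  have h' : fderiv ℝ (fun q => wedge (α q) (β q) a b) u = _ := h
  rw [h']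
  simp only [sub_apply, add_apply, smul_apply, smul_eq_mul, fderiv_form_apply hα,
    fderiv_form_apply hβ]
  ring

/-- `d(α ∧ β) = dα ∧ β - dβ ∧ α`. -/
lemma extD₂_wedge {α β : V → V →L[ℝ] ℂ} {u : V} (hα : DifferentiableAt ℝ α u)
    (hβ : DifferentiableAt ℝ β u) (a b c : V) : extD₂ (fun q => wedge (α q) (β q)) u a b c =
      wedge₃ (extD α u) (β u) a b c - wedge₃ (extD β u) (α u) a b c := by
  simp only [extD₂, fderiv_wedge hα hβ, wedge₃, extD]
  ring

lemma extD₂_congr {Θ Θ' : V → V → V → ℂ} {S : Set V} (hS : IsOpen S)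
    (h : ∀ q ∈ S, ∀ a b, Θ q a b = Θ' q a b) {u : V} (hu : u ∈ S) (a b c : V) :
    extD₂ Θ u a b c = extD₂ Θ' u a b c := by
  have e : ∀ a b, fderiv ℝ (fun q => Θ q a b) u = fderiv ℝ (fun q => Θ' q a b) u := fun a b =>
    Filter.EventuallyEq.fderiv_eq (by
      filter_upwards [hS.mem_nhds hu] with q hq using h q hq a b)
  simp only [extD₂, e]

/-- The identity `d² = 0` for a form whose differential is a sum of three products. -/
lemma bianchi {S : Set V} (hS : IsOpen S) {ξ α₁ α₂ α₃ β₁ β₂ β₃ : V → V →L[ℝ] ℂ} (c₁ c₂ c₃ : ℂ)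
    (hξ : ContDiffOn ℝ ∞ ξ S)
    (hα₁ : ContDiffOn ℝ ∞ α₁ S) (hα₂ : ContDiffOn ℝ ∞ α₂ S) (hα₃ : ContDiffOn ℝ ∞ α₃ S)
    (hβ₁ : ContDiffOn ℝ ∞ β₁ S) (hβ₂ : ContDiffOn ℝ ∞ β₂ S) (hβ₃ : ContDiffOn ℝ ∞ β₃ S)
    (h : ∀ q ∈ S, ∀ a b, extD ξ q a b = c₁ * wedge (α₁ q) (β₁ q) a b + c₂ * wedge (α₂ q) (β₂ q) a b
      + c₃ * wedge (α₃ q) (β₃ q) a b) {u : V} (hu : u ∈ S) (a b c : V) :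
    c₁ * (wedge₃ (extD α₁ u) (β₁ u) a b c - wedge₃ (extD β₁ u) (α₁ u) a b c)
    + c₂ * (wedge₃ (extD α₂ u) (β₂ u) a b c - wedge₃ (extD β₂ u) (α₂ u) a b c)
    + c₃ * (wedge₃ (extD α₃ u) (β₃ u) a b c - wedge₃ (extD β₃ u) (α₃ u) a b c) = 0 := by
  have hd : ∀ {α : V → V →L[ℝ] ℂ}, ContDiffOn ℝ ∞ α S → DifferentiableAt ℝ α u := fun hα =>
    (hα.contDiffAt (hS.mem_nhds hu)).differentiableAt (by simp)
  -- Read backwards, the left side is the differential of the right side of `h`, and the zero on the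
  -- other side becomes `d(dξ)`. The two agree because `h` holds on an open set.
  rw [← extD₂_wedge (hd hα₁) (hd hβ₁), ← extD₂_wedge (hd hα₂) (hd hβ₂),
    ← extD₂_wedge (hd hα₃) (hd hβ₃), ← extD₂_extD (hξ.contDiffAt (hS.mem_nhds hu)) a b c,
    extD₂_congr hS h hu]
  have e : ∀ a b c, fderiv ℝ (fun q => c₁ * wedge (α₁ q) (β₁ q) a b + c₂ * wedge (α₂ q) (β₂ q) a b
      + c₃ * wedge (α₃ q) (β₃ q) a b) u c = c₁ * fderiv ℝ (fun q => wedge (α₁ q) (β₁ q) a b) u c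
      + c₂ * fderiv ℝ (fun q => wedge (α₂ q) (β₂ q) a b) u c
      + c₃ * fderiv ℝ (fun q => wedge (α₃ q) (β₃ q) a b) u c := by
    intro a b c
    have := ((((differentiableAt_wedge (hd hα₁) (hd hβ₁) a b).hasFDerivAt.const_mul c₁).add
      ((differentiableAt_wedge (hd hα₂) (hd hβ₂) a b).hasFDerivAt.const_mul c₂)).add
      ((differentiableAt_wedge (hd hα₃) (hd hβ₃) a b).hasFDerivAt.const_mul c₃)).fderiv
    have h' : fderiv ℝ (fun q => c₁ * wedge (α₁ q) (β₁ q) a b + c₂ * wedge (α₂ q) (β₂ q) a b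
      + c₃ * wedge (α₃ q) (β₃ q) a b) u = _ := this
    rw [h']
    simp
  simp only [extD₂, e]
  ring

end FlatForms

/-! ### The connection forms of a normalized coframe on an open subset of `ℝ³` -/

section BaseForms

/-- The linear combination of three covectors. -/
def lin (t t₁ t₂ : E3 →L[ℝ] ℂ) (a b c : ℂ) : E3 →L[ℝ] ℂ := a • t + b • t₁ + c • t₂

lemma lin_apply (t t₁ t₂ : E3 →L[ℝ] ℂ) (a b c : ℂ) (v : E3) :
    lin t t₁ t₂ a b c v = a * t v + b * t₁ v + c * t₂ v := rfl

/-- `Θ = p t ∧ t₁ + q t ∧ t₂ + r t₁ ∧ t₂`. -/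
def HasCoef (t t₁ t₂ : E3 →L[ℝ] ℂ) (Θ : E3 → E3 → ℂ) (p q r : ℂ) : Prop :=
  ∀ v w, Θ v w = p * wedge t t₁ v w + q * wedge t t₂ v w + r * wedge t₁ t₂ v w

/-- In dimension three all 3-forms are multiples of `t ∧ t₁ ∧ t₂`. Evaluation on the standard basis
therefore turns an identity between 3-forms into a scalar equation times `cdet`. -/
lemma wedge₃_lin {t t₁ t₂ : E3 →L[ℝ] ℂ} {Θ : E3 → E3 → ℂ} {p q r : ℂ}
    (h : HasCoef t t₁ t₂ Θ p q r) (a b c : ℂ) :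
    wedge₃ Θ (lin t t₁ t₂ a b c) (e3 0) (e3 1) (e3 2) = (p * c - q * b + r * a) * cdet t t₁ t₂ := by
  simp only [wedge₃, h _ _, wedge, lin_apply, cdet]
  ring

/-- Each coefficient is isolated by wedging with the covector absent from its term. The sign of the
middle one comes from `t ∧ t₂ ∧ t₁ = -t ∧ t₁ ∧ t₂`. -/
lemma hasCoef_extD {t t₁ t₂ : E3 →L[ℝ] ℂ} (hdet : cdet t t₁ t₂ ≠ 0) (α : E3 → E3 →L[ℝ] ℂ)
    (u : E3) : HasCoef t t₁ t₂ (extD α u)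
      (wedge₃ (extD α u) t₂ (e3 0) (e3 1) (e3 2) / cdet t t₁ t₂)
      (-wedge₃ (extD α u) t₁ (e3 0) (e3 1) (e3 2) / cdet t t₁ t₂)
      (wedge₃ (extD α u) t (e3 0) (e3 1) (e3 2) / cdet t t₁ t₂) := by
  intro v w
  have h : ∀ v w, extD α u v w = alt (fderiv ℝ α u) v w := fun _ _ => rfl
  have h20 : alt (fderiv ℝ α u) (e3 2) (e3 0) = -alt (fderiv ℝ α u) (e3 0) (e3 2) := by
    simp only [alt]; ring
  rw [div_mul_eq_mul_div, div_mul_eq_mul_div, div_mul_eq_mul_div, ← add_div, ← add_div,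
    eq_div_iff hdet]
  simp only [wedge₃, h, h20]
  rw [alt_expand _ v w]
  simp only [wedge, cov_expand t v, cov_expand t w, cov_expand t₁ v, cov_expand t₁ w,
    cov_expand t₂ v, cov_expand t₂ w, cdet]
  ring

variable {O : Set E3} {t t₁ t₂ : E3 → E3 →L[ℝ] ℂ}

lemma ContDiffOn.extD {α : E3 → E3 →L[ℝ] ℂ} (hO : IsOpen O) (hα : ContDiffOn ℝ ∞ α O) (v w : E3) :
    ContDiffOn ℝ ∞ (fun u => extD α u v w) O := by
  have h := hα.fderiv_of_isOpen hO (m := ∞) (by simp)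
  exact ((h.clm_apply contDiffOn_const).clm_apply contDiffOn_const).sub
    ((h.clm_apply contDiffOn_const).clm_apply contDiffOn_const)

/-- The coefficients are smooth because they are smooth functions divided by the nonvanishing
determinant of the coframe. -/
lemma exists_coef_extD (hO : IsOpen O) (ht : ContDiffOn ℝ ∞ t O) (ht₁ : ContDiffOn ℝ ∞ t₁ O)
    (ht₂ : ContDiffOn ℝ ∞ t₂ O) (hdet : ∀ u ∈ O, cdet (t u) (t₁ u) (t₂ u) ≠ 0)
    {α : E3 → E3 →L[ℝ] ℂ} (hα : ContDiffOn ℝ ∞ α O) :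
    ∃ p q r : E3 → ℂ, ContDiffOn ℝ ∞ p O ∧ ContDiffOn ℝ ∞ q O ∧ ContDiffOn ℝ ∞ r O ∧
      ∀ u ∈ O, HasCoef (t u) (t₁ u) (t₂ u) (extD α u) (p u) (q u) (r u) := by
  have hw : ∀ {γ : E3 → E3 →L[ℝ] ℂ}, ContDiffOn ℝ ∞ γ O → ContDiffOn ℝ ∞
      (fun u => wedge₃ (extD α u) (γ u) (e3 0) (e3 1) (e3 2)) O := fun hγ =>
    (((ContDiffOn.extD hO hα _ _).mul (hγ.clm_apply contDiffOn_const)).add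
      ((ContDiffOn.extD hO hα _ _).mul (hγ.clm_apply contDiffOn_const))).add
      ((ContDiffOn.extD hO hα _ _).mul (hγ.clm_apply contDiffOn_const))
  have hd := ContDiffOn.cdet ht ht₁ ht₂
  exact ⟨_, _, _, (hw ht₂).mul (hd.inv hdet), (hw ht₁).neg.mul (hd.inv hdet),
    (hw ht).mul (hd.inv hdet), fun u hu => hasCoef_extD (hdet u hu) α u⟩

lemma exists_coef (ht : ContDiffOn ℝ ∞ t O) (ht₁ : ContDiffOn ℝ ∞ t₁ O)
    (ht₂ : ContDiffOn ℝ ∞ t₂ O) (hdet : ∀ u ∈ O, cdet (t u) (t₁ u) (t₂ u) ≠ 0)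
    {α : E3 → E3 →L[ℝ] ℂ} (hα : ContDiffOn ℝ ∞ α O) :
    ∃ p q r : E3 → ℂ, ContDiffOn ℝ ∞ p O ∧ ContDiffOn ℝ ∞ q O ∧ ContDiffOn ℝ ∞ r O ∧
      ∀ u ∈ O, α u = lin (t u) (t₁ u) (t₂ u) (p u) (q u) (r u) := by
  have hd := ContDiffOn.cdet ht ht₁ ht₂
  exact ⟨_, _, _, (ContDiffOn.cdet hα ht₁ ht₂).mul (hd.inv hdet),
    (ContDiffOn.cdet ht hα ht₂).mul (hd.inv hdet), (ContDiffOn.cdet ht ht₁ hα).mul (hd.inv hdet),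
    fun u hu => cramer (hdet u hu) (α u)⟩

/-- Connection forms and curvature coefficients on an open subset of `ℝ³`, for a coframe
normalized by `dt = t₁ ∧ t₂`. -/
structure BaseConnection (O : Set E3) (t t₁ t₂ : E3 → E3 →L[ℝ] ℂ) where
  x : E3 → E3 →L[ℝ] ℂ
  f₁ : E3 → E3 →L[ℝ] ℂ
  f₂ : E3 → E3 →L[ℝ] ℂ
  g : E3 → E3 →L[ℝ] ℂ
  Q₁ : E3 → ℂ
  Q₂ : E3 → ℂ
  U₁ : E3 → ℂ
  U₂ : E3 → ℂ
  smooth_x : ContDiffOn ℝ ∞ x O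
  smooth_f₁ : ContDiffOn ℝ ∞ f₁ O
  smooth_f₂ : ContDiffOn ℝ ∞ f₂ O
  smooth_g : ContDiffOn ℝ ∞ g O
  smooth_Q₁ : ContDiffOn ℝ ∞ Q₁ O
  smooth_Q₂ : ContDiffOn ℝ ∞ Q₂ O
  smooth_U₁ : ContDiffOn ℝ ∞ U₁ O
  smooth_U₂ : ContDiffOn ℝ ∞ U₂ O
  d_t₁ : ∀ u ∈ O, ∀ v w, extD t₁ u v w = wedge (t₁ u) (x u) v w + wedge (t u) (f₁ u) v w
  d_t₂ : ∀ u ∈ O, ∀ v w, extD t₂ u v w = -wedge (t₂ u) (x u) v w + wedge (t u) (f₂ u) v w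
  d_φ : ∀ u ∈ O, ∀ v w, 0 = wedge (t₁ u) (f₂ u) v w - wedge (t₂ u) (f₁ u) v w
    + wedge (t u) (g u) v w
  d_x : ∀ u ∈ O, ∀ v w, extD x u v w = 3 / 2 * wedge (t₂ u) (f₁ u) v w
    + 3 / 2 * wedge (t₁ u) (f₂ u) v w
  d_f₁ : ∀ u ∈ O, ∀ v w, extD f₁ u v w = wedge (f₁ u) (x u) v w + 1 / 2 * wedge (t₁ u) (g u) v w
    + Q₁ u * wedge (t u) (t₂ u) v w
  d_f₂ : ∀ u ∈ O, ∀ v w, extD f₂ u v w = -wedge (f₂ u) (x u) v w + 1 / 2 * wedge (t₂ u) (g u) v w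
    + Q₂ u * wedge (t u) (t₁ u) v w
  d_g : ∀ u ∈ O, ∀ v w, extD g u v w = 2 * wedge (f₁ u) (f₂ u) v w
    + (U₁ u * wedge (t₁ u) (t u) v w + U₂ u * wedge (t₂ u) (t u) v w)

/-- The equations for `dt₁`, `dt₂` and `dφ = 0` fix `x, f₁, f₂, g` except for the functions `x0, p0,
q0, g0`. The equation for `dx` determines the first three algebraically, one coefficient at a time,
and the equation for `df₁` determines `g0`. The components of `df₁`, `df₂`, `dg` that could still
violate the structure equations vanish by `d² = 0` applied to `t₁`, `t₂`, `x` and `φ`. -/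
theorem exists_baseConnection (hO : IsOpen O) (ht : ContDiffOn ℝ ∞ t O) (ht₁ : ContDiffOn ℝ ∞ t₁ O)
    (ht₂ : ContDiffOn ℝ ∞ t₂ O) (hdet : ∀ u ∈ O, cdet (t u) (t₁ u) (t₂ u) ≠ 0)
    (hdt : ∀ u ∈ O, ∀ v w, extD t u v w = wedge (t₁ u) (t₂ u) v w) :
    Nonempty (BaseConnection O t t₁ t₂) := by
  have hlin : ∀ {a b c : E3 → ℂ}, ContDiffOn ℝ ∞ a O → ContDiffOn ℝ ∞ b O → ContDiffOn ℝ ∞ c O →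
      ContDiffOn ℝ ∞ (fun u => lin (t u) (t₁ u) (t₂ u) (a u) (b u) (c u)) O := fun ha hb hc =>
    ((ha.smul ht).add (hb.smul ht₁)).add (hc.smul ht₂)
  have ex2 := fun {α : E3 → E3 →L[ℝ] ℂ} (hα : ContDiffOn ℝ ∞ α O) =>
    exists_coef_extD hO ht ht₁ ht₂ hdet hα
  have e0 : ∀ u, t u = lin (t u) (t₁ u) (t₂ u) 1 0 0 := fun u =>
    ContinuousLinearMap.ext fun v => by rw [lin_apply]; ring
  have e1 : ∀ u, t₁ u = lin (t u) (t₁ u) (t₂ u) 0 1 0 := fun u =>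
    ContinuousLinearMap.ext fun v => by rw [lin_apply]; ring
  have e2 : ∀ u, t₂ u = lin (t u) (t₁ u) (t₂ u) 0 0 1 := fun u =>
    ContinuousLinearMap.ext fun v => by rw [lin_apply]; ring
  obtain ⟨A, B, C, hA, hB, hC, hdt₁⟩ := ex2 ht₁
  obtain ⟨A', B', C', hA', hB', hC', hdt₂⟩ := ex2 ht₂
  have hdt' : ∀ u ∈ O, HasCoef (t u) (t₁ u) (t₂ u) (extD t u) 0 0 1 := fun u hu v w => by
    rw [hdt u hu]; ring
  -- `d² t = 0`
  have hB'A : ∀ u ∈ O, B' u = -A u := by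
    intro u hu
    have h := bianchi hO 1 0 0 ht ht₁ ht ht ht₂ ht ht
      (fun q hq a b => by rw [hdt q hq]; ring) hu (e3 0) (e3 1) (e3 2)
    have w1 := wedge₃_lin (hdt₁ u hu) 0 0 1
    have w2 := wedge₃_lin (hdt₂ u hu) 0 1 0
    rw [← e2] at w1
    rw [← e1] at w2
    rw [w1, w2] at h
    have := (mul_eq_zero.1 (show (B' u + A u) * cdet (t u) (t₁ u) (t₂ u) = 0 by
      linear_combination h)).resolve_right (hdet u hu)
    linear_combination this
  -- The `t₁ ∧ t₂` coefficients of `dt₁` and `dt₂` force `x = x0 t + C' t₁ + C t₂`. Only `x0` is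
  -- free.
  have hy := hlin contDiffOn_const hC' hC (a := fun _ => 0)
  obtain ⟨r01, r02, r12, hr01, hr02, hr12, hdy⟩ := ex2 hy
  -- The `t₁ ∧ t₂` coefficient of the equation for `dx` reads `x0 + r12 = -3 (A + x0)`. The summand
  -- `x0` on the left comes from `x0 dt`.
  set x0 : E3 → ℂ := fun u => -((r12 u + 3 * A u) / 4) with hx0def
  have hx0 : ContDiffOn ℝ ∞ x0 O := ((hr12.add (contDiffOn_const.mul hA)).div_const 4).neg
  obtain ⟨k0, k1, k2, hk0, hk1, hk2, hdx0⟩ := exists_coef ht ht₁ ht₂ hdet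
    (hx0.fderiv_of_isOpen hO (m := ∞) (by simp))
  -- With `dx0 = k0 t + k1 t₁ + k2 t₂`, the coefficients of `t ∧ t₁` and `t ∧ t₂` in the same
  -- equation read `r01 - k1 = -(3/2) q0` and `r02 - k2 = -(3/2) p0`.
  set q0 : E3 → ℂ := fun u => 2 / 3 * (k1 u - r01 u) with hq0def
  set p0 : E3 → ℂ := fun u => 2 / 3 * (k2 u - r02 u) with hp0def
  have hq0 : ContDiffOn ℝ ∞ q0 O := contDiffOn_const.mul (hk1.sub hr01)
  have hp0 : ContDiffOn ℝ ∞ p0 O := contDiffOn_const.mul (hk2.sub hr02)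
  have hx := hlin hx0 hC' hC
  have hf₁ := hlin hp0 (hA.add hx0) hB
  have hf₂ := hlin hq0 hA' (hA.add hx0).neg
  obtain ⟨s0, s1, s2, hs0, hs1, hs2, hdf₁⟩ := ex2 hf₁
  obtain ⟨m0, m1, m2, hm0, hm1, hm2, hdf₂⟩ := ex2 hf₂
  -- This choice cancels the `t ∧ t₁` coefficient of `df₁ - f₁ ∧ x - (1/2) t₁ ∧ g`.
  set g0 : E3 → ℂ := fun u => -2 * (s0 u - (p0 u * C' u - (A u + x0 u) * x0 u)) with hg0def
  have hg0 : ContDiffOn ℝ ∞ g0 O :=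
    contDiffOn_const.mul (hs0.sub ((hp0.mul hC').sub ((hA.add hx0).mul hx0)))
  have hg := hlin hg0 hq0 hp0.neg
  obtain ⟨n0, n1, n2, hn0, hn1, hn2, hdg⟩ := ex2 hg
  have E1 : ∀ u ∈ O, ∀ v w, extD t₁ u v w =
      wedge (t₁ u) (lin (t u) (t₁ u) (t₂ u) (x0 u) (C' u) (C u)) v w +
      wedge (t u) (lin (t u) (t₁ u) (t₂ u) (p0 u) (A u + x0 u) (B u)) v w := by
    intro u hu v w
    rw [hdt₁ u hu]
    simp only [wedge, lin_apply]
    ring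
  have E2 : ∀ u ∈ O, ∀ v w, extD t₂ u v w =
      -wedge (t₂ u) (lin (t u) (t₁ u) (t₂ u) (x0 u) (C' u) (C u)) v w +
      wedge (t u) (lin (t u) (t₁ u) (t₂ u) (q0 u) (A' u) (-(A u + x0 u))) v w := by
    intro u hu v w
    rw [hdt₂ u hu, hB'A u hu]
    simp only [wedge, lin_apply]
    ring
  have E3' : ∀ u ∈ O, ∀ v w, 0 =
      wedge (t₁ u) (lin (t u) (t₁ u) (t₂ u) (q0 u) (A' u) (-(A u + x0 u))) v w -
      wedge (t₂ u) (lin (t u) (t₁ u) (t₂ u) (p0 u) (A u + x0 u) (B u)) v w +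
      wedge (t u) (lin (t u) (t₁ u) (t₂ u) (g0 u) (q0 u) (-p0 u)) v w := by
    intro u hu v w
    simp only [wedge, lin_apply]
    ring
  have E4 : ∀ u ∈ O, ∀ v w,
      extD (fun u => lin (t u) (t₁ u) (t₂ u) (x0 u) (C' u) (C u)) u v w =
      3 / 2 * wedge (t₂ u) (lin (t u) (t₁ u) (t₂ u) (p0 u) (A u + x0 u) (B u)) v w +
      3 / 2 * wedge (t₁ u) (lin (t u) (t₁ u) (t₂ u) (q0 u) (A' u) (-(A u + x0 u))) v w := by
    intro u hu v w
    have hdiff : ∀ {G : Type} [NormedAddCommGroup G] [NormedSpace ℝ G] {f : E3 → G},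
        ContDiffOn ℝ ∞ f O → DifferentiableAt ℝ f u := fun hf =>
      (hf.contDiffAt (hO.mem_nhds hu)).differentiableAt (by simp)
    -- Separating `x0 t` from the part whose differential was expanded above leaves a single product
    -- rule.
    have hsplit : (fun u => lin (t u) (t₁ u) (t₂ u) (x0 u) (C' u) (C u)) =
        fun u => x0 u • t u + lin (t u) (t₁ u) (t₂ u) 0 (C' u) (C u) := by
      funext u
      refine ContinuousLinearMap.ext fun v => ?_
      change _ = x0 u * t u v + lin (t u) (t₁ u) (t₂ u) 0 (C' u) (C u) v
      simp only [lin_apply]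
      ring
    rw [hsplit, extD_add (α := fun u => x0 u • t u) (hdiff (hx0.smul ht)) (hdiff hy), extD_smul (hdiff hx0) (hdiff ht),
      hdx0 u hu, hdt u hu, hdy u hu]
    simp only [wedge, lin_apply, hq0def, hp0def, hx0def]
    ring
  refine ⟨⟨fun u => lin (t u) (t₁ u) (t₂ u) (x0 u) (C' u) (C u),
    fun u => lin (t u) (t₁ u) (t₂ u) (p0 u) (A u + x0 u) (B u),
    fun u => lin (t u) (t₁ u) (t₂ u) (q0 u) (A' u) (-(A u + x0 u)),
    fun u => lin (t u) (t₁ u) (t₂ u) (g0 u) (q0 u) (-p0 u),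
    -- The curvature coefficients are the components of `df₁`, `df₂`, `dg` on which no condition is
    -- imposed, after subtraction of the quadratic terms.
    fun u => s1 u - (p0 u * C u - B u * x0 u),
    fun u => m0 u + (q0 u * C' u - A' u * x0 u),
    fun u => -(n0 u - 2 * (p0 u * A' u - (A u + x0 u) * q0 u)),
    fun u => -(n1 u - 2 * (p0 u * (-(A u + x0 u)) - B u * q0 u)),
    hx, hf₁, hf₂, hg, hs1.sub ((hp0.mul hC).sub (hB.mul hx0)),
    hm0.add ((hq0.mul hC').sub (hA'.mul hx0)),
    (hn0.sub (contDiffOn_const.mul ((hp0.mul hA').sub ((hA.add hx0).mul hq0)))).neg,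
    (hn1.sub (contDiffOn_const.mul ((hp0.mul (hA.add hx0).neg).sub (hB.mul hq0)))).neg,
    E1, E2, E3', E4, ?_, ?_, ?_⟩⟩
  -- The three remaining equations share the identities `d² = 0` for `t₁`, `t₂`, `φ` and `x`,
  -- evaluated on the standard basis. Unused slots of `bianchi` are filled with coefficient zero.
  all_goals
    intro u hu
    have hdx : HasCoef (t u) (t₁ u) (t₂ u)
        (extD (fun u => lin (t u) (t₁ u) (t₂ u) (x0 u) (C' u) (C u)) u)
        (-(3 / 2) * q0 u) (-(3 / 2) * p0 u) (3 / 2 * (-(A u + x0 u) - (A u + x0 u))) := by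
      intro v w
      rw [E4 u hu]
      simp only [wedge, lin_apply]
      ring
    have B1 := bianchi hO 1 1 0 ht₁ ht₁ ht ht hx hf₁ ht
      (fun q hq a b => by rw [E1 q hq]; ring) hu (e3 0) (e3 1) (e3 2)
    have B2 := bianchi hO (-1) 1 0 ht₂ ht₂ ht ht hx hf₂ ht
      (fun q hq a b => by rw [E2 q hq]; ring) hu (e3 0) (e3 1) (e3 2)
    -- Here `ξ` is the restriction of `φ` to the section, which is zero.
    have B3 := bianchi hO 1 (-1) 1 (ξ := fun _ => 0) contDiffOn_const ht₁ ht₂ ht hf₂ hf₁ hg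
      (fun q hq a b => by
        have h0 : extD (fun _ : E3 => (0 : E3 →L[ℝ] ℂ)) q a b = 0 := by simp [extD]
        rw [h0, E3' q hq a b]; ring) hu (e3 0) (e3 1) (e3 2)
    have B4 := bianchi hO (3 / 2) (3 / 2) 0 hx ht₂ ht₁ ht hf₁ hf₂ ht
      (fun q hq a b => by rw [E4 q hq]; ring) hu (e3 0) (e3 1) (e3 2)
    have c0 := fun {Θ p q r} (h : HasCoef (t u) (t₁ u) (t₂ u) Θ p q r) => wedge₃_lin h 1 0 0
    have c1 := fun {Θ p q r} (h : HasCoef (t u) (t₁ u) (t₂ u) Θ p q r) => wedge₃_lin h 0 1 0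
    have c2 := fun {Θ p q r} (h : HasCoef (t u) (t₁ u) (t₂ u) Θ p q r) => wedge₃_lin h 0 0 1
    simp only [← e0, ← e1, ← e2] at c0 c1 c2
    simp only [wedge₃_lin (hdt₁ u hu), wedge₃_lin (hdt₂ u hu), wedge₃_lin (hdt' u hu), c1 hdx,
      c2 hdx, c0 (hdf₁ u hu), c2 (hdf₁ u hu), c0 (hdf₂ u hu), c1 (hdf₂ u hu), c0 (hdg u hu),
      zero_mul, add_zero] at B1 B2 B3 B4
    have cancel : ∀ {a : ℂ}, a * cdet (t u) (t₁ u) (t₂ u) = 0 → a = 0 := fun h =>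
      (mul_eq_zero.1 h).resolve_right (hdet u hu)
    -- `R1` and `R2` say that `Φ¹` and `Φ²` have no `t₁ ∧ t₂` term, by `d²t₁ = 0` and `d²t₂ = 0`.
    -- `R3` says that `Φ²` has no `t ∧ t₂` term. It follows from `d²x = 0` because `g0` has already
    -- removed the `t ∧ t₁` term of `Φ¹`.
    have R1 : s2 u - ((A u + x0 u) * C u - B u * C' u) + 1 / 2 * p0 u = 0 := 
      cancel (by linear_combination -B1)
    have R2 : m2 u + (A' u * C u + (A u + x0 u) * C' u) + 1 / 2 * q0 u = 0 := 
      cancel (by rw [hB'A u hu] at B2; linear_combination -B2)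
    have hg0u : g0 u = -2 * (s0 u - (p0 u * C' u - (A u + x0 u) * x0 u)) := rfl
    have R3 : m1 u + (q0 u * C u + (A u + x0 u) * x0 u) + 1 / 2 * g0 u = 0 := cancel (by
        rw [hB'A u hu] at B4
        linear_combination (2 / 3) * B4 + (1 / 2) * hg0u * cdet (t u) (t₁ u) (t₂ u))
  · intro v w
    rw [hdf₁ u hu]
    simp only [wedge, lin_apply]
    linear_combination (t u v * t₁ u w - t u w * t₁ u v) * (-1 / 2) * hg0u +
      (t₁ u v * t₂ u w - t₁ u w * t₂ u v) * R1
  · intro v w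
    rw [hdf₂ u hu]
    simp only [wedge, lin_apply]
    linear_combination (t u v * t₂ u w - t u w * t₂ u v) * R3 +
      (t₁ u v * t₂ u w - t₁ u w * t₂ u v) * R2
  · intro v w
    -- The missing `t₁ ∧ t₂` term of `Ψ`, from `d²φ = 0`. The contributions of `df₁` and `df₂` are
    -- removed by the choice of `g0` and by `R3`.
    have R4 : n2 u - 2 * ((A u + x0 u) * (-(A u + x0 u)) - B u * A' u) = 0 := cancel (by
        rw [hB'A u hu] at B3
        linear_combination -B3 + cdet (t u) (t₁ u) (t₂ u) * R3
          - (1 / 2) * hg0u * cdet (t u) (t₁ u) (t₂ u))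
    rw [hdg u hu]
    simp only [wedge, lin_apply]
    linear_combination (t₁ u v * t₂ u w - t₁ u w * t₂ u v) * R4

end BaseForms

/-! ### Gauge transformations of matrix-valued forms -/

section Gauge

variable {V : Type*} [NormedAddCommGroup V] [NormedSpace ℝ V]

/-- The derivative of a matrix-valued function. -/
def matD (f : V → Mat3) (q v : V) : Mat3 := Matrix.of fun i j => fderiv ℝ (fun q => f q i j) q v

/-- Differentiability of a matrix-valued function. -/
def MatDiff (f : V → Mat3) (q : V) : Prop := ∀ i j, DifferentiableAt ℝ (fun q => f q i j) q

lemma matD_congr {f g : V → Mat3} {q : V} (h : f =ᶠ[𝓝 q] g) (v : V) : matD f q v = matD g q v := by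
  ext i j
  have : (fun q => f q i j) =ᶠ[𝓝 q] fun q => g q i j := 
    h.mono fun q hq => congrFun (congrFun hq i) j
  simp only [matD, Matrix.of_apply, this.fderiv_eq]

lemma matD_add {f g : V → Mat3} {q : V} (hf : MatDiff f q) (hg : MatDiff g q) (v : V) :
    matD (fun q => f q + g q) q v = matD f q v + matD g q v := by
  ext i j
  have := ((hf i j).hasFDerivAt.add (hg i j).hasFDerivAt).fderiv
  have h : fderiv ℝ (fun q => (f q + g q) i j) q = _ := this
  simp only [matD, Matrix.of_apply, Matrix.add_apply]
  exact congrArg (fun f : V →L[ℝ] ℂ => f v) h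

lemma MatDiff.add {f g : V → Mat3} {q : V} (hf : MatDiff f q) (hg : MatDiff g q) :
    MatDiff (fun q => f q + g q) q := fun i j => (hf i j).add (hg i j)

lemma matDiff_mul_aux {f g : V → Mat3} {q : V} (hf : MatDiff f q) (hg : MatDiff g q) (i j : Fin 3) :
    HasFDerivAt (fun q => (f q * g q) i j) (∑ k, (f q i k • fderiv ℝ (fun q => g q k j) q +
      g q k j • fderiv ℝ (fun q => f q i k) q)) q := by
  have h := HasFDerivAt.fun_sum (u := Finset.univ) fun k _ =>
    (hf i k).hasFDerivAt.mul (hg k j).hasFDerivAt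
  exact h

lemma MatDiff.mul {f g : V → Mat3} {q : V} (hf : MatDiff f q) (hg : MatDiff g q) :
    MatDiff (fun q => f q * g q) q := fun i j => (matDiff_mul_aux hf hg i j).differentiableAt

lemma matD_mul {f g : V → Mat3} {q : V} (hf : MatDiff f q) (hg : MatDiff g q) (v : V) :
    matD (fun q => f q * g q) q v = matD f q v * g q + f q * matD g q v := by
  ext i j
  change fderiv ℝ (fun q => (f q * g q) i j) q v = _
  rw [(matDiff_mul_aux hf hg i j).fderiv]
  simp only [matD, Matrix.of_apply, Matrix.add_apply, Matrix.mul_apply, sum_apply, add_apply,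
    smul_apply, smul_eq_mul, Finset.sum_add_distrib]
  rw [add_comm]
  simp only [mul_comm]

lemma matD_const (c : Mat3) (q v : V) : matD (fun _ => c) q v = 0 := by
  ext i j
  simp [matD]

/-- The value of a matrix of covectors. -/
def evalForm (P : Matrix (Fin 3) (Fin 3) (V →L[ℝ] ℂ)) (v : V) : Mat3 := P.map fun α => α v

/-- The curvature `dP + P ∧ P` of a matrix of 1-forms. -/
def curv (P : V → Matrix (Fin 3) (Fin 3) (V →L[ℝ] ℂ)) (q v w : V) : Mat3 :=
  Matrix.of fun i j => extD (fun q => P q i j) q v w + ∑ k, wedge (P q i k) (P q k j) v w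

/-- On two vectors `P ∧ P` is the commutator of the values of `P`. With this form of the curvature
the gauge computation is noncommutative algebra in `Mat3`. -/
lemma curv_eq {P : V → Matrix (Fin 3) (Fin 3) (V →L[ℝ] ℂ)} {q : V}
    (hP : ∀ i j, DifferentiableAt ℝ (fun q => P q i j) q) (v w : V) :
    curv P q v w = matD (fun q => evalForm (P q) w) q v - matD (fun q => evalForm (P q) v) q w
      + (evalForm (P q) v * evalForm (P q) w - evalForm (P q) w * evalForm (P q) v) := by
  ext i j
  have h : ∀ v w, fderiv ℝ (fun q => P q i j w) q v = fderiv ℝ (fun q => P q i j) q v w :=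
    fun v w => fderiv_form_apply (hP i j) v w
  simp only [curv, Matrix.of_apply, Matrix.add_apply, Matrix.sub_apply, matD, evalForm,
    Matrix.map_apply, h, Matrix.mul_apply, extD, wedge, Finset.sum_sub_distrib]

/-- The gauge transform `H⁻¹ A H + H⁻¹ dH + ε` of a matrix of forms, with `K = H⁻¹`. -/
def gaugeForm (A : V → Matrix (Fin 3) (Fin 3) (V →L[ℝ] ℂ)) (H K : V → Mat3) (ε : V → V →L[ℝ] ℂ)
    (q : V) : Matrix (Fin 3) (Fin 3) (V →L[ℝ] ℂ) :=
  Matrix.of fun i j => ∑ k, ∑ l, (K q i k * H q l j) • A q k l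
    + ∑ k, K q i k • fderiv ℝ (fun q => H q k j) q + (1 : Mat3) i j • ε q

lemma evalForm_gaugeForm (A : V → Matrix (Fin 3) (Fin 3) (V →L[ℝ] ℂ)) (H K : V → Mat3)
    (ε : V → V →L[ℝ] ℂ) (q v : V) : evalForm (gaugeForm A H K ε q) v =
      K q * evalForm (A q) v * H q + K q * matD H q v + ε q v • (1 : Mat3) := by
  ext i j
  simp only [evalForm, gaugeForm, Matrix.map_apply, Matrix.of_apply, Matrix.add_apply,
    Matrix.mul_apply, matD, Matrix.smul_apply, add_apply, sum_apply, smul_apply, smul_eq_mul,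
    Finset.sum_mul]
  rw [Finset.sum_comm, mul_comm ((1 : Mat3) i j)]
  simp only [mul_right_comm]

/-- The curvature of a gauge transform. -/
theorem curv_gaugeForm {A : V → Matrix (Fin 3) (Fin 3) (V →L[ℝ] ℂ)} {H K : V → Mat3}
    {ε : V → V →L[ℝ] ℂ} {q : V} (hA : ∀ i j, DifferentiableAt ℝ (fun q => A q i j) q)
    (hH : ∀ i j, ContDiffAt ℝ ∞ (fun q => H q i j) q)
    (hK : ∀ i j, ContDiffAt ℝ ∞ (fun q => K q i j) q) (hε : DifferentiableAt ℝ ε q)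
    (hdε : ∀ v w, extD ε q v w = 0) (hKH : ∀ᶠ q in 𝓝 q, K q * H q = 1) (v w : V) :
    curv (gaugeForm A H K ε) q v w = K q * curv A q v w * H q := by
  have hH1 : MatDiff H q := fun i j => (hH i j).differentiableAt (by simp)
  have hK1 : MatDiff K q := fun i j => (hK i j).differentiableAt (by simp)
  have hH2 : ∀ i j, DifferentiableAt ℝ (fderiv ℝ (fun q => H q i j)) q := fun i j =>
    ((hH i j).fderiv_right (m := 1) (by norm_cast)).differentiableAt (by simp)
  have hdH : ∀ v, MatDiff (fun q => matD H q v) q := fun v i j =>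
    differentiableAt_form_apply (hH2 i j) v
  have hA1 : ∀ v, MatDiff (fun q => evalForm (A q) v) q := fun v i j =>
    differentiableAt_form_apply (hA i j) v
  have hε1 : ∀ v, MatDiff (fun q => ε q v • (1 : Mat3)) q := fun v i j =>
    (differentiableAt_form_apply hε v).mul (differentiableAt_const _)
  have hG : ∀ i j, DifferentiableAt ℝ (fun q => gaugeForm A H K ε q i j) q := by
    intro i j
    have h1 : DifferentiableAt ℝ (fun q => ∑ k, ∑ l, (K q i k * H q l j) • A q k l) q :=
      DifferentiableAt.fun_sum fun k _ => DifferentiableAt.fun_sum fun l _ =>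
        ((hK1 i k).mul (hH1 l j)).smul (hA k l)
    have h2 : DifferentiableAt ℝ (fun q => ∑ k, K q i k • fderiv ℝ (fun q => H q k j) q) q :=
      DifferentiableAt.fun_sum fun k _ => (hK1 i k).smul (hH2 k j)
    have h3 : DifferentiableAt ℝ (fun q => (1 : Mat3) i j • ε q) q :=
      (hε.hasFDerivAt.const_smul ((1 : Mat3) i j)).differentiableAt
    exact (h1.add h2).add h3
  -- The second derivative of `H` is symmetric, so `K d(dH)` drops out after antisymmetrization.
  have hsymm : ∀ v w, matD (fun q => matD H q w) q v = matD (fun q => matD H q v) q w := by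
    intro v w
    ext i j
    have h1 : ∀ v w, fderiv ℝ (fun q => fderiv ℝ (fun q => H q i j) q w) q v = _ := fun v w =>
      fderiv_form_apply (hH2 i j) v w
    simp only [matD, Matrix.of_apply, h1]
    exact ((hH i j).isSymmSndFDerivAt (by
      simpa using (WithTop.coe_le_coe.2 (le_top : (2 : ℕ∞) ≤ ⊤)))).eq v w
  have hDε : ∀ v w, matD (fun q => ε q w • (1 : Mat3)) q v = fderiv ℝ ε q v w • (1 : Mat3) := by
    intro v w
    ext i j
    have := ((differentiableAt_form_apply hε w).hasFDerivAt.mul_const ((1 : Mat3) i j)).fderiv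
    have h' : fderiv ℝ (fun q => (ε q w • (1 : Mat3)) i j) q = _ := this
    change fderiv ℝ (fun q => (ε q w • (1 : Mat3)) i j) q v = fderiv ℝ ε q v w * (1 : Mat3) i j
    rw [h', smul_apply, smul_eq_mul, fderiv_form_apply hε, mul_comm]
  have hKH0 : K q * H q = 1 := hKH.self_of_nhds
  have hHK0 : H q * K q = 1 := mul_eq_one_comm.1 hKH0
  -- The derivative of the inverse, obtained by differentiating `K H = 1`. This is why that identity
  -- is required near `q` and not only at `q`.
  have hdK : ∀ v, matD K q v = -(K q * matD H q v * K q) := by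
    intro v
    have h1 : matD (fun q => K q * H q) q v = 0 := by
      rw [matD_congr (g := fun _ => (1 : Mat3)) hKH, matD_const]
    rw [matD_mul hK1 hH1] at h1
    calc matD K q v = (matD K q v * H q) * K q := by rw [mul_assoc, hHK0, mul_one]
      _ = _ := by rw [eq_neg_of_add_eq_zero_left h1, neg_mul]
  have hD : ∀ v w, matD (fun q => evalForm (gaugeForm A H K ε q) w) q v =
      (matD K q v * evalForm (A q) w + K q * matD (fun q => evalForm (A q) w) q v) * H q
        + K q * evalForm (A q) w * matD H q v
        + (matD K q v * matD H q w + K q * matD (fun q => matD H q w) q v)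
        + fderiv ℝ ε q v w • (1 : Mat3) := by
    intro v w
    simp only [evalForm_gaugeForm]
    rw [matD_add (((hK1.mul (hA1 w)).mul hH1).add (hK1.mul (hdH w))) (hε1 w),
      matD_add ((hK1.mul (hA1 w)).mul hH1) (hK1.mul (hdH w)), matD_mul (hK1.mul (hA1 w)) hH1,
      matD_mul hK1 (hA1 w), matD_mul hK1 (hdH w), hDε]
  rw [curv_eq hG, curv_eq hA, hD, hD, hsymm w v, evalForm_gaugeForm, evalForm_gaugeForm,
    hdK, hdK]
  -- Since `ε` is closed, its derivative does not contribute to the curvature.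
  have e0 : fderiv ℝ ε q v w = fderiv ℝ ε q w v := sub_eq_zero.1 (hdε v w)
  rw [e0]
  -- From here on only matrix algebra is used. The terms containing `dH` cancel once `H K = 1` is
  -- applied.
  generalize matD (fun q => matD H q w) q v = H2
  generalize matD (fun q => evalForm (A q) w) q v = A1
  generalize matD (fun q => evalForm (A q) v) q w = A2
  generalize evalForm (A q) v = Av
  generalize evalForm (A q) w = Aw
  generalize matD H q v = Hv
  generalize matD H q w = Hw
  generalize fderiv ℝ ε q w v • (1 : Mat3) = E
  have c1 : ∀ X : Mat3, H q * (K q * X) = X := fun X => by rw [← mul_assoc, hHK0, one_mul]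
  simp only [mul_add, add_mul, mul_sub, sub_mul, neg_mul, mul_assoc, c1, smul_mul_assoc,
    mul_smul_comm, mul_one, one_mul, smul_add]
  -- The products of two values of `ε` commute, that is, `ε ∧ ε = 0`.
  rw [smul_comm (ε q w) (ε q v) (1 : Mat3)]
  abel

end Gauge

/-! ### The Cartan matrix and the structure equations at a point -/

section Jets

/-- Eight covectors on a vector space `T` with the differentials of all but the first. -/
structure Jet (T : Type*) [AddCommGroup T] [Module ℝ T] [TopologicalSpace T] where
  ω₀ : T →L[ℝ] ℂ
  ω₁ : T →L[ℝ] ℂ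
  ω₂ : T →L[ℝ] ℂ
  φ : T →L[ℝ] ℂ
  x : T →L[ℝ] ℂ
  f₁ : T →L[ℝ] ℂ
  f₂ : T →L[ℝ] ℂ
  g : T →L[ℝ] ℂ
  -- The differential of `ω` is omitted: its equation (1) does not involve the unknown forms.
  dω₁ : T → T → ℂ
  dω₂ : T → T → ℂ
  dφ : T → T → ℂ
  dx : T → T → ℂ
  df₁ : T → T → ℂ
  df₂ : T → T → ℂ
  dg : T → T → ℂ

namespace Jet

variable {T T' : Type*} [AddCommGroup T] [Module ℝ T] [TopologicalSpace T] [AddCommGroup T']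
  [Module ℝ T'] [TopologicalSpace T']

/-- The pull-back of a jet by a linear map. -/
def comap (J : Jet T) (L : T' →L[ℝ] T) : Jet T' where
  ω₀ := J.ω₀.comp L
  ω₁ := J.ω₁.comp L
  ω₂ := J.ω₂.comp L
  φ := J.φ.comp L
  x := J.x.comp L
  f₁ := J.f₁.comp L
  f₂ := J.f₂.comp L
  g := J.g.comp L
  dω₁ v w := J.dω₁ (L v) (L w)
  dω₂ v w := J.dω₂ (L v) (L w)
  dφ v w := J.dφ (L v) (L w)
  dx v w := J.dx (L v) (L w)
  df₁ v w := J.df₁ (L v) (L w)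
  df₂ v w := J.df₂ (L v) (L w)
  dg v w := J.dg (L v) (L w)

/-- The structure equations of a Cartan connection whose curvature has the coefficients `Q₁`, `Q₂`,
`U₁`, `U₂`. -/
structure Solves (J : Jet T) (Q₁ Q₂ U₁ U₂ : ℂ) : Prop where
  d_ω₁ : ∀ v w, J.dω₁ v w = 1 / 2 * wedge J.ω₁ J.φ v w + wedge J.ω₁ J.x v w + wedge J.ω₀ J.f₁ v w
  d_ω₂ : ∀ v w, J.dω₂ v w = 1 / 2 * wedge J.ω₂ J.φ v w - wedge J.ω₂ J.x v w + wedge J.ω₀ J.f₂ v w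
  d_φ : ∀ v w, J.dφ v w = wedge J.ω₁ J.f₂ v w - wedge J.ω₂ J.f₁ v w + wedge J.ω₀ J.g v w
  d_x : ∀ v w, J.dx v w = 3 / 2 * wedge J.ω₂ J.f₁ v w + 3 / 2 * wedge J.ω₁ J.f₂ v w
  d_f₁ : ∀ v w, J.df₁ v w = wedge J.f₁ J.x v w + 1 / 2 * wedge J.ω₁ J.g v w
    + 1 / 2 * wedge J.φ J.f₁ v w + Q₁ * wedge J.ω₀ J.ω₂ v w
  d_f₂ : ∀ v w, J.df₂ v w = -wedge J.f₂ J.x v w + 1 / 2 * wedge J.ω₂ J.g v w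
    + 1 / 2 * wedge J.φ J.f₂ v w + Q₂ * wedge J.ω₀ J.ω₁ v w
  d_g : ∀ v w, J.dg v w = 2 * wedge J.f₁ J.f₂ v w + wedge J.φ J.g v w
    + (U₁ * wedge J.ω₁ J.ω₀ v w + U₂ * wedge J.ω₂ J.ω₀ v w)

/-- The joint kernel of the connection forms. -/
def IsHorizontal (J : Jet T) (v : T) : Prop := J.φ v = 0 ∧ J.x v = 0 ∧ J.f₁ v = 0 ∧ J.f₂ v = 0 ∧ J.g v = 0

/-- The canonical normalization at a point. -/
structure Canonical (J : Jet T) : Prop where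
  d_ω₁ : ∀ v w, J.dω₁ v w = 1 / 2 * wedge J.ω₁ J.φ v w + wedge J.ω₁ J.x v w + wedge J.ω₀ J.f₁ v w
  d_ω₂ : ∀ v w, J.dω₂ v w = 1 / 2 * wedge J.ω₂ J.φ v w - wedge J.ω₂ J.x v w + wedge J.ω₀ J.f₂ v w
  d_φ : ∀ v w, J.dφ v w = wedge J.ω₁ J.f₂ v w - wedge J.ω₂ J.f₁ v w + wedge J.ω₀ J.g v w
  d_x : ∃ l : T →L[ℝ] ℂ, ∀ v w, J.dx v w - 3 / 2 * wedge J.ω₂ J.f₁ v w - 3 / 2 * wedge J.ω₁ J.f₂ v w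
    = wedge J.ω₀ l v w
  terms_x : ∃ r : ℂ, ∀ v, J.IsHorizontal v → ∀ w, J.IsHorizontal w → J.dx v w
    - 3 / 2 * wedge J.ω₂ J.f₁ v w - 3 / 2 * wedge J.ω₁ J.f₂ v w = r * wedge J.ω₁ J.ω₂ v w
  terms_f₁ : ∃ q r : ℂ, ∀ v, J.IsHorizontal v → ∀ w, J.IsHorizontal w → J.df₁ v w - wedge J.f₁ J.x v w
    - 1 / 2 * wedge J.ω₁ J.g v w - 1 / 2 * wedge J.φ J.f₁ v w =
      q * wedge J.ω₀ J.ω₂ v w + r * wedge J.ω₁ J.ω₂ v w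

/-- For a solution `Ω₁¹` is zero and `Φ¹` is a multiple of `ω ∧ ω²`, so none of the forbidden terms
can occur. -/
lemma Solves.canonical {J : Jet T} {Q₁ Q₂ U₁ U₂ : ℂ} (h : J.Solves Q₁ Q₂ U₁ U₂) : J.Canonical where
  d_ω₁ := h.d_ω₁
  d_ω₂ := h.d_ω₂
  d_φ := h.d_φ
  d_x := ⟨0, fun v w => by rw [h.d_x]; simp [wedge]⟩
  terms_x := ⟨0, fun v _ w _ => by rw [h.d_x]; ring⟩
  terms_f₁ := ⟨Q₁, 0, fun v _ w _ => by rw [h.d_f₁]; ring⟩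

/-- A vector is horizontal for the pulled-back jet exactly when its image is horizontal, so the
conditions restricted to horizontal vectors pull back as well. -/
lemma Canonical.comap {J : Jet T} (h : J.Canonical) (L : T' →L[ℝ] T) : (J.comap L).Canonical where
  d_ω₁ v w := h.d_ω₁ (L v) (L w)
  d_ω₂ v w := h.d_ω₂ (L v) (L w)
  d_φ v w := h.d_φ (L v) (L w)
  d_x := h.d_x.imp' (fun l => l.comp L) fun _ H v w => H (L v) (L w)
  terms_x := h.terms_x.imp fun _ H v hv w hw => H (L v) hv (L w) hw
  terms_f₁ := h.terms_f₁.imp fun _ => Exists.imp fun _ H v hv w hw => H (L v) hv (L w) hw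

/-- The structure equations are tested on pairs of vectors, so a surjective map transports them
forwards. It is applied to differentials of inverse charts. -/
lemma Solves.of_comap {J : Jet T} {L : T' →L[ℝ] T} (hL : Function.Surjective L) {Q₁ Q₂ U₁ U₂ : ℂ}
    (h : (J.comap L).Solves Q₁ Q₂ U₁ U₂) : J.Solves Q₁ Q₂ U₁ U₂ where
  d_ω₁ := hL.forall₂.2 h.d_ω₁
  d_ω₂ := hL.forall₂.2 h.d_ω₂
  d_φ := hL.forall₂.2 h.d_φ
  d_x := hL.forall₂.2 h.d_x
  d_f₁ := hL.forall₂.2 h.d_f₁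
  d_f₂ := hL.forall₂.2 h.d_f₂
  d_g := hL.forall₂.2 h.d_g

end Jet

/-- The matrix of a Cartan connection. -/
def cartanMat {T : Type*} [AddCommGroup T] [Module ℝ T] [TopologicalSpace T]
    (ω₀ ω₁ ω₂ φ x f₁ f₂ g : T →L[ℝ] ℂ) : Matrix (Fin 3) (Fin 3) (T →L[ℝ] ℂ) :=
  !![-((1 / 2 : ℂ) • φ) - (1 / 3 : ℂ) • x, -f₂, -((1 / 4 : ℂ) • g);
    ω₁, (2 / 3 : ℂ) • x, (1 / 2 : ℂ) • f₁;
    (2 : ℂ) • ω₀, (2 : ℂ) • ω₂, (1 / 2 : ℂ) • φ - (1 / 3 : ℂ) • x]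

variable {V : Type*} [NormedAddCommGroup V] [NormedSpace ℝ V]

/-- The jet of eight forms on a normed space. -/
def jetOf (ω₀ ω₁ ω₂ φ x f₁ f₂ g : V → V →L[ℝ] ℂ) (q : V) : Jet V :=
  ⟨ω₀ q, ω₁ q, ω₂ q, φ q, x q, f₁ q, f₂ q, g q, extD ω₁ q, extD ω₂ q, extD φ q, extD x q,
    extD f₁ q, extD f₂ q, extD g q⟩

/-- The curvature of a Cartan matrix. -/
lemma curv_cartanMat {ω₀ ω₁ ω₂ φ x f₁ f₂ g : V → V →L[ℝ] ℂ} {q : V}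
    (hω₀ : DifferentiableAt ℝ ω₀ q) (hω₂ : DifferentiableAt ℝ ω₂ q)
    (hφ : DifferentiableAt ℝ φ q) (hx : DifferentiableAt ℝ x q) (hf₁ : DifferentiableAt ℝ f₁ q)
    (hg : DifferentiableAt ℝ g q) (v w : V) :
    -- `X` is `Ω₁¹`, and `P` is the defect of the equation for `dφ`. Both lie on the diagonal, in
    -- combinations of total trace zero.
    let X := extD x q v w - 3 / 2 * wedge (ω₂ q) (f₁ q) v w - 3 / 2 * wedge (ω₁ q) (f₂ q) v w
    let P := extD φ q v w - wedge (ω₁ q) (f₂ q) v w + wedge (ω₂ q) (f₁ q) v w - wedge (ω₀ q) (g q) v w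
    curv (fun q => cartanMat (ω₀ q) (ω₁ q) (ω₂ q) (φ q) (x q) (f₁ q) (f₂ q) (g q)) q v w =
      -- Off the diagonal each entry is a multiple of the defect of a single structure equation. The
      -- lower left one is the defect of (1).
      !![-(1 / 2) * P - 1 / 3 * X,
          -(extD f₂ q v w + wedge (f₂ q) (x q) v w - 1 / 2 * wedge (ω₂ q) (g q) v w
            - 1 / 2 * wedge (φ q) (f₂ q) v w),
          -(1 / 4) * (extD g q v w - 2 * wedge (f₁ q) (f₂ q) v w - wedge (φ q) (g q) v w);
        extD ω₁ q v w - 1 / 2 * wedge (ω₁ q) (φ q) v w - wedge (ω₁ q) (x q) v w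
            - wedge (ω₀ q) (f₁ q) v w, 2 / 3 * X,
          1 / 2 * (extD f₁ q v w - wedge (f₁ q) (x q) v w - 1 / 2 * wedge (ω₁ q) (g q) v w
            - 1 / 2 * wedge (φ q) (f₁ q) v w);
        2 * (extD ω₀ q v w - wedge (ω₁ q) (ω₂ q) v w - wedge (ω₀ q) (φ q) v w),
          2 * (extD ω₂ q v w - 1 / 2 * wedge (ω₂ q) (φ q) v w + wedge (ω₂ q) (x q) v w
            - wedge (ω₀ q) (f₂ q) v w),
          1 / 2 * P - 1 / 3 * X] := by
  intro X P
  have s : ∀ (c : ℂ) {α : V → V →L[ℝ] ℂ}, DifferentiableAt ℝ α q →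
      DifferentiableAt ℝ (fun q => c • α q) q := fun c α h => (h.hasFDerivAt.const_smul c).differentiableAt
  have e00 : extD (fun q => -((1 / 2 : ℂ) • φ q) - (1 / 3 : ℂ) • x q) q v w =
      -(1 / 2 * extD φ q v w) - 1 / 3 * extD x q v w := by
    rw [extD_sub (α := fun q => -((1 / 2 : ℂ) • φ q)) (s _ hφ).neg (s _ hx),
      extD_neg (α := fun q => (1 / 2 : ℂ) • φ q), extD_const_smul _ hφ, extD_const_smul _ hx]
  have e22 : extD (fun q => (1 / 2 : ℂ) • φ q - (1 / 3 : ℂ) • x q) q v w =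
      1 / 2 * extD φ q v w - 1 / 3 * extD x q v w := by
    rw [extD_sub (α := fun q => (1 / 2 : ℂ) • φ q) (s _ hφ) (s _ hx),
      extD_const_smul _ hφ, extD_const_smul _ hx]
  have e01 : extD (fun q => -f₂ q) q v w = -extD f₂ q v w := extD_neg v w
  have e02 : extD (fun q => -((1 / 4 : ℂ) • g q)) q v w = -(1 / 4 * extD g q v w) := by
    rw [extD_neg (α := fun q => (1 / 4 : ℂ) • g q), extD_const_smul _ hg]
  have a00 : ∀ v, (-((1 / 2 : ℂ) • φ q) - (1 / 3 : ℂ) • x q) v = -(1 / 2 * φ q v) - 1 / 3 * x q v :=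
    fun _ => rfl
  have a22 : ∀ v, ((1 / 2 : ℂ) • φ q - (1 / 3 : ℂ) • x q) v = 1 / 2 * φ q v - 1 / 3 * x q v :=
    fun _ => rfl
  have a02 : ∀ v, (-((1 / 4 : ℂ) • g q)) v = -(1 / 4 * g q v) := fun _ => rfl
  have a01 : ∀ v, (-f₂ q) v = -f₂ q v := fun _ => rfl
  have as : ∀ (c : ℂ) (α : V →L[ℝ] ℂ) v, (c • α) v = c * α v := fun _ _ _ => rfl
  ext i j
  fin_cases i <;> fin_cases j <;>
    simp only [curv, cartanMat, Matrix.of_apply, Matrix.cons_val', Matrix.cons_val_zero,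
      Matrix.cons_val_one, Matrix.cons_val, Fin.zero_eta, Fin.mk_one, Fin.reduceFinMk,
      Fin.sum_univ_three, Fin.isValue]
  · rw [e00]; simp only [wedge, a00, a02, a01, as, X, P]; ring
  · rw [e01]; simp only [wedge, a00, a02, a01, as]; ring
  · rw [e02]; simp only [wedge, a00, a02, a01, a22, as]; ring
  · simp only [wedge, a00, as]; ring
  · rw [extD_const_smul _ hx]; simp only [wedge, a01, as, X]; ring
  · rw [extD_const_smul _ hf₁]; simp only [wedge, a02, a22, as]; ring
  · rw [extD_const_smul _ hω₀]; simp only [wedge, a00, a22, as]; ring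
  · rw [extD_const_smul _ hω₂]; simp only [wedge, a01, a22, as]; ring
  · rw [e22]; simp only [wedge, a02, a22, as, X, P]; ring

end Jets

/-! ### The Cartan connection in coordinates -/

section Flat

/-- The domain of fibre coordinates over `O`. -/
def flatDomain (O : Set E3) : Set EY := {q | q.1 ∈ O ∧ q.2 0 ≠ 0 ∧ q.2 1 ≠ 0}

/-- The differentials of the fibre coordinates. -/
def pr (i : Fin 5) : EY →L[ℝ] ℂ :=
  (ContinuousLinearMap.proj (R := ℝ) (φ := fun _ : Fin 5 => ℂ) i).comp
    (ContinuousLinearMap.snd ℝ E3 (Fin 5 → ℂ))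

/-- The pull-back of a form on the base. -/
def pull (α : E3 → E3 →L[ℝ] ℂ) (q : EY) : EY →L[ℝ] ℂ :=
  (α q.1).comp (ContinuousLinearMap.fst ℝ E3 (Fin 5 → ℂ))

lemma pr_apply (i : Fin 5) (v : EY) : pr i v = v.2 i := rfl

lemma pull_apply (α : E3 → E3 →L[ℝ] ℂ) (q v : EY) : pull α q v = α q.1 v.1 := rfl

variable {O : Set E3} {t t₁ t₂ : E3 → E3 →L[ℝ] ℂ}

lemma isOpen_flatDomain (hO : IsOpen O) : IsOpen (flatDomain O) := by
  refine (hO.preimage continuous_fst).inter (IsOpen.inter ?_ ?_)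
  · exact isOpen_ne_fun (pr 0).continuous continuous_const
  · exact isOpen_ne_fun (pr 1).continuous continuous_const

lemma contDiffOn_pull {α : E3 → E3 →L[ℝ] ℂ} (hα : ContDiffOn ℝ ∞ α O) :
    ContDiffOn ℝ ∞ (pull α) (flatDomain O) :=
  (hα.comp contDiff_fst.contDiffOn fun _ hq => hq.1).clm_comp contDiffOn_const

lemma contDiff_fibre (i : Fin 5) : ContDiff ℝ ∞ fun q : EY => q.2 i := (pr i).contDiff

lemma contDiffOn_inv₀ : ContDiffOn ℝ ∞ (fun q : EY => (q.2 0)⁻¹) (flatDomain O) :=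
  (contDiff_fibre 0).contDiffOn.inv fun _ hq => hq.2.1

lemma contDiffOn_inv₁ : ContDiffOn ℝ ∞ (fun q : EY => (q.2 1)⁻¹) (flatDomain O) :=
  (contDiff_fibre 1).contDiffOn.inv fun _ hq => hq.2.2

variable (t t₁ t₂) in
/-- The coordinate expression of `ω`. -/
def flatω₀ (q : EY) : EY →L[ℝ] ℂ := (q.2 0 * q.2 1) • pull t q

variable (t t₁ t₂) in
/-- The coordinate expression of `ω¹`. -/
def flatω₁ (q : EY) : EY →L[ℝ] ℂ := (q.2 2 * (q.2 0 * q.2 1)) • pull t q + q.2 0 • pull t₁ q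

variable (t t₁ t₂) in
/-- The coordinate expression of `ω²`. -/
def flatω₂ (q : EY) : EY →L[ℝ] ℂ := (q.2 3 * (q.2 0 * q.2 1)) • pull t q + q.2 1 • pull t₂ q

variable (t t₁ t₂) in
/-- The coordinate expression of `φ`. -/
def flatφ (q : EY) : EY →L[ℝ] ℂ :=
  (q.2 4) • pull t q + (q.2 0 * q.2 3) • pull t₁ q - (q.2 1 * q.2 2) • pull t₂ q
    -- The coordinate of `E` is `λ = k₀k₁`, so `-λ⁻¹ dλ` splits into these two logarithmic
    -- differentials.
    - (q.2 0)⁻¹ • pr 0 - (q.2 1)⁻¹ • pr 1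

/-- The gauge transformation of fibre coordinates. -/
def hmat (k : Fin 5 → ℂ) : Mat3 :=
  -- This is `a⁻¹ h` for an element `h` of the Borel group moving `(1, 1, 0, 0, 0)` to `k`, which
  -- means `k₀ = a²b`, `k₁ = 1/(ab²)`, `k₂ = -2abd`, `k₃ = c/a`, `k₄ = 4e/b - 2acd`. Since `a³ =
  -- k₀²k₁`, the matrix `h` itself involves a cube root, but `a⁻¹ h` does not.
  !![1, k 3, k 4 * ((k 0)⁻¹ * (k 1)⁻¹) / 4 - k 2 * k 3 / 4;
    0, (k 0)⁻¹, -(k 2 * (k 0)⁻¹) / 2;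
    0, 0, (k 0)⁻¹ * (k 1)⁻¹]

/-- The inverse of `hmat`. -/
def hinv (k : Fin 5 → ℂ) : Mat3 :=
  !![1, -(k 3 * k 0), -(k 0 * k 1 * k 2 * k 3 + k 4) / 4;
    0, k 0, k 0 * k 1 * k 2 / 2;
    0, 0, k 0 * k 1]

/-- The trace correction. -/
def traceForm (q : EY) : EY →L[ℝ] ℂ :=
  -- As `a³ = k₀²k₁`, this is the logarithmic differential of `a`. It restores the trace lost by
  -- passing from `h` to `a⁻¹ h`.
  (2 / 3 * (q.2 0)⁻¹) • pr 0 + (1 / 3 * (q.2 1)⁻¹) • pr 1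

lemma hinv_mul_hmat {k : Fin 5 → ℂ} (h0 : k 0 ≠ 0) (h1 : k 1 ≠ 0) : hinv k * hmat k = 1 := by
  ext i j
  fin_cases i <;> fin_cases j <;>
    simp [hinv, hmat, Matrix.mul_apply, Fin.sum_univ_three] <;> field_simp <;> ring

lemma contDiffOn_hmat (i j : Fin 3) :
    ContDiffOn ℝ ∞ (fun q : EY => hmat q.2 i j) (flatDomain O) := by
  have h := fun i => (contDiff_fibre i).contDiffOn (s := flatDomain O)
  have h0 := contDiffOn_inv₀ (O := O)
  have h1 := contDiffOn_inv₁ (O := O)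
  fin_cases i <;> fin_cases j <;> simp only [hmat, Matrix.of_apply, Matrix.cons_val',
    Matrix.cons_val_zero, Matrix.cons_val_one, Matrix.cons_val, Fin.zero_eta, Fin.mk_one,
    Fin.reduceFinMk, Fin.isValue]
  · exact contDiffOn_const
  · exact h 3
  · exact (((h 4).mul (h0.mul h1)).mul contDiffOn_const).sub (((h 2).mul (h 3)).mul contDiffOn_const)
  · exact contDiffOn_const
  · exact h0
  · exact ((h 2).mul h0).neg.mul contDiffOn_const
  · exact contDiffOn_const
  · exact contDiffOn_const
  · exact h0.mul h1

lemma contDiffOn_hinv (i j : Fin 3) :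
    ContDiffOn ℝ ∞ (fun q : EY => hinv q.2 i j) (flatDomain O) := by
  have h := fun i => (contDiff_fibre i).contDiffOn (s := flatDomain O)
  fin_cases i <;> fin_cases j <;> simp only [hinv, Matrix.of_apply, Matrix.cons_val',
    Matrix.cons_val_zero, Matrix.cons_val_one, Matrix.cons_val, Fin.zero_eta, Fin.mk_one,
    Fin.reduceFinMk, Fin.isValue]
  · exact contDiffOn_const
  · exact ((h 3).mul (h 0)).neg
  · exact (((((h 0).mul (h 1)).mul (h 2)).mul (h 3)).add (h 4)).neg.mul contDiffOn_const
  · exact contDiffOn_const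
  · exact h 0
  · exact (((h 0).mul (h 1)).mul (h 2)).mul contDiffOn_const
  · exact contDiffOn_const
  · exact contDiffOn_const
  · exact (h 0).mul (h 1)

lemma contDiffOn_traceForm : ContDiffOn ℝ ∞ traceForm (flatDomain O) :=
  ((contDiffOn_const.mul contDiffOn_inv₀).smul contDiffOn_const).add
    ((contDiffOn_const.mul contDiffOn_inv₁).smul contDiffOn_const)

lemma hasFDerivAt_fibre_inv {i : Fin 5} {q : EY} (h : q.2 i ≠ 0) :
    ∃ L : EY →L[ℝ] ℂ, HasFDerivAt (fun q : EY => (q.2 i)⁻¹) L q ∧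
      ∀ v, L v = -((q.2 i)⁻¹ * v.2 i * (q.2 i)⁻¹) := by
  refine ⟨_, (hasFDerivAt_inv' (𝕜 := ℝ) h).comp q (pr i).hasFDerivAt, fun v => ?_⟩
  rfl

/-- The form is closed because each summand is a constant times a logarithmic differential. -/
lemma extD_traceForm {q : EY} (hq : q.2 0 ≠ 0 ∧ q.2 1 ≠ 0) (v w : EY) :
    extD traceForm q v w = 0 := by
  obtain ⟨L0, h0, e0⟩ := hasFDerivAt_fibre_inv hq.1
  obtain ⟨L1, h1, e1⟩ := hasFDerivAt_fibre_inv hq.2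
  have h := (((h0.const_mul (2 / 3)).smul_const (pr 0)).add
    ((h1.const_mul (1 / 3)).smul_const (pr 1))).fderiv
  have h' : fderiv ℝ traceForm q = _ := h
  rw [extD, h']
  simp only [add_apply, ContinuousLinearMap.smulRight_apply, smul_apply, smul_eq_mul, e0, e1,
    pr_apply]
  ring

lemma matD_hmat {q : EY} (hq : q.2 0 ≠ 0 ∧ q.2 1 ≠ 0) (v : EY) :
    matD (fun q : EY => hmat q.2) q v =
      !![0, v.2 3, (v.2 4 * ((q.2 0)⁻¹ * (q.2 1)⁻¹) - q.2 4 * ((q.2 0)⁻¹ * (q.2 1)⁻¹) *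
            ((q.2 0)⁻¹ * v.2 0 + (q.2 1)⁻¹ * v.2 1)) / 4 - (v.2 2 * q.2 3 + q.2 2 * v.2 3) / 4;
        0, -((q.2 0)⁻¹ * v.2 0 * (q.2 0)⁻¹), -(v.2 2 * (q.2 0)⁻¹
            - q.2 2 * ((q.2 0)⁻¹ * v.2 0 * (q.2 0)⁻¹)) / 2;
        0, 0, -((q.2 0)⁻¹ * (q.2 1)⁻¹ * ((q.2 0)⁻¹ * v.2 0 + (q.2 1)⁻¹ * v.2 1))] := by
  obtain ⟨L0, h0, e0⟩ := hasFDerivAt_fibre_inv hq.1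
  obtain ⟨L1, h1, e1⟩ := hasFDerivAt_fibre_inv hq.2
  have hp : ∀ i, HasFDerivAt (fun q : EY => q.2 i) (pr i) q := fun i => (pr i).hasFDerivAt
  ext i j
  fin_cases i <;> fin_cases j <;> simp only [matD, hmat, Matrix.of_apply, Matrix.cons_val',
    Matrix.cons_val_zero, Matrix.cons_val_one, Matrix.cons_val, Fin.zero_eta, Fin.mk_one,
    Fin.reduceFinMk, Fin.isValue, fderiv_const_apply, zero_apply, div_eq_mul_inv]
  · rw [(hp 3).fderiv]; rfl
  · refine (congrArg (fun L : EY →L[ℝ] ℂ => L v) ((((hp 4).mul (h0.mul h1)).mul_const (4 : ℂ)⁻¹).sub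
      (((hp 2).mul (hp 3)).mul_const (4 : ℂ)⁻¹)).fderiv).trans ?_
    simp only [add_apply, sub_apply, smul_apply, smul_eq_mul, e0, e1, pr_apply, Pi.mul_apply]
    ring
  · rw [h0.fderiv, e0]
  · refine (congrArg (fun L : EY →L[ℝ] ℂ => L v)
      (((hp 2).mul h0).neg.mul_const (2 : ℂ)⁻¹).fderiv).trans ?_
    simp only [add_apply, neg_apply, smul_apply, smul_eq_mul, e0, pr_apply]
    ring
  · refine (congrArg (fun L : EY →L[ℝ] ℂ => L v) (h0.mul h1).fderiv).trans ?_
    simp only [add_apply, smul_apply, smul_eq_mul, e0, e1]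
    ring

/-! ### The gauge transform of the connection on the base, and its curvature -/

namespace BaseConnection

variable (C : BaseConnection O t t₁ t₂)

/-- The Cartan matrix on the base. -/
def baseMat (q : EY) : Matrix (Fin 3) (Fin 3) (EY →L[ℝ] ℂ) :=
  -- The zero in fourth place is `φ` along the section of `Y` given by the coframe.
  cartanMat (pull t q) (pull t₁ q) (pull t₂ q) (0 : EY →L[ℝ] ℂ) (pull C.x q) (pull C.f₁ q)
    (pull C.f₂ q) (pull C.g q)

/-- The Cartan matrix on the total space. -/
def totalMat (q : EY) : Matrix (Fin 3) (Fin 3) (EY →L[ℝ] ℂ) :=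
  gaugeForm C.baseMat (fun q => hmat q.2) (fun q => hinv q.2) traceForm q

/-- The coordinate expression of `ω₁¹`. -/
def flatX (q : EY) : EY →L[ℝ] ℂ := (3 / 2 : ℂ) • C.totalMat q 1 1

/-- The coordinate expression of `φ¹`. -/
def flatF₁ (q : EY) : EY →L[ℝ] ℂ := (2 : ℂ) • C.totalMat q 1 2

/-- The coordinate expression of `φ²`. -/
def flatF₂ (q : EY) : EY →L[ℝ] ℂ := -C.totalMat q 0 1

/-- The coordinate expression of `ψ`. -/
def flatG (q : EY) : EY →L[ℝ] ℂ := (-4 : ℂ) • C.totalMat q 0 2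

lemma evalForm_baseMat (q v : EY) : evalForm (C.baseMat q) v =
    !![-(1 / 3 * C.x q.1 v.1), -C.f₂ q.1 v.1, -(1 / 4 * C.g q.1 v.1);
      t₁ q.1 v.1, 2 / 3 * C.x q.1 v.1, 1 / 2 * C.f₁ q.1 v.1;
      2 * t q.1 v.1, 2 * t₂ q.1 v.1, -(1 / 3 * C.x q.1 v.1)] := by
  ext i j
  fin_cases i <;> fin_cases j <;> simp [evalForm, baseMat, cartanMat, pull_apply]

/-- The jet of the coordinate expressions. -/
def flatJet (q : EY) : Jet EY :=
  jetOf (flatω₀ t) (flatω₁ t t₁) (flatω₂ t t₂) (flatφ t t₁ t₂) C.flatX C.flatF₁ C.flatF₂ C.flatG q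

/-- Four entries hold by the definition of the forms `flatX`, `flatF₁`, `flatF₂`, `flatG`, which
undo the scalings in `cartanMat`. The content lies in the other five: the gauge transform reproduces
the tautological forms. -/
lemma totalMat_eq {q : EY} (hq : q ∈ flatDomain O) : C.totalMat q =
    cartanMat (flatω₀ t q) (flatω₁ t t₁ q) (flatω₂ t t₂ q) (flatφ t t₁ t₂ q) (C.flatX q)
      (C.flatF₁ q) (C.flatF₂ q) (C.flatG q) := by
  have h0 := hq.2.1
  have h1 := hq.2.2
  have key : ∀ v i j, C.totalMat q i j v = (hinv q.2 * evalForm (C.baseMat q) v * hmat q.2 +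
      hinv q.2 * matD (fun q : EY => hmat q.2) q v + traceForm q v • (1 : Mat3)) i j := by
    intro v i j
    have := congrFun (congrFun (evalForm_gaugeForm C.baseMat (fun q => hmat q.2)
      (fun q => hinv q.2) traceForm q v) i) j
    exact this
  refine Matrix.ext fun i j => ContinuousLinearMap.ext fun v => ?_
  have htr : traceForm q v = 2 / 3 * (q.2 0)⁻¹ * v.2 0 + 1 / 3 * (q.2 1)⁻¹ * v.2 1 := rfl
  -- The corners of the diagonal also contain `ω₁¹`, which is by definition a multiple of the middle
  -- entry.
  have k11 := key v 1 1
  have kk := key v i j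
  rw [evalForm_baseMat, matD_hmat ⟨h0, h1⟩] at kk k11
  have hx : C.flatX q v = 3 / 2 * C.totalMat q 1 1 v := rfl
  have hφ : flatφ t t₁ t₂ q v = q.2 4 * t q.1 v.1 + q.2 0 * q.2 3 * t₁ q.1 v.1
    - q.2 1 * q.2 2 * t₂ q.1 v.1 - (q.2 0)⁻¹ * v.2 0 - (q.2 1)⁻¹ * v.2 1 := rfl
  fin_cases i <;> fin_cases j
  · change C.totalMat q 0 0 v = -(1 / 2 * flatφ t t₁ t₂ q v) - 1 / 3 * C.flatX q v
    refine kk.trans ?_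
    rw [hx, k11, hφ, htr]
    simp [hinv, hmat]
    field_simp
    ring
  · change C.totalMat q 0 1 v = -(-(C.totalMat q 0 1 v))
    ring
  · change C.totalMat q 0 2 v = -(1 / 4 * (-4 * C.totalMat q 0 2 v))
    ring
  · refine kk.trans ?_
    change _ = q.2 2 * (q.2 0 * q.2 1) * t q.1 v.1 + q.2 0 * t₁ q.1 v.1
    simp [hinv, hmat]
    ring
  · change C.totalMat q 1 1 v = 2 / 3 * (3 / 2 * C.totalMat q 1 1 v)
    ring
  · change C.totalMat q 1 2 v = 1 / 2 * (2 * C.totalMat q 1 2 v)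
    ring
  · refine kk.trans ?_
    change _ = 2 * (q.2 0 * q.2 1 * t q.1 v.1)
    simp [hinv, hmat]
    ring
  · refine kk.trans ?_
    change _ = 2 * (q.2 3 * (q.2 0 * q.2 1) * t q.1 v.1 + q.2 1 * t₂ q.1 v.1)
    simp [hinv, hmat]
    field_simp
  · change C.totalMat q 2 2 v = 1 / 2 * flatφ t t₁ t₂ q v - 1 / 3 * C.flatX q v
    refine kk.trans ?_
    rw [hx, k11, hφ, htr]
    simp [hinv, hmat]
    field_simp
    ring

lemma contDiffOn_baseMat (ht : ContDiffOn ℝ ∞ t O) (ht₁ : ContDiffOn ℝ ∞ t₁ O)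
    (ht₂ : ContDiffOn ℝ ∞ t₂ O) (i j : Fin 3) :
    ContDiffOn ℝ ∞ (fun q => C.baseMat q i j) (flatDomain O) := by
  have p := fun {α : E3 → E3 →L[ℝ] ℂ} (hα : ContDiffOn ℝ ∞ α O) => contDiffOn_pull hα
  have s := fun (c : ℂ) {α : EY → EY →L[ℝ] ℂ} (hα : ContDiffOn ℝ ∞ α (flatDomain O)) =>
    contDiffOn_const (c := c) |>.smul hα
  fin_cases i <;> fin_cases j
  · exact (s _ contDiffOn_const).neg.sub (s _ (p C.smooth_x))
  · exact (p C.smooth_f₂).neg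
  · exact (s _ (p C.smooth_g)).neg
  · exact p ht₁
  · exact s _ (p C.smooth_x)
  · exact s _ (p C.smooth_f₁)
  · exact s _ (p ht)
  · exact s _ (p ht₂)
  · exact (s _ contDiffOn_const).sub (s _ (p C.smooth_x))

lemma contDiffOn_totalMat (hO : IsOpen O) (ht : ContDiffOn ℝ ∞ t O) (ht₁ : ContDiffOn ℝ ∞ t₁ O)
    (ht₂ : ContDiffOn ℝ ∞ t₂ O) (i j : Fin 3) :
    ContDiffOn ℝ ∞ (fun q => C.totalMat q i j) (flatDomain O) := by
  refine ContDiffOn.add (ContDiffOn.add (ContDiffOn.sum fun k _ => ContDiffOn.sum fun l _ => ?_)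
    (ContDiffOn.sum fun k _ => ?_)) ((contDiffOn_const (c := (1 : Mat3) i j)).smul contDiffOn_traceForm)
  · exact ((contDiffOn_hinv i k).mul (contDiffOn_hmat l j)).smul
      (C.contDiffOn_baseMat ht ht₁ ht₂ k l)
  · exact (contDiffOn_hinv i k).smul
      ((contDiffOn_hmat k j).fderiv_of_isOpen (isOpen_flatDomain hO) (by simp))

/-- By the structure equations on the base all defects in `curv_cartanMat` vanish except `Φ¹`, `Φ²`
and `Ψ`, which keep their four coefficients. -/
lemma curv_baseMat (hO : IsOpen O) (ht : ContDiffOn ℝ ∞ t O) (ht₁ : ContDiffOn ℝ ∞ t₁ O)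
    (ht₂ : ContDiffOn ℝ ∞ t₂ O)
    (hdt : ∀ u ∈ O, ∀ v w, extD t u v w = wedge (t₁ u) (t₂ u) v w) {q : EY}
    (hq : q ∈ flatDomain O) (v w : EY) : curv C.baseMat q v w =
      !![0, -(C.Q₂ q.1 * wedge (t q.1) (t₁ q.1) v.1 w.1),
          -(1 / 4) * (C.U₁ q.1 * wedge (t₁ q.1) (t q.1) v.1 w.1
            + C.U₂ q.1 * wedge (t₂ q.1) (t q.1) v.1 w.1);
        0, 0, 1 / 2 * (C.Q₁ q.1 * wedge (t q.1) (t₂ q.1) v.1 w.1); 0, 0, 0] := by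
  have dO : ∀ {α : E3 → E3 →L[ℝ] ℂ}, ContDiffOn ℝ ∞ α O → DifferentiableAt ℝ α q.1 := fun hα =>
    (hα.contDiffAt (hO.mem_nhds hq.1)).differentiableAt (by simp)
  have dp : ∀ {α : E3 → E3 →L[ℝ] ℂ}, ContDiffOn ℝ ∞ α O → DifferentiableAt ℝ (pull α) q := fun hα =>
    ((contDiffOn_pull hα).contDiffAt ((isOpen_flatDomain hO).mem_nhds hq)).differentiableAt
      (by simp)
  have ep : ∀ {α : E3 → E3 →L[ℝ] ℂ}, ContDiffOn ℝ ∞ α O →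
      extD (pull α) q v w = extD α q.1 v.1 w.1 := fun {α} hα =>
    extD_comp (α := α) (ContinuousLinearMap.fst ℝ E3 (Fin 5 → ℂ)) (u := q) (dO hα) v w
  have ew : ∀ α β : E3 → E3 →L[ℝ] ℂ, wedge (pull α q) (pull β q) v w =
    wedge (α q.1) (β q.1) v.1 w.1 := fun _ _ => rfl
  have e0 : extD (fun _ : EY => (0 : EY →L[ℝ] ℂ)) q v w = 0 := by simp [extD]
  have w0 : ∀ α : EY →L[ℝ] ℂ, wedge (0 : EY →L[ℝ] ℂ) α v w = 0 := by simp [wedge]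
  have w1 : ∀ α : EY →L[ℝ] ℂ, wedge α (0 : EY →L[ℝ] ℂ) v w = 0 := by simp [wedge]
  have h := curv_cartanMat (ω₀ := pull t) (ω₁ := pull t₁) (f₂ := pull C.f₂)
    (φ := fun _ => (0 : EY →L[ℝ] ℂ)) (dp ht)
    (dp ht₂) (differentiableAt_const _) (dp C.smooth_x) (dp C.smooth_f₁) (dp C.smooth_g) v w
  refine h.trans ?_
  have c1 := C.d_t₁ q.1 hq.1 v.1 w.1
  have c2 := C.d_t₂ q.1 hq.1 v.1 w.1
  have c3 := C.d_φ q.1 hq.1 v.1 w.1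
  have c4 := C.d_x q.1 hq.1 v.1 w.1
  have c5 := C.d_f₁ q.1 hq.1 v.1 w.1
  have c6 := C.d_f₂ q.1 hq.1 v.1 w.1
  have c7 := C.d_g q.1 hq.1 v.1 w.1
  have c8 := hdt q.1 hq.1 v.1 w.1
  simp only [ep ht, ep ht₁, ep ht₂, ep C.smooth_x, ep C.smooth_f₁, ep C.smooth_f₂, ep C.smooth_g,
    ew, e0, w0, w1, c1, c2, c4, c5, c6, c7, c8]
  ext i j
  fin_cases i <;> fin_cases j <;> simp only [Matrix.of_apply, Matrix.cons_val',
    Matrix.cons_val_zero, Matrix.cons_val_one, Matrix.cons_val, Fin.zero_eta, Fin.mk_one,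
    Fin.reduceFinMk, Fin.isValue]
  -- On the diagonal only the equation for `dφ` is left to use, which here has left side zero.
  · linear_combination -1 / 2 * c3
  · ring
  · ring
  · ring
  · ring
  · ring
  · ring
  · ring
  · linear_combination 1 / 2 * c3

/-- The coordinate expression of the coefficient `Q¹`. -/
def flatQ₁ (q : EY) : ℂ := C.Q₁ q.1 * (q.2 0)⁻¹ * (q.2 1)⁻¹ ^ 3

/-- The coordinate expression of the coefficient `Q²`. -/
def flatQ₂ (q : EY) : ℂ := C.Q₂ q.1 * (q.2 0)⁻¹ ^ 3 * (q.2 1)⁻¹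

/-- The coordinate expression of the coefficient `U₁`. -/
def flatU₁ (q : EY) : ℂ :=
  -- Conjugation adds multiples of the entries of `Φ²` and `Φ¹` to the upper right corner. Hence
  -- `Q₂` enters `U₁` through `k₂`, and `Q₁` enters `U₂` through `k₃`.
  (2 * q.2 2 * C.Q₂ q.1 * (q.2 0)⁻¹ + C.U₁ q.1 * ((q.2 0)⁻¹ * (q.2 1)⁻¹)) *
    ((q.2 0)⁻¹ ^ 2 * (q.2 1)⁻¹)

/-- The coordinate expression of the coefficient `U₂`. -/
def flatU₂ (q : EY) : ℂ :=
  (C.U₂ q.1 * ((q.2 0)⁻¹ * (q.2 1)⁻¹) - 2 * q.2 3 * C.Q₁ q.1 * (q.2 1)⁻¹) *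
    ((q.2 0)⁻¹ * (q.2 1)⁻¹ ^ 2)

lemma contDiffOn_fst {f : E3 → ℂ} (hf : ContDiffOn ℝ ∞ f O) :
    ContDiffOn ℝ ∞ (fun q : EY => f q.1) (flatDomain O) :=
  hf.comp contDiff_fst.contDiffOn fun _ hq => hq.1

lemma contDiffOn_flatQ₁ : ContDiffOn ℝ ∞ C.flatQ₁ (flatDomain O) :=
  ((contDiffOn_fst C.smooth_Q₁).mul contDiffOn_inv₀).mul (contDiffOn_inv₁.pow 3)

lemma contDiffOn_flatQ₂ : ContDiffOn ℝ ∞ C.flatQ₂ (flatDomain O) :=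
  ((contDiffOn_fst C.smooth_Q₂).mul (contDiffOn_inv₀.pow 3)).mul contDiffOn_inv₁

lemma contDiffOn_flatU₁ : ContDiffOn ℝ ∞ C.flatU₁ (flatDomain O) :=
  ((((contDiffOn_const.mul (contDiff_fibre 2).contDiffOn).mul (contDiffOn_fst C.smooth_Q₂)).mul
    contDiffOn_inv₀).add ((contDiffOn_fst C.smooth_U₁).mul (contDiffOn_inv₀.mul contDiffOn_inv₁))).mul
    ((contDiffOn_inv₀.pow 2).mul contDiffOn_inv₁)

lemma contDiffOn_flatU₂ : ContDiffOn ℝ ∞ C.flatU₂ (flatDomain O) :=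
  (((contDiffOn_fst C.smooth_U₂).mul (contDiffOn_inv₀.mul contDiffOn_inv₁)).sub
    (((contDiffOn_const.mul (contDiff_fibre 3).contDiffOn).mul (contDiffOn_fst C.smooth_Q₁)).mul
    contDiffOn_inv₁)).mul (contDiffOn_inv₀.mul (contDiffOn_inv₁.pow 2))

end BaseConnection

lemma contDiffOn_flatω₀ (ht : ContDiffOn ℝ ∞ t O) : ContDiffOn ℝ ∞ (flatω₀ t) (flatDomain O) :=
  ((contDiff_fibre 0).mul (contDiff_fibre 1)).contDiffOn.smul (contDiffOn_pull ht)

lemma contDiffOn_flatω₁ (ht : ContDiffOn ℝ ∞ t O) (ht₁ : ContDiffOn ℝ ∞ t₁ O) :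
    ContDiffOn ℝ ∞ (flatω₁ t t₁) (flatDomain O) :=
  (((contDiff_fibre 2).mul ((contDiff_fibre 0).mul (contDiff_fibre 1))).contDiffOn.smul
    (contDiffOn_pull ht)).add ((contDiff_fibre 0).contDiffOn.smul (contDiffOn_pull ht₁))

lemma contDiffOn_flatω₂ (ht : ContDiffOn ℝ ∞ t O) (ht₂ : ContDiffOn ℝ ∞ t₂ O) :
    ContDiffOn ℝ ∞ (flatω₂ t t₂) (flatDomain O) :=
  (((contDiff_fibre 3).mul ((contDiff_fibre 0).mul (contDiff_fibre 1))).contDiffOn.smul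
    (contDiffOn_pull ht)).add ((contDiff_fibre 1).contDiffOn.smul (contDiffOn_pull ht₂))

lemma contDiffOn_flatφ (ht : ContDiffOn ℝ ∞ t O) (ht₁ : ContDiffOn ℝ ∞ t₁ O)
    (ht₂ : ContDiffOn ℝ ∞ t₂ O) : ContDiffOn ℝ ∞ (flatφ t t₁ t₂) (flatDomain O) :=
  ((((((contDiff_fibre 4).contDiffOn.smul (contDiffOn_pull ht)).add
    (((contDiff_fibre 0).mul (contDiff_fibre 3)).contDiffOn.smul (contDiffOn_pull ht₁))).sub
    (((contDiff_fibre 1).mul (contDiff_fibre 2)).contDiffOn.smul (contDiffOn_pull ht₂))).sub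
    (contDiffOn_inv₀.smul contDiffOn_const)).sub (contDiffOn_inv₁.smul contDiffOn_const))

namespace BaseConnection

variable (C : BaseConnection O t t₁ t₂)

lemma contDiffOn_flatX (hO : IsOpen O) (ht : ContDiffOn ℝ ∞ t O) (ht₁ : ContDiffOn ℝ ∞ t₁ O)
    (ht₂ : ContDiffOn ℝ ∞ t₂ O) : ContDiffOn ℝ ∞ C.flatX (flatDomain O) :=
  (contDiffOn_const (c := (3 / 2 : ℂ))).smul (C.contDiffOn_totalMat hO ht ht₁ ht₂ 1 1)

lemma contDiffOn_flatF₁ (hO : IsOpen O) (ht : ContDiffOn ℝ ∞ t O) (ht₁ : ContDiffOn ℝ ∞ t₁ O)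
    (ht₂ : ContDiffOn ℝ ∞ t₂ O) : ContDiffOn ℝ ∞ C.flatF₁ (flatDomain O) :=
  (contDiffOn_const (c := (2 : ℂ))).smul (C.contDiffOn_totalMat hO ht ht₁ ht₂ 1 2)

lemma contDiffOn_flatF₂ (hO : IsOpen O) (ht : ContDiffOn ℝ ∞ t O) (ht₁ : ContDiffOn ℝ ∞ t₁ O)
    (ht₂ : ContDiffOn ℝ ∞ t₂ O) : ContDiffOn ℝ ∞ C.flatF₂ (flatDomain O) :=
  (C.contDiffOn_totalMat hO ht ht₁ ht₂ 0 1).neg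

lemma contDiffOn_flatG (hO : IsOpen O) (ht : ContDiffOn ℝ ∞ t O) (ht₁ : ContDiffOn ℝ ∞ t₁ O)
    (ht₂ : ContDiffOn ℝ ∞ t₂ O) : ContDiffOn ℝ ∞ C.flatG (flatDomain O) :=
  (contDiffOn_const (c := (-4 : ℂ))).smul (C.contDiffOn_totalMat hO ht ht₁ ht₂ 0 2)

/-- The structure equations on the total space. -/
theorem flat_solves (hO : IsOpen O) (ht : ContDiffOn ℝ ∞ t O) (ht₁ : ContDiffOn ℝ ∞ t₁ O)
    (ht₂ : ContDiffOn ℝ ∞ t₂ O)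
    (hdt : ∀ u ∈ O, ∀ v w, extD t u v w = wedge (t₁ u) (t₂ u) v w) {q : EY}
    (hq : q ∈ flatDomain O) :
    (C.flatJet q).Solves (C.flatQ₁ q) (C.flatQ₂ q) (C.flatU₁ q) (C.flatU₂ q) ∧
      ∀ v w, extD (flatω₀ t) q v w = wedge (flatω₁ t t₁ q) (flatω₂ t t₂ q) v w
        + wedge (flatω₀ t q) (flatφ t t₁ t₂ q) v w := by
  have hS := isOpen_flatDomain hO
  have hn := hS.mem_nhds hq
  have df : ∀ {α : EY → EY →L[ℝ] ℂ}, ContDiffOn ℝ ∞ α (flatDomain O) → DifferentiableAt ℝ α q :=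
    fun hα => (hα.contDiffAt hn).differentiableAt (by simp)
  -- The matrix of coordinate expressions is a gauge transform of the base matrix, so its curvature
  -- is a conjugate of the base curvature. Conjugation by upper triangular matrices preserves the
  -- strictly upper triangular shape.
  have key : ∀ v w, curv (fun q => cartanMat (flatω₀ t q) (flatω₁ t t₁ q) (flatω₂ t t₂ q)
      (flatφ t t₁ t₂ q) (C.flatX q) (C.flatF₁ q) (C.flatF₂ q) (C.flatG q)) q v w =
      hinv q.2 * curv C.baseMat q v w * hmat q.2 := by
    intro v w
    rw [← curv_gaugeForm (A := C.baseMat) (H := fun q => hmat q.2) (K := fun q => hinv q.2)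
      (ε := traceForm) (fun i j => df (C.contDiffOn_baseMat ht ht₁ ht₂ i j))
      (fun i j => (contDiffOn_hmat i j).contDiffAt hn) (fun i j => (contDiffOn_hinv i j).contDiffAt hn)
      (df contDiffOn_traceForm) (extD_traceForm hq.2)
      (Filter.eventually_of_mem hn fun q' hq' => hinv_mul_hmat hq'.2.1 hq'.2.2)]
    ext i j
    have hE : EqOn (fun q => cartanMat (flatω₀ t q) (flatω₁ t t₁ q) (flatω₂ t t₂ q)
      (flatφ t t₁ t₂ q) (C.flatX q) (C.flatF₁ q) (C.flatF₂ q) (C.flatG q) i j)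
      (fun q => C.totalMat q i j) (flatDomain O) := fun q hq =>
        (congrFun (congrFun (C.totalMat_eq hq) i) j).symm
    simp only [curv, Matrix.of_apply]
    rw [extD_congr_on hS hE hq, ← C.totalMat_eq hq]
    rfl
  -- Comparing with `curv_cartanMat` entry by entry yields all structure equations, equation (1)
  -- included.
  have key2 : ∀ v w i j, _ := fun v w i j => congrFun (congrFun ((curv_cartanMat
    (df (contDiffOn_flatω₀ ht)) (df (contDiffOn_flatω₂ ht ht₂)) (df (contDiffOn_flatφ ht ht₁ ht₂))
    (df (C.contDiffOn_flatX hO ht ht₁ ht₂)) (df (C.contDiffOn_flatF₁ hO ht ht₁ ht₂))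
    (f₂ := C.flatF₂) (ω₁ := flatω₁ t t₁)
    (df (C.contDiffOn_flatG hO ht ht₁ ht₂)) v w).symm.trans (key v w)) i) j
  simp only [C.curv_baseMat hO ht ht₁ ht₂ hdt hq] at key2
  have h0 := hq.2.1
  have h1 := hq.2.2
  have a0 : ∀ v, flatω₀ t q v = q.2 0 * q.2 1 * t q.1 v.1 := fun _ => rfl
  have a1 : ∀ v, flatω₁ t t₁ q v = q.2 2 * (q.2 0 * q.2 1) * t q.1 v.1 + q.2 0 * t₁ q.1 v.1 :=
    fun _ => rfl
  have a2 : ∀ v, flatω₂ t t₂ q v = q.2 3 * (q.2 0 * q.2 1) * t q.1 v.1 + q.2 1 * t₂ q.1 v.1 :=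
    fun _ => rfl
  refine ⟨⟨?_, ?_, ?_, ?_, ?_, ?_, ?_⟩, ?_⟩ <;> intro v w
  · have := key2 v w 1 0
    simp [hinv, hmat] at this
    simp only [flatJet, jetOf]
    linear_combination this
  · have := key2 v w 2 1
    simp [hinv, hmat] at this
    simp only [flatJet, jetOf]
    linear_combination this
  -- The difference of the two corner entries eliminates `Ω₁¹` and leaves the equation for `dφ`.
  · have h := key2 v w 0 0
    have h' := key2 v w 2 2
    simp [hinv, hmat] at h h'
    simp only [flatJet, jetOf]
    linear_combination h' - h
  · have h := key2 v w 1 1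
    simp [hinv, hmat] at h
    simp only [flatJet, jetOf]
    linear_combination h
  · have h := key2 v w 1 2
    simp [hinv, hmat] at h
    simp only [flatJet, jetOf]
    -- Conjugation multiplies this entry by `k₁⁻¹`, while `ω ∧ ω²` is `k₀k₁²` times `t ∧ t₂`. This
    -- accounts for the exponents in `flatQ₁`.
    have e : C.flatQ₁ q * wedge (flatω₀ t q) (flatω₂ t t₂ q) v w =
        (q.2 1)⁻¹ * (C.Q₁ q.1 * wedge (t q.1) (t₂ q.1) v.1 w.1) := by
      simp only [flatQ₁, wedge, a0, a2]
      field_simp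
      ring
    rw [e]
    field_simp at h ⊢
    linear_combination h
  · have h := key2 v w 0 1
    simp [hinv, hmat] at h
    simp only [flatJet, jetOf]
    have e : C.flatQ₂ q * wedge (flatω₀ t q) (flatω₁ t t₁ q) v w =
        (q.2 0)⁻¹ * (C.Q₂ q.1 * wedge (t q.1) (t₁ q.1) v.1 w.1) := by
      simp only [flatQ₂, wedge, a0, a1]
      field_simp
      ring
    rw [e]
    field_simp at h ⊢
    linear_combination -h
  · have h := key2 v w 0 2
    simp [hinv, hmat] at h
    simp only [flatJet, jetOf]
    have e : C.flatU₁ q * wedge (flatω₁ t t₁ q) (flatω₀ t q) v w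
        + C.flatU₂ q * wedge (flatω₂ t t₂ q) (flatω₀ t q) v w =
        (C.U₁ q.1 * wedge (t₁ q.1) (t q.1) v.1 w.1 + C.U₂ q.1 * wedge (t₂ q.1) (t q.1) v.1 w.1) *
          ((q.2 0)⁻¹ * (q.2 1)⁻¹) + 2 * q.2 2 * C.Q₂ q.1 * (q.2 0)⁻¹ *
            wedge (t₁ q.1) (t q.1) v.1 w.1 - 2 * q.2 3 * C.Q₁ q.1 * (q.2 1)⁻¹ *
            wedge (t₂ q.1) (t q.1) v.1 w.1 := by
      simp only [flatU₁, flatU₂, wedge, a0, a1, a2]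
      field_simp
      ring
    rw [e]
    simp only [wedge] at h ⊢
    field_simp at h ⊢
    linear_combination -1 / 2 * h
  · have h := key2 v w 2 0
    simp [hinv, hmat] at h
    linear_combination h

end BaseConnection

end Flat

/-! ### Uniqueness of the canonical connection forms -/

section Uniqueness

/-- Contraction with a complex combination of the vectors `e j`. -/
def contract {T : Type*} [AddCommGroup T] [Module ℝ T] [TopologicalSpace T] (c : Fin 3 → ℂ)
    (e : Fin 3 → T) (α : T →L[ℝ] ℂ) : ℂ := ∑ j, c j * α (e j)

section Pointwise

variable {T : Type*} [AddCommGroup T] [Module ℝ T] [TopologicalSpace T]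

/-- Contraction of `α ∧ β` with a complexified vector. Complex coefficients are needed because a
basis dual to complex covectors need not consist of real tangent vectors. -/
lemma sum_wedge (c : Fin 3 → ℂ) (e : Fin 3 → T) (α β : T →L[ℝ] ℂ) (v : T) :
    ∑ j, c j * wedge α β v (e j) = α v * contract c e β - contract c e α * β v := by
  simp only [contract, wedge, mul_sub, Finset.sum_sub_distrib, Finset.mul_sum, Finset.sum_mul]
  congr 1 <;> exact Finset.sum_congr rfl fun j _ => by ring

/-- Vectors on which three covectors are linearly independent. -/
def Independent (α β γ : T →L[ℝ] ℂ) (e : Fin 3 → T) : Prop :=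
  (Matrix.of fun i j => ![α, β, γ] i (e j)).det ≠ 0

/-- Dual combinations of vectors. -/
lemma Independent.exists_dual {α β γ : T →L[ℝ] ℂ} {e : Fin 3 → T} (h : Independent α β γ e) :
    ∃ c : Fin 3 → Fin 3 → ℂ, ∀ i, contract (c i) e α = (if i = 0 then 1 else 0) ∧
      contract (c i) e β = (if i = 1 then 1 else 0) ∧ contract (c i) e γ = (if i = 2 then 1 else 0) := by
  set A : Mat3 := Matrix.of fun i j => ![α, β, γ] i (e j) with hA
  have hd : IsUnit A.det := isUnit_iff_ne_zero.2 h
  refine ⟨fun i j => A⁻¹ j i, fun i => ?_⟩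
  have key : ∀ k, ∑ j, A⁻¹ j i * A k j = if i = k then 1 else 0 := by
    intro k
    have := congrFun (congrFun (Matrix.mul_nonsing_inv A hd) k) i
    rw [Matrix.mul_apply, Matrix.one_apply] at this
    simp only [eq_comm (a := i), ← this, mul_comm]
  exact ⟨key 0, key 1, key 2⟩

variable {w₀ w₁ w₂ : T →L[ℝ] ℂ} {e : Fin 3 → T}

/-- A 2-form `p w₀ ∧ w₁ + q w₀ ∧ w₂ + r w₁ ∧ w₂` determines its coefficients. -/
lemma Independent.coef_eq_zero (h : Independent w₀ w₁ w₂ e) {p q r : ℂ}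
    (H : ∀ i j, p * wedge w₀ w₁ (e i) (e j) + q * wedge w₀ w₂ (e i) (e j)
      + r * wedge w₁ w₂ (e i) (e j) = 0) : p = 0 ∧ q = 0 ∧ r = 0 := by
  obtain ⟨c, hc⟩ := h.exists_dual
  have key : ∀ a b, p * (contract (c a) e w₀ * contract (c b) e w₁
      - contract (c b) e w₀ * contract (c a) e w₁) + q * (contract (c a) e w₀ * contract (c b) e w₂
      - contract (c b) e w₀ * contract (c a) e w₂) + r * (contract (c a) e w₁ * contract (c b) e w₂
      - contract (c b) e w₁ * contract (c a) e w₂) = 0 := by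
    intro a b
    have h1 : ∀ i, ∑ j, c b j * (p * wedge w₀ w₁ (e i) (e j) + q * wedge w₀ w₂ (e i) (e j)
      + r * wedge w₁ w₂ (e i) (e j)) = 0 := fun i =>
      Finset.sum_eq_zero fun j _ => by rw [H, mul_zero]
    have h2 : ∑ i, c a i * ∑ j, c b j * (p * wedge w₀ w₁ (e i) (e j)
      + q * wedge w₀ w₂ (e i) (e j) + r * wedge w₁ w₂ (e i) (e j)) = 0 :=
      Finset.sum_eq_zero fun i _ => by rw [h1, mul_zero]
    rw [← h2]
    simp only [contract, wedge, Fin.sum_univ_three]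
    ring
  refine ⟨?_, ?_, ?_⟩
  · have := key 0 1; simpa [hc] using this
  · have := key 0 2; simpa [hc] using this
  · have := key 1 2; simpa [hc] using this

/-- The difference of two solutions of the structure equations for `dω¹`, `dω²`, `dφ`. -/
lemma Independent.cartan_lemma (h : Independent w₀ w₁ w₂ e) {ξ η₁ η₂ ζ : T →L[ℝ] ℂ}
    (h₁ : ∀ v w, wedge w₁ ξ v w + wedge w₀ η₁ v w = 0)
    (h₂ : ∀ v w, -wedge w₂ ξ v w + wedge w₀ η₂ v w = 0)
    (h₃ : ∀ v w, wedge w₁ η₂ v w - wedge w₂ η₁ v w + wedge w₀ ζ v w = 0) :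
    ∃ D E F G : ℂ, ∀ v, ξ v = D * w₀ v ∧ η₁ v = D * w₁ v + E * w₀ v ∧
      η₂ v = -D * w₂ v + F * w₀ v ∧ ζ v = F * w₁ v - E * w₂ v + G * w₀ v := by
  obtain ⟨c, hc⟩ := h.exists_dual
  have k₁ : ∀ a v, w₁ v * contract (c a) e ξ - contract (c a) e w₁ * ξ v +
      (w₀ v * contract (c a) e η₁ - contract (c a) e w₀ * η₁ v) = 0 := by
    intro a v
    rw [← sum_wedge, ← sum_wedge, ← Finset.sum_add_distrib]
    exact Finset.sum_eq_zero fun j _ => by rw [← mul_add, h₁, mul_zero]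
  have k₂ : ∀ a v, -(w₂ v * contract (c a) e ξ - contract (c a) e w₂ * ξ v) +
      (w₀ v * contract (c a) e η₂ - contract (c a) e w₀ * η₂ v) = 0 := by
    intro a v
    rw [← sum_wedge, ← sum_wedge, ← Finset.sum_neg_distrib, ← Finset.sum_add_distrib]
    exact Finset.sum_eq_zero fun j _ => by linear_combination c a j * h₂ v (e j)
  have k₃ : ∀ a v, w₁ v * contract (c a) e η₂ - contract (c a) e w₁ * η₂ v -
      (w₂ v * contract (c a) e η₁ - contract (c a) e w₂ * η₁ v) +
      (w₀ v * contract (c a) e ζ - contract (c a) e w₀ * ζ v) = 0 := by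
    intro a v
    rw [← sum_wedge, ← sum_wedge, ← sum_wedge, ← Finset.sum_sub_distrib, ← Finset.sum_add_distrib]
    exact Finset.sum_eq_zero fun j _ => by linear_combination c a j * h₃ v (e j)
  have app : ∀ {α β γ δ : T →L[ℝ] ℂ} {p q r : ℂ} (_ : ∀ v, α v = p * β v + q * γ v + r * δ v) (a),
      contract (c a) e α = p * contract (c a) e β + q * contract (c a) e γ + r * contract (c a) e δ := by
    intro α β γ δ p q r hh a
    simp only [contract, hh, Fin.sum_univ_three]
    ring
  simp [hc] at k₁ k₂ k₃
  -- The second relation puts `ξ` into the span of `w₂` and `w₀`, so `ξ` vanishes on the vector dual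
  -- to `w₁`. The first relation, contracted with that vector, then leaves only a multiple of `w₀`.
  have ξ1 : ∀ v, ξ v = contract (c 2) e ξ * w₂ v + -contract (c 2) e η₂ * w₀ v + 0 * w₀ v := fun v => by
    have := k₂ 2 v
    simp at this
    linear_combination this
  have e1 := app ξ1 1
  have e0 := app ξ1 0
  simp [hc] at e0 e1
  have ξ0 : ∀ v, ξ v = contract (c 1) e η₁ * w₀ v + 0 * w₀ v + 0 * w₀ v := fun v => by
    have := k₁ 1 v
    simp at this
    linear_combination -this + w₁ v * e1
  have e0' := app ξ0 0
  simp [hc] at e0'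
  -- Contracting the three relations with the vector dual to `w₀` expresses `η₁`, `η₂`, `ζ` through
  -- these four numbers.
  refine ⟨contract (c 0) e ξ, contract (c 0) e η₁, contract (c 0) e η₂, contract (c 0) e ζ,
    fun v => ⟨?_, ?_, ?_, ?_⟩⟩
  · linear_combination ξ0 v - w₀ v * e0'
  · have := k₁ 0 v
    simp at this
    linear_combination -this
  · have := k₂ 0 v
    simp at this
    linear_combination -this
  · have := k₃ 0 v
    simp at this
    linear_combination -this

/-- Independence persists for vectors corrected by vertical ones. -/
lemma Independent.congr (h : Independent w₀ w₁ w₂ e) {e' : Fin 3 → T}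
    (H : ∀ j, w₀ (e' j) = w₀ (e j) ∧ w₁ (e' j) = w₁ (e j) ∧ w₂ (e' j) = w₂ (e j)) :
    Independent w₀ w₁ w₂ e' := by
  have : (Matrix.of fun i j => ![w₀, w₁, w₂] i (e' j) : Mat3) =
      Matrix.of fun i j => ![w₀, w₁, w₂] i (e j) := by
    ext i j
    fin_cases i
    exacts [(H j).1, (H j).2.1, (H j).2.2]
  rwa [Independent, this]

end Pointwise

variable {V : Type*} [NormedAddCommGroup V] [NormedSpace ℝ V]

/-- Canonically normalized connection forms coincide with a solution of the structure equations. -/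
theorem canonical_unique {S : Set V} (hS : IsOpen S) {w₀ w₁ w₂ φ x f₁ f₂ g x' f₁' f₂' g' :
    V → V →L[ℝ] ℂ} {Q₁ Q₂ U₁ U₂ : V → ℂ} (hw : ContDiffOn ℝ ∞ w₀ S) (hx : ContDiffOn ℝ ∞ x S)
    (hx' : ContDiffOn ℝ ∞ x' S)
    (hdw : ∀ q ∈ S, ∀ v w, extD w₀ q v w = wedge (w₁ q) (w₂ q) v w + wedge (w₀ q) (φ q) v w)
    (h : ∀ q ∈ S, (jetOf w₀ w₁ w₂ φ x f₁ f₂ g q).Solves (Q₁ q) (Q₂ q) (U₁ q) (U₂ q))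
    (h' : ∀ q ∈ S, (jetOf w₀ w₁ w₂ φ x' f₁' f₂' g' q).Canonical)
    (hind : ∀ q ∈ S, ∃ e, Independent (w₀ q) (w₁ q) (w₂ q) e)
    (hvert : ∀ q ∈ S, ∀ a : Fin 5 → ℂ, ∃ v, (w₀ q v = 0 ∧ w₁ q v = 0 ∧ w₂ q v = 0) ∧ φ q v = a 0 ∧
      x q v = a 1 ∧ f₁ q v = a 2 ∧ f₂ q v = a 3 ∧ g q v = a 4) :
    EqOn x' x S ∧ EqOn f₁' f₁ S ∧ EqOn f₂' f₂ S ∧ EqOn g' g S := by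
  have diff : ∀ q ∈ S, ∃ D E F G : ℂ, ∀ v, x' q v = x q v + D * w₀ q v ∧
      f₁' q v = f₁ q v + (D * w₁ q v + E * w₀ q v) ∧ f₂' q v = f₂ q v + (-D * w₂ q v + F * w₀ q v) ∧
      g' q v = g q v + (F * w₁ q v - E * w₂ q v + G * w₀ q v) := by
    intro q hq
    obtain ⟨e, he⟩ := hind q hq
    obtain ⟨D, E, F, G, H⟩ := he.cartan_lemma (ξ := x' q - x q) (η₁ := f₁' q - f₁ q)
      (η₂ := f₂' q - f₂ q) (ζ := g' q - g q)
      (fun v w => by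
        have e1 := (h q hq).d_ω₁ v w
        have e2 := (h' q hq).d_ω₁ v w
        simp only [jetOf, wedge, sub_apply] at e1 e2 ⊢
        linear_combination e1 - e2)
      (fun v w => by
        have e1 := (h q hq).d_ω₂ v w
        have e2 := (h' q hq).d_ω₂ v w
        simp only [jetOf, wedge, sub_apply] at e1 e2 ⊢
        linear_combination e1 - e2)
      (fun v w => by
        have e1 := (h q hq).d_φ v w
        have e2 := (h' q hq).d_φ v w
        simp only [jetOf, wedge, sub_apply] at e1 e2 ⊢
        linear_combination e1 - e2)
    refine ⟨D, E, F, G, fun v => ?_⟩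
    obtain ⟨h1, h2, h3, h4⟩ := H v
    simp only [sub_apply] at h1 h2 h3 h4
    refine ⟨by linear_combination h1, by linear_combination h2, by linear_combination h3,
      by linear_combination h4⟩
  -- Nothing is known about the regularity of the four functions. They are never differentiated
  -- below.
  choose! D E F G H using diff
  have hD : ∀ q ∈ S, D q = 0 := by
    intro q hq
    have hn := hS.mem_nhds hq
    obtain ⟨e, he⟩ := hind q hq
    have hwd := (hw.contDiffAt hn).differentiableAt (by simp)
    have hxd := (hx.contDiffAt hn).differentiableAt (by simp)
    have hxd' := (hx'.contDiffAt hn).differentiableAt (by simp)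
    -- Since `x' - x` is a multiple of `w₀`, the product `(x' - x) ∧ w₀` vanishes on `S`. Its
    -- differential gives information on `D` without using derivatives of `D`.
    have z : ∀ a b c, extD₂ (fun q a b => wedge (x' q - x q) (w₀ q) a b) q a b c = 0 := by
      intro a b c
      rw [extD₂_congr (Θ' := fun _ _ _ => 0) hS (fun q hq a b => by
        simp only [wedge, sub_apply, (H q hq _).1]
        ring) hq]
      simp [extD₂]
    obtain ⟨l, hl⟩ := (h' q hq).d_x
    have key : ∀ a b c, D q * (wedge₃ (wedge (w₁ q) (w₂ q)) (w₀ q) a b c) = 0 := by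
      intro a b c
      have h1 := z a b c
      rw [extD₂_wedge (α := fun q => x' q - x q) (hxd'.sub hxd) hwd] at h1
      simp only [wedge₃] at h1 ⊢
      have e1 : ∀ v w, extD (fun q => x' q - x q) q v w = extD x' q v w - extD x q v w :=
        extD_sub hxd' hxd
      have e2 : ∀ v w, extD x' q v w - 3 / 2 * wedge (w₂ q) (f₁' q) v w
        - 3 / 2 * wedge (w₁ q) (f₂' q) v w = wedge (w₀ q) l v w := hl
      have e3 : ∀ v w, extD x q v w = 3 / 2 * wedge (w₂ q) (f₁ q) v w
        + 3 / 2 * wedge (w₁ q) (f₂ q) v w := (h q hq).d_x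
      have e4 : ∀ v w, extD x' q v w = 3 / 2 * wedge (w₂ q) (f₁' q) v w
        + 3 / 2 * wedge (w₁ q) (f₂' q) v w + wedge (w₀ q) l v w := fun v w => by
        linear_combination e2 v w
      simp only [e1, e3, e4, hdw q hq, sub_apply, wedge, (H q hq _).1, (H q hq _).2.1,
        (H q hq _).2.2.1] at h1
      simp only [wedge]
      -- Modulo `w₀`, `dx' - dx` is `-3D w₁ ∧ w₂`, and `-dw₀ ∧ (x' - x)` adds another `-D w₁ ∧ w₂ ∧
      -- w₀`. The total factor is `-4`, and the form `l` is killed by the factor `w₀`.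
      linear_combination -1 / 4 * h1
    by_contra hne
    have hz := (mul_eq_zero.1 (key (e 0) (e 1) (e 2))).resolve_left hne
    apply he
    rw [Matrix.det_fin_three]
    simp [wedge₃, wedge] at hz ⊢
    linear_combination hz
  have hx_eq : EqOn x' x S := fun q hq => ContinuousLinearMap.ext fun v => by
    rw [(H q hq v).1, hD q hq, zero_mul, add_zero]
  -- Independent vectors become horizontal after adding vectors killed by `w₀, w₁, w₂`. On the added
  -- vectors the two systems agree, so prescribing the unprimed forms prescribes the primed ones.
  have hor : ∀ q ∈ S, ∃ e' : Fin 3 → V, Independent (w₀ q) (w₁ q) (w₂ q) e' ∧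
      ∀ j, (jetOf w₀ w₁ w₂ φ x' f₁' f₂' g' q).IsHorizontal (e' j) := by
    intro q hq
    obtain ⟨e, he⟩ := hind q hq
    choose v hv using fun j => hvert q hq ![-φ q (e j), -x' q (e j), -f₁' q (e j), -f₂' q (e j),
      -g' q (e j)]
    refine ⟨fun j => e j + v j, he.congr fun j => ?_, fun j => ?_⟩
    · obtain ⟨⟨h0, h1, h2⟩, -⟩ := hv j
      simp [h0, h1, h2]
    · obtain ⟨⟨h0, h1, h2⟩, h3, h4, h5, h6, h7⟩ := hv j
      obtain ⟨k1, k2, k3, k4⟩ := H q hq (v j)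
      simp only [h0, h1, h2, h4, h5, h6, h7, mul_zero, add_zero, sub_zero] at k1 k2 k3 k4
      simp only [Jet.IsHorizontal, jetOf, map_add, h3, k1, k2, k3, k4]
      simp
  have hEF : ∀ q ∈ S, F q = 0 ∧ E q = 0 := by
    intro q hq
    obtain ⟨e', he', hor⟩ := hor q hq
    obtain ⟨r, hr⟩ := (h' q hq).terms_x
    have e3 : ∀ v w, extD x q v w = 3 / 2 * wedge (w₂ q) (f₁ q) v w
        + 3 / 2 * wedge (w₁ q) (f₂ q) v w := (h q hq).d_x
    have ex : extD x' q = extD x q := extD_congr_on hS hx_eq hq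
    -- Once `x' = x`, the primed `Ω₁¹` is `(3/2) F w₀ ∧ w₁ + (3/2) E w₀ ∧ w₂`. The normalization
    -- allows only a multiple of `w₁ ∧ w₂` on horizontal vectors.
    have := he'.coef_eq_zero (p := 3 / 2 * F q) (q := 3 / 2 * E q) (r := -r) fun i j => by
      have h1 := hr _ (hor i) _ (hor j)
      simp only [jetOf, ex, e3, wedge, (H q hq _).2.1, (H q hq _).2.2.1, hD q hq] at h1
      simp only [wedge]
      linear_combination h1
    exact ⟨by simpa using this.1, by simpa using this.2.1⟩
  have hf₁ : EqOn f₁' f₁ S := fun q hq => ContinuousLinearMap.ext fun v => by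
    rw [(H q hq v).2.1, hD q hq, (hEF q hq).2]; ring
  have hf₂ : EqOn f₂' f₂ S := fun q hq => ContinuousLinearMap.ext fun v => by
    rw [(H q hq v).2.2.1, hD q hq, (hEF q hq).1]; ring
  have hG : ∀ q ∈ S, G q = 0 := by
    intro q hq
    obtain ⟨e', he', hor⟩ := hor q hq
    obtain ⟨b, r, hr⟩ := (h' q hq).terms_f₁
    have e3 : ∀ v w, extD f₁ q v w = wedge (f₁ q) (x q) v w + 1 / 2 * wedge (w₁ q) (g q) v w
      + 1 / 2 * wedge (φ q) (f₁ q) v w + Q₁ q * wedge (w₀ q) (w₂ q) v w := (h q hq).d_f₁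
    have ex : extD f₁' q = extD f₁ q := extD_congr_on hS hf₁ hq
    -- Now `f₁' = f₁`, and the change of `g` adds `(1/2) G w₀ ∧ w₁` to `Φ¹`, which is the forbidden
    -- term.
    have := he'.coef_eq_zero (p := 1 / 2 * G q) (q := Q₁ q - b) (r := 1 / 2 * E q - r) fun i j => by
      have h1 := hr _ (hor i) _ (hor j)
      simp only [jetOf, ex, e3, hf₁ hq, hx_eq hq, wedge, (H q hq _).2.2.2, (hEF q hq).1,
        (hEF q hq).2] at h1
      simp only [wedge, (hEF q hq).2]
      linear_combination h1
    simpa using this.1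
  exact ⟨hx_eq, hf₁, hf₂, fun q hq => ContinuousLinearMap.ext fun v => by
    rw [(H q hq v).2.2.2, hG q hq, (hEF q hq).1, (hEF q hq).2]; ring⟩

end Uniqueness

/-! ### Nondegeneracy of the Cartan matrix in coordinates -/

section FlatNondegenerate

variable {O : Set E3} {t t₁ t₂ : E3 → E3 →L[ℝ] ℂ} (C : BaseConnection O t t₁ t₂)

/-- The real coordinate functions are in particular complex covectors, so by Cramer's rule they are
combinations of `a, b, c`. -/
lemma eq_zero_of_cdet {a b c : E3 →L[ℝ] ℂ} (h : cdet a b c ≠ 0) {v : E3} (ha : a v = 0)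
    (hb : b v = 0) (hc : c v = 0) : v = 0 := by
  ext j
  have := congrArg (fun α : E3 →L[ℝ] ℂ => α v) (cramer h (Complex.ofRealCLM.comp
    (EuclideanSpace.proj j : E3 →L[ℝ] ℝ)))
  simpa [ha, hb, hc] using this

/-- The change of coframe is triangular with diagonal `k₀k₁`, `k₀`, `k₁`. -/
lemma flatω_eq_zero_iff {q : EY} (hq : q ∈ flatDomain O) (v : EY) :
    (flatω₀ t q v = 0 ∧ flatω₁ t t₁ q v = 0 ∧ flatω₂ t t₂ q v = 0) ↔
      (t q.1 v.1 = 0 ∧ t₁ q.1 v.1 = 0 ∧ t₂ q.1 v.1 = 0) := by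
  have a0 : flatω₀ t q v = q.2 0 * q.2 1 * t q.1 v.1 := rfl
  have a1 : flatω₁ t t₁ q v = q.2 2 * (q.2 0 * q.2 1) * t q.1 v.1 + q.2 0 * t₁ q.1 v.1 := rfl
  have a2 : flatω₂ t t₂ q v = q.2 3 * (q.2 0 * q.2 1) * t q.1 v.1 + q.2 1 * t₂ q.1 v.1 := rfl
  rw [a0, a1, a2]
  constructor
  · rintro ⟨h0, h1, h2⟩
    have h0' : t q.1 v.1 = 0 := by simpa [hq.2.1, hq.2.2] using h0
    exact ⟨h0', by simpa [h0', hq.2.1] using h1, by simpa [h0', hq.2.2] using h2⟩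
  · rintro ⟨h0, h1, h2⟩
    simp [h0, h1, h2]

lemma exists_independent {q : EY} (hq : q ∈ flatDomain O)
    (hdet : cdet (t q.1) (t₁ q.1) (t₂ q.1) ≠ 0) :
    ∃ e, Independent (flatω₀ t q) (flatω₁ t t₁ q) (flatω₂ t t₂ q) e := by
  refine ⟨fun j => (e3 j, 0), ?_⟩
  have a0 : ∀ j, flatω₀ t q (e3 j, 0) = q.2 0 * q.2 1 * t q.1 (e3 j) := fun _ => rfl
  have a1 : ∀ j, flatω₁ t t₁ q (e3 j, 0) = q.2 2 * (q.2 0 * q.2 1) * t q.1 (e3 j)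
    + q.2 0 * t₁ q.1 (e3 j) := fun _ => rfl
  have a2 : ∀ j, flatω₂ t t₂ q (e3 j, 0) = q.2 3 * (q.2 0 * q.2 1) * t q.1 (e3 j)
    + q.2 1 * t₂ q.1 (e3 j) := fun _ => rfl
  have : (Matrix.of fun i j => ![flatω₀ t q, flatω₁ t t₁ q, flatω₂ t t₂ q] i (e3 j, 0) : Mat3).det =
      (q.2 0 * q.2 1) ^ 2 * cdet (t q.1) (t₁ q.1) (t₂ q.1) := by
    rw [Matrix.det_fin_three]
    simp only [Matrix.of_apply, Matrix.cons_val_zero, Matrix.cons_val_one, Matrix.cons_val, a0, a1,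
      a2, cdet]
    ring
  rw [Independent, this]
  exact mul_ne_zero (pow_ne_zero 2 (mul_ne_zero hq.2.1 hq.2.2)) hdet

/-- The entries `ω`, `ω¹`, `ω²` detect the base component of a vector. On fibre directions the
matrix is `H⁻¹ dH + ε`, and `hmat` determines the fibre coordinates infinitesimally. -/
lemma BaseConnection.totalMat_injective {q : EY} (hq : q ∈ flatDomain O)
    (hdet : cdet (t q.1) (t₁ q.1) (t₂ q.1) ≠ 0) {v : EY} (hv : evalForm (C.totalMat q) v = 0) :
    v = 0 := by
  have hv' := hv
  rw [C.totalMat_eq hq] at hv'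
  have h0 : 2 * flatω₀ t q v = 0 := congrFun (congrFun hv' 2) 0
  have h1 : flatω₁ t t₁ q v = 0 := congrFun (congrFun hv' 1) 0
  have h2 : 2 * flatω₂ t t₂ q v = 0 := congrFun (congrFun hv' 2) 1
  obtain ⟨k0, k1, k2⟩ := (flatω_eq_zero_iff hq v).1
    ⟨by simpa using h0, h1, by simpa using h2⟩
  have hv1 : v.1 = 0 := eq_zero_of_cdet hdet k0 k1 k2
  have hA : evalForm (C.baseMat q) v = 0 := by
    rw [C.evalForm_baseMat, hv1]
    ext i j
    fin_cases i <;> fin_cases j <;> simp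
  have key := evalForm_gaugeForm C.baseMat (fun q => hmat q.2) (fun q => hinv q.2) traceForm q v
  change evalForm (C.totalMat q) v = _ at key
  rw [hv, hA, mul_zero, zero_mul, zero_add] at key
  have hD : matD (fun q : EY => hmat q.2) q v = -(traceForm q v • hmat q.2) := by
    have hHK := mul_eq_one_comm.1 (hinv_mul_hmat hq.2.1 hq.2.2)
    have := congrArg (hmat q.2 * ·) key
    simp only [mul_zero, mul_add, ← mul_assoc, hHK, one_mul, mul_smul_comm, mul_one] at this
    exact eq_neg_of_add_eq_zero_left this.symm
  rw [matD_hmat hq.2] at hD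
  -- The upper left entry of `hmat` is constantly `1`, so comparing it in `dH = -ε H` gives `ε = 0`,
  -- and therefore `dH = 0`.
  have ε0 : traceForm q v = 0 := by
    have := congrFun (congrFun hD 0) 0
    simpa [hmat] using this
  rw [ε0, zero_smul, neg_zero] at hD
  have c3 : v.2 3 = 0 := congrFun (congrFun hD 0) 1
  have c0 : v.2 0 = 0 := by
    have := congrFun (congrFun hD 1) 1
    simpa [hq.2.1] using this
  have c2 : v.2 2 = 0 := by
    have := congrFun (congrFun hD 1) 2
    simpa [hq.2.1, c0] using this
  have c1 : v.2 1 = 0 := by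
    have := congrFun (congrFun hD 2) 2
    simpa [hq.2.1, hq.2.2, c0] using this
  have c4 : v.2 4 = 0 := by
    have := congrFun (congrFun hD 0) 2
    simpa [hq.2.1, hq.2.2, c0, c1, c2, c3] using this
  refine Prod.ext hv1 (funext fun j => ?_)
  fin_cases j
  exacts [c0, c1, c2, c3, c4]

/-- On the fibre direction `ℂ⁵` the five remaining forms define a real-linear endomorphism of `ℂ⁵`.
It is injective by `totalMat_injective`, hence surjective. -/
lemma BaseConnection.exists_vertical {q : EY} (hq : q ∈ flatDomain O)
    (hdet : cdet (t q.1) (t₁ q.1) (t₂ q.1) ≠ 0) (a : Fin 5 → ℂ) : ∃ v : EY,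
      (flatω₀ t q v = 0 ∧ flatω₁ t t₁ q v = 0 ∧ flatω₂ t t₂ q v = 0) ∧ flatφ t t₁ t₂ q v = a 0 ∧
      C.flatX q v = a 1 ∧ C.flatF₁ q v = a 2 ∧ C.flatF₂ q v = a 3 ∧ C.flatG q v = a 4 := by
  let L : (Fin 5 → ℂ) →ₗ[ℝ] (Fin 5 → ℂ) := LinearMap.pi fun i =>
    (![flatφ t t₁ t₂ q, C.flatX q, C.flatF₁ q, C.flatF₂ q, C.flatG q] i : EY →ₗ[ℝ] ℂ) ∘ₗ
      LinearMap.inr ℝ E3 (Fin 5 → ℂ)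
  have hw : ∀ k : Fin 5 → ℂ, flatω₀ t q (0, k) = 0 ∧ flatω₁ t t₁ q (0, k) = 0 ∧
      flatω₂ t t₂ q (0, k) = 0 := fun k =>
    (flatω_eq_zero_iff hq (0, k)).2 ⟨map_zero _, map_zero _, map_zero _⟩
  have hL : Function.Injective L := by
    rw [injective_iff_map_eq_zero]
    intro k hk
    have e := fun i => congrFun hk i
    have e0 : flatφ t t₁ t₂ q (0, k) = 0 := e 0
    have e1 : C.flatX q (0, k) = 0 := e 1
    have e2 : C.flatF₁ q (0, k) = 0 := e 2
    have e3 : C.flatF₂ q (0, k) = 0 := e 3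
    have e4 : C.flatG q (0, k) = 0 := e 4
    obtain ⟨h0, h1, h2⟩ := hw k
    have : ((0, k) : EY) = 0 := C.totalMat_injective hq hdet (by
      rw [C.totalMat_eq hq]
      ext i j
      fin_cases i <;> fin_cases j <;> simp [evalForm, cartanMat, *])
    exact congrArg Prod.snd this
  obtain ⟨k, hk⟩ := LinearMap.injective_iff_surjective.1 hL a
  subst hk
  exact ⟨(0, k), hw k, rfl, rfl, rfl, rfl, rfl⟩

/-- In coordinates there is only one system of canonically normalized forms. -/
theorem BaseConnection.flat_unique (hO : IsOpen O) (ht : ContDiffOn ℝ ∞ t O)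
    (ht₁ : ContDiffOn ℝ ∞ t₁ O) (ht₂ : ContDiffOn ℝ ∞ t₂ O)
    (hdet : ∀ u ∈ O, cdet (t u) (t₁ u) (t₂ u) ≠ 0)
    (hdt : ∀ u ∈ O, ∀ v w, extD t u v w = wedge (t₁ u) (t₂ u) v w) {S : Set EY} (hS : IsOpen S)
    (hSO : S ⊆ flatDomain O) {x f₁ f₂ g : EY → EY →L[ℝ] ℂ} (hx : ContDiffOn ℝ ∞ x S)
    (h : ∀ q ∈ S, (jetOf (flatω₀ t) (flatω₁ t t₁) (flatω₂ t t₂) (flatφ t t₁ t₂) x f₁ f₂ g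
      q).Canonical) :
    EqOn x C.flatX S ∧ EqOn f₁ C.flatF₁ S ∧ EqOn f₂ C.flatF₂ S ∧ EqOn g C.flatG S :=
  canonical_unique hS ((contDiffOn_flatω₀ ht).mono hSO) ((C.contDiffOn_flatX hO ht ht₁ ht₂).mono hSO)
    hx (fun _ hq => (C.flat_solves hO ht ht₁ ht₂ hdt (hSO hq)).2)
    (fun _ hq => (C.flat_solves hO ht ht₁ ht₂ hdt (hSO hq)).1) h
    (fun _ hq => exists_independent (hSO hq) (hdet _ (hSO hq).1))
    (fun _ hq => C.exists_vertical (hSO hq) (hdet _ (hSO hq).1))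

end FlatNondegenerate

/-! ### The tautological forms in the charts of `Y` -/

section Charts

variable {M : Type*} [TopologicalSpace M] [ChartedSpace E3 M] [IsManifold (𝓡 3) ∞ M]
  {F : FlagStructure M}

variable (F) in
/-- The domain of the coordinates near `x₀`. -/
def baseDomain (x₀ : M) : Set E3 := (chartAt E3 x₀).target ∩ (chartAt E3 x₀).symm ⁻¹' (cof F x₀).U

variable (F) in
lemma isOpen_baseDomain (x₀ : M) : IsOpen (baseDomain F x₀) :=
  (chartAt E3 x₀).isOpen_inter_preimage_symm (cof F x₀).isOpen_U

variable (F) in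
/-- The coordinate expression of the chosen contact form. -/
def cofθ (x₀ : M) : E3 → E3 →L[ℝ] ℂ := inChart (cof F x₀).θ x₀

variable (F) in
/-- The coordinate expression of the second form of the chosen coframe. -/
def cofθ₁ (x₀ : M) : E3 → E3 →L[ℝ] ℂ := inChart (cof F x₀).θ₁ x₀

variable (F) in
/-- The coordinate expression of the third form of the chosen coframe. -/
def cofθ₂ (x₀ : M) : E3 → E3 →L[ℝ] ℂ := inChart (cof F x₀).θ₂ x₀

variable (F) in
lemma contDiffOn_cofθ (x₀ : M) : ContDiffOn ℝ ∞ (cofθ F x₀) (baseDomain F x₀) :=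
  (cof F x₀).smooth x₀

variable (F) in
lemma contDiffOn_cofθ₁ (x₀ : M) : ContDiffOn ℝ ∞ (cofθ₁ F x₀) (baseDomain F x₀) :=
  (cof F x₀).smooth₁ x₀

variable (F) in
lemma contDiffOn_cofθ₂ (x₀ : M) : ContDiffOn ℝ ∞ (cofθ₂ F x₀) (baseDomain F x₀) :=
  (cof F x₀).smooth₂ x₀

/-- The coframe at the point is the pull-back of its coordinate expression by the differential of
the chart, so a vanishing coordinate determinant would make the intrinsic one vanish. -/
lemma cdet_cof {x₀ : M} {u : E3} (hu : u ∈ baseDomain F x₀) :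
    cdet (cofθ F x₀ u) (cofθ₁ F x₀ u) (cofθ₂ F x₀ u) ≠ 0 := by
  have hM : IsManifold (𝓡 3) 1 M := IsManifold.of_le (n := ∞) (by simp)
  set D : E3 →L[ℝ] E3 := mfderiv (𝓡 3) (𝓡 3) (chartAt E3 x₀).symm u with hD
  set D' : E3 →L[ℝ] E3 := mfderiv (𝓡 3) (𝓡 3) (chartAt E3 x₀) ((chartAt E3 x₀).symm u) with hD'
  intro h0
  apply (cof F x₀).det_ne_zero hu.2
  have h : ∀ α : OneForm E3 M, (α ((chartAt E3 x₀).symm u) : E3 →L[ℝ] ℂ) =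
      (inChart α x₀ u).comp D' := fun α => ContinuousLinearMap.ext fun v =>
    (congrArg (α ((chartAt E3 x₀).symm u)) (symm_comp_chart_deriv x₀ hu.1 v)).symm
  refine (congrArg₂ (fun x (y : (E3 →L[ℝ] ℂ) × (E3 →L[ℝ] ℂ)) => cdet x y.1 y.2) (h (cof F x₀).θ)
    (Prod.ext (h (cof F x₀).θ₁) (h (cof F x₀).θ₂) : (((cof F x₀).θ₁ ((chartAt E3 x₀).symm u),
      (cof F x₀).θ₂ ((chartAt E3 x₀).symm u)) :
      (E3 →L[ℝ] ℂ) × (E3 →L[ℝ] ℂ)) = (_, _))).trans ?_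
  refine (cdet_comp _ _ _ _).trans ?_
  have h0' : cdet (inChart (cof F x₀).θ x₀ u) (inChart (cof F x₀).θ₁ x₀ u)
    (inChart (cof F x₀).θ₂ x₀ u) = 0 := h0
  rw [h0', zero_mul]

/-- The normalization is stated in the preferred chart of each point. Naturality of `d` transfers it
to the fixed chart at `x₀`. -/
lemma extD_cofθ {x₀ : M} {u : E3} (hu : u ∈ baseDomain F x₀) (v w : E3) :
    extD (cofθ F x₀) u v w = wedge (cofθ₁ F x₀ u) (cofθ₂ F x₀ u) v w := by
  refine (d_eq_inChart (cof F x₀).smooth (cof F x₀).isOpen_U x₀ hu.1 hu.2 v w).symm.trans ?_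
  rw [(cof F x₀).d_θ _ hu.2]
  rfl

variable (F) in
/-- The connection near `x₀`. -/
def conn (x₀ : M) : BaseConnection (baseDomain F x₀) (cofθ F x₀) (cofθ₁ F x₀) (cofθ₂ F x₀) :=
  (exists_baseConnection (isOpen_baseDomain F x₀) (contDiffOn_cofθ F x₀) (contDiffOn_cofθ₁ F x₀)
    (contDiffOn_cofθ₂ F x₀) (fun _ hu => cdet_cof hu) fun _ hu => extD_cofθ hu).some

lemma frame_target (y₀ : Frame F) :
    (chartAt EY y₀).target = flatDomain (baseDomain F y₀.base.pt) := by
  ext q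
  change (q.1 ∈ _ ∧ _ ∧ _) ↔ (q.1 ∈ _ ∧ _) ∧ _
  rw [and_assoc]
  rfl

variable {y₀ : Frame F} {q : EY}

lemma symm_pt (hq : q ∈ (chartAt EY y₀).target) :
    ((chartAt EY y₀).symm q).base.pt = (chartAt E3 y₀.base.pt).symm q.1 :=
  (frameAtlas F).proj_point _ _ _ hq.2.1 hq.2.2

lemma symm_mem (hq : q ∈ (chartAt EY y₀).target) :
    ((chartAt EY y₀).symm q).base.pt ∈ (cof F y₀.base.pt).U := by
  rw [symm_pt hq]
  exact hq.2.1

lemma frameCoord_symm (hq : q ∈ (chartAt EY y₀).target) :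
    frameCoord y₀.base.pt ((chartAt EY y₀).symm q) = q.2 :=
  (frameAtlas F).coord_point _ _ _ hq.2.1 hq.2.2

/-- The relation `a₁a₂ = λ` is the part of (1) not involving `θ`. -/
lemma lam_symm (hq : q ∈ (chartAt EY y₀).target) :
    lam y₀.base.pt ((chartAt EY y₀).symm q).base = q.2 0 * q.2 1 := by
  have h := ((chartAt EY y₀).symm q).relations (symm_mem hq)
  rw [← h.1, ← frameCoord_symm hq]
  rfl

/-- The differential of the inverse chart. -/
abbrev dsymm (y₀ : Frame F) (q : EY) : EY →L[ℝ] TangentSpace 𝓘(ℝ, EY) ((chartAt EY y₀).symm q) :=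
  mfderiv 𝓘(ℝ, EY) 𝓘(ℝ, EY) (chartAt EY y₀).symm q

lemma mdifferentiableAt_symm (hq : q ∈ (chartAt EY y₀).target) :
    MDifferentiableAt 𝓘(ℝ, EY) 𝓘(ℝ, EY) (chartAt EY y₀).symm q := by
  have : IsManifold 𝓘(ℝ, EY) 1 (Frame F) := IsManifold.of_le (n := ∞) (by simp)
  exact mdifferentiableAt_atlas_symm (chart_mem_atlas EY y₀) hq

/-- The chain rule, applied to the fact that `Y → E → M` is the first projection in the charts. Thus
forms on `Y` pulled back from `M` have pulled-back coordinate expressions. -/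
lemma dpt_dsymm (hq : q ∈ (chartAt EY y₀).target) (v : EY) :
    (dpt F _ (dbase F _ (dsymm y₀ q v)) : E3) =
      mfderiv (𝓡 3) (𝓡 3) (chartAt E3 y₀.base.pt).symm q.1 v.1 := by
  have hM : IsManifold (𝓡 3) 1 M := IsManifold.of_le (n := ∞) (by simp)
  set y := (chartAt EY y₀).symm q with hy
  have hb : MDifferentiableAt 𝓘(ℝ, EY) 𝓘(ℝ, E3 × ℂ) (Frame.base (F := F)) y :=
    (contMDiff_base y).mdifferentiableAt (by simp)
  have hp : MDifferentiableAt 𝓘(ℝ, E3 × ℂ) (𝓡 3) ContactForm.pt y.base :=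
    ((contactAtlas F).contMDiff_proj y.base).mdifferentiableAt (by simp)
  have hs1 := mdifferentiableAt_atlas_symm (I := 𝓡 3) (chart_mem_atlas E3 y₀.base.pt) hq.1
  have hf : MDifferentiableAt 𝓘(ℝ, EY) (𝓡 3) (Prod.fst : EY → E3) q :=
    differentiableAt_fst.mdifferentiableAt
  have h0 := mfderiv_comp q hb (mdifferentiableAt_symm hq)
  have h1 := mfderiv_comp q hp (hb.comp q (mdifferentiableAt_symm hq))
  have h2 := mfderiv_comp q hs1 hf
  have h3 : ContactForm.pt ∘ (Frame.base ∘ (chartAt EY y₀).symm) =ᶠ[𝓝 q]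
      (chartAt E3 y₀.base.pt).symm ∘ Prod.fst := by
    filter_upwards [(chartAt EY y₀).open_target.mem_nhds hq] with q hq
    exact symm_pt hq
  have h4 := h3.mfderiv_eq (I := 𝓘(ℝ, EY)) (I' := 𝓡 3)
  have h5 := (mfderiv_eq_fderiv (𝕜 := ℝ) (f := (Prod.fst : EY → E3)) (x := q)).trans fderiv_fst
  have h0' := congrArg (fun f : EY →L[ℝ] E3 × ℂ => f v) h0
  have h1' := congrArg (fun f : EY →L[ℝ] E3 => f v) h1
  have h2' := congrArg (fun f : EY →L[ℝ] E3 => f v) h2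
  have h4' := congrArg (fun f : EY →L[ℝ] E3 => f v) h4
  have h5' := congrArg (fun f : EY →L[ℝ] E3 => f v) h5
  refine (congrArg (dpt F y.base : E3 × ℂ →L[ℝ] E3) h0').symm.trans ?_
  exact h1'.symm.trans (h4'.trans (h2'.trans
    (congrArg (mfderiv (𝓡 3) (𝓡 3) (chartAt E3 y₀.base.pt).symm q.1 : E3 →L[ℝ] E3) h5')))

/-- The chain rule together with the product rule for `λ = k₀k₁`. -/
lemma dlam_dsymm (hq : q ∈ (chartAt EY y₀).target) (v : EY) :
    dlam y₀.base.pt ((chartAt EY y₀).symm q).base (dbase F _ (dsymm y₀ q v)) =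
      q.2 0 * v.2 1 + q.2 1 * v.2 0 := by
  set y := (chartAt EY y₀).symm q with hy
  have hb : MDifferentiableAt 𝓘(ℝ, EY) 𝓘(ℝ, E3 × ℂ) (Frame.base (F := F)) y :=
    (contMDiff_base y).mdifferentiableAt (by simp)
  have hl : MDifferentiableAt 𝓘(ℝ, E3 × ℂ) 𝓘(ℝ, ℂ) (lam y₀.base.pt) y.base :=
    (contMDiffAt_lam (symm_mem hq)).mdifferentiableAt (by simp)
  have h0 := mfderiv_comp q hb (mdifferentiableAt_symm hq)
  have h1 := mfderiv_comp q hl (hb.comp q (mdifferentiableAt_symm hq))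
  have h3 : lam y₀.base.pt ∘ (Frame.base ∘ (chartAt EY y₀).symm) =ᶠ[𝓝 q]
      fun q : EY => q.2 0 * q.2 1 := by
    filter_upwards [(chartAt EY y₀).open_target.mem_nhds hq] with q hq
    exact lam_symm hq
  have h4 := h3.mfderiv_eq (I := 𝓘(ℝ, EY)) (I' := 𝓘(ℝ, ℂ))
  have hm : HasFDerivAt (fun q : EY => q.2 0 * q.2 1) _ q :=
    (pr 0).hasFDerivAt.mul (pr 1).hasFDerivAt
  have h5 := (mfderiv_eq_fderiv (𝕜 := ℝ) (f := fun q : EY => q.2 0 * q.2 1) (x := q)).trans hm.fderiv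
  have h0' := congrArg (fun f : EY →L[ℝ] E3 × ℂ => f v) h0
  have h1' := congrArg (fun f : EY →L[ℝ] ℂ => f v) h1
  have h4' := congrArg (fun f : EY →L[ℝ] ℂ => f v) h4
  have h5' := congrArg (fun f : EY →L[ℝ] ℂ => f v) h5
  refine (congrArg (dlam y₀.base.pt y.base : E3 × ℂ →L[ℝ] ℂ) h0').symm.trans ?_
  exact h1'.symm.trans (h4'.trans h5')

/-- Transport of a form along an equality of points. -/
lemma form_congr {V : Type*} [NormedAddCommGroup V] [NormedSpace ℝ V] {N : Type*}
    [TopologicalSpace N] [ChartedSpace V N] (α : OneForm V N) {p p' : N} (h : p = p') (v : V) :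
    (α p : V →L[ℝ] ℂ) v = (α p' : V →L[ℝ] ℂ) v := by
  subst h
  rfl

lemma form_dsymm (hq : q ∈ (chartAt EY y₀).target) (α : OneForm E3 M) (v : EY) :
    α _ (dpt F _ (dbase F _ (dsymm y₀ q v))) = inChart α y₀.base.pt q.1 v.1 :=
  (form_congr α (symm_pt hq) _).trans
    (congrArg (α ((chartAt E3 y₀.base.pt).symm q.1) : E3 →L[ℝ] ℂ) (dpt_dsymm hq v))

/-- The coframe of the base at a point of a chart. -/
lemma comb_dsymm (hq : q ∈ (chartAt EY y₀).target) (a b c : ℂ) (v : EY) :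
    (cof F y₀.base.pt).comb _ a b c (dpt F _ (dbase F _ (dsymm y₀ q v))) =
      a * cofθ F y₀.base.pt q.1 v.1 + b * cofθ₁ F y₀.base.pt q.1 v.1
        + c * cofθ₂ F y₀.base.pt q.1 v.1 := by
  change a * (cof F y₀.base.pt).θ _ _ + b * (cof F y₀.base.pt).θ₁ _ _
    + c * (cof F y₀.base.pt).θ₂ _ _ = _
  rw [form_dsymm hq, form_dsymm hq, form_dsymm hq]
  rfl

lemma inChart_ω₀ (hq : q ∈ (chartAt EY y₀).target) :
    inChart (ω₀ F) y₀ q = flatω₀ (cofθ F y₀.base.pt) q := by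
  refine ContinuousLinearMap.ext fun v => ?_
  have h := congrArg (fun f : E3 →L[ℝ] ℂ => f (dpt F _ (dbase F _ (dsymm y₀ q v))))
    (θ_eq (symm_mem hq))
  exact h.trans (congrArg₂ (fun x y : ℂ => x * y) (lam_symm hq) (form_dsymm hq _ v))

lemma coef₀_symm (hq : q ∈ (chartAt EY y₀).target) :
    (cof F y₀.base.pt).coef₀ ((chartAt EY y₀).symm q).base.pt ((chartAt EY y₀).symm q).η₁ =
      q.2 2 * (q.2 0 * q.2 1) ∧
    (cof F y₀.base.pt).coef₀ ((chartAt EY y₀).symm q).base.pt ((chartAt EY y₀).symm q).η₂ =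
      q.2 3 * (q.2 0 * q.2 1) := by
  have hl := lam_ne_zero (symm_mem hq)
  have h2 := congrFun (frameCoord_symm hq) 2
  have h3 := congrFun (frameCoord_symm hq) 3
  have h2' : _ / lam y₀.base.pt ((chartAt EY y₀).symm q).base = q.2 2 := h2
  have h3' : _ / lam y₀.base.pt ((chartAt EY y₀).symm q).base = q.2 3 := h3
  rw [div_eq_iff hl, lam_symm hq] at h2' h3'
  exact ⟨h2', h3'⟩

lemma inChart_ω₁ (hq : q ∈ (chartAt EY y₀).target) :
    inChart (ω₁ F) y₀ q = flatω₁ (cofθ F y₀.base.pt) (cofθ₁ F y₀.base.pt) q := by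
  refine ContinuousLinearMap.ext fun v => ?_
  have h := congrArg (fun f : E3 →L[ℝ] ℂ => f (dpt F _ (dbase F _ (dsymm y₀ q v))))
    ((cof F y₀.base.pt).eq_of_dual₁ (symm_mem hq) ((chartAt EY y₀).symm q).dual₁).1
  refine h.trans ((comb_dsymm hq _ _ _ v).trans ?_)
  have h0 : (cof F y₀.base.pt).coef₁ _ ((chartAt EY y₀).symm q).η₁ = q.2 0 :=
    congrFun (frameCoord_symm hq) 0
  rw [(coef₀_symm hq).1, h0, zero_mul, add_zero]
  rfl

lemma inChart_ω₂ (hq : q ∈ (chartAt EY y₀).target) :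
    inChart (ω₂ F) y₀ q = flatω₂ (cofθ F y₀.base.pt) (cofθ₂ F y₀.base.pt) q := by
  refine ContinuousLinearMap.ext fun v => ?_
  have h := congrArg (fun f : E3 →L[ℝ] ℂ => f (dpt F _ (dbase F _ (dsymm y₀ q v))))
    ((cof F y₀.base.pt).eq_of_dual₂ (symm_mem hq) ((chartAt EY y₀).symm q).dual₂).1
  refine h.trans ((comb_dsymm hq _ _ _ v).trans ?_)
  have h0 : (cof F y₀.base.pt).coef₂ _ ((chartAt EY y₀).symm q).η₂ = q.2 1 :=
    congrFun (frameCoord_symm hq) 1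
  rw [(coef₀_symm hq).2, h0, zero_mul, add_zero]
  rfl

lemma inChart_φ (hq : q ∈ (chartAt EY y₀).target) :
    inChart (φ F) y₀ q =
      flatφ (cofθ F y₀.base.pt) (cofθ₁ F y₀.base.pt) (cofθ₂ F y₀.base.pt) q := by
  refine ContinuousLinearMap.ext fun v => ?_
  set y := (chartAt EY y₀).symm q with hy
  have hl := lam_symm hq
  -- Equation (1) determines `φ` up to a multiple of `θ`. Its coefficient `s` is the fifth
  -- coordinate.
  obtain ⟨-, s, hs⟩ := y.relations (symm_mem hq)
  have hs4 : s = q.2 4 := by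
    have h3 : betaOf y₀.base.pt y.base y.φ = _ :=
      (congrArg (betaOf y₀.base.pt y.base) hs).trans (betaOf_phiOf _ _ _)
    have h4 : frameCoord y₀.base.pt y 4 = s :=
      (congrArg ((cof F y₀.base.pt).coef₀ y.base.pt) h3).trans
        ((cof F y₀.base.pt).coef₀_comb (symm_mem hq) _ _ _)
    rw [← h4, frameCoord_symm hq]
  have h0 : (cof F y₀.base.pt).coef₁ y.base.pt y.η₁ = q.2 0 := congrFun (frameCoord_symm hq) 0
  have h1 : (cof F y₀.base.pt).coef₂ y.base.pt y.η₂ = q.2 1 := congrFun (frameCoord_symm hq) 1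
  have h2 : (cof F y₀.base.pt).coef₀ y.base.pt y.η₁ / lam y₀.base.pt y.base = q.2 2 :=
    congrFun (frameCoord_symm hq) 2
  have h3 : (cof F y₀.base.pt).coef₀ y.base.pt y.η₂ / lam y₀.base.pt y.base = q.2 3 :=
    congrFun (frameCoord_symm hq) 3
  rw [h0, h1, h2, h3, hs4] at hs
  have h := congrArg (fun f : E3 × ℂ →L[ℝ] ℂ => f (dbase F _ (dsymm y₀ q v))) hs
  refine h.trans ((phiOf_apply _ _ _ _).trans ?_)
  have hb := comb_dsymm hq (q.2 4) (q.2 0 * q.2 3) (-(q.2 1 * q.2 2)) v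
  have hp : (dpt F _ (dbase F _ (dsymm y₀ q v)) : E3) =
    (dbase F _ (dsymm y₀ q v) : E3 × ℂ).1 := dpt_apply _ _
  have hb' := (congrArg ((cof F y₀.base.pt).comb y.base.pt (q.2 4) (q.2 0 * q.2 3)
    (-(q.2 1 * q.2 2)) : E3 →L[ℝ] ℂ) hp).symm.trans hb
  refine (congrArg₂ (fun a b : ℂ => -((lam y₀.base.pt y.base)⁻¹ * a) + b)
    (dlam_dsymm hq v) hb').trans ?_
  rw [hl]
  have hq0 : q.2 0 ≠ 0 := hq.2.2.1
  have hq1 : q.2 1 ≠ 0 := hq.2.2.2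
  have e : flatφ (cofθ F y₀.base.pt) (cofθ₁ F y₀.base.pt) (cofθ₂ F y₀.base.pt) q v =
    q.2 4 * cofθ F y₀.base.pt q.1 v.1 + q.2 0 * q.2 3 * cofθ₁ F y₀.base.pt q.1 v.1
      - q.2 1 * q.2 2 * cofθ₂ F y₀.base.pt q.1 v.1 - (q.2 0)⁻¹ * v.2 0 - (q.2 1)⁻¹ * v.2 1 := rfl
  rw [e]
  field_simp
  ring

end Charts

/-! ### Forms given by their expression in one chart -/

section LocalForm

variable {V : Type*} [NormedAddCommGroup V] [NormedSpace ℝ V] {N : Type*}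
  [TopologicalSpace N] [ChartedSpace V N]

/-- The form with the expression `α` in the chart at `p₀`. -/
def localForm (p₀ : N) (α : V → V →L[ℝ] ℂ) : OneForm V N := fun p =>
  (α (chartAt V p₀ p)).comp
    (mfderiv 𝓘(ℝ, V) 𝓘(ℝ, V) (chartAt V p₀) p : TangentSpace 𝓘(ℝ, V) p →L[ℝ] V)

variable [IsManifold 𝓘(ℝ, V) ∞ N]

lemma inChart_localForm (p₀ : N) (α : V → V →L[ℝ] ℂ) {u : V} (hu : u ∈ (chartAt V p₀).target) :
    inChart (localForm p₀ α) p₀ u = α u := by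
  refine ContinuousLinearMap.ext fun v => ?_
  refine (congrArg (α (chartAt V p₀ ((chartAt V p₀).symm u))) (chart_comp_symm_deriv p₀ hu v)).trans ?_
  rw [(chartAt V p₀).right_inv hu]

/-- In another chart the expression is the pull-back of `α` by the transition map, which is smooth.
-/
lemma smoothOn_localForm (p₀ : N) {α : V → V →L[ℝ] ℂ}
    (hα : ContDiffOn ℝ ∞ α (chartAt V p₀).target) :
    (localForm p₀ α).SmoothOn (chartAt V p₀).source := by
  intro p
  have hτ := contDiffOn_transition (V := V) p p₀
  have ho := isOpen_transition_source (V := V) p p₀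
  have hm : MapsTo (transition (V := V) p p₀)
      ((chartAt V p).target ∩ (chartAt V p).symm ⁻¹' (chartAt V p₀).source)
      (chartAt V p₀).target := fun u hu => (chartAt V p₀).map_source hu.2
  refine ((hα.comp hτ hm).clm_comp (hτ.fderiv_of_isOpen ho (m := ∞) (by simp))).congr fun u hu => ?_
  rw [inChart_transition _ p p₀ hu.1 hu.2, inChart_localForm _ _ (hm hu)]
  rfl

end LocalForm

/-! ### Dependence of jets on germs only -/

section Jets

variable {V : Type*} [NormedAddCommGroup V] [NormedSpace ℝ V]

lemma jetOf_congr {ω₀ ω₁ ω₂ φ x f₁ f₂ g ω₀' ω₁' ω₂' φ' x' f₁' f₂' g' : V → V →L[ℝ] ℂ} {q : V}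
    (h₀ : ω₀ =ᶠ[𝓝 q] ω₀') (h₁ : ω₁ =ᶠ[𝓝 q] ω₁') (h₂ : ω₂ =ᶠ[𝓝 q] ω₂') (hφ : φ =ᶠ[𝓝 q] φ')
    (hx : x =ᶠ[𝓝 q] x') (hf₁ : f₁ =ᶠ[𝓝 q] f₁') (hf₂ : f₂ =ᶠ[𝓝 q] f₂') (hg : g =ᶠ[𝓝 q] g') :
    jetOf ω₀ ω₁ ω₂ φ x f₁ f₂ g q = jetOf ω₀' ω₁' ω₂' φ' x' f₁' f₂' g' q := by
  have e : ∀ {α β : V → V →L[ℝ] ℂ}, α =ᶠ[𝓝 q] β → extD α q = extD β q := fun h => by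
    funext v w
    simp only [extD, h.fderiv_eq]
  unfold jetOf
  rw [h₀.eq_of_nhds, h₁.eq_of_nhds, h₂.eq_of_nhds, hφ.eq_of_nhds, hx.eq_of_nhds, hf₁.eq_of_nhds,
    hf₂.eq_of_nhds, hg.eq_of_nhds, e h₁, e h₂, e hφ, e hx, e hf₁, e hf₂, e hg]

end Jets

/-! ### The canonical forms on `Y` -/

section Transfer

variable {M : Type*} [TopologicalSpace M] [ChartedSpace E3 M] [IsManifold (𝓡 3) ∞ M]
  {F : FlagStructure M}

lemma exists_symm_eq (y₀ : Frame F) {y : Frame F} (hy : y ∈ (chartAt EY y₀).source) :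
    ∃ q ∈ (chartAt EY y₀).target, (chartAt EY y₀).symm q = y :=
  ⟨_, (chartAt EY y₀).map_source hy, (chartAt EY y₀).left_inv hy⟩

/-- Points are parametrized by inverse charts, because there the forms have explicit expressions and
`dsymm` is surjective. -/
lemma forall_frame {P : Frame F → Prop}
    (h : ∀ y₀ : Frame F, ∀ q ∈ (chartAt EY y₀).target, P ((chartAt EY y₀).symm q)) (y : Frame F) :
    P y := by
  obtain ⟨q, hq, e⟩ := exists_symm_eq y (mem_chart_source EY y)
  exact e ▸ h y q hq

lemma dsymm_surjective {y₀ : Frame F} {q : EY} (hq : q ∈ (chartAt EY y₀).target) :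
    Function.Surjective (dsymm y₀ q) := fun v =>
  ⟨mfderiv 𝓘(ℝ, EY) 𝓘(ℝ, EY) (chartAt EY y₀) ((chartAt EY y₀).symm q) v,
    symm_comp_chart_deriv y₀ hq v⟩

lemma target_mem_nhds {y₀ : Frame F} {q : EY} (hq : q ∈ (chartAt EY y₀).target) :
    (chartAt EY y₀).target ∈ 𝓝 q := (chartAt EY y₀).open_target.mem_nhds hq

lemma smoothOn_of_eqOn {α : YForm F} {β : Frame F → EY → EY →L[ℝ] ℂ}
    (h : ∀ y₀, EqOn (inChart α y₀) (β y₀) (chartAt EY y₀).target)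
    (hβ : ∀ y₀, ContDiffOn ℝ ∞ (β y₀) (flatDomain (baseDomain F y₀.base.pt))) : α.SmoothOn univ :=
  fun y₀ => (((hβ y₀).congr fun _ hq => h y₀ (by rwa [frame_target]))).mono fun _ hq => by
    rw [← frame_target]
    exact hq.1

variable (F) in
lemma smoothOn_ω₁ : (ω₁ F).SmoothOn univ :=
  smoothOn_of_eqOn (fun _ _ hq => inChart_ω₁ hq) fun _ =>
    contDiffOn_flatω₁ (contDiffOn_cofθ F _) (contDiffOn_cofθ₁ F _)

variable (F) in
lemma smoothOn_ω₂ : (ω₂ F).SmoothOn univ :=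
  smoothOn_of_eqOn (fun _ _ hq => inChart_ω₂ hq) fun _ =>
    contDiffOn_flatω₂ (contDiffOn_cofθ F _) (contDiffOn_cofθ₂ F _)

variable (F) in
lemma smoothOn_φ : (φ F).SmoothOn univ :=
  smoothOn_of_eqOn (fun _ _ hq => inChart_φ hq) fun _ =>
    contDiffOn_flatφ (contDiffOn_cofθ F _) (contDiffOn_cofθ₁ F _) (contDiffOn_cofθ₂ F _)

lemma d_dsymm {α : YForm F} {S : Set (Frame F)} (hα : α.SmoothOn S) (hS : IsOpen S) {y₀ : Frame F}
    {q : EY} (hq : q ∈ (chartAt EY y₀).target) (hqS : (chartAt EY y₀).symm q ∈ S) (v w : EY) :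
    d α ((chartAt EY y₀).symm q) (dsymm y₀ q v) (dsymm y₀ q w) = extD (inChart α y₀) q v w :=
  d_eq_inChart hα hS y₀ hq hqS v w

/-! ### Canonical normalization as a pointwise condition, and its expression in charts -/

namespace ConnectionForms

variable (Γ : ConnectionForms F)

/-- The tautological and the connection forms at a point, with their differentials. -/
def jet (y : Frame F) : Jet (TangentSpace 𝓘(ℝ, EY) y) :=
  ⟨ω₀ F y, ω₁ F y, ω₂ F y, φ F y, Γ.ω₁₁ y, Γ.φ₁ y, Γ.φ₂ y, Γ.ψ y, d (ω₁ F) y, d (ω₂ F) y,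
    d (φ F) y, d Γ.ω₁₁ y, d Γ.φ₁ y, d Γ.φ₂ y, d Γ.ψ y⟩

/-- All components are smooth. -/
structure SmoothOn (S : Set (Frame F)) : Prop where
  ω₁₁ : Γ.ω₁₁.SmoothOn S
  φ₁ : Γ.φ₁.SmoothOn S
  φ₂ : Γ.φ₂.SmoothOn S
  ψ : Γ.ψ.SmoothOn S

variable {Γ}

lemma mem_horizontal {y : Frame F} {v : TangentSpace 𝓘(ℝ, EY) y} :
    v ∈ Γ.horizontal y ↔ (Γ.jet y).IsHorizontal v :=
  ⟨fun h => ⟨h.1.1.1.1, h.1.1.1.2, h.1.1.2, h.1.2, h.2⟩,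
    fun h => ⟨⟨⟨⟨h.1, h.2.1⟩, h.2.2.1⟩, h.2.2.2.1⟩, h.2.2.2.2⟩⟩

lemma IsCanonical.smoothOn (h : Γ.IsCanonical) : Γ.SmoothOn univ :=
  ⟨h.smooth_ω₁₁, h.smooth_φ₁, h.smooth_φ₂, h.smooth_ψ⟩

lemma IsCanonical.jet (h : Γ.IsCanonical) (y : Frame F) : (Γ.jet y).Canonical where
  d_ω₁ v w := congrFun (congrFun (congrFun h.d_ω₁ y) v) w
  d_ω₂ v w := congrFun (congrFun (congrFun h.d_ω₂ y) v) w
  d_φ v w := congrFun (congrFun (congrFun h.d_φ y) v) w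
  d_x := h.Ω₁₁_eq.imp' (fun l => l y) fun _ H v w => congrFun (congrFun (congrFun H y) v) w
  terms_x := h.Ω₁₁_terms.imp' (fun r => r y) fun r H v hv w hw => by
    refine (H y v (mem_horizontal.2 hv) w (mem_horizontal.2 hw)).trans ?_
    change 0 * _ + 0 * _ + _ = _
    rw [zero_mul, zero_mul, zero_add, zero_add]
    rfl
  terms_f₁ := by
    obtain ⟨q, r, H⟩ := h.Φ₁_terms
    refine ⟨q y, r y, fun v hv w hw => ?_⟩
    refine (H y v (mem_horizontal.2 hv) w (mem_horizontal.2 hw)).trans ?_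
    change 0 * _ + _ + _ = _
    rw [zero_mul, zero_add]
    rfl

/-- Here `Ω₁¹ = 0`, so `λ = 0` serves as the witness, and `Q₁` is the coefficient of `ω ∧ ω²` in
`Φ¹`. -/
lemma isCanonical_of_solves (hs : Γ.SmoothOn univ) {Q₁ Q₂ U₁ U₂ : Frame F → ℂ}
    (h : ∀ y, (Γ.jet y).Solves (Q₁ y) (Q₂ y) (U₁ y) (U₂ y)) : Γ.IsCanonical where
  smooth_ω₁₁ := hs.ω₁₁
  smooth_φ₁ := hs.φ₁
  smooth_φ₂ := hs.φ₂
  smooth_ψ := hs.ψ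
  d_ω₁ := funext fun y => funext fun v => funext fun w => (h y).d_ω₁ v w
  d_ω₂ := funext fun y => funext fun v => funext fun w => (h y).d_ω₂ v w
  d_φ := funext fun y => funext fun v => funext fun w => (h y).d_φ v w
  Ω₁₁_eq := ⟨fun _ => 0, funext fun y => funext fun v => funext fun w => by
    have h1 := (h y).d_x v w
    change (Γ.jet y).dx v w - 3 / 2 * wedge (Γ.jet y).ω₂ (Γ.jet y).f₁ v w
      - 3 / 2 * wedge (Γ.jet y).ω₁ (Γ.jet y).f₂ v w = ω₀ F y v * 0 - ω₀ F y w * 0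
    rw [h1]
    ring⟩
  Ω₁₁_terms := ⟨0, fun y v _ w _ => by
    have h1 := (h y).d_x v w
    change (Γ.jet y).dx v w - 3 / 2 * wedge (Γ.jet y).ω₂ (Γ.jet y).f₁ v w
      - 3 / 2 * wedge (Γ.jet y).ω₁ (Γ.jet y).f₂ v w = 0 * _ + 0 * _ + 0 * _
    rw [h1]
    ring⟩
  Φ₁_terms := ⟨Q₁, 0, fun y v _ w _ => by
    have h1 := (h y).d_f₁ v w
    change (Γ.jet y).df₁ v w - wedge (Γ.jet y).f₁ (Γ.jet y).x v w
      - 1 / 2 * wedge (Γ.jet y).ω₁ (Γ.jet y).g v w - 1 / 2 * wedge (Γ.jet y).φ (Γ.jet y).f₁ v w =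
      0 * _ + Q₁ y * wedge (Γ.jet y).ω₀ (Γ.jet y).ω₂ v w + 0 * _
    rw [h1]
    ring⟩

/-- Naturality of `d` turns the jet on `Y` into a jet on the model space, with the tautological
components in standard form. Smoothness is needed only on `S`, so the lemma applies to forms
constructed near a single point. -/
lemma comap_jet {S : Set (Frame F)} (hΓ : Γ.SmoothOn S) (hS : IsOpen S) {y₀ : Frame F} {q : EY}
    (hq : q ∈ (chartAt EY y₀).target) (hqS : (chartAt EY y₀).symm q ∈ S) :
    (Γ.jet ((chartAt EY y₀).symm q)).comap (dsymm y₀ q) =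
      jetOf (flatω₀ (cofθ F y₀.base.pt)) (flatω₁ (cofθ F y₀.base.pt) (cofθ₁ F y₀.base.pt))
        (flatω₂ (cofθ F y₀.base.pt) (cofθ₂ F y₀.base.pt))
        (flatφ (cofθ F y₀.base.pt) (cofθ₁ F y₀.base.pt) (cofθ₂ F y₀.base.pt))
        (inChart Γ.ω₁₁ y₀) (inChart Γ.φ₁ y₀) (inChart Γ.φ₂ y₀) (inChart Γ.ψ y₀) q := by
  have hn := target_mem_nhds hq
  have e₀ : inChart (ω₀ F) y₀ =ᶠ[𝓝 q] _ := Filter.eventually_of_mem hn fun _ hq => inChart_ω₀ hq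
  have e₁ : inChart (ω₁ F) y₀ =ᶠ[𝓝 q] _ := Filter.eventually_of_mem hn fun _ hq => inChart_ω₁ hq
  have e₂ : inChart (ω₂ F) y₀ =ᶠ[𝓝 q] _ := Filter.eventually_of_mem hn fun _ hq => inChart_ω₂ hq
  have e₃ : inChart (φ F) y₀ =ᶠ[𝓝 q] _ := Filter.eventually_of_mem hn fun _ hq => inChart_φ hq
  refine Eq.trans ?_ (jetOf_congr e₀ e₁ e₂ e₃ .rfl .rfl .rfl .rfl)
  have h : ∀ {α : YForm F}, α.SmoothOn S →
      (fun v w => d α ((chartAt EY y₀).symm q) (dsymm y₀ q v) (dsymm y₀ q w)) =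
        extD (inChart α y₀) q := fun hα => funext fun v => funext fun w => d_dsymm hα hS hq hqS v w
  have h' : ∀ {α : YForm F}, α.SmoothOn univ →
      (fun v w => d α ((chartAt EY y₀).symm q) (dsymm y₀ q v) (dsymm y₀ q w)) =
        extD (inChart α y₀) q := fun hα =>
    funext fun v => funext fun w => d_dsymm hα isOpen_univ hq (mem_univ _) v w
  unfold Jet.comap jet jetOf
  rw [Jet.mk.injEq]
  exact ⟨rfl, rfl, rfl, rfl, rfl, rfl, rfl, rfl, h' (smoothOn_ω₁ F), h' (smoothOn_ω₂ F),
    h' (smoothOn_φ F), h hΓ.ω₁₁, h hΓ.φ₁, h hΓ.φ₂, h hΓ.ψ⟩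

/-- Canonically normalized forms have the expected expression in each chart. -/
lemma eqOn_flat {S : Set (Frame F)} (hΓ : Γ.SmoothOn S) (hS : IsOpen S)
    (h : ∀ y ∈ S, (Γ.jet y).Canonical) (y₀ : Frame F) :
    EqOn (inChart Γ.ω₁₁ y₀) (conn F y₀.base.pt).flatX
        ((chartAt EY y₀).target ∩ (chartAt EY y₀).symm ⁻¹' S) ∧
      EqOn (inChart Γ.φ₁ y₀) (conn F y₀.base.pt).flatF₁
        ((chartAt EY y₀).target ∩ (chartAt EY y₀).symm ⁻¹' S) ∧
      EqOn (inChart Γ.φ₂ y₀) (conn F y₀.base.pt).flatF₂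
        ((chartAt EY y₀).target ∩ (chartAt EY y₀).symm ⁻¹' S) ∧
      EqOn (inChart Γ.ψ y₀) (conn F y₀.base.pt).flatG
        ((chartAt EY y₀).target ∩ (chartAt EY y₀).symm ⁻¹' S) := by
  refine (conn F y₀.base.pt).flat_unique (isOpen_baseDomain F _) (contDiffOn_cofθ F _)
    (contDiffOn_cofθ₁ F _) (contDiffOn_cofθ₂ F _) (fun _ hu => cdet_cof hu)
    (fun _ hu => extD_cofθ hu) ((chartAt EY y₀).isOpen_inter_preimage_symm hS)
    (fun q hq => by rw [← frame_target]; exact hq.1) (hΓ.ω₁₁ y₀) fun q hq => ?_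
  rw [← comap_jet hΓ hS hq.1 hq.2]
  exact (h _ hq.2).comap _

/-- The canonical forms near `y₀`. -/
def near (y₀ : Frame F) : ConnectionForms F where
  ω₁₁ := localForm y₀ (conn F y₀.base.pt).flatX
  φ₁ := localForm y₀ (conn F y₀.base.pt).flatF₁
  φ₂ := localForm y₀ (conn F y₀.base.pt).flatF₂
  ψ := localForm y₀ (conn F y₀.base.pt).flatG

end ConnectionForms

lemma contDiffOn_conn (x₀ : M) :
    ContDiffOn ℝ ∞ (conn F x₀).flatX (flatDomain (baseDomain F x₀)) ∧
    ContDiffOn ℝ ∞ (conn F x₀).flatF₁ (flatDomain (baseDomain F x₀)) ∧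
    ContDiffOn ℝ ∞ (conn F x₀).flatF₂ (flatDomain (baseDomain F x₀)) ∧
    ContDiffOn ℝ ∞ (conn F x₀).flatG (flatDomain (baseDomain F x₀)) :=
  ⟨(conn F x₀).contDiffOn_flatX (isOpen_baseDomain F _) (contDiffOn_cofθ F _)
    (contDiffOn_cofθ₁ F _) (contDiffOn_cofθ₂ F _),
  (conn F x₀).contDiffOn_flatF₁ (isOpen_baseDomain F _) (contDiffOn_cofθ F _)
    (contDiffOn_cofθ₁ F _) (contDiffOn_cofθ₂ F _),
  (conn F x₀).contDiffOn_flatF₂ (isOpen_baseDomain F _) (contDiffOn_cofθ F _)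
    (contDiffOn_cofθ₁ F _) (contDiffOn_cofθ₂ F _),
  (conn F x₀).contDiffOn_flatG (isOpen_baseDomain F _) (contDiffOn_cofθ F _)
    (contDiffOn_cofθ₁ F _) (contDiffOn_cofθ₂ F _)⟩

lemma conn_solves {x₀ : M} {q : EY} (hq : q ∈ flatDomain (baseDomain F x₀)) :
    ((conn F x₀).flatJet q).Solves ((conn F x₀).flatQ₁ q) ((conn F x₀).flatQ₂ q)
      ((conn F x₀).flatU₁ q) ((conn F x₀).flatU₂ q) ∧ ∀ v w, extD (flatω₀ (cofθ F x₀)) q v w =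
      wedge (flatω₁ (cofθ F x₀) (cofθ₁ F x₀) q) (flatω₂ (cofθ F x₀) (cofθ₂ F x₀) q) v w +
      wedge (flatω₀ (cofθ F x₀) q) (flatφ (cofθ F x₀) (cofθ₁ F x₀) (cofθ₂ F x₀) q) v w :=
  (conn F x₀).flat_solves (isOpen_baseDomain F _) (contDiffOn_cofθ F _)
    (contDiffOn_cofθ₁ F _) (contDiffOn_cofθ₂ F _) (fun _ hu => extD_cofθ hu) hq

namespace ConnectionForms

lemma near_smoothOn (y₀ : Frame F) : (near y₀).SmoothOn (chartAt EY y₀).source := by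
  have h := contDiffOn_conn (F := F) y₀.base.pt
  rw [← frame_target] at h
  exact ⟨smoothOn_localForm _ h.1, smoothOn_localForm _ h.2.1, smoothOn_localForm _ h.2.2.1,
    smoothOn_localForm _ h.2.2.2⟩

lemma comap_jet_flat {Γ : ConnectionForms F} {S : Set (Frame F)} (hΓ : Γ.SmoothOn S)
    (hS : IsOpen S) {y₀ : Frame F} {q : EY} (hq : q ∈ (chartAt EY y₀).target)
    (hqS : (chartAt EY y₀).symm q ∈ S)
    (hx : inChart Γ.ω₁₁ y₀ =ᶠ[𝓝 q] (conn F y₀.base.pt).flatX)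
    (hf₁ : inChart Γ.φ₁ y₀ =ᶠ[𝓝 q] (conn F y₀.base.pt).flatF₁)
    (hf₂ : inChart Γ.φ₂ y₀ =ᶠ[𝓝 q] (conn F y₀.base.pt).flatF₂)
    (hg : inChart Γ.ψ y₀ =ᶠ[𝓝 q] (conn F y₀.base.pt).flatG) :
    (Γ.jet ((chartAt EY y₀).symm q)).comap (dsymm y₀ q) = (conn F y₀.base.pt).flatJet q :=
  (comap_jet hΓ hS hq hqS).trans (jetOf_congr .rfl .rfl .rfl .rfl hx hf₁ hf₂ hg)

/-- In the chart at `y₀` the jet is the coordinate solution, and the structure equations descend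
along the surjective differential of the inverse chart. -/
lemma near_canonical (y₀ : Frame F) {y : Frame F} (hy : y ∈ (chartAt EY y₀).source) :
    ((near y₀).jet y).Canonical := by
  obtain ⟨q, hq, rfl⟩ := exists_symm_eq y₀ hy
  have hn := target_mem_nhds hq
  have h := comap_jet_flat (near_smoothOn y₀) (chartAt EY y₀).open_source hq hy
    (Filter.eventually_of_mem hn fun _ hq => inChart_localForm _ _ hq)
    (Filter.eventually_of_mem hn fun _ hq => inChart_localForm _ _ hq)
    (Filter.eventually_of_mem hn fun _ hq => inChart_localForm _ _ hq)
    (Filter.eventually_of_mem hn fun _ hq => inChart_localForm _ _ hq)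
  have hq' : q ∈ flatDomain (baseDomain F y₀.base.pt) := by rwa [← frame_target]
  have hs := (conn_solves hq').1
  rw [← h] at hs
  exact (hs.of_comap (dsymm_surjective hq)).canonical

variable (F) in
/-- The canonical forms. -/
def canonical : ConnectionForms F :=
  -- At each point the form built from the chart at that point is used. Local uniqueness shows that
  -- any other chart gives the same value.
  ⟨fun y => (near y).ω₁₁ y, fun y => (near y).φ₁ y, fun y => (near y).φ₂ y, fun y => (near y).ψ y⟩

/-- `Γ` has the canonical expression in all charts. -/
structure IsFlat (Γ : ConnectionForms F) : Prop where
  ω₁₁ : ∀ y₀, EqOn (inChart Γ.ω₁₁ y₀) (conn F y₀.base.pt).flatX (chartAt EY y₀).target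
  φ₁ : ∀ y₀, EqOn (inChart Γ.φ₁ y₀) (conn F y₀.base.pt).flatF₁ (chartAt EY y₀).target
  φ₂ : ∀ y₀, EqOn (inChart Γ.φ₂ y₀) (conn F y₀.base.pt).flatF₂ (chartAt EY y₀).target
  ψ : ∀ y₀, EqOn (inChart Γ.ψ y₀) (conn F y₀.base.pt).flatG (chartAt EY y₀).target

lemma inChart_congr (α β : YForm F) {y₀ : Frame F} {q : EY}
    (h : α ((chartAt EY y₀).symm q) = β ((chartAt EY y₀).symm q)) :
    inChart α y₀ q = inChart β y₀ q :=
  congrArg (fun f => ContinuousLinearMap.comp f (dsymm y₀ q)) h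

/-- This is the gluing step. The value at `y` comes from forms that are canonical on the whole chart
domain of `y`, and uniqueness identifies their expression in the chart at `y₀`. -/
lemma isFlat_canonical : (canonical F).IsFlat := by
  have h : ∀ (y₀ : Frame F) (q : EY), q ∈ (chartAt EY y₀).target →
      inChart (canonical F).ω₁₁ y₀ q = (conn F y₀.base.pt).flatX q ∧
      inChart (canonical F).φ₁ y₀ q = (conn F y₀.base.pt).flatF₁ q ∧
      inChart (canonical F).φ₂ y₀ q = (conn F y₀.base.pt).flatF₂ q ∧
      inChart (canonical F).ψ y₀ q = (conn F y₀.base.pt).flatG q := by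
    intro y₀ q hq
    have hω₁₁ : (canonical F).ω₁₁ = fun y => (near y).ω₁₁ y := rfl
    have hφ₁ : (canonical F).φ₁ = fun y => (near y).φ₁ y := rfl
    have hφ₂ : (canonical F).φ₂ = fun y => (near y).φ₂ y := rfl
    have hψ : (canonical F).ψ = fun y => (near y).ψ y := rfl
    set y := (chartAt EY y₀).symm q with hy
    -- Uniqueness is applied on the open set of coordinates of the overlap of the charts at `y` and
    -- `y₀`. It contains `q` because `y` is the point with coordinates `q`.
    obtain ⟨h1, h2, h3, h4⟩ := eqOn_flat (near_smoothOn y)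
      (chartAt EY y).open_source (fun _ hy => near_canonical y hy) y₀
    have hm : q ∈ (chartAt EY y₀).target ∩ (chartAt EY y₀).symm ⁻¹' (chartAt EY y).source :=
      ⟨hq, mem_chart_source EY y⟩
    have e1 := h1 hm
    have e2 := h2 hm
    have e3 := h3 hm
    have e4 := h4 hm
    exact ⟨(inChart_congr (canonical F).ω₁₁ (near y).ω₁₁ (congrFun hω₁₁ _)).trans e1,
      (inChart_congr (canonical F).φ₁ (near y).φ₁ (congrFun hφ₁ _)).trans e2,
      (inChart_congr (canonical F).φ₂ (near y).φ₂ (congrFun hφ₂ _)).trans e3,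
      (inChart_congr (canonical F).ψ (near y).ψ (congrFun hψ _)).trans e4⟩
  exact ⟨fun y₀ q hq => (h y₀ q hq).1, fun y₀ q hq => (h y₀ q hq).2.1,
    fun y₀ q hq => (h y₀ q hq).2.2.1, fun y₀ q hq => (h y₀ q hq).2.2.2⟩

variable {Γ Γ' : ConnectionForms F}

lemma IsCanonical.isFlat (h : Γ.IsCanonical) : Γ.IsFlat := by
  have H := eqOn_flat h.smoothOn isOpen_univ (fun y _ => h.jet y)
  simp only [preimage_univ, inter_univ] at H
  exact ⟨fun y₀ => (H y₀).1, fun y₀ => (H y₀).2.1, fun y₀ => (H y₀).2.2.1, fun y₀ => (H y₀).2.2.2⟩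

lemma IsFlat.smoothOn (h : Γ.IsFlat) : Γ.SmoothOn univ :=
  ⟨smoothOn_of_eqOn h.ω₁₁ fun _ => (contDiffOn_conn _).1,
    smoothOn_of_eqOn h.φ₁ fun _ => (contDiffOn_conn _).2.1,
    smoothOn_of_eqOn h.φ₂ fun _ => (contDiffOn_conn _).2.2.1,
    smoothOn_of_eqOn h.ψ fun _ => (contDiffOn_conn _).2.2.2⟩

lemma IsFlat.solves_symm (h : Γ.IsFlat) {y₀ : Frame F} {q : EY} (hq : q ∈ (chartAt EY y₀).target) :
    (Γ.jet ((chartAt EY y₀).symm q)).Solves ((conn F y₀.base.pt).flatQ₁ q)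
      ((conn F y₀.base.pt).flatQ₂ q) ((conn F y₀.base.pt).flatU₁ q)
      ((conn F y₀.base.pt).flatU₂ q) := by
  have hn := target_mem_nhds hq
  have H := comap_jet_flat h.smoothOn isOpen_univ hq (mem_univ _)
    (Filter.eventually_of_mem hn (h.ω₁₁ y₀)) (Filter.eventually_of_mem hn (h.φ₁ y₀))
    (Filter.eventually_of_mem hn (h.φ₂ y₀)) (Filter.eventually_of_mem hn (h.ψ y₀))
  have hq' : q ∈ flatDomain (baseDomain F y₀.base.pt) := by rwa [← frame_target]
  have hs := (conn_solves hq').1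
  rw [← H] at hs
  exact hs.of_comap (dsymm_surjective hq)

end ConnectionForms

/-- Since the differential of an inverse chart is surjective, a form is determined by its coordinate
expressions. -/
lemma form_eq_of_eqOn {α β : YForm F} {γ : Frame F → EY → EY →L[ℝ] ℂ}
    (hα : ∀ y₀, EqOn (inChart α y₀) (γ y₀) (chartAt EY y₀).target)
    (hβ : ∀ y₀, EqOn (inChart β y₀) (γ y₀) (chartAt EY y₀).target) : α = β := by
  refine funext fun y => forall_frame (P := fun y => α y = β y) (fun y₀ q hq => ?_) y
  refine ContinuousLinearMap.ext fun v => ?_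
  obtain ⟨v, rfl⟩ := dsymm_surjective hq v
  exact congrArg (fun f : EY →L[ℝ] ℂ => f v) ((hα y₀ hq).trans (hβ y₀ hq).symm)

namespace ConnectionForms

variable {Γ Γ' : ConnectionForms F}

lemma IsFlat.unique (h : Γ.IsFlat) (h' : Γ'.IsFlat) : Γ = Γ' :=
  ConnectionForms.ext (form_eq_of_eqOn h.ω₁₁ h'.ω₁₁) (form_eq_of_eqOn h.φ₁ h'.φ₁)
    (form_eq_of_eqOn h.φ₂ h'.φ₂) (form_eq_of_eqOn h.ψ h'.ψ)

/-- The coefficient `Q¹` of the curvature. -/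
def curvQ₁ (y : Frame F) : ℂ := (conn F y.base.pt).flatQ₁ (chartAt EY y y)

/-- The coefficient `Q²` of the curvature. -/
def curvQ₂ (y : Frame F) : ℂ := (conn F y.base.pt).flatQ₂ (chartAt EY y y)

/-- The coefficient `U₁` of the curvature. -/
def curvU₁ (y : Frame F) : ℂ := (conn F y.base.pt).flatU₁ (chartAt EY y y)

/-- The coefficient `U₂` of the curvature. -/
def curvU₂ (y : Frame F) : ℂ := (conn F y.base.pt).flatU₂ (chartAt EY y y)

lemma IsFlat.solves (h : Γ.IsFlat) (y : Frame F) :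
    (Γ.jet y).Solves (curvQ₁ y) (curvQ₂ y) (curvU₁ y) (curvU₂ y) := by
  have H := h.solves_symm (mem_chart_target EY y)
  rwa [(chartAt EY y).left_inv (mem_chart_source EY y)] at H

lemma IsFlat.isCanonical (h : Γ.IsFlat) : Γ.IsCanonical :=
  isCanonical_of_solves h.smoothOn h.solves

variable (F) in
/-- There is exactly one canonically normalized system of forms. -/
theorem existsUnique_isCanonical : ∃! Γ : ConnectionForms F, Γ.IsCanonical :=
  ⟨canonical F, isFlat_canonical.isCanonical, fun _ h => h.isFlat.unique isFlat_canonical⟩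

end ConnectionForms

end Transfer

/-! ### The Cartan connection on `Y` -/

lemma Jet.Solves.comap {T T' : Type*} [AddCommGroup T] [Module ℝ T] [TopologicalSpace T]
    [AddCommGroup T'] [Module ℝ T'] [TopologicalSpace T'] {J : Jet T} {Q₁ Q₂ U₁ U₂ : ℂ}
    (h : J.Solves Q₁ Q₂ U₁ U₂) (L : T' →L[ℝ] T) : (J.comap L).Solves Q₁ Q₂ U₁ U₂ where
  d_ω₁ v w := h.d_ω₁ (L v) (L w)
  d_ω₂ v w := h.d_ω₂ (L v) (L w)
  d_φ v w := h.d_φ (L v) (L w)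
  d_x v w := h.d_x (L v) (L w)
  d_f₁ v w := h.d_f₁ (L v) (L w)
  d_f₂ v w := h.d_f₂ (L v) (L w)
  d_g v w := h.d_g (L v) (L w)

/-- The curvature coefficients are determined by the jet. -/
lemma Jet.Solves.coef_unique {V : Type*} [NormedAddCommGroup V] [NormedSpace ℝ V] {J : Jet V}
    {Q₁ Q₂ U₁ U₂ Q₁' Q₂' U₁' U₂' : ℂ} (h : J.Solves Q₁ Q₂ U₁ U₂) (h' : J.Solves Q₁' Q₂' U₁' U₂')
    {e : Fin 3 → V} (he : Independent J.ω₀ J.ω₁ J.ω₂ e) :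
    Q₁ = Q₁' ∧ Q₂ = Q₂' ∧ U₁ = U₁' ∧ U₂ = U₂' := by
  have h1 := he.coef_eq_zero (p := 0) (q := Q₁ - Q₁') (r := 0) fun i j => by
    linear_combination (h.d_f₁ (e i) (e j)).symm.trans (h'.d_f₁ (e i) (e j))
  have h2 := he.coef_eq_zero (p := Q₂ - Q₂') (q := 0) (r := 0) fun i j => by
    linear_combination (h.d_f₂ (e i) (e j)).symm.trans (h'.d_f₂ (e i) (e j))
  have h3 := he.coef_eq_zero (p := U₁' - U₁) (q := U₂' - U₂) (r := 0) fun i j => by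
    have := (h.d_g (e i) (e j)).symm.trans (h'.d_g (e i) (e j))
    simp only [wedge] at this ⊢
    linear_combination this
  exact ⟨sub_eq_zero.1 h1.2.1, sub_eq_zero.1 h2.1, (sub_eq_zero.1 h3.1).symm,
    (sub_eq_zero.1 h3.2.1).symm⟩

section Connection

variable {M : Type*} [TopologicalSpace M] [ChartedSpace E3 M] [IsManifold (𝓡 3) ∞ M]
  {F : FlagStructure M}

namespace ConnectionForms

variable {Γ : ConnectionForms F}

lemma inChart_cartanForm (Γ : ConnectionForms F) (y₀ : Frame F) (q : EY) (i j : Fin 3) :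
    inChart (Γ.cartanForm i j) y₀ q = cartanMat (inChart (ω₀ F) y₀ q) (inChart (ω₁ F) y₀ q)
      (inChart (ω₂ F) y₀ q) (inChart (φ F) y₀ q) (inChart Γ.ω₁₁ y₀ q) (inChart Γ.φ₁ y₀ q)
      (inChart Γ.φ₂ y₀ q) (inChart Γ.ψ y₀ q) i j := by
  fin_cases i <;> fin_cases j <;> rfl

lemma IsFlat.inChart_cartanForm (h : Γ.IsFlat) {y₀ : Frame F} {q : EY}
    (hq : q ∈ (chartAt EY y₀).target) (i j : Fin 3) :
    inChart (Γ.cartanForm i j) y₀ q = (conn F y₀.base.pt).totalMat q i j := by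
  have hq' : q ∈ flatDomain (baseDomain F y₀.base.pt) := by rwa [← frame_target]
  rw [ConnectionForms.inChart_cartanForm, inChart_ω₀ hq, inChart_ω₁ hq, inChart_ω₂ hq,
    inChart_φ hq, h.ω₁₁ y₀ hq, h.φ₁ y₀ hq, h.φ₂ y₀ hq, h.ψ y₀ hq, (conn F y₀.base.pt).totalMat_eq hq']

lemma IsFlat.evalMat_dsymm (h : Γ.IsFlat) {y₀ : Frame F} {q : EY}
    (hq : q ∈ (chartAt EY y₀).target) (v : EY) :
    evalMat Γ.cartanForm ((chartAt EY y₀).symm q) (dsymm y₀ q v) =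
      evalForm ((conn F y₀.base.pt).totalMat q) v :=
  Matrix.ext fun i j => congrArg (fun f : EY →L[ℝ] ℂ => f v) (h.inChart_cartanForm hq i j)

lemma IsFlat.smoothOn_cartanForm (h : Γ.IsFlat) (i j : Fin 3) :
    (Γ.cartanForm i j).SmoothOn univ :=
  smoothOn_of_eqOn (β := fun y₀ q => (conn F y₀.base.pt).totalMat q i j)
    (fun _ _ hq => h.inChart_cartanForm hq i j) fun _ => (conn F _).contDiffOn_totalMat
      (isOpen_baseDomain F _) (contDiffOn_cofθ F _) (contDiffOn_cofθ₁ F _) (contDiffOn_cofθ₂ F _) i j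

lemma evalMat_mem_sl (Γ : ConnectionForms F) (y : Frame F) (v : TangentSpace 𝓘(ℝ, EY) y) :
    evalMat Γ.cartanForm y v ∈ LieAlgebra.SpecialLinear.sl (Fin 3) ℂ := by
  change (evalMat Γ.cartanForm y v).trace = 0
  rw [Matrix.trace_fin_three]
  change -(1 / 2 * φ F y v) - 1 / 3 * Γ.ω₁₁ y v + 2 / 3 * Γ.ω₁₁ y v
    + (1 / 2 * φ F y v - 1 / 3 * Γ.ω₁₁ y v) = 0
  ring

lemma IsFlat.injective (h : Γ.IsFlat) (y : Frame F) :
    Function.Injective (evalMat Γ.cartanForm y) := by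
  refine forall_frame (P := fun y => Function.Injective (evalMat Γ.cartanForm y))
    (fun y₀ q hq => ?_) y
  have hq' : q ∈ flatDomain (baseDomain F y₀.base.pt) := by rwa [← frame_target]
  intro v w hvw
  obtain ⟨v, rfl⟩ := dsymm_surjective hq v
  obtain ⟨w, rfl⟩ := dsymm_surjective hq w
  rw [h.evalMat_dsymm hq, h.evalMat_dsymm hq] at hvw
  have : v - w = 0 := (conn F y₀.base.pt).totalMat_injective hq' (cdet_cof hq'.1) (by
    refine Matrix.ext fun i j => ((conn F y₀.base.pt).totalMat q i j).map_sub v w |>.trans ?_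
    exact sub_eq_zero.2 (congrFun (congrFun hvw i) j))
  rw [sub_eq_zero.1 this]

lemma IsFlat.comap_jet (h : Γ.IsFlat) {y₀ : Frame F} {q : EY} (hq : q ∈ (chartAt EY y₀).target) :
    (Γ.jet ((chartAt EY y₀).symm q)).comap (dsymm y₀ q) = (conn F y₀.base.pt).flatJet q := by
  have hn := target_mem_nhds hq
  exact comap_jet_flat h.smoothOn isOpen_univ hq (mem_univ _)
    (Filter.eventually_of_mem hn (h.ω₁₁ y₀)) (Filter.eventually_of_mem hn (h.φ₁ y₀))
    (Filter.eventually_of_mem hn (h.φ₂ y₀)) (Filter.eventually_of_mem hn (h.ψ y₀))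

/-- The coefficients are defined at each point through its own chart. They are determined by the
jet, so a fixed chart gives the same values, and their smoothness becomes visible. -/
lemma IsFlat.coef_symm (h : Γ.IsFlat) {y₀ : Frame F} {q : EY} (hq : q ∈ (chartAt EY y₀).target) :
    curvQ₁ ((chartAt EY y₀).symm q) = (conn F y₀.base.pt).flatQ₁ q ∧
    curvQ₂ ((chartAt EY y₀).symm q) = (conn F y₀.base.pt).flatQ₂ q ∧
    curvU₁ ((chartAt EY y₀).symm q) = (conn F y₀.base.pt).flatU₁ q ∧
    curvU₂ ((chartAt EY y₀).symm q) = (conn F y₀.base.pt).flatU₂ q := by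
  have hq' : q ∈ flatDomain (baseDomain F y₀.base.pt) := by rwa [← frame_target]
  obtain ⟨e, he⟩ := exists_independent hq' (cdet_cof hq'.1)
  have h1 := (h.solves ((chartAt EY y₀).symm q)).comap (dsymm y₀ q)
  rw [h.comap_jet hq] at h1
  exact h1.coef_unique (conn_solves hq').1 he

lemma contMDiff_of_symm {f : Frame F → ℂ} {g : M → EY → ℂ}
    (hg : ∀ x₀, ContDiffOn ℝ ∞ (g x₀) (flatDomain (baseDomain F x₀)))
    (h : ∀ y₀ : Frame F, ∀ q ∈ (chartAt EY y₀).target,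
      f ((chartAt EY y₀).symm q) = g y₀.base.pt q) : ContMDiff 𝓘(ℝ, EY) 𝓘(ℝ, ℂ) ∞ f := by
  intro y
  have h1 : ContMDiffAt 𝓘(ℝ, EY) 𝓘(ℝ, EY) ∞ (chartAt EY y) y :=
    contMDiffAt_of_mem_maximalAtlas (IsManifold.chart_mem_maximalAtlas y) (mem_chart_source _ y)
  have h2 : ContMDiffAt 𝓘(ℝ, EY) 𝓘(ℝ, ℂ) ∞ (g y.base.pt) (chartAt EY y y) := by
    have := hg y.base.pt
    rw [← frame_target] at this
    exact (this.contDiffAt (target_mem_nhds (mem_chart_target EY y))).contMDiffAt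
  refine (h2.comp y h1).congr_of_eventuallyEq ?_
  filter_upwards [(chartAt EY y).open_source.mem_nhds (mem_chart_source EY y)] with y' hy'
  have := h y _ ((chartAt EY y).map_source hy')
  rwa [(chartAt EY y).left_inv hy'] at this

lemma IsFlat.curvature_dsymm (h : Γ.IsFlat) {y₀ : Frame F} {q : EY}
    (hq : q ∈ (chartAt EY y₀).target) (v w : EY) (i j : Fin 3) :
    curvature Γ.cartanForm i j ((chartAt EY y₀).symm q) (dsymm y₀ q v) (dsymm y₀ q w) =
      curv (conn F y₀.base.pt).totalMat q v w i j := by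
  have h1 : d (Γ.cartanForm i j) ((chartAt EY y₀).symm q) (dsymm y₀ q v) (dsymm y₀ q w) =
      extD (fun q => (conn F y₀.base.pt).totalMat q i j) q v w :=
    (d_dsymm (h.smoothOn_cartanForm i j) isOpen_univ hq (mem_univ _) v w).trans
      (extD_congr_on (chartAt EY y₀).open_target (fun q hq => h.inChart_cartanForm hq i j) hq ▸ rfl)
  simp only [curvature, Matrix.of_apply, Pi.add_apply, Finset.sum_apply, curv, h1]
  refine congrArg _ (Finset.sum_congr rfl fun k _ => ?_)
  rw [← h.inChart_cartanForm hq, ← h.inChart_cartanForm hq]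
  rfl

/-- By `curv_cartanMat` the entries are defects of structure equations. Those of (1), (2), (3) and
of `Ω₁¹` vanish, and the other three are `Φ²`, `Ψ`, `Φ¹` by definition. -/
lemma IsFlat.curvature_eq (h : Γ.IsFlat) : curvature Γ.cartanForm =
    !![0, -Γ.Φ₂, -((1 / 4 : ℂ) • Γ.Ψ); 0, 0, (1 / 2 : ℂ) • Γ.Φ₁; 0, 0, 0] := by
  refine Matrix.ext fun i j => funext fun y => ?_
  refine forall_frame (P := fun y => curvature Γ.cartanForm i j y =
    (!![0, -Γ.Φ₂, -((1 / 4 : ℂ) • Γ.Ψ); 0, 0, (1 / 2 : ℂ) • Γ.Φ₁; 0, 0, 0] :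
      Matrix (Fin 3) (Fin 3) (TwoForm EY (Frame F))) i j y) (fun y₀ q hq => ?_) y
  have hq' : q ∈ flatDomain (baseDomain F y₀.base.pt) := by rwa [← frame_target]
  refine funext fun v => funext fun w => ?_
  obtain ⟨v, rfl⟩ := dsymm_surjective hq v
  obtain ⟨w, rfl⟩ := dsymm_surjective hq w
  rw [h.curvature_dsymm hq]
  set C := conn F y₀.base.pt
  have hS := isOpen_flatDomain (isOpen_baseDomain F y₀.base.pt)
  have df : ∀ {α : EY → EY →L[ℝ] ℂ}, ContDiffOn ℝ ∞ α (flatDomain (baseDomain F y₀.base.pt)) →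
    DifferentiableAt ℝ α q := fun hα => (hα.contDiffAt (hS.mem_nhds hq')).differentiableAt (by simp)
  have hc := contDiffOn_conn (F := F) y₀.base.pt
  have key := curv_cartanMat (df (contDiffOn_flatω₀ (contDiffOn_cofθ F _)))
    (df (contDiffOn_flatω₂ (contDiffOn_cofθ F _) (contDiffOn_cofθ₂ F _)))
    (df (contDiffOn_flatφ (contDiffOn_cofθ F _) (contDiffOn_cofθ₁ F _) (contDiffOn_cofθ₂ F _)))
    (df hc.1) (df hc.2.1) (f₂ := C.flatF₂) (ω₁ := flatω₁ (cofθ F y₀.base.pt) (cofθ₁ F y₀.base.pt))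
    (df hc.2.2.2) v w
  have e : curv C.totalMat q v w = curv (fun q => cartanMat (flatω₀ (cofθ F y₀.base.pt) q)
      (flatω₁ (cofθ F y₀.base.pt) (cofθ₁ F y₀.base.pt) q)
      (flatω₂ (cofθ F y₀.base.pt) (cofθ₂ F y₀.base.pt) q)
      (flatφ (cofθ F y₀.base.pt) (cofθ₁ F y₀.base.pt) (cofθ₂ F y₀.base.pt) q)
      (C.flatX q) (C.flatF₁ q) (C.flatF₂ q) (C.flatG q)) q v w := by
    refine Matrix.ext fun i j => ?_
    simp only [curv, Matrix.of_apply]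
    rw [extD_congr_on hS (fun q hq => congrFun (congrFun (C.totalMat_eq hq) i) j) hq',
      C.totalMat_eq hq']
  have hs := (conn_solves hq').1
  have h0 := (conn_solves hq').2 v w
  have s1 := hs.d_ω₁ v w
  have s2 := hs.d_ω₂ v w
  have s3 := hs.d_φ v w
  have s4 := hs.d_x v w
  -- With a variable jet `J` the identity is definitional, and the explicit coordinate jet can be
  -- substituted afterwards.
  have P1 : ∀ J : Jet EY, (Γ.jet ((chartAt EY y₀).symm q)).comap (dsymm y₀ q) = J →
      Γ.Φ₁ ((chartAt EY y₀).symm q) (dsymm y₀ q v) (dsymm y₀ q w) = J.df₁ v w - wedge J.f₁ J.x v w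
        - 1 / 2 * wedge J.ω₁ J.g v w - 1 / 2 * wedge J.φ J.f₁ v w := by rintro _ rfl; rfl
  have P2 : ∀ J : Jet EY, (Γ.jet ((chartAt EY y₀).symm q)).comap (dsymm y₀ q) = J →
      Γ.Φ₂ ((chartAt EY y₀).symm q) (dsymm y₀ q v) (dsymm y₀ q w) = J.df₂ v w + wedge J.f₂ J.x v w
        - 1 / 2 * wedge J.ω₂ J.g v w - 1 / 2 * wedge J.φ J.f₂ v w := by rintro _ rfl; rfl
  have P3 : ∀ J : Jet EY, (Γ.jet ((chartAt EY y₀).symm q)).comap (dsymm y₀ q) = J →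
      Γ.Ψ ((chartAt EY y₀).symm q) (dsymm y₀ q v) (dsymm y₀ q w) = J.dg v w
        - 2 * wedge J.f₁ J.f₂ v w - wedge J.φ J.g v w := by rintro _ rfl; rfl
  have p1 := P1 _ (h.comap_jet hq)
  have p2 := P2 _ (h.comap_jet hq)
  have p3 := P3 _ (h.comap_jet hq)
  simp only [BaseConnection.flatJet, jetOf] at s1 s2 s3 s4 p1 p2 p3
  rw [e, key]
  fin_cases i <;> fin_cases j
  · change -(1 / 2) * _ - 1 / 3 * _ = (0 : ℂ)
    linear_combination -1 / 2 * s3 - 1 / 3 * s4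
  · change -(_ : ℂ) = -(Γ.Φ₂ _ _ _)
    rw [p2]
  · change -(1 / 4) * (_ : ℂ) = -(1 / 4 * Γ.Ψ _ _ _)
    rw [p3]
    ring
  · change _ = (0 : ℂ)
    simp only [Matrix.of_apply, Matrix.cons_val', Matrix.cons_val_zero, Matrix.cons_val_one,
      Fin.zero_eta, Fin.mk_one, Fin.isValue]
    linear_combination s1
  · change 2 / 3 * _ = (0 : ℂ)
    linear_combination 2 / 3 * s4
  · change 1 / 2 * _ = 1 / 2 * Γ.Φ₁ _ _ _
    rw [p1]
  · change 2 * _ = (0 : ℂ)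
    linear_combination 2 * h0
  · change 2 * _ = (0 : ℂ)
    linear_combination 2 * s2
  · change 1 / 2 * _ - 1 / 3 * _ = (0 : ℂ)
    linear_combination 1 / 2 * s3 - 1 / 3 * s4

lemma IsFlat.exists_coefficients (h : Γ.IsFlat) : ∃ Q₁ Q₂ U₁ U₂ : Frame F → ℂ,
    ContMDiff 𝓘(ℝ, EY) 𝓘(ℝ, ℂ) ∞ Q₁ ∧ ContMDiff 𝓘(ℝ, EY) 𝓘(ℝ, ℂ) ∞ Q₂ ∧
    ContMDiff 𝓘(ℝ, EY) 𝓘(ℝ, ℂ) ∞ U₁ ∧ ContMDiff 𝓘(ℝ, EY) 𝓘(ℝ, ℂ) ∞ U₂ ∧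
    ∀ y v w,
      Γ.Φ₁ y v w = Q₁ y * (ω₀ F ∧ᶠ ω₂ F) y v w ∧
      Γ.Φ₂ y v w = Q₂ y * (ω₀ F ∧ᶠ ω₁ F) y v w ∧
      Γ.Ψ y v w = U₁ y * (ω₁ F ∧ᶠ ω₀ F) y v w + U₂ y * (ω₂ F ∧ᶠ ω₀ F) y v w := by
  refine ⟨curvQ₁, curvQ₂, curvU₁, curvU₂,
    contMDiff_of_symm (fun x₀ => (conn F x₀).contDiffOn_flatQ₁) fun _ _ hq => (h.coef_symm hq).1,
    contMDiff_of_symm (fun x₀ => (conn F x₀).contDiffOn_flatQ₂) fun _ _ hq => (h.coef_symm hq).2.1,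
    contMDiff_of_symm (fun x₀ => (conn F x₀).contDiffOn_flatU₁) fun _ _ hq => (h.coef_symm hq).2.2.1,
    contMDiff_of_symm (fun x₀ => (conn F x₀).contDiffOn_flatU₂) fun _ _ hq => (h.coef_symm hq).2.2.2,
    fun y v w => ⟨?_, ?_, ?_⟩⟩ <;> have hs := h.solves y
  · change (Γ.jet y).df₁ v w - wedge (Γ.jet y).f₁ (Γ.jet y).x v w
      - 1 / 2 * wedge (Γ.jet y).ω₁ (Γ.jet y).g v w - 1 / 2 * wedge (Γ.jet y).φ (Γ.jet y).f₁ v w =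
      curvQ₁ y * wedge (Γ.jet y).ω₀ (Γ.jet y).ω₂ v w
    linear_combination hs.d_f₁ v w
  · change (Γ.jet y).df₂ v w + wedge (Γ.jet y).f₂ (Γ.jet y).x v w
      - 1 / 2 * wedge (Γ.jet y).ω₂ (Γ.jet y).g v w - 1 / 2 * wedge (Γ.jet y).φ (Γ.jet y).f₂ v w =
      curvQ₂ y * wedge (Γ.jet y).ω₀ (Γ.jet y).ω₁ v w
    linear_combination hs.d_f₂ v w
  · change (Γ.jet y).dg v w - 2 * wedge (Γ.jet y).f₁ (Γ.jet y).f₂ v w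
      - wedge (Γ.jet y).φ (Γ.jet y).g v w = curvU₁ y * wedge (Γ.jet y).ω₁ (Γ.jet y).ω₀ v w +
        curvU₂ y * wedge (Γ.jet y).ω₂ (Γ.jet y).ω₀ v w
    linear_combination hs.d_g v w

end ConnectionForms

end Connection

/-! ### The action of the Borel subgroup in coordinates -/

section ActionCoordinates

/-- The action on the fibre coordinates. -/
def fibreAct (h : Borel) (k : Fin 5 → ℂ) : Fin 5 → ℂ :=
  -- Third and fourth coordinates are `θ`-coefficients divided by `λ = k₀k₁`, and `λ` is itself
  -- multiplied by `a/b`. Hence their factors differ from those in the action on `η₁` and `η₂`.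
  ![borelMat h 0 0 ^ 2 * borelMat h 2 2 * k 0,
    (borelMat h 0 0)⁻¹ * (borelMat h 2 2)⁻¹ ^ 2 * k 1,
    borelMat h 0 0 * borelMat h 2 2 ^ 2 * k 2 - 2 * (borelMat h 0 0 * borelMat h 2 2 * borelMat h 1 2),
    (borelMat h 0 0)⁻¹ ^ 2 * (borelMat h 2 2)⁻¹ * k 3 + borelMat h 0 1 * (borelMat h 0 0)⁻¹,
    k 4 + (borelMat h 0 0 * borelMat h 2 2 * borelMat h 0 1 * k 2
      + 2 * borelMat h 1 2 * (borelMat h 2 2)⁻¹ * k 3 + 4 * borelMat h 0 2 * (borelMat h 2 2)⁻¹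
      - 2 * (borelMat h 0 0 * borelMat h 0 1 * borelMat h 1 2)) * (k 0 * k 1)]

/-- The action on coordinates. -/
def coordAct (h : Borel) (q : EY) : EY := (q.1, fibreAct h q.2)

lemma borelMat_lower (h : Borel) :
    borelMat h 1 0 = 0 ∧ borelMat h 2 0 = 0 ∧ borelMat h 2 1 = 0 := (blockTriangular_iff _).1 h.2

lemma borelMat_middle (h : Borel) :
    borelMat h 1 1 = (borelMat h 0 0)⁻¹ * (borelMat h 2 2)⁻¹ := by
  have ha := borelMat_ne_zero₀ h
  have hb := borelMat_ne_zero₂ h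
  have hd := borelMat_diag h
  field_simp
  linear_combination hd

/-- The action on the fibre corresponds to right multiplication of `hmat`. -/
lemma hmat_fibreAct (h : Borel) {k : Fin 5 → ℂ} (h0 : k 0 ≠ 0) (h1 : k 1 ≠ 0) :
    hmat (fibreAct h k) = hmat k * ((borelMat h 0 0)⁻¹ • borelMat h) := by
  have ha := borelMat_ne_zero₀ h
  have hb := borelMat_ne_zero₂ h
  obtain ⟨l1, l2, l3⟩ := borelMat_lower h
  have hm := borelMat_middle h
  have f0 : fibreAct h k 0 = borelMat h 0 0 ^ 2 * borelMat h 2 2 * k 0 := rfl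
  have f1 : fibreAct h k 1 = (borelMat h 0 0)⁻¹ * (borelMat h 2 2)⁻¹ ^ 2 * k 1 := rfl
  have f2 : fibreAct h k 2 = borelMat h 0 0 * borelMat h 2 2 ^ 2 * k 2
    - 2 * (borelMat h 0 0 * borelMat h 2 2 * borelMat h 1 2) := rfl
  have f3 : fibreAct h k 3 = (borelMat h 0 0)⁻¹ ^ 2 * (borelMat h 2 2)⁻¹ * k 3
    + borelMat h 0 1 * (borelMat h 0 0)⁻¹ := rfl
  have f4 : fibreAct h k 4 = k 4 + (borelMat h 0 0 * borelMat h 2 2 * borelMat h 0 1 * k 2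
      + 2 * borelMat h 1 2 * (borelMat h 2 2)⁻¹ * k 3 + 4 * borelMat h 0 2 * (borelMat h 2 2)⁻¹
      - 2 * (borelMat h 0 0 * borelMat h 0 1 * borelMat h 1 2)) * (k 0 * k 1) := rfl
  -- Only the vanishing entries and the determinant condition matter from here. The factor `a⁻¹`
  -- keeps the corner entry equal to `1`.
  generalize borelMat h = A at *
  refine Matrix.ext fun i j => ?_
  rw [Matrix.mul_apply, Fin.sum_univ_three]
  simp only [Matrix.smul_apply, smul_eq_mul]
  fin_cases i <;> fin_cases j <;> simp only [hmat, Matrix.of_apply, Matrix.cons_val',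
    Matrix.cons_val_zero, Matrix.cons_val_one, Matrix.cons_val, Fin.zero_eta, Fin.mk_one,
    Fin.reduceFinMk, Fin.isValue, f0, f1, f2, f3, f4, l1, l2, l3, hm] <;> field_simp <;> ring

lemma inv_mul_borelMat (h : Borel) : borelMat h⁻¹ * borelMat h = 1 :=
  congrArg borelMat (inv_mul_cancel h)

lemma fibreAct_ne_zero (h : Borel) {k : Fin 5 → ℂ} (h0 : k 0 ≠ 0) (h1 : k 1 ≠ 0) :
    fibreAct h k 0 ≠ 0 ∧ fibreAct h k 1 ≠ 0 :=
  ⟨mul_ne_zero (mul_ne_zero (pow_ne_zero 2 (borelMat_ne_zero₀ h)) (borelMat_ne_zero₂ h)) h0,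
    mul_ne_zero (mul_ne_zero (inv_ne_zero (borelMat_ne_zero₀ h))
      (pow_ne_zero 2 (inv_ne_zero (borelMat_ne_zero₂ h)))) h1⟩

/-- Both sides are left inverses of `hmat (fibreAct h k)`. -/
lemma hinv_fibreAct (h : Borel) {k : Fin 5 → ℂ} (h0 : k 0 ≠ 0) (h1 : k 1 ≠ 0) :
    hinv (fibreAct h k) = (borelMat h 0 0 • borelMat h⁻¹) * hinv k := by
  have e1 := hinv_mul_hmat (fibreAct_ne_zero h h0 h1).1 (fibreAct_ne_zero h h0 h1).2
  have e2 : (borelMat h 0 0 • borelMat h⁻¹) * hinv k * hmat (fibreAct h k) = 1 := by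
    rw [hmat_fibreAct h h0 h1, mul_assoc, ← mul_assoc (hinv k), hinv_mul_hmat h0 h1, one_mul,
      smul_mul_assoc, mul_smul_comm, inv_mul_borelMat, smul_smul,
      mul_inv_cancel₀ (borelMat_ne_zero₀ h), one_smul]
  exact (left_inv_eq_right_inv e2 (mul_eq_one_comm.1 e1)).symm

lemma fibreAct_of_eq_one {h : Borel} (e : borelMat h = 1) (k : Fin 5 → ℂ) : fibreAct h k = k := by
  funext i
  fin_cases i <;> simp [fibreAct, e]

lemma contDiff_coordAct (h : Borel) : ContDiff ℝ ∞ (coordAct h) := by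
  have k := contDiff_fibre
  have c := fun z : ℂ => contDiff_const (𝕜 := ℝ) (n := ∞) (E := EY) (c := z)
  refine contDiff_fst.prodMk (contDiff_pi.2 fun i => ?_)
  fin_cases i
  · exact (c _).mul (k 0)
  · exact (c _).mul (k 1)
  · exact ((c _).mul (k 2)).sub (c _)
  · exact ((c _).mul (k 3)).add (c _)
  · exact (k 4).add ((((((c _).mul (k 2)).add ((c _).mul (k 3))).add (c _)).sub (c _)).mul
      ((k 0).mul (k 1)))

lemma coordAct_mem {O : Set E3} (h : Borel) {q : EY} (hq : q ∈ flatDomain O) :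
    coordAct h q ∈ flatDomain O := ⟨hq.1, fibreAct_ne_zero h hq.2.1 hq.2.2⟩

lemma matD_comp {V W : Type*} [NormedAddCommGroup V] [NormedSpace ℝ V] [NormedAddCommGroup W]
    [NormedSpace ℝ W] {f : V → Mat3} {g : W → V} {g' : W →L[ℝ] V} {q : W}
    (hg : HasFDerivAt g g' q) (hf : MatDiff f (g q)) (v : W) :
    matD (fun q => f (g q)) q v = matD f (g q) (g' v) :=
  Matrix.ext fun i j => congrArg (fun L : W →L[ℝ] ℂ => L v)
    ((hf i j).hasFDerivAt.comp q hg).fderiv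

lemma matDiff_hmat {q : EY} (hq : q.2 0 ≠ 0 ∧ q.2 1 ≠ 0) : MatDiff (fun q : EY => hmat q.2) q :=
  fun i j => ((contDiffOn_hmat (O := univ) i j).contDiffAt
    ((isOpen_flatDomain isOpen_univ).mem_nhds ⟨mem_univ _, hq⟩)).differentiableAt (by simp)

variable {O : Set E3} {t t₁ t₂ : E3 → E3 →L[ℝ] ℂ}

/-- Equivariance of the Cartan matrix in coordinates. -/
theorem BaseConnection.totalMat_coordAct (C : BaseConnection O t t₁ t₂) (h : Borel) {q : EY}
    (hq : q ∈ flatDomain O) (v : EY) :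
    evalForm (C.totalMat (coordAct h q)) (fderiv ℝ (coordAct h) q v) =
      borelMat h⁻¹ * evalForm (C.totalMat q) v * borelMat h := by
  have hA := ((contDiff_coordAct h).contDiffAt (x := q)).differentiableAt (by simp) |>.hasFDerivAt
  set A' := fderiv ℝ (coordAct h) q with hA'
  have a1 : (A' v).1 = v.1 := congrArg (fun L : EY →L[ℝ] E3 => L v)
    (hA.fst.unique (hasFDerivAt_fst (𝕜 := ℝ) (p := q)))
  have a20 : (A' v).2 0 = borelMat h 0 0 ^ 2 * borelMat h 2 2 * v.2 0 :=
    congrArg (fun L : EY →L[ℝ] ℂ => L v) (((pr 0).hasFDerivAt.comp q hA).unique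
      ((pr 0).hasFDerivAt.const_mul (borelMat h 0 0 ^ 2 * borelMat h 2 2)))
  have a21 : (A' v).2 1 = (borelMat h 0 0)⁻¹ * (borelMat h 2 2)⁻¹ ^ 2 * v.2 1 :=
    congrArg (fun L : EY →L[ℝ] ℂ => L v) (((pr 1).hasFDerivAt.comp q hA).unique
      ((pr 1).hasFDerivAt.const_mul ((borelMat h 0 0)⁻¹ * (borelMat h 2 2)⁻¹ ^ 2)))
  -- The action preserves the base point, hence also the forms pulled back from the base.
  have hB : evalForm (C.baseMat (coordAct h q)) (A' v) = evalForm (C.baseMat q) v := by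
    rw [C.evalForm_baseMat, C.evalForm_baseMat, a1]
    rfl
  -- The coordinates `k₀` and `k₁` are multiplied by constants, so their logarithmic differentials
  -- do not change.
  have hT : traceForm (coordAct h q) (A' v) = traceForm q v := by
    have ha := borelMat_ne_zero₀ h
    have hb := borelMat_ne_zero₂ h
    have h0 := hq.2.1
    have h1 := hq.2.2
    change 2 / 3 * (borelMat h 0 0 ^ 2 * borelMat h 2 2 * q.2 0)⁻¹ * (A' v).2 0 +
      1 / 3 * ((borelMat h 0 0)⁻¹ * (borelMat h 2 2)⁻¹ ^ 2 * q.2 1)⁻¹ * (A' v).2 1 =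
      2 / 3 * (q.2 0)⁻¹ * v.2 0 + 1 / 3 * (q.2 1)⁻¹ * v.2 1
    rw [a20, a21]
    field_simp
  -- The factor in `hmat_fibreAct` is constant along `Y`, so `dH` is multiplied by it on the right.
  -- The scalars `a` and `a⁻¹` cancel in the end.
  have hD : matD (fun q : EY => hmat q.2) (coordAct h q) (A' v) =
      matD (fun q : EY => hmat q.2) q v * ((borelMat h 0 0)⁻¹ • borelMat h) := by
    rw [← matD_comp hA (matDiff_hmat (coordAct_mem h hq).2)]
    have e : (fun q : EY => hmat (coordAct h q).2) =ᶠ[𝓝 q]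
        fun q => hmat q.2 * ((borelMat h 0 0)⁻¹ • borelMat h) :=
      Filter.eventually_of_mem ((isOpen_flatDomain (O := univ) isOpen_univ).mem_nhds
        ⟨mem_univ _, hq.2⟩) fun q' hq' => hmat_fibreAct h hq'.2.1 hq'.2.2
    have em := matD_mul (g := fun _ => (borelMat h 0 0)⁻¹ • borelMat h) (matDiff_hmat hq.2)
      (fun _ _ => differentiableAt_const _) v
    rw [matD_const, mul_zero, add_zero] at em
    exact (matD_congr e v).trans em
  have k1 := evalForm_gaugeForm C.baseMat (fun q => hmat q.2) (fun q => hinv q.2) traceForm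
    (coordAct h q) (A' v)
  have k2 := evalForm_gaugeForm C.baseMat (fun q => hmat q.2) (fun q => hinv q.2) traceForm q v
  change evalForm (C.totalMat _) _ = _ at k1 k2
  rw [k1, k2, hB, hT, hD]
  change hinv (fibreAct h q.2) * _ * hmat (fibreAct h q.2) + hinv (fibreAct h q.2) * _ + _ = _
  rw [hinv_fibreAct h hq.2.1 hq.2.2, hmat_fibreAct h hq.2.1 hq.2.2]
  have ha := borelMat_ne_zero₀ h
  simp only [mul_add, add_mul, smul_mul_assoc, mul_smul_comm, smul_smul,
    inv_mul_cancel₀ ha, one_smul, mul_one, inv_mul_borelMat, mul_assoc]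

/-- Fundamental vector fields in coordinates. -/
theorem BaseConnection.totalMat_fundamental (C : BaseConnection O t t₁ t₂) {q : EY}
    (hq : q ∈ flatDomain O) (X : borelAlgebra) : ∃ c' : EY,
      HasDerivAt (fun s : ℝ => coordAct (borelExp ((s : ℂ) • X)) q) c' 0 ∧
        evalForm (C.totalMat q) c' = X := by
  set E : ℝ → Mat3 := fun s => borelMat (borelExp ((s : ℂ) • X)) with hE
  have hE0 : E 0 = 1 := by
    change NormedSpace.exp ((((0 : ℝ) : ℂ) • X : borelAlgebra) : Mat3) = 1
    simp
  have hEd : ∀ i j, HasDerivAt (fun s => E s i j) ((X : Mat3) i j) 0 := by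
    intro i j
    let _ : NormedRing Mat3 := Matrix.linftyOpNormedRing
    let _ : NormedAlgebra ℂ Mat3 := Matrix.linftyOpNormedAlgebra
    have h1 := hasDerivAt_exp_smul_const (𝕂 := ℂ) (X : Mat3) ((0 : ℝ) : ℂ)
    rw [Complex.ofReal_zero, zero_smul, NormedSpace.exp_zero, one_mul] at h1
    have h2 : HasDerivAt (fun z : ℂ => NormedSpace.exp (z • (X : Mat3)) i j) ((X : Mat3) i j)
        ((0 : ℝ) : ℂ) := by
      rw [Complex.ofReal_zero]
      exact hasDerivAt_pi.1 (hasDerivAt_pi.1 h1 i) j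
    exact h2.comp_ofReal
  have n0 : E 0 0 0 ≠ 0 := borelMat_ne_zero₀ _
  have n2 : E 0 2 2 ≠ 0 := borelMat_ne_zero₂ _
  have d0 := hEd 0 0
  have d2 := hEd 2 2
  have i0 := d0.inv n0
  have i2 := d2.inv n2
  -- These derivatives follow the five components of `fibreAct`. Only the first two values are
  -- computed, for `traceForm`. The others are needed only for differentiability.
  have c0 := ((d0.pow 2).mul d2).mul_const (q.2 0)
  have c1 := (i0.mul (i2.pow 2)).mul_const (q.2 1)
  have c2 := ((d0.mul (d2.pow 2)).mul_const (q.2 2)).sub (((d0.mul d2).mul (hEd 1 2)).const_mul 2)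
  have c3 := (((i0.pow 2).mul i2).mul_const (q.2 3)).add ((hEd 0 1).mul i0)
  have c4 := (((((((d0.mul d2).mul (hEd 0 1)).mul_const (q.2 2)).add
    ((((hEd 1 2).const_mul 2).mul i2).mul_const (q.2 3))).add
    (((hEd 0 2).const_mul 4).mul i2)).sub (((d0.mul (hEd 0 1)).mul (hEd 1 2)).const_mul 2)).mul_const
    (q.2 0 * q.2 1)).const_add (q.2 4)
  obtain ⟨c', hc', h0, h1, h2⟩ : ∃ c' : EY,
      HasDerivAt (fun s : ℝ => coordAct (borelExp ((s : ℂ) • X)) q) c' 0 ∧ c'.1 = 0 ∧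
      c'.2 0 = (2 * (X : Mat3) 0 0 + (X : Mat3) 2 2) * q.2 0 ∧
      c'.2 1 = -((X : Mat3) 0 0 + 2 * (X : Mat3) 2 2) * q.2 1 := by
    refine ⟨(0, fun i => deriv (fun s : ℝ => fibreAct (borelExp ((s : ℂ) • X)) q.2 i) 0),
      (hasDerivAt_const (0 : ℝ) q.1).prodMk (hasDerivAt_pi.2 fun i =>
        DifferentiableAt.hasDerivAt ?_), rfl, c0.deriv.trans ?_, c1.deriv.trans ?_⟩
    · fin_cases i
      exacts [c0.differentiableAt, c1.differentiableAt, c2.differentiableAt, c3.differentiableAt,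
        c4.differentiableAt]
    · simp [hE0]
    · simp [hE0]
      left
      ring
  have hq0 : coordAct (borelExp (((0 : ℝ) : ℂ) • X)) q = q := by
    exact Prod.ext rfl (fibreAct_of_eq_one hE0 q.2)
  -- Along the orbit `hmat` is multiplied on the right by the exponential divided by its own upper
  -- left entry. The derivative of this factor at `0` is `X` minus its upper left entry times the
  -- identity.
  have hD : matD (fun q : EY => hmat q.2) q c' =
      hmat q.2 * ((X : Mat3) - (X : Mat3) 0 0 • 1) := by
    have m1 := matD_comp (f := fun q : EY => hmat q.2) hc'.hasFDerivAt
      (by rw [hq0]; exact matDiff_hmat hq.2) 1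
    rw [hq0] at m1
    have e1 : (ContinuousLinearMap.toSpanSingleton ℝ c') 1 = c' := by simp
    rw [e1] at m1
    rw [← m1]
    have e2 : (fun s : ℝ => hmat (coordAct (borelExp ((s : ℂ) • X)) q).2) =
        fun s => hmat q.2 * ((E s 0 0)⁻¹ • E s) := funext fun s =>
      hmat_fibreAct _ hq.2.1 hq.2.2
    have d : ∀ i j, HasDerivAt (fun s => ((E s 0 0)⁻¹ • E s) i j)
        (((X : Mat3) - (X : Mat3) 0 0 • 1) i j) 0 := fun i j =>
      (i0.mul (hEd i j)).congr_deriv (by simp [hE0]; ring)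
    have em := matD_mul (f := fun _ : ℝ => hmat q.2) (fun _ _ => differentiableAt_const _)
      (fun i j => (d i j).differentiableAt) 1
    rw [matD_const, zero_mul, zero_add] at em
    refine (congrArg (fun f => matD f 0 1) e2).trans (em.trans ?_)
    refine congrArg _ (Matrix.ext fun i j => ?_)
    exact (d i j).deriv
  -- `(2/3)(2 X₀₀ + X₂₂) - (1/3)(X₀₀ + 2 X₂₂) = X₀₀`, which is exactly the scalar missing from `H⁻¹
  -- dH`.
  have hT : traceForm q c' = (X : Mat3) 0 0 := by
    change 2 / 3 * (q.2 0)⁻¹ * c'.2 0 + 1 / 3 * (q.2 1)⁻¹ * c'.2 1 = _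
    have k0 := hq.2.1
    have k1 := hq.2.2
    rw [h1, h2]
    field_simp
    ring
  have hB : evalForm (C.baseMat q) c' = 0 := by
    rw [C.evalForm_baseMat, h0]
    ext i j
    fin_cases i <;> fin_cases j <;> simp
  refine ⟨c', hc', ?_⟩
  have k := evalForm_gaugeForm C.baseMat (fun q => hmat q.2) (fun q => hinv q.2) traceForm q c'
  refine k.trans ?_
  rw [hB, hT, hD, mul_zero, zero_mul, zero_add, ← mul_assoc, hinv_mul_hmat hq.2.1 hq.2.2, one_mul,
    sub_add_cancel]

end ActionCoordinates

/-! ### The action of the Borel subgroup in the charts of `Y` -/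

section ActionCharts

variable {M : Type*} [TopologicalSpace M] [ChartedSpace E3 M] [IsManifold (𝓡 3) ∞ M]
  {F : FlagStructure M}

lemma dlam_scale {x₀ : M} {μ : ℂ} (hμ : μ ≠ 0) {e : ContactForm F} (he : e.pt ∈ (cof F x₀).U)
    (v : E3 × ℂ) : dlam x₀ (e.scale μ hμ) (dilation μ v) = μ * dlam x₀ e v := by
  have hl : MDifferentiableAt 𝓘(ℝ, E3 × ℂ) 𝓘(ℝ, ℂ) (lam x₀) (e.scale μ hμ) :=
    (contMDiffAt_lam (x₀ := x₀) (e := e.scale μ hμ) he).mdifferentiableAt (by simp)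
  have hl' : MDifferentiableAt 𝓘(ℝ, E3 × ℂ) 𝓘(ℝ, ℂ) (lam x₀) e :=
    (contMDiffAt_lam he).mdifferentiableAt (by simp)
  have hm : MDifferentiableAt 𝓘(ℝ, ℂ) 𝓘(ℝ, ℂ) (fun z : ℂ => μ * z) (lam x₀ e) :=
    (differentiableAt_id.const_mul μ).mdifferentiableAt
  have h1 := mfderiv_comp e hl (mdifferentiableAt_scale hμ e)
  have h2 := mfderiv_comp e hm hl'
  have h3 : lam x₀ ∘ ContactForm.scale (F := F) μ hμ = (fun z : ℂ => μ * z) ∘ lam x₀ :=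
    funext fun e => lam_scale x₀ hμ e
  have h4 := (mfderiv_eq_fderiv (𝕜 := ℝ) (f := fun z : ℂ => μ * z) (x := lam x₀ e)).trans
    ((hasFDerivAt_id (𝕜 := ℝ) (lam x₀ e)).const_mul μ).fderiv
  have h1' := congrArg (fun f : E3 × ℂ →L[ℝ] ℂ => f v) h1
  have h2' := congrArg (fun f : E3 × ℂ →L[ℝ] ℂ => f v) h2
  have h3' := congrArg (fun f : ContactForm F → ℂ =>
    (mfderiv 𝓘(ℝ, E3 × ℂ) 𝓘(ℝ, ℂ) f e : E3 × ℂ →L[ℝ] ℂ) v) h3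
  have h4' := congrArg (fun f : ℂ →L[ℝ] ℂ => f (dlam x₀ e v)) h4
  have h5 := congrArg (fun f : E3 × ℂ →L[ℝ] E3 × ℂ => f v) (mfderiv_scale hμ e)
  refine (congrArg (dlam x₀ (e.scale μ hμ)) h5).symm.trans ?_
  exact h1'.symm.trans (h3'.trans (h2'.trans h4'))

/-- The dilation multiplies `λ` by a constant, so `λ⁻¹ dλ` is invariant and only `ψ` contributes. -/
lemma betaOf_scale {x₀ : M} {μ : ℂ} (hμ : μ ≠ 0) {e : ContactForm F} (he : e.pt ∈ (cof F x₀).U)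
    (ψ : E3 × ℂ →L[ℝ] ℂ) (v : E3) :
    betaOf x₀ (e.scale μ hμ) (ψ.comp (scaleInv hμ e : E3 × ℂ →L[ℝ] E3 × ℂ)) v =
      betaOf x₀ e ψ v := by
  have h1 : (scaleInv hμ e : E3 × ℂ →L[ℝ] E3 × ℂ) (v, 0) = (v, 0) :=
    (scaleInv_apply hμ e (v, 0)).trans (Prod.ext rfl (mul_zero _))
  have h2 : dilation μ ((v, 0) : E3 × ℂ) = (v, 0) := Prod.ext rfl (mul_zero μ)
  have h3 := dlam_scale (x₀ := x₀) hμ he (v, 0)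
  rw [h2] at h3
  have h4 : (lam x₀ (e.scale μ hμ))⁻¹ * dlam x₀ (e.scale μ hμ) (v, 0) =
      (lam x₀ e)⁻¹ * dlam x₀ e (v, 0) := by
    refine (congrArg₂ (fun a b : ℂ => a⁻¹ * b) (lam_scale x₀ hμ e) h3).trans ?_
    field_simp
  exact congrArg₂ (fun a b : ℂ => a + b) (congrArg ψ h1) h4

/-- The action in the fibre coordinates. -/
lemma frameCoord_act (h : Borel) {x₀ : M} {y : Frame F} (hy : y.base.pt ∈ (cof F x₀).U) :
    frameCoord x₀ (act h y) = fibreAct h (frameCoord x₀ y) := by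
  have ha := borelMat_ne_zero₀ h
  have hb := borelMat_ne_zero₂ h
  have hμ := div_ne_zero ha hb
  set C := cof F x₀ with hC
  set l := lam x₀ y.base with hldef
  have hl : l ≠ 0 := lam_ne_zero hy
  obtain ⟨hk, s, hs⟩ := y.relations hy
  have hs4 : betaOf x₀ y.base y.φ = _ :=
    (congrArg (betaOf x₀ y.base) hs).trans (betaOf_phiOf _ _ _)
  have k0 : frameCoord x₀ y 0 = C.coef₁ y.base.pt y.η₁ := rfl
  have k1 : frameCoord x₀ y 1 = C.coef₂ y.base.pt y.η₂ := rfl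
  have k2 : frameCoord x₀ y 2 = C.coef₀ y.base.pt y.η₁ / l := rfl
  have k3 : frameCoord x₀ y 3 = C.coef₀ y.base.pt y.η₂ / l := rfl
  have k4 : frameCoord x₀ y 4 = s :=
    (congrArg (C.coef₀ y.base.pt) hs4).trans (C.coef₀_comb hy _ _ _)
  have hη₁ := (C.eq_of_dual₁ hy y.dual₁).1
  have hη₂ := (C.eq_of_dual₂ hy y.dual₂).1
  set p₁ := C.coef₀ y.base.pt y.η₁
  set a₁ := C.coef₁ y.base.pt y.η₁
  set p₂ := C.coef₀ y.base.pt y.η₂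
  set a₂ := C.coef₂ y.base.pt y.η₂
  have eθ : ∀ u : E3, y.base.θ u = l * C.θ y.base.pt u := fun u =>
    congrArg (fun f : E3 →L[ℝ] ℂ => f u) (θ_eq hy)
  have e₁ : ∀ u : E3, y.η₁ u = p₁ * C.θ y.base.pt u + a₁ * C.θ₁ y.base.pt u := by
    intro u
    refine (congrArg (fun f : E3 →L[ℝ] ℂ => f u) hη₁).trans ?_
    change p₁ * C.θ y.base.pt u + a₁ * C.θ₁ y.base.pt u + 0 * C.θ₂ y.base.pt u = _
    rw [zero_mul, add_zero]
  have e₂ : ∀ u : E3, y.η₂ u = p₂ * C.θ y.base.pt u + a₂ * C.θ₂ y.base.pt u := by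
    intro u
    refine (congrArg (fun f : E3 →L[ℝ] ℂ => f u) hη₂).trans ?_
    change p₂ * C.θ y.base.pt u + 0 * C.θ₁ y.base.pt u + a₂ * C.θ₂ y.base.pt u = _
    rw [zero_mul, add_zero]
  have n₁ : y.newη₁ h = C.comb y.base.pt
      (borelMat h 0 0 ^ 2 * borelMat h 2 2 * p₁ - 2 * borelMat h 0 0 ^ 2 * borelMat h 1 2 * l)
      (borelMat h 0 0 ^ 2 * borelMat h 2 2 * a₁) 0 := by
    refine ContinuousLinearMap.ext fun u : E3 => ?_
    change borelMat h 0 0 ^ 2 * borelMat h 2 2 * y.η₁ u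
      - 2 * borelMat h 0 0 ^ 2 * borelMat h 1 2 * y.base.θ u = _ * C.θ y.base.pt u +
        _ * C.θ₁ y.base.pt u + 0 * C.θ₂ y.base.pt u
    rw [e₁, eθ]
    ring
  have n₂ : y.newη₂ h = C.comb y.base.pt
      (1 / (borelMat h 0 0 * borelMat h 2 2 ^ 2) * p₂ + borelMat h 0 1 / borelMat h 2 2 * l)
      0 (1 / (borelMat h 0 0 * borelMat h 2 2 ^ 2) * a₂) := by
    refine ContinuousLinearMap.ext fun u : E3 => ?_
    change 1 / (borelMat h 0 0 * borelMat h 2 2 ^ 2) * y.η₂ u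
      + borelMat h 0 1 / borelMat h 2 2 * y.base.θ u = _ * C.θ y.base.pt u +
        0 * C.θ₁ y.base.pt u + _ * C.θ₂ y.base.pt u
    rw [e₂, eθ]
    ring
  have nβ : betaOf x₀ (act h y).base (act h y).φ = C.comb y.base.pt
      (s + borelMat h 0 0 * borelMat h 2 2 * borelMat h 0 1 * p₁
        + 2 * borelMat h 1 2 / borelMat h 2 2 * p₂ + (4 * borelMat h 0 2 / borelMat h 2 2
        - 2 * borelMat h 0 0 * borelMat h 0 1 * borelMat h 1 2) * l)
      (a₁ * (p₂ / l) + borelMat h 0 0 * borelMat h 2 2 * borelMat h 0 1 * a₁)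
      (-(a₂ * (p₁ / l)) + 2 * borelMat h 1 2 / borelMat h 2 2 * a₂) := by
    refine ContinuousLinearMap.ext fun u : E3 => ?_
    refine (betaOf_scale hμ hy (y.newφ h) u).trans ?_
    have b : betaOf x₀ y.base y.φ u = s * C.θ y.base.pt u + a₁ * (p₂ / l) * C.θ₁ y.base.pt u
      + -(a₂ * (p₁ / l)) * C.θ₂ y.base.pt u := congrArg (fun f : E3 →L[ℝ] ℂ => f u) hs4
    have b' : y.φ ((u, 0) : E3 × ℂ) + l⁻¹ * dlam x₀ y.base (u, 0) = s * C.θ y.base.pt u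
      + a₁ * (p₂ / l) * C.θ₁ y.base.pt u + -(a₂ * (p₁ / l)) * C.θ₂ y.base.pt u := b
    have q₁ : y.η₁ (dpt F y.base ((u, 0) : E3 × ℂ)) = y.η₁ u :=
      congrArg (y.η₁ : E3 →L[ℝ] ℂ) (dpt_apply y.base (u, 0))
    have q₂ : y.η₂ (dpt F y.base ((u, 0) : E3 × ℂ)) = y.η₂ u :=
      congrArg (y.η₂ : E3 →L[ℝ] ℂ) (dpt_apply y.base (u, 0))
    have q₀ : tautE F y.base ((u, 0) : E3 × ℂ) = y.base.θ u := tautE_apply y.base (u, 0)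
    have q : y.newφ h ((u, 0) : E3 × ℂ) = y.φ ((u, 0) : E3 × ℂ)
        + borelMat h 0 0 * borelMat h 2 2 * borelMat h 0 1 * y.η₁ (dpt F y.base ((u, 0) : E3 × ℂ))
        + 2 * borelMat h 1 2 / borelMat h 2 2 * y.η₂ (dpt F y.base ((u, 0) : E3 × ℂ))
        + (4 * borelMat h 0 2 / borelMat h 2 2
          - 2 * borelMat h 0 0 * borelMat h 0 1 * borelMat h 1 2) *
            tautE F y.base ((u, 0) : E3 × ℂ) := rfl
    rw [q₁, q₂, q₀, e₁, e₂, eθ] at q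
    refine (congrArg (fun z : ℂ => z + l⁻¹ * dlam x₀ y.base (u, 0)) q).trans ?_
    change _ = _ * C.θ y.base.pt u + _ * C.θ₁ y.base.pt u + _ * C.θ₂ y.base.pt u
    linear_combination b'
  have hl' : lam x₀ (act h y).base = borelMat h 0 0 / borelMat h 2 2 * l := lam_scale x₀ hμ y.base
  funext i
  fin_cases i
  · refine (congrArg (C.coef₁ y.base.pt) n₁).trans ((C.coef₁_comb hy _ _ _).trans ?_)
    rfl
  · refine (congrArg (C.coef₂ y.base.pt) n₂).trans ((C.coef₂_comb hy _ _ _).trans ?_)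
    change _ = (borelMat h 0 0)⁻¹ * (borelMat h 2 2)⁻¹ ^ 2 * a₂
    field_simp
  · refine (congrArg₂ (fun z z' : ℂ => z / z') ((congrArg (C.coef₀ y.base.pt) n₁).trans
      (C.coef₀_comb hy _ _ _)) hl').trans ?_
    change _ = borelMat h 0 0 * borelMat h 2 2 ^ 2 * (p₁ / l)
      - 2 * (borelMat h 0 0 * borelMat h 2 2 * borelMat h 1 2)
    field_simp
  · refine (congrArg₂ (fun z z' : ℂ => z / z') ((congrArg (C.coef₀ y.base.pt) n₂).trans
      (C.coef₀_comb hy _ _ _)) hl').trans ?_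
    change _ = (borelMat h 0 0)⁻¹ ^ 2 * (borelMat h 2 2)⁻¹ * (p₂ / l)
      + borelMat h 0 1 * (borelMat h 0 0)⁻¹
    field_simp
  · refine (congrArg (C.coef₀ y.base.pt) nβ).trans ((C.coef₀_comb hy _ _ _).trans ?_)
    change _ = frameCoord x₀ y 4 + (borelMat h 0 0 * borelMat h 2 2 * borelMat h 0 1 * (p₁ / l)
      + 2 * borelMat h 1 2 * (borelMat h 2 2)⁻¹ * (p₂ / l) + 4 * borelMat h 0 2 * (borelMat h 2 2)⁻¹
      - 2 * (borelMat h 0 0 * borelMat h 0 1 * borelMat h 1 2)) * (a₁ * a₂)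
    -- The new multiple of `ω` contributes `λ` to the `θ`-coefficient, and in coordinates `λ` is the
    -- product `k₀k₁`.
    have hk' : a₁ * a₂ = l := hk
    rw [k4, hk']
    field_simp
    ring

lemma coordAct_mem_target (h : Borel) {y₀ : Frame F} {q : EY}
    (hq : q ∈ (chartAt EY y₀).target) : coordAct h q ∈ (chartAt EY y₀).target := by
  rw [frame_target] at hq ⊢
  exact coordAct_mem h hq

/-- The action fixes the point of `M`, so every chart domain is invariant, and in each chart the
action is given by the same formula. -/
lemma act_symm (h : Borel) {y₀ : Frame F} {q : EY} (hq : q ∈ (chartAt EY y₀).target) :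
    act h ((chartAt EY y₀).symm q) = (chartAt EY y₀).symm (coordAct h q) := by
  have hs : act h ((chartAt EY y₀).symm q) ∈ (chartAt EY y₀).source :=
    (chartAt EY y₀).map_target hq
  have e : chartAt EY y₀ (act h ((chartAt EY y₀).symm q)) = coordAct h q := by
    refine Prod.ext ?_ ?_
    · have e' : (chartAt EY y₀ ((chartAt EY y₀).symm q)).1 = q.1 :=
        congrArg Prod.fst ((chartAt EY y₀).right_inv hq)
      exact e'
    · refine (frameCoord_act h (symm_mem hq)).trans ?_
      rw [frameCoord_symm hq]
      rfl
  rw [← e, (chartAt EY y₀).left_inv hs]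

lemma mdifferentiableAt_act (h : Borel) {y₀ : Frame F} {q : EY}
    (hq : q ∈ (chartAt EY y₀).target) :
    MDifferentiableAt 𝓘(ℝ, EY) 𝓘(ℝ, EY) (act h) ((chartAt EY y₀).symm q) := by
  have : IsManifold 𝓘(ℝ, EY) 1 (Frame F) := IsManifold.of_le (n := ∞) (by simp)
  have hs := (chartAt EY y₀).map_target hq
  have h1 := mdifferentiableAt_atlas (I := 𝓘(ℝ, EY)) (chart_mem_atlas EY y₀) hs
  have e := (chartAt EY y₀).right_inv hq
  have h2 : MDifferentiableAt 𝓘(ℝ, EY) 𝓘(ℝ, EY) (coordAct h)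
      (chartAt EY y₀ ((chartAt EY y₀).symm q)) :=
    ((contDiff_coordAct h).contDiffAt.differentiableAt (by simp)).mdifferentiableAt
  have h3 : MDifferentiableAt 𝓘(ℝ, EY) 𝓘(ℝ, EY) (chartAt EY y₀).symm
      (coordAct h (chartAt EY y₀ ((chartAt EY y₀).symm q))) := by
    rw [e]
    exact mdifferentiableAt_symm (coordAct_mem_target h hq)
  refine ((h3.comp _ h2).comp _ h1).congr_of_eventuallyEq ?_
  filter_upwards [(chartAt EY y₀).open_source.mem_nhds hs] with y hy
  have := act_symm h ((chartAt EY y₀).map_source hy)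
  rwa [(chartAt EY y₀).left_inv hy] at this

lemma mfderiv_act (h : Borel) {y₀ : Frame F} {q : EY} (hq : q ∈ (chartAt EY y₀).target) (v : EY) :
    (mfderiv 𝓘(ℝ, EY) 𝓘(ℝ, EY) (act h) ((chartAt EY y₀).symm q) (dsymm y₀ q v) : EY) =
      (dsymm y₀ (coordAct h q) (fderiv ℝ (coordAct h) q v) : EY) := by
  have hA : MDifferentiableAt 𝓘(ℝ, EY) 𝓘(ℝ, EY) (coordAct h) q :=
    ((contDiff_coordAct h).contDiffAt.differentiableAt (by simp)).mdifferentiableAt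
  have h1 := mfderiv_comp q (mdifferentiableAt_act h hq) (mdifferentiableAt_symm hq)
  have h2 := mfderiv_comp q (mdifferentiableAt_symm (coordAct_mem_target h hq)) hA
  have h3 : act h ∘ (chartAt EY y₀).symm =ᶠ[𝓝 q] (chartAt EY y₀).symm ∘ coordAct h :=
    Filter.eventually_of_mem (target_mem_nhds hq) fun q hq => act_symm h hq
  have h4 := h3.mfderiv_eq (I := 𝓘(ℝ, EY)) (I' := 𝓘(ℝ, EY))
  have h5 := mfderiv_eq_fderiv (𝕜 := ℝ) (f := coordAct h) (x := q)
  have h1' := congrArg (fun f : EY →L[ℝ] EY => f v) h1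
  have h2' := congrArg (fun f : EY →L[ℝ] EY => f v) h2
  have h4' := congrArg (fun f : EY →L[ℝ] EY => f v) h4
  have h5' := congrArg (fun f : EY →L[ℝ] EY => f v) h5
  exact h1'.symm.trans (h4'.trans (h2'.trans
    (congrArg (dsymm y₀ (coordAct h q) : EY →L[ℝ] EY) h5')))

/-- All tangent spaces of `Y` are the model space `EY`, so vectors at equal but differently
presented points can be compared directly. -/
lemma evalMat_congr (P : Matrix (Fin 3) (Fin 3) (YForm F)) {y y' : Frame F} (e : y = y')
    {v v' : EY} (hv : v = v') : evalMat P y v = evalMat P y' v' := by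
  subst e hv
  rfl

namespace ConnectionForms

variable {Γ : ConnectionForms F}

lemma IsFlat.equivariant (hΓ : Γ.IsFlat) (h : Borel) (y : Frame F)
    (v : TangentSpace 𝓘(ℝ, EY) y) :
    evalMat Γ.cartanForm (act h y) (mfderiv 𝓘(ℝ, EY) 𝓘(ℝ, EY) (act h) y v) =
      borelMat h⁻¹ * evalMat Γ.cartanForm y v * borelMat h := by
  refine forall_frame (P := fun y => ∀ v : TangentSpace 𝓘(ℝ, EY) y,
    evalMat Γ.cartanForm (act h y) (mfderiv 𝓘(ℝ, EY) 𝓘(ℝ, EY) (act h) y v) =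
      borelMat h⁻¹ * evalMat Γ.cartanForm y v * borelMat h) (fun y₀ q hq v => ?_) y v
  have hq' : q ∈ flatDomain (baseDomain F y₀.base.pt) := by rwa [← frame_target]
  obtain ⟨v, rfl⟩ := dsymm_surjective hq v
  rw [hΓ.evalMat_dsymm hq, ← (conn F y₀.base.pt).totalMat_coordAct h hq',
    ← hΓ.evalMat_dsymm (coordAct_mem_target h hq)]
  exact evalMat_congr _ (act_symm h hq) (mfderiv_act h hq v)

lemma IsFlat.fundamental (hΓ : Γ.IsFlat) (X : borelAlgebra) (y : Frame F) :
    evalMat Γ.cartanForm (orbit X y 0)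
      (mfderiv 𝓘(ℝ, ℝ) 𝓘(ℝ, EY) (orbit X y) 0 (1 : ℝ)) = X := by
  refine forall_frame (P := fun y => evalMat Γ.cartanForm (orbit X y 0)
    (mfderiv 𝓘(ℝ, ℝ) 𝓘(ℝ, EY) (orbit X y) 0 (1 : ℝ)) = X) (fun y₀ q hq => ?_) y
  have hq' : q ∈ flatDomain (baseDomain F y₀.base.pt) := by rwa [← frame_target]
  obtain ⟨c', hc', e⟩ := (conn F y₀.base.pt).totalMat_fundamental hq' X
  set c : ℝ → EY := fun s => coordAct (borelExp ((s : ℂ) • X)) q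
  -- The orbit never leaves the chart domain, so its velocity is the image under `dsymm` of the
  -- coordinate velocity.
  have ho : orbit X ((chartAt EY y₀).symm q) = (chartAt EY y₀).symm ∘ c :=
    funext fun s => act_symm _ hq
  have hm : c 0 ∈ (chartAt EY y₀).target := coordAct_mem_target _ hq
  have hc0 : c 0 = q := by
    have h1 := orbit_zero X ((chartAt EY y₀).symm q)
    rw [ho] at h1
    exact (chartAt EY y₀).symm.injOn hm hq h1
  have h1 := mfderiv_comp (0 : ℝ) (mdifferentiableAt_symm hm) hc'.differentiableAt.mdifferentiableAt
  have h2 := mfderiv_eq_fderiv (𝕜 := ℝ) (f := c) (x := 0)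
  have h1' := congrArg (fun f : ℝ →L[ℝ] EY => f 1) h1
  have h2' := congrArg (fun f : ℝ →L[ℝ] EY => f 1) h2
  have h3 : fderiv ℝ c 0 1 = c' := hc'.deriv
  have h4 : (mfderiv 𝓘(ℝ, ℝ) 𝓘(ℝ, EY) (orbit X ((chartAt EY y₀).symm q)) 0 : ℝ →L[ℝ] EY) 1 =
      (dsymm y₀ q c' : EY) := by
    refine (congrArg (fun f : ℝ → Frame F =>
      (mfderiv 𝓘(ℝ, ℝ) 𝓘(ℝ, EY) f 0 : ℝ →L[ℝ] EY) 1) ho).trans (h1'.trans ?_)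
    refine (congrArg (dsymm y₀ (c 0) : EY →L[ℝ] EY) (h2'.trans h3)).trans ?_
    exact congrArg (fun q => (dsymm y₀ q c' : EY)) hc0
  exact (evalMat_congr _ (orbit_zero X _) h4).trans ((hΓ.evalMat_dsymm hq c').trans e)

/-- The matrix of canonically normalized forms is a Cartan connection. -/
theorem IsFlat.isCartanConnection (h : Γ.IsFlat) : IsCartanConnection Γ.cartanForm where
  smooth := h.smoothOn_cartanForm
  mem_sl := evalMat_mem_sl Γ
  injective := h.injective
  fundamental := h.fundamental
  equivariant := h.equivariant

end ConnectionForms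

end ActionCharts

end FlagGeometry

end

theorem theorem5p2 {M : Type*} [TopologicalSpace M] [ChartedSpace E3 M] [IsManifold (𝓡 3) ∞ M]
    (F : FlagStructure M) :
    (∃! Γ : ConnectionForms F, Γ.IsCanonical) ∧
    ∀ Γ : ConnectionForms F, Γ.IsCanonical →
      IsCartanConnection Γ.cartanForm ∧
      curvature Γ.cartanForm =
        !![0, -Γ.Φ₂, -((1 / 4 : ℂ) • Γ.Ψ);
          0, 0, (1 / 2 : ℂ) • Γ.Φ₁;
          0, 0, 0] ∧
      ∃ Q₁ Q₂ U₁ U₂ : Frame F → ℂ,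
        ContMDiff 𝓘(ℝ, EY) 𝓘(ℝ, ℂ) ∞ Q₁ ∧ ContMDiff 𝓘(ℝ, EY) 𝓘(ℝ, ℂ) ∞ Q₂ ∧
        ContMDiff 𝓘(ℝ, EY) 𝓘(ℝ, ℂ) ∞ U₁ ∧ ContMDiff 𝓘(ℝ, EY) 𝓘(ℝ, ℂ) ∞ U₂ ∧
        ∀ y v w,
          Γ.Φ₁ y v w = Q₁ y * (ω₀ F ∧ᶠ ω₂ F) y v w ∧
          Γ.Φ₂ y v w = Q₂ y * (ω₀ F ∧ᶠ ω₁ F) y v w ∧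
          Γ.Ψ y v w = U₁ y * (ω₁ F ∧ᶠ ω₀ F) y v w + U₂ y * (ω₂ F ∧ᶠ ω₀ F) y v w := by
  -- A canonically normalized system has the explicit expression in every chart, and the remaining
  -- claims are consequences of that expression.
  refine ⟨ConnectionForms.existsUnique_isCanonical F, fun Γ h =>
    ⟨h.isFlat.isCartanConnection, h.isFlat.curvature_eq, h.isFlat.exists_coefficients⟩⟩
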